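/- Let $M$ be a compact oriented smooth $4$-manifold without boundary, let $E\to M$ be an oriented rank-three real vector bundle with a fibre metric (an $SO(3)$-vector bundle), and fix a real number $\Lambda\neq 0$. In a local oriented orthonormal frame $e_i$ of $E$ write a metric connection $A$ as $\mathrm d_A e_i=\epsilon_{ijk}A^j\otimes e_k$, its curvature as $(\mathrm d_A)^2e_i=\epsilon_{ijk}F^j\otimes e_k$, and $a\in\Omega^1(M,\mathfrak{so}(E))$ as $a(e_i)=\epsilon_{ijk}a^j\otimes e_k$ (repeated indices are summed). A smooth metric connection $A$ is *definite* if $F_A(u,v)\neq0$ for all linearly independent tangent vectors $u,v$ and $F^i\wedge F^j$ is a positive definite matrix times a positive $4$-form on $M$. Then there are a unique positive $4$-form $\mu_A$ and a unique symmetric matrix $Y$, positive definite if $\Lambda>0$ and negative definite if $\Lambda<0$, with $F^i\wedge F^j=2(Y^2)^{ij}\mu_A$ and $\operatorname{tr}Y=\Lambda$. Put $X=Y^{-1}$, $\Sigma_i=X_{ij}F^j$ and $\Psi_A=Y-\frac\Lambda3\mathrm{Id}$. Thus $\Sigma_i\wedge\Sigma_j=2\delta_{ij}\mu_A$, and there is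 a unique Riemannian metric $g_A$ on $M$ with volume form $\mu_A$ for which the $\Sigma_i$ are self-dual. We require that $A$ has the same sign as $\Lambda$, i.e. that $e_i\mapsto\Sigma_i$ is an orientation preserving isomorphism from $E$ to the bundle $\Lambda^+$ of $g_A$-self-dual $2$-forms, where $\Lambda^+$ is oriented by $f^{01}+f^{23},\,f^{02}+f^{31},\,f^{03}+f^{12}$ for any oriented orthonormal coframe $f^0,\dots,f^3$ of $g_A$. The pure connection action is $$S(A)=\int_M\Big\{F^i\wedge\Sigma_i-\tfrac12\big(\Psi_A^{ij}+\tfrac\Lambda3\delta^{ij}\big)\Sigma_i\wedge\Sigma_j\Big\}=\tfrac12\int_M X_{ij}F^i\wedge F^j=\Lambda\,\mathrm{vol}(M,g_A),$$ and $D^2S(a,a)=\frac{d^2}{dt^2}\big|_{t=0}S(A+ta)$. **Proposition.** Let $A$ be a definite connection with the same sign as $\Lambda$ which is a critical point of $S$. Let $a\in\Omega^1(M,\mathfrak{so}(E))$ be smooth and satisfy the horizontal gauge condition $\Sigma_i\wedge a^i=0$ and the vertical gauge condition $\epsilon_{ijk}\Sigma_j\wedge(\mathrm d_Aa)^k=0$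 for each $i$. Then $t\mapsto S(A+ta)$ is twice continuously differentiable near $t=0$ and $$D^2S(a,a)=\int_M\Big(|a|^2-X_{ij}\big\langle(\mathrm d_A^-a)^i,(\mathrm d_A^-a)^j\big\rangle\Big)\mu_A,$$ where $|a|^2=\sum_i|a^i|^2$, the inner products of forms are those of $g_A$, and $\mathrm d_A^-a$ is the $g_A$-anti-self-dual part of $\mathrm d_Aa$. In particular, if the part $R_+$ of the Riemannian curvature operator of $g_A$ which acts on self-dual $2$-forms is negative definite at every point, then $X$ is negative definite at every point, and for every such $a$ one has $D^2S(a,a)\geq0$, with equality if and only if $a=0$. -/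

import Mathlib

open Bundle Manifold
open scoped ContDiff MatrixOrder

noncomputable section

namespace PureConnection

/-- The model space `ℝ⁴` of the base manifold. -/
abbrev R4 := EuclideanSpace ℝ (Fin 4)

/-- The model space `ℝ³` of the fibres of the bundle. -/
abbrev R3 := EuclideanSpace ℝ (Fin 3)

/-! ### Multilinear algebra on one vector space

A 2-form on `V` is given by its values `β u v`, a 4-form by its values `ω v` on quadruples. -/

section Algebra

variable {V : Type*} [AddCommGroup V] [Module ℝ V]

/-- The Levi-Civita symbol `ε_{ijk}`: the determinant of the matrix with rows `δ_i, δ_j, δ_k`. -/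
def eps (i j k : Fin 3) : ℝ :=
  (Matrix.of fun r c : Fin 3 => if (![i, j, k] r) = c then (1 : ℝ) else 0).det

/-- The wedge product of two 2-forms, evaluated on four vectors. -/
def wedge22 (α β : V → V → ℝ) (v : Fin 4 → V) : ℝ :=
  α (v 0) (v 1) * β (v 2) (v 3) - α (v 0) (v 2) * β (v 1) (v 3) + α (v 0) (v 3) * β (v 1) (v 2)
    + α (v 1) (v 2) * β (v 0) (v 3) - α (v 1) (v 3) * β (v 0) (v 2) + α (v 2) (v 3) * β (v 0) (v 1)

/-- The wedge product of a 2-form and a 1-form, evaluated on three vectors. -/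
def wedge21 (α : V → V → ℝ) (θ : V → ℝ) (u v w : V) : ℝ :=
  α u v * θ w + α v w * θ u + α w u * θ v

/-- The components `β (f_a, f_b)` of a 2-form in a frame `f`. -/
def comps (f : Fin 4 → V) (β : V → V → ℝ) : Matrix (Fin 4) (Fin 4) ℝ :=
  Matrix.of fun a b => β (f a) (f b)

/-- The Hodge star on 2-forms, in terms of the components in an oriented orthonormal frame:
`(*B)₀₁ = B₂₃`, `(*B)₀₂ = B₃₁`, `(*B)₀₃ = B₁₂`, `(*B)₂₃ = B₀₁`, `(*B)₃₁ = B₀₂`, `(*B)₁₂ = B₀₃`. -/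
def star2 (B : Matrix (Fin 4) (Fin 4) ℝ) : Matrix (Fin 4) (Fin 4) ℝ :=
  !![0, B 2 3, B 3 1, B 1 2;
     B 3 2, 0, B 0 3, B 2 0;
     B 1 3, B 3 0, 0, B 0 1;
     B 2 1, B 0 2, B 1 0, 0]

/-- The anti-self-dual part `(B - *B)/2`. -/
def asd (B : Matrix (Fin 4) (Fin 4) ℝ) : Matrix (Fin 4) (Fin 4) ℝ :=
  (1 / 2 : ℝ) • (B - star2 B)

/-- The inner product of 2-forms with components `B`, `C` in an orthonormal frame
(so that `f^a ∧ f^b`, `a < b`, are orthonormal). -/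
def inner2 (B C : Matrix (Fin 4) (Fin 4) ℝ) : ℝ :=
  (1 / 2 : ℝ) * ∑ a, ∑ b, B a b * C a b

/-- The symmetric square root `Y` of a positive multiple of the positive definite matrix `G`
whose sign is the sign of `Λ` and whose trace is `Λ`. -/
def signedRoot (Λ : ℝ) (G : Matrix (Fin 3) (Fin 3) ℝ) : Matrix (Fin 3) (Fin 3) ℝ :=
  (Λ / (CFC.sqrt G).trace) • CFC.sqrt G

theorem sqrt_posDef {G : Matrix (Fin 3) (Fin 3) ℝ} (hG : G.PosDef) : (CFC.sqrt G).PosDef := by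
  have hs := CFC.sqrt_mul_sqrt_self G hG.posSemidef.nonneg
  refine (Matrix.PosSemidef.posDef_iff_isUnit (Matrix.nonneg_iff_posSemidef.mp (CFC.sqrt_nonneg G))).mpr ?_
  exact isUnit_of_mul_isUnit_left (hs ▸ hG.isUnit)

theorem signedRoot_trace {Λ : ℝ} {G : Matrix (Fin 3) (Fin 3) ℝ} (hG : G.PosDef) :
    (signedRoot Λ G).trace = Λ := by
  have hp : (CFC.sqrt G).PosDef := sqrt_posDef hG
  have h : (CFC.sqrt G).trace ≠ 0 := hp.trace_pos.ne'
  rw [signedRoot, Matrix.trace_smul, smul_eq_mul]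
  field_simp

theorem signedRoot_sq {Λ : ℝ} {G : Matrix (Fin 3) (Fin 3) ℝ} (hΛ : Λ ≠ 0) (hG : G.PosDef) :
    ∃ c : ℝ, 0 < c ∧ signedRoot Λ G * signedRoot Λ G = c • G := by
  have hp : (CFC.sqrt G).PosDef := sqrt_posDef hG
  have h : (CFC.sqrt G).trace ≠ 0 := hp.trace_pos.ne'
  refine ⟨(Λ / (CFC.sqrt G).trace) ^ 2, by positivity, ?_⟩
  rw [signedRoot, smul_mul_smul_comm, CFC.sqrt_mul_sqrt_self G hG.posSemidef.nonneg, pow_two]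

theorem signedRoot_sign {Λ : ℝ} {G : Matrix (Fin 3) (Fin 3) ℝ} (hΛ : Λ ≠ 0) (hG : G.PosDef) :
    (Λ • signedRoot Λ G).PosDef := by
  have hp : (CFC.sqrt G).PosDef := sqrt_posDef hG
  have h : 0 < (CFC.sqrt G).trace := hp.trace_pos
  rw [signedRoot, smul_smul]
  exact hp.smul (by rw [← mul_div_assoc]; exact div_pos (mul_self_pos.mpr hΛ) h)

end Algebra

/-! ### Orientations and integration -/

/-- An orientation of a real vector bundle `V` of rank `n` with model fibre `F`: an orientation of
each fibre which near every point is the one given by a smooth local frame. -/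
structure BundleOrientation {B H M : Type*} [NormedAddCommGroup B] [NormedSpace ℝ B]
    [TopologicalSpace H] (I : ModelWithCorners ℝ B H) [TopologicalSpace M] [ChartedSpace H M]
    (F : Type*) [NormedAddCommGroup F] [NormedSpace ℝ F] (n : ℕ)
    (V : M → Type*) [TopologicalSpace (TotalSpace F V)] [∀ x, AddCommGroup (V x)]
    [∀ x, Module ℝ (V x)] [∀ x, TopologicalSpace (V x)] [FiberBundle F V] where
  at' : ∀ x, Orientation ℝ (V x) (Fin n)
  locally_frame : ∀ x₀ : M, ∃ U ∈ nhds x₀, ∃ s : Fin n → (x : M) → V x,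
    ∃ hs : IsLocalFrameOn I F ∞ s U, ∀ x (hx : x ∈ U), (hs.toBasisAt hx).orientation = at' x

section Manifold

variable {M : Type*} [TopologicalSpace M] [ChartedSpace R4 M]

theorem finrank_tangent (x : M) : Module.finrank ℝ (TangentSpace (𝓡 4) x) = 4 := by
  change Module.finrank ℝ (EuclideanSpace ℝ (Fin 4)) = 4
  simp

instance (x : M) : FiniteDimensional ℝ (TangentSpace (𝓡 4) x) :=
  inferInstanceAs (FiniteDimensional ℝ (EuclideanSpace ℝ (Fin 4)))

/-- An orientation of the 4-manifold `M`. -/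
abbrev ManifoldOrientation (M : Type*) [TopologicalSpace M] [ChartedSpace R4 M]
    [IsManifold (𝓡 4) ∞ M] :=
  BundleOrientation (𝓡 4) R4 4 (fun x : M => TangentSpace (𝓡 4) x)

variable [IsManifold (𝓡 4) ∞ M]

/-- A positively oriented reference basis of `T_x M`. -/
def refBasis (oM : ManifoldOrientation M) (x : M) : Module.Basis (Fin 4) ℝ (TangentSpace (𝓡 4) x) :=
  (oM.at' x).someBasis (by rw [finrank_tangent]; simp)

/-- `+1` on positively oriented bases of `T_x M` and `-1` on negatively oriented ones. -/
def orientationSign (oM : ManifoldOrientation M) (x : M)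
    (v : Fin 4 → TangentSpace (𝓡 4) x) : ℝ :=
  if 0 < (refBasis oM x).det v then 1 else -1

/-- The coordinate frame `∂₀, …, ∂₃` of the preferred chart at `i`, at the point with
coordinates `y`. -/
def coordFrame (i : M) (y : R4) (k : Fin 4) :
    TangentSpace (𝓡 4) ((extChartAt (𝓡 4) i).symm y) :=
  mfderiv 𝓘(ℝ, R4) (𝓡 4) (extChartAt (𝓡 4) i).symm y (EuclideanSpace.single k (1 : ℝ))

variable [T2Space M] [CompactSpace M]

/-- A smooth partition of unity subordinate to the preferred charts of `M`. -/
def chartPartition (M : Type*) [TopologicalSpace M] [ChartedSpace R4 M]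
    [IsManifold (𝓡 4) ∞ M] [T2Space M] [CompactSpace M] :
    SmoothPartitionOfUnity M (𝓡 4) M Set.univ :=
  Classical.choose (SmoothPartitionOfUnity.exists_isSubordinate_chartAt_source (𝓡 4) M)

/-- The integral `∫_M η` of a 4-form over the compact oriented manifold `M`: the sum of the
integrals of `ρ_i η` in the charts of a partition of unity, with the sign of the chart. -/
def integralForm (oM : ManifoldOrientation M)
    (η : ∀ x : M, (Fin 4 → TangentSpace (𝓡 4) x) → ℝ) : ℝ :=
  ∑ᶠ i : M, ∫ y in (extChartAt (𝓡 4) i).target,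
    chartPartition M i ((extChartAt (𝓡 4) i).symm y)
      * orientationSign oM _ (coordFrame i y) * η _ (coordFrame i y)

end Manifold

/-! ### Connections on an oriented Riemannian bundle of rank three -/

theorem finrank_fibre {M : Type*} [TopologicalSpace M] {E : M → Type*}
    [∀ x, NormedAddCommGroup (E x)] [∀ x, InnerProductSpace ℝ (E x)]
    [TopologicalSpace (TotalSpace R3 E)] [FiberBundle R3 E] [VectorBundle ℝ R3 E] (x : M) :
    Module.finrank ℝ (E x) = 3 := by
  have h := (Trivialization.continuousLinearEquivAt ℝ (trivializationAt R3 E x) x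
    (FiberBundle.mem_baseSet_trivializationAt' x)).toLinearEquiv.finrank_eq
  simpa using h

section Connections

variable {M : Type*} [TopologicalSpace M] [ChartedSpace R4 M] [IsManifold (𝓡 4) ∞ M]
  {E : M → Type*} [∀ x, NormedAddCommGroup (E x)] [∀ x, InnerProductSpace ℝ (E x)]
  [TopologicalSpace (TotalSpace R3 E)] [FiberBundle R3 E] [VectorBundle ℝ R3 E]

/-- The curvature `F_A(u,v) e = ∇_u ∇_v e - ∇_v ∇_u e - ∇_[u,v] e`, computed with local extensions
of `u`, `v` and `e`. -/
def curvature {F : Type*} [NormedAddCommGroup F] [NormedSpace ℝ F] {V : M → Type*}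
    [TopologicalSpace (TotalSpace F V)] [∀ x, AddCommGroup (V x)] [∀ x, Module ℝ (V x)]
    [∀ x, TopologicalSpace (V x)] [∀ x, IsTopologicalAddGroup (V x)]
    [∀ x, ContinuousSMul ℝ (V x)] [FiberBundle F V]
    (A : CovariantDerivative (𝓡 4) F V) (x : M) (u v : TangentSpace (𝓡 4) x) (e : V x) : V x :=
  let U : (y : M) → TangentSpace (𝓡 4) y := FiberBundle.extend R4 u
  let W : (y : M) → TangentSpace (𝓡 4) y := FiberBundle.extend R4 v
  let s : (y : M) → V y := FiberBundle.extend F e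
  A (fun y => A s y (W y)) x u - A (fun y => A s y (U y)) x v
    - A s x (VectorField.mlieBracket (𝓡 4) U W x)

/-- The exterior covariant derivative of an `End(E)`-valued 1-form `a`:
`(d_A a)(u,v) = ∇_u (a(v)) - ∇_v (a(u)) - a([u,v])` for the induced connection on `End(E)`,
applied to `e`. As in Mathlib, `a x e u` is `a(u) e`. -/
def dA (A : CovariantDerivative (𝓡 4) R3 E)
    (a : (x : M) → E x →L[ℝ] TangentSpace (𝓡 4) x →L[ℝ] E x)
    (x : M) (u v : TangentSpace (𝓡 4) x) (e : E x) : E x :=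
  let U : (y : M) → TangentSpace (𝓡 4) y := FiberBundle.extend R4 u
  let W : (y : M) → TangentSpace (𝓡 4) y := FiberBundle.extend R4 v
  let s : (y : M) → E y := FiberBundle.extend R3 e
  (A (fun y => a y (s y) (W y)) x u - a x (A s x u) v)
    - (A (fun y => a y (s y) (U y)) x v - a x (A s x v) u)
    - a x e (VectorField.mlieBracket (𝓡 4) U W x)

/-- `a` is an element of `Ω¹(M, so(E))`: a smooth 1-form with values in the skew endomorphisms
of `E`. -/
structure IsSoForm (a : (x : M) → E x →L[ℝ] TangentSpace (𝓡 4) x →L[ℝ] E x) : Prop where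
  skew : ∀ x (u : TangentSpace (𝓡 4) x) (e e' : E x),
    inner ℝ (a x e u) e' = - inner ℝ e (a x e' u)
  smooth : ContMDiff (𝓡 4) ((𝓡 4).prod 𝓘(ℝ, R3 →L[ℝ] (R4 →L[ℝ] R3))) ∞
    (fun x => TotalSpace.mk' (R3 →L[ℝ] (R4 →L[ℝ] R3))
      (E := fun x => E x →L[ℝ] TangentSpace (𝓡 4) x →L[ℝ] E x) x (a x))

/-- An orientation of the rank-three bundle `E`. -/
abbrev FibreOrientation {M : Type*} [TopologicalSpace M] [ChartedSpace R4 M] (E : M → Type*)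
    [∀ x, NormedAddCommGroup (E x)] [∀ x, InnerProductSpace ℝ (E x)]
    [TopologicalSpace (TotalSpace R3 E)] [FiberBundle R3 E] :=
  BundleOrientation (𝓡 4) R3 3 E

/-- `A` is a smooth `SO(3)`-connection: a smooth covariant derivative compatible with the fibre
metric of `E`. -/
structure IsSO3Connection [ContMDiffVectorBundle ∞ R3 E (𝓡 4)]
    [IsContMDiffRiemannianBundle (𝓡 4) ∞ R3 E] (A : CovariantDerivative (𝓡 4) R3 E) : Prop where
  metric : A.IsMetricCompatible
  smooth : A.ContMDiffCovariantDerivative ∞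

variable (oM : ManifoldOrientation M) (oE : FibreOrientation E) (Λ : ℝ)
  (A : CovariantDerivative (𝓡 4) R3 E)

/-- An oriented orthonormal basis `e₀, e₁, e₂` of the fibre `E x`. -/
def fibreFrame (x : M) : OrthonormalBasis (Fin 3) ℝ (E x) :=
  (oE.at' x).finOrthonormalBasis (by norm_num) (finrank_fibre x)

/-- The components `β^j` of a skew endomorphism `B` of `E x`, determined by
`B e_i = ∑_{j,k} ε_{ijk} β^j e_k`. -/
def soComp (x : M) (B : E x → E x) (j : Fin 3) : ℝ :=
  inner ℝ (B (fibreFrame oE x (j + 2))) (fibreFrame oE x (j + 1))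

/-- The curvature 2-forms `F^i` of `A`. -/
def curvForm (x : M) (i : Fin 3) (u v : TangentSpace (𝓡 4) x) : ℝ :=
  soComp oE x (curvature A x u v) i

/-- The matrix of the 4-forms `F^i ∧ F^j`, evaluated on a positive reference basis of `T_x M`. -/
def FF (x : M) : Matrix (Fin 3) (Fin 3) ℝ :=
  Matrix.of fun i j => wedge22 (curvForm oE A x i) (curvForm oE A x j) (refBasis oM x)

/-- `A` is a definite connection: `F_A(u,v) ≠ 0` whenever `u`, `v` are linearly independent, and
`F^i ∧ F^j` is a positive definite matrix times a positive 4-form on the oriented manifold `M`. -/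
structure IsDefinite : Prop where
  ne_zero : ∀ (x : M) (u v : TangentSpace (𝓡 4) x), LinearIndependent ℝ ![u, v] →
    ∃ e : E x, curvature A x u v e ≠ 0
  posDef : ∀ x : M, (FF oM oE A x).PosDef

/-- The square root `Y` of the matrix of `F^i ∧ F^j`, with the sign of `Λ` and trace `Λ`. -/
def Y (x : M) : Matrix (Fin 3) (Fin 3) ℝ := signedRoot Λ (FF oM oE A x)

/-- The inverse `X` of `Y`. -/
def X (x : M) : Matrix (Fin 3) (Fin 3) ℝ := (Y oM oE Λ A x)⁻¹

/-- The 2-forms `Σ_i = X_{ij} F^j`. -/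
def Sig (x : M) (i : Fin 3) (u v : TangentSpace (𝓡 4) x) : ℝ :=
  ∑ j, X oM oE Λ A x i j * curvForm oE A x j u v

/-- The trace-free matrix `Ψ_A`, determined by `Ψ_A + (Λ/3) Id = Y`. -/
def Psi (x : M) : Matrix (Fin 3) (Fin 3) ℝ := Y oM oE Λ A x - (Λ / 3) • 1

/-- The Plebanski integrand `F^i ∧ Σ_i - ½ (Ψ^{ij} + (Λ/3) δ^{ij}) Σ_i ∧ Σ_j`. -/
def plebanskiForm {V : Type*} (Λ : ℝ) (F S : Fin 3 → V → V → ℝ) (Ψ : Matrix (Fin 3) (Fin 3) ℝ)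
    (v : Fin 4 → V) : ℝ :=
  ∑ i, wedge22 (F i) (S i) v
    - (1 / 2) * ∑ i, ∑ j, (Ψ + (Λ / 3) • (1 : Matrix (Fin 3) (Fin 3) ℝ)) i j
        * wedge22 (S i) (S j) v

/-- The pure connection action `S(A) = S_P(A, Σ_A, Ψ_A)`, with `S_P` the Plebanski action. -/
def action [T2Space M] [CompactSpace M] : ℝ :=
  integralForm oM fun x =>
    plebanskiForm Λ (curvForm oE A x) (Sig oM oE Λ A x) (Psi oM oE Λ A x)

/-- The volume form `μ_A` of `g_A`, determined by `Σ_i ∧ Σ_j = 2 δ_{ij} μ_A`. -/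
def volForm (x : M) (v : Fin 4 → TangentSpace (𝓡 4) x) : ℝ :=
  (1 / 6) * ∑ i, wedge22 (Sig oM oE Λ A x i) (Sig oM oE Λ A x i) v

/-- `f` is an oriented orthonormal frame at `x` of the metric `g_A`. The metric `g_A` is the unique
one with volume form `μ_A` for which the `Σ_i` are self-dual, so this says that the metric with
oriented orthonormal frame `f` has volume form `μ_A` and makes the `Σ_i` self-dual. -/
structure IsMetricFrame (x : M) (f : Module.Basis (Fin 4) ℝ (TangentSpace (𝓡 4) x)) : Prop where
  vol : volForm oM oE Λ A x f = 1
  selfDual : ∀ i, star2 (comps f (Sig oM oE Λ A x i)) = comps f (Sig oM oE Λ A x i)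

/-- A choice of oriented `g_A`-orthonormal frame at each point (no smoothness in the point). -/
def metricFrame (x : M) : Module.Basis (Fin 4) ℝ (TangentSpace (𝓡 4) x) :=
  @Classical.epsilon _ ⟨refBasis oM x⟩ (IsMetricFrame oM oE Λ A x)

/-- The metric `g_A`. -/
def gA (x : M) (u v : TangentSpace (𝓡 4) x) : ℝ :=
  ∑ c, (metricFrame oM oE Λ A x).repr u c * (metricFrame oM oE Λ A x).repr v c

/-- The sign of the definite connection `A` is the sign of `Λ`: the isomorphism `e_i ↦ F^i` from
`E` to `Λ⁺` preserves orientation if `Λ > 0` and reverses it if `Λ < 0`. Here `Λ⁺` is oriented by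
its basis `f⁰ ∧ f^a + f^b ∧ f^c`, `(a,b,c)` cyclic, for an oriented orthonormal frame `f`, in which
a self-dual form `β` has the components `β(f₀, f_a)`. -/
def HasSignOf : Prop :=
  ∀ x : M, 0 < Λ * (Matrix.of fun i a : Fin 3 =>
    curvForm oE A x i (metricFrame oM oE Λ A x 0) (metricFrame oM oE Λ A x a.succ)).det

/-- The connection `A + t a`. -/
def shift (a : (x : M) → E x →L[ℝ] TangentSpace (𝓡 4) x →L[ℝ] E x) (t : ℝ) :
    CovariantDerivative (𝓡 4) R3 E :=
  A.addOneForm fun x => t • a x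

/-- `A` is a critical point of the pure connection action. -/
def IsCritical [T2Space M] [CompactSpace M] : Prop :=
  ∀ a : (x : M) → E x →L[ℝ] TangentSpace (𝓡 4) x →L[ℝ] E x, IsSoForm a →
    HasDerivAt (fun t : ℝ => action oM oE Λ (shift A a t)) 0 0

/-- The Hessian `D²S(a,a)` at `A`: the second derivative of `S(A + t a)` at `t = 0`. -/
def hessian [T2Space M] [CompactSpace M]
    (a : (x : M) → E x →L[ℝ] TangentSpace (𝓡 4) x →L[ℝ] E x) : ℝ :=
  iteratedDeriv 2 (fun t : ℝ => action oM oE Λ (shift A a t)) 0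

/-- The component 1-forms `a^i`. -/
def aForm (a : (x : M) → E x →L[ℝ] TangentSpace (𝓡 4) x →L[ℝ] E x) (x : M) (i : Fin 3)
    (u : TangentSpace (𝓡 4) x) : ℝ :=
  soComp oE x (fun e => a x e u) i

/-- The component 2-forms `(d_A a)^i`. -/
def dAForm (a : (x : M) → E x →L[ℝ] TangentSpace (𝓡 4) x →L[ℝ] E x) (x : M) (i : Fin 3)
    (u v : TangentSpace (𝓡 4) x) : ℝ :=
  soComp oE x (dA A a x u v) i

/-- Horizontal gauge: `Σ_i ∧ a^i = 0`. -/
def IsHorizontal (a : (x : M) → E x →L[ℝ] TangentSpace (𝓡 4) x →L[ℝ] E x) : Prop :=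
  ∀ (x : M) (u v w : TangentSpace (𝓡 4) x),
    ∑ i, wedge21 (Sig oM oE Λ A x i) (aForm oE a x i) u v w = 0

/-- Vertical gauge: `ε_{ijk} Σ_j ∧ (d_A a)^k = 0` for each `i`. -/
def IsVertical (a : (x : M) → E x →L[ℝ] TangentSpace (𝓡 4) x →L[ℝ] E x) : Prop :=
  ∀ (x : M) (i : Fin 3) (v : Fin 4 → TangentSpace (𝓡 4) x),
    ∑ j, ∑ k, eps i j k * wedge22 (Sig oM oE Λ A x j) (dAForm oE A a x k) v = 0

/-- The pointwise norm squared `|a|²` with respect to `g_A`. -/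
def normSq (a : (x : M) → E x →L[ℝ] TangentSpace (𝓡 4) x →L[ℝ] E x) (x : M) : ℝ :=
  ∑ i, ∑ c, aForm oE a x i (metricFrame oM oE Λ A x c) ^ 2

/-- The components of the `g_A`-anti-self-dual part `(d_A^- a)^i` in the frame `metricFrame`. -/
def dAMinus (a : (x : M) → E x →L[ℝ] TangentSpace (𝓡 4) x →L[ℝ] E x) (x : M) (i : Fin 3) :
    Matrix (Fin 4) (Fin 4) ℝ :=
  asd (comps (metricFrame oM oE Λ A x) (dAForm oE A a x i))

/-- The 4-form `(|a|² - X_{ij} ⟨(d_A^- a)^i, (d_A^- a)^j⟩) μ_A`. -/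
def hessianForm (a : (x : M) → E x →L[ℝ] TangentSpace (𝓡 4) x →L[ℝ] E x) (x : M)
    (v : Fin 4 → TangentSpace (𝓡 4) x) : ℝ :=
  (normSq oM oE Λ A a x
      - ∑ i, ∑ j, X oM oE Λ A x i j
          * inner2 (dAMinus oM oE Λ A a x i) (dAMinus oM oE Λ A a x j))
    * volForm oM oE Λ A x v

/-- `D` is the Levi-Civita connection of `g_A`. -/
structure IsLeviCivita
    (D : CovariantDerivative (𝓡 4) R4 (fun x : M => TangentSpace (𝓡 4) x)) : Prop where
  smooth : D.ContMDiffCovariantDerivative ∞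
  torsion_free : D.torsion = 0
  metric : ∀ (x : M) (u : TangentSpace (𝓡 4) x) (V W : (y : M) → TangentSpace (𝓡 4) y),
    MDifferentiableAt (𝓡 4) (𝓡 4).tangent (fun y => (⟨y, V y⟩ : TangentBundle (𝓡 4) M)) x →
    MDifferentiableAt (𝓡 4) (𝓡 4).tangent (fun y => (⟨y, W y⟩ : TangentBundle (𝓡 4) M)) x →
    mvfderiv (𝓡 4) (fun y => gA oM oE Λ A y (V y) (W y)) x u
      = gA oM oE Λ A x (D V x u) (W x) + gA oM oE Λ A x (V x) (D W x u)

/-- The quadratic form `(Rm w, w)` of the curvature operator `Rm` of `g_A`, with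
`⟨Rm(u ∧ v), p ∧ q⟩ = g_A(R(u,v) q, p)`, on the 2-vector with components `w` in the orthonormal
frame `metricFrame`. -/
def curvatureQuadratic
    (D : CovariantDerivative (𝓡 4) R4 (fun x : M => TangentSpace (𝓡 4) x))
    (x : M) (w : Matrix (Fin 4) (Fin 4) ℝ) : ℝ :=
  (1 / 4) * ∑ a, ∑ b, ∑ c, ∑ d, w a b * w c d *
    gA oM oE Λ A x
      (curvature D x (metricFrame oM oE Λ A x a) (metricFrame oM oE Λ A x b)
        (metricFrame oM oE Λ A x d))
      (metricFrame oM oE Λ A x c)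

/-- `R₊ < 0` for the metric `g_A`: the curvature operator of its Levi-Civita connection is
negative definite on self-dual 2-forms. -/
def RPlusNegative : Prop :=
  ∃ D : CovariantDerivative (𝓡 4) R4 (fun x : M => TangentSpace (𝓡 4) x),
    IsLeviCivita oM oE Λ A D ∧
    ∀ (x : M) (w : Matrix (Fin 4) (Fin 4) ℝ), w.transpose = -w → star2 w = w → w ≠ 0 →
      curvatureQuadratic oM oE Λ A D x w < 0

end Connections

end PureConnection

end

/-!
# The second variation of the pure connection action at a critical definite connection

*The second variation.* In an oriented frame of `TM` the integrand of the action is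
`(tr √G)² / (2Λ)`, where `G` is the positive definite matrix of the 4-forms `F^i ∧ F^j`
(`plebanskiForm_eq`, `rootLagrangian_eq`), so everything reduces to differentiating the trace of the
square root along the polynomial curve `G(t)` of the connections `A + t a` (`GOf_shift`). The first
derivative is `Σ_i ∧ (d_A a)^i` (`hasDerivAt_pleb`). The `a` with `Σ_i ∧ a^i = 0` form a module over
the smooth functions on which this expression is linear, hence at a critical point it vanishes
pointwise on such `a` (`variationDensity_eq_zero`). The vertical gauge condition makes the matrix
`m^{ij} = Σ_i ∧ (d_A a)^j` symmetric, and the Euler–Lagrange equation makes it trace-free; then `√G`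
moves by a multiple of `m` to first order, so that its trace is stationary, and the second derivative
is an explicit expression (`iteratedDeriv_two_rootLagrangian`). In it the self-dual part of `d_A a`
cancels, the quadratic term `[a, a]` contributes `|a|²` because of the horizontal gauge condition
(`sum_pf_bracket`), and the anti-self-dual part of `d_A a` is what remains (`iteratedDeriv_pleb`).
Joint smoothness in `t` and the coordinates allows differentiation under the integral sign
(`action_shift`, `hessian_eq`).

All pointwise computations are made in frames of `TM` in which the `Σ_i` are the standard self-dual
forms. They exist because three 2-forms with `Σ_i ∧ Σ_j = 2 δ_{ij} μ_A` define almost complex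
structures which satisfy the quaternion relations: `v, J₁v, J₂v, J₃v` is conformally such a frame
(`quatFrame_spec`). Its dependence on the point is smooth, which yields smooth local frames
(`exists_adaptedFrame`) and Urbantke's formula for `g_A` (`gA_basis`).

*Positivity.* Let `τ` be the difference between `A` and the connection which the Levi-Civita
connection of `g_A` induces on the bundle of self-dual forms. The Euler–Lagrange equation, tested with
the localised horizontal forms `a^i = s_i Σ_i(f_d, ·)`, `∑ s_i = 0`, and the second Bianchi identity
for `F^i = Y_{ij} Σ_j` are linear algebraic equations for `τ` and `∇Y`. Since `tr Y = Λ` is a nonzero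
constant, they imply `τ = 0` (`selfDualDiff_eq_zero`, `selfDualDiff_frame_eq_zero`). Therefore the
curvature of `A` is the self-dual part of the Riemannian curvature (`curvFormOf_eq_riemann`), and the
curvature operator takes the value `2 Y_{ii}` on `Σ_i` (`curvatureQuadratic_sdBasis`). If it is
negative on self-dual forms, then `Λ = tr Y < 0` (`neg_of_RPlusNegative`), so `Y` and its inverse `X`
are negative definite, the integrand of the second variation is at least `|a|² μ_A`, and its integral
vanishes only for `a = 0` (`hessian_nonneg`).
-/

set_option linter.unusedSectionVars false

noncomputable section

namespace PureConnection

/-! ### Sections smooth near a point -/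

section SmoothNear

variable {M : Type*} [TopologicalSpace M] [ChartedSpace R4 M] [IsManifold (𝓡 4) ∞ M]
  {F : Type*} [NormedAddCommGroup F] [NormedSpace ℝ F]
  {V : M → Type*} [TopologicalSpace (TotalSpace F V)] [∀ x, AddCommGroup (V x)]
  [∀ x, Module ℝ (V x)] [∀ x, TopologicalSpace (V x)] [FiberBundle F V]

/-- The section `s` is smooth on a neighbourhood of `x`. -/
def SmoothNear (F : Type*) [NormedAddCommGroup F] [NormedSpace ℝ F]
    {V : M → Type*} [TopologicalSpace (TotalSpace F V)]
    [∀ x, TopologicalSpace (V x)] [FiberBundle F V] (s : (y : M) → V y) (x : M) : Prop :=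
  ∀ᶠ y in nhds x, ContMDiffAt (𝓡 4) ((𝓡 4).prod 𝓘(ℝ, F)) ∞ (fun y => TotalSpace.mk' F y (s y)) y

/-- The function `f` is smooth on a neighbourhood of `x`. -/
def FSmoothNear (f : M → ℝ) (x : M) : Prop :=
  ∀ᶠ y in nhds x, ContMDiffAt (𝓡 4) 𝓘(ℝ, ℝ) ∞ f y

variable {s t : (y : M) → V y} {f g : M → ℝ} {x : M}

theorem SmoothNear.at_self (h : SmoothNear F s x) :
    ContMDiffAt (𝓡 4) ((𝓡 4).prod 𝓘(ℝ, F)) ∞ (fun y => TotalSpace.mk' F y (s y)) x :=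
  h.self_of_nhds

theorem SmoothNear.mdiff (h : SmoothNear F s x) :
    MDifferentiableAt (𝓡 4) ((𝓡 4).prod 𝓘(ℝ, F)) (fun y => TotalSpace.mk' F y (s y)) x :=
  h.self_of_nhds.mdifferentiableAt (by simp)

theorem SmoothNear.eventually (h : SmoothNear F s x) : ∀ᶠ y in nhds x, SmoothNear F s y :=
  h.eventually_nhds

theorem FSmoothNear.mdiff (h : FSmoothNear f x) : MDifferentiableAt (𝓡 4) 𝓘(ℝ, ℝ) f x :=
  h.self_of_nhds.mdifferentiableAt (by simp)

theorem FSmoothNear.eventually (h : FSmoothNear f x) : ∀ᶠ y in nhds x, FSmoothNear f y :=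
  h.eventually_nhds

theorem SmoothNear.congr (h : SmoothNear F s x) (hst : ∀ᶠ y in nhds x, t y = s y) :
    SmoothNear F t x := by
  filter_upwards [h, hst.eventually_nhds] with y hy hy'
  exact hy.congr_of_eventuallyEq (hy'.mono fun z hz => by simp [hz])

theorem FSmoothNear.congr (h : FSmoothNear f x) (hst : ∀ᶠ y in nhds x, g y = f y) :
    FSmoothNear g x := by
  filter_upwards [h, hst.eventually_nhds] with y hy hy'
  exact hy.congr_of_eventuallyEq hy'

theorem FSmoothNear.const (c : ℝ) : FSmoothNear (fun _ : M => c) x :=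
  Filter.Eventually.of_forall fun _ => contMDiffAt_const

theorem FSmoothNear.add (hf : FSmoothNear f x) (hg : FSmoothNear g x) :
    FSmoothNear (fun y => f y + g y) x := by
  filter_upwards [hf, hg] with y h1 h2 using h1.add h2

theorem FSmoothNear.sub (hf : FSmoothNear f x) (hg : FSmoothNear g x) :
    FSmoothNear (fun y => f y - g y) x := by
  filter_upwards [hf, hg] with y h1 h2 using h1.sub h2

theorem FSmoothNear.neg (hf : FSmoothNear f x) :
    FSmoothNear (fun y => - f y) x := by
  filter_upwards [hf] with y h1 using h1.neg

theorem FSmoothNear.mul (hf : FSmoothNear f x) (hg : FSmoothNear g x) :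
    FSmoothNear (fun y => f y * g y) x := by
  filter_upwards [hf, hg] with y h1 h2 using h1.mul h2

theorem FSmoothNear.sum {ι : Type*} (S : Finset ι) {f : ι → M → ℝ}
    (hf : ∀ i ∈ S, FSmoothNear (f i) x) : FSmoothNear (fun y => ∑ i ∈ S, f i y) x := by
  have : ∀ᶠ y in nhds x, ∀ i ∈ S, ContMDiffAt (𝓡 4) 𝓘(ℝ, ℝ) ∞ (f i) y :=
    (Finset.eventually_all S).mpr hf
  filter_upwards [this] with y hy using contMDiffAt_finsetSum hy

/-- Composition of finitely many smooth functions with a smooth function of several variables. -/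
theorem FSmoothNear.comp_pi {W : Type*} [NormedAddCommGroup W] [NormedSpace ℝ W]
    {φ : M → W} {G : W → ℝ} (hφ : ∀ᶠ y in nhds x, ContMDiffAt (𝓡 4) 𝓘(ℝ, W) ∞ φ y)
    (hG : ∀ᶠ w in nhds (φ x), ContDiffAt ℝ ∞ G w) : FSmoothNear (fun y => G (φ y)) x := by
  have hc : ContinuousAt φ x := hφ.self_of_nhds.continuousAt
  filter_upwards [hφ, hc.eventually hG] with y h1 h2
  exact ContMDiffAt.comp y h2.contMDiffAt h1

variable [VectorBundle ℝ F V]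

theorem SmoothNear.add (hs : SmoothNear F s x) (ht : SmoothNear F t x) :
    SmoothNear F (s + t) x := by
  filter_upwards [hs, ht] with y h1 h2 using h1.add_section h2

theorem SmoothNear.sub (hs : SmoothNear F s x) (ht : SmoothNear F t x) :
    SmoothNear F (s - t) x := by
  filter_upwards [hs, ht] with y h1 h2 using h1.sub_section h2

theorem SmoothNear.smul (hf : FSmoothNear f x) (hs : SmoothNear F s x) :
    SmoothNear F (f • s) x := by
  filter_upwards [hf, hs] with y h1 h2 using h1.smul_section h2

theorem SmoothNear.sum {ι : Type*} (S : Finset ι) {s : ι → (y : M) → V y}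
    (hs : ∀ i ∈ S, SmoothNear F (s i) x) : SmoothNear F (fun y => ∑ i ∈ S, s i y) x := by
  have : ∀ᶠ y in nhds x, ∀ i ∈ S, ContMDiffAt (𝓡 4) ((𝓡 4).prod 𝓘(ℝ, F)) ∞
      (fun y => TotalSpace.mk' F y (s i y)) y :=
    (Finset.eventually_all S).mpr hs
  filter_upwards [this] with y hy using ContMDiffAt.sum_section hy

theorem smoothNear_extend [ContMDiffVectorBundle ∞ F V (𝓡 4)] (v : V x) :
    SmoothNear F (FiberBundle.extend F v) x := by
  obtain ⟨U, hU, h⟩ := FiberBundle.exists_contMDiffOn_extend (k := ∞) (𝓡 4) F v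
  filter_upwards [eventually_eventually_nhds.mpr hU] with y hy
  exact h.contMDiffAt hy

/-- An operation on locally smooth sections which is additive and linear over smooth functions
depends only on the value of the section at the point. -/
theorem eq_of_tensorial [FiniteDimensional ℝ F] [ContMDiffVectorBundle ∞ F V (𝓡 4)]
    {B : Type*} [AddCommGroup B] [Module ℝ B] (Φ : ((y : M) → V y) → B)
    (hsmul : ∀ (f : M → ℝ) s, FSmoothNear f x → SmoothNear F s x → Φ (f • s) = f x • Φ s)
    (hadd : ∀ s t, SmoothNear F s x → SmoothNear F t x → Φ (s + t) = Φ s + Φ t)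
    (hs : SmoothNear F s x) (ht : SmoothNear F t x) (hst : s x = t x) : Φ s = Φ t := by
  classical
  have hlocal : ∀ {s t : (y : M) → V y}, SmoothNear F s x → SmoothNear F t x →
      (∀ᶠ y in nhds x, s y = t y) → Φ s = Φ t := by
    intro s t hs ht h
    let ψ (y : M) : ℝ := if s y = t y then 1 else 0
    have hψx : ψ x = 1 := by simp [ψ, h.self_of_nhds]
    have heq : ψ • s = ψ • t := by
      funext y
      by_cases hy : s y = t y
      · simp [hy]
      · simp [ψ, hy]
    have hψ : FSmoothNear ψ x := (FSmoothNear.const 1).congr (h.mono fun y hy => by simp [ψ, hy])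
    have h1 := hsmul ψ s hψ hs
    have h2 := hsmul ψ t hψ ht
    rw [hψx, one_smul] at h1 h2
    rw [← h1, ← h2, heq]
  have hsum : ∀ {ι : Type} (S : Finset ι) (σ : ι → (y : M) → V y),
      (∀ i ∈ S, SmoothNear F (σ i) x) → Φ (fun y => ∑ i ∈ S, σ i y) = ∑ i ∈ S, Φ (σ i) := by
    intro ι S σ h
    induction S using Finset.induction_on with
    | empty =>
      have h0 := hsmul (fun _ => 0) s (FSmoothNear.const 0) hs
      have e : (fun _ : M => (0 : ℝ)) • s = fun y => ∑ i ∈ (∅ : Finset ι), σ i y := by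
        funext y; simp
      rw [← e, h0]; simp
    | insert a S ha ih =>
      simp only [Finset.mem_insert, forall_eq_or_imp] at h
      simp only [Finset.sum_insert ha, ← ih h.2]
      exact hadd _ _ h.1 (SmoothNear.sum S h.2)
  let e := trivializationAt F V x
  have x_mem : x ∈ e.baseSet := FiberBundle.mem_baseSet_trivializationAt F V x
  let b := Module.finBasis ℝ F
  have hfr (i) : SmoothNear F (e.localFrame b i) x := by
    filter_upwards [e.open_baseSet.mem_nhds x_mem] with y hy
    exact contMDiffAt_localFrame_of_mem ∞ _ b i hy
  have hc {s : (y : M) → V y} (hs : SmoothNear F s x) (i) :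
      FSmoothNear (LinearMap.piApply (e.localFrameCoeff (𝓡 4) b i) s) x := by
    filter_upwards [e.open_baseSet.mem_nhds x_mem, hs] with y hy hsy
    exact contMDiffAt_localFrameCoeff b hy hsy i
  have hexp {s : (y : M) → V y} (hs : SmoothNear F s x) :
      Φ s = ∑ i, e.localFrameCoeff (𝓡 4) b i x (s x) • Φ (e.localFrame b i) := by
    rw [hlocal hs (t := fun y => ∑ i, ((LinearMap.piApply (e.localFrameCoeff (𝓡 4) b i) s) •
      (e.localFrame b i)) y)
      (SmoothNear.sum _ fun i _ => SmoothNear.smul (hc hs i) (hfr i))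
      (e.eventually_eq_localFrame_sum_coeff_smul b x_mem),
      hsum Finset.univ (fun i => (LinearMap.piApply (e.localFrameCoeff (𝓡 4) b i) s) •
        (e.localFrame b i)) (fun i _ => SmoothNear.smul (hc hs i) (hfr i))]
    refine Finset.sum_congr rfl fun i _ => ?_
    rw [hsmul _ _ (hc hs i) (hfr i)]
    rfl
  rw [hexp hs, hexp ht, hst]

end SmoothNear

/-! ### Derivatives along vector fields, Lie brackets and covariant derivatives -/

section Derivatives

theorem minSmoothness_two_le_infty : minSmoothness ℝ 2 ≤ (∞ : WithTop ℕ∞) := by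
  rw [minSmoothness_of_isRCLikeNormedField]
  exact WithTop.coe_le_coe.mpr (le_top : (2 : ℕ∞) ≤ ⊤)

variable {M : Type*} [TopologicalSpace M] [ChartedSpace R4 M] [IsManifold (𝓡 4) ∞ M]
  {F : Type*} [NormedAddCommGroup F] [NormedSpace ℝ F]
  {V : M → Type*} [TopologicalSpace (TotalSpace F V)] [∀ x, AddCommGroup (V x)]
  [∀ x, Module ℝ (V x)] [∀ x, TopologicalSpace (V x)] [FiberBundle F V]
  {f g : M → ℝ} {x : M} {U W : (y : M) → TangentSpace (𝓡 4) y}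

theorem FSmoothNear.deriv (hf : FSmoothNear f x) (hU : SmoothNear R4 U x) :
    FSmoothNear (fun y => mvfderiv (𝓡 4) f y (U y)) x := by
  filter_upwards [hf, hU] with y h1 h2
  have h := ContMDiffAt.mfderiv_const (m := ∞) h1 (by simp)
  have h3 := ContMDiffAt.clm_apply_of_inCoordinates
    (F₁ := R4) (F₂ := ℝ) (E₁ := fun x : M => TangentSpace (𝓡 4) x)
    (E₂ := fun x : ℝ => TangentSpace 𝓘(ℝ, ℝ) x) (b₁ := id) (b₂ := f)
    (IM := 𝓡 4) (IB₁ := 𝓡 4) (IB₂ := 𝓘(ℝ, ℝ)) h h2 h1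
  rw [contMDiffAt_totalSpace] at h3
  refine h3.2.congr_of_eventuallyEq (Filter.Eventually.of_forall fun z => ?_)
  simp [mvfderiv, trivializationAt]
  rfl

/-- The vector field `U` read in the chart at `x`. -/
def chartField (x : M) (U : (y : M) → TangentSpace (𝓡 4) y) : R4 → R4 :=
  VectorField.mpullbackWithin 𝓘(ℝ, R4) (𝓡 4) (extChartAt (𝓡 4) x).symm U (Set.range (𝓡 4))

theorem chartField_differentiableAt (hU : SmoothNear R4 U x) :
    DifferentiableAt ℝ (chartField x U) (extChartAt (𝓡 4) x x) := by
  have h := VectorField.contMDiffWithinAt_mpullbackWithin_extChartAt_symm (m := 1) (n := ∞)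
    (I := 𝓡 4) (s := Set.univ) (x := x) (V := U)
    (hU.at_self.contMDiffWithinAt.of_le (by simp)) uniqueMDiffOn_univ (Set.mem_univ x) (by rw [one_add_one_eq_two]; exact WithTop.coe_le_coe.mpr (le_top : (2 : ℕ∞) ≤ ⊤))
  have h2 := contMDiffWithinAt_vectorSpace_iff_contDiffWithinAt.1 h
  have h3 : ContDiffAt ℝ 1 (chartField x U) (extChartAt (𝓡 4) x x) := by
    refine h2.contDiffAt ?_
    rw [Set.preimage_univ, Set.inter_univ]
    exact extChartAt_target_mem_nhds x
  exact h3.differentiableAt (by simp)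

theorem mvfderiv_eq_chart (hf : ∀ᶠ y in nhds x, ContMDiffAt (𝓡 4) 𝓘(ℝ, ℝ) ∞ f y) :
    ∀ᶠ y in nhds x, mvfderiv (𝓡 4) f y (U y) =
      fderiv ℝ (f ∘ (extChartAt (𝓡 4) x).symm) (extChartAt (𝓡 4) x y)
        (chartField x U (extChartAt (𝓡 4) x y)) := by
  filter_upwards [hf, extChartAt_source_mem_nhds (I := 𝓡 4) x,
    (VectorField.eventuallyEq_mpullback_mpullbackWithin_extChartAt (I := 𝓡 4) (s := Set.univ)
      (x := x) U).filter_mono (by simp)] with y hy hys hU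
  have hinv := isInvertible_mfderiv_extChartAt (I := 𝓡 4) hys
  have hφ : MDifferentiableAt (𝓡 4) 𝓘(ℝ, R4) (extChartAt (𝓡 4) x) y :=
    (contMDiffAt_extChartAt' (n := ∞) (by simpa using hys)).mdifferentiableAt (by simp)
  have hleft : (extChartAt (𝓡 4) x).symm (extChartAt (𝓡 4) x y) = y :=
    (extChartAt (𝓡 4) x).left_inv hys
  have hg : MDifferentiableAt 𝓘(ℝ, R4) 𝓘(ℝ, ℝ) (f ∘ (extChartAt (𝓡 4) x).symm)
      (extChartAt (𝓡 4) x y) := by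
    refine MDifferentiableAt.comp (I' := 𝓡 4) _ ?_ ?_
    · rw [hleft]; exact hy.mdifferentiableAt (by simp)
    · exact (((contMDiffOn_extChartAt_symm (n := ∞) (I := 𝓡 4) x).contMDiffAt
        (extChartAt_target_mem_nhds' ((extChartAt (𝓡 4) x).map_source hys))).mdifferentiableAt (by simp))
  have heq : mvfderiv (𝓡 4) f y
      = mvfderiv (𝓡 4) ((f ∘ (extChartAt (𝓡 4) x).symm) ∘ (extChartAt (𝓡 4) x)) y := by
    unfold mvfderiv
    have : f =ᶠ[nhds y] (f ∘ (extChartAt (𝓡 4) x).symm) ∘ (extChartAt (𝓡 4) x) := by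
      filter_upwards [extChartAt_source_mem_nhds' (I := 𝓡 4) hys] with z hz
      rw [Function.comp_apply, Function.comp_apply, (extChartAt (𝓡 4) x).left_inv hz]
    rw [this.mfderiv_eq]
    simp only [Function.comp_apply]
    rfl
  rw [heq, mvfderiv_comp_apply y hg hφ, hU, VectorField.mpullback_apply]
  have h5 : (mfderiv (𝓡 4) 𝓘(ℝ, R4) (extChartAt (𝓡 4) x) y)
      ((mfderiv (𝓡 4) 𝓘(ℝ, R4) (extChartAt (𝓡 4) x) y).inverse
        (chartField x U (extChartAt (𝓡 4) x y))) = chartField x U (extChartAt (𝓡 4) x y) := by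
    have := hinv.self_comp_inverse
    exact congrArg (fun L => L (chartField x U (extChartAt (𝓡 4) x y))) this
  erw [h5]
  unfold mvfderiv
  rw [mfderiv_eq_fderiv]
  rfl

/-- The Lie bracket acts on functions as the commutator of the two derivations. -/
theorem mvfderiv_mlieBracket (hf : FSmoothNear f x) (hU : SmoothNear R4 U x)
    (hW : SmoothNear R4 W x) :
    mvfderiv (𝓡 4) f x (VectorField.mlieBracket (𝓡 4) U W x)
      = mvfderiv (𝓡 4) (fun y => mvfderiv (𝓡 4) f y (W y)) x (U x)
        - mvfderiv (𝓡 4) (fun y => mvfderiv (𝓡 4) f y (U y)) x (W x) := by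
  have hchart : ∀ {h : M → ℝ}, FSmoothNear h x →
      ContDiffAt ℝ ∞ (h ∘ (extChartAt (𝓡 4) x).symm) (extChartAt (𝓡 4) x x) := by
    intro h hh
    have h1 : ContMDiffAt 𝓘(ℝ, R4) 𝓘(ℝ, ℝ) ∞ (h ∘ (extChartAt (𝓡 4) x).symm)
        (extChartAt (𝓡 4) x x) := by
      refine ContMDiffAt.comp (I' := 𝓡 4) _ ?_ ?_
      · rw [extChartAt_to_inv]; exact hh.self_of_nhds
      · exact (contMDiffOn_extChartAt_symm (n := ∞) (I := 𝓡 4) x).contMDiffAt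
          (extChartAt_target_mem_nhds x)
    exact contMDiffAt_iff_contDiffAt.mp h1
  have hcongr : ∀ {Z : (y : M) → TangentSpace (𝓡 4) y}, SmoothNear R4 Z x →
      (fun y => mvfderiv (𝓡 4) f y (Z y)) ∘ (extChartAt (𝓡 4) x).symm
        =ᶠ[nhds (extChartAt (𝓡 4) x x)] fun w => fderiv ℝ (f ∘ (extChartAt (𝓡 4) x).symm) w
          (chartField x Z w) := by
    intro Z hZ
    have hc : ContinuousAt (extChartAt (𝓡 4) x).symm (extChartAt (𝓡 4) x x) :=
      continuousAt_extChartAt_symm x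
    have h1 := mvfderiv_eq_chart (U := Z) hf
    rw [← extChartAt_to_inv (I := 𝓡 4) x] at h1
    filter_upwards [hc.eventually h1, extChartAt_target_mem_nhds (I := 𝓡 4) x] with w hw hw'
    have := (extChartAt (𝓡 4) x).right_inv hw'
    simp only [Function.comp_apply]
    rw [hw]
    simp only [extChartAt_to_inv, this]
  rw [(mvfderiv_eq_chart (U := W) (hf.deriv hU)).self_of_nhds,
    (mvfderiv_eq_chart (U := U) (hf.deriv hW)).self_of_nhds, (hcongr hU).fderiv_eq,
    (hcongr hW).fderiv_eq, ← VectorField.fderiv_apply_lieBracket (hchart hf) minSmoothness_two_le_infty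
      (chartField_differentiableAt hW) (chartField_differentiableAt hU),
    (mvfderiv_eq_chart (U := VectorField.mlieBracket (𝓡 4) U W) hf).self_of_nhds]
  congr 1
  have hinv := isInvertible_mfderiv_extChartAt (I := 𝓡 4) (mem_extChartAt_source (I := 𝓡 4) x)
  have h1 := ((VectorField.eventuallyEq_mpullback_mpullbackWithin_extChartAt (I := 𝓡 4)
    (s := Set.univ) (x := x) (VectorField.mlieBracket (𝓡 4) U W)).filter_mono
      (nhdsWithin_univ x).ge).self_of_nhds
  rw [VectorField.mpullback_apply] at h1
  have h2 : VectorField.mlieBracket (𝓡 4) U W x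
      = (mfderiv (𝓡 4) 𝓘(ℝ, R4) (extChartAt (𝓡 4) x) x).inverse
        (VectorField.lieBracket ℝ (chartField x U) (chartField x W) (extChartAt (𝓡 4) x x)) := by
    rw [← VectorField.mlieBracketWithin_univ, VectorField.mlieBracketWithin_apply]
    have hr : (extChartAt (𝓡 4) x).symm ⁻¹' Set.univ ∩ Set.range (𝓡 4) = Set.univ := by simp
    rw [hr]
    have hl := VectorField.lieBracketWithin_univ (𝕜 := ℝ) (V := chartField x U)
      (W := chartField x W)
    exact congrArg (fun v => (mfderiv (𝓡 4) 𝓘(ℝ, R4) (extChartAt (𝓡 4) x) x).inverse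
      (v (extChartAt (𝓡 4) x x))) hl
  have h3 := congrArg (mfderiv (𝓡 4) 𝓘(ℝ, R4) (extChartAt (𝓡 4) x) x) (h1.symm.trans h2)
  have h4 := fun v => congrArg (fun L => L v) hinv.self_comp_inverse
  exact (h4 _).symm.trans (h3.trans (h4 _))

theorem SmoothNear.mlieBracket (hU : SmoothNear R4 U x) (hW : SmoothNear R4 W x) :
    SmoothNear R4 (VectorField.mlieBracket (𝓡 4) U W) x := by
  have : IsManifold (𝓡 4) (((⊤ : ℕ∞) : WithTop ℕ∞) + 1) M := inferInstanceAs (IsManifold (𝓡 4) ∞ M)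
  filter_upwards [hU, hW] with y h1 h2
  have : IsManifold (𝓡 4) (minSmoothness ℝ 2) M := IsManifold.of_le (n := ∞) minSmoothness_two_le_infty
  exact ContMDiffAt.mlieBracket_vectorField (m := ⊤) (n := ⊤) h1 h2 (by simp)

theorem SmoothNear.covariant [T2Space M] [VectorBundle ℝ F V] [ContMDiffVectorBundle ∞ F V (𝓡 4)]
    [∀ x, IsTopologicalAddGroup (V x)] [∀ x, ContinuousSMul ℝ (V x)]
    {D : CovariantDerivative (𝓡 4) F V} (hD : D.ContMDiffCovariantDerivative ∞)
    {s : (y : M) → V y} (hs : SmoothNear F s x) (hU : SmoothNear R4 U x) :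
    SmoothNear F (fun y => D s y (U y)) x := by
  obtain ⟨O, hO, hOo, hxO⟩ := eventually_nhds_iff.mp hs
  obtain ⟨χ, hχ⟩ := ((SmoothBumpFunction.nhds_basis_tsupport (I := 𝓡 4) x).mem_iff.mp (hOo.mem_nhds hxO))
  have hglob := ContMDiffOn.smul_section_of_tsupport (ψ := χ) (s := s) (u := O) (n := ∞)
    (I := 𝓡 4) χ.contMDiff.contMDiffOn hOo hχ.2 (fun y hy => (hO y hy).contMDiffWithinAt)
  have h1 := hD.contMDiff.contMDiff (σ := (χ : M → ℝ) • s) hglob.contMDiffOn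
  have h1e : ∀ᶠ y in nhds x, χ y = 1 := χ.eventuallyEq_one
  filter_upwards [h1e.eventually_nhds.eventually_nhds, hU, hs.eventually_nhds] with y hy hUy hsy
  have h2 := (h1 y (Set.mem_univ y)).contMDiffAt Filter.univ_mem
  refine (ContMDiffAt.clm_bundle_apply h2 hUy).congr_of_eventuallyEq ?_
  filter_upwards [hy, hsy] with z hz hsz
  congr 2
  refine D.isCovariantDerivativeOnUniv.congr_of_eventuallyEq (hsz.mdifferentiableAt (by simp))
    ((hglob z).mdifferentiableAt (by simp)) Filter.univ_mem ?_
  filter_upwards [hz] with w hw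
  simp [hw]

end Derivatives

/-! ### Coordinate vector fields -/

section CoordField

variable {M : Type*} [TopologicalSpace M] [ChartedSpace R4 M] [IsManifold (𝓡 4) ∞ M]

/-- The vector field with constant coefficients `w` in the chart at `i`, extended by zero. -/
def coordField (i : M) (w : R4) (y : M) : TangentSpace (𝓡 4) y :=
  (trivializationAt R4 (fun y : M => TangentSpace (𝓡 4) y) i).symm y w

variable {i p : M}

theorem smoothNear_coordField (hp : p ∈ (chartAt R4 i).source) (w : R4) :
    SmoothNear R4 (coordField i w) p := by
  have hb : (trivializationAt R4 (fun y : M => TangentSpace (𝓡 4) y) i).baseSet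
      = (chartAt R4 i).source := rfl
  filter_upwards [(chartAt R4 i).open_source.mem_nhds hp] with y hy
  rw [Trivialization.contMDiffAt_section_iff
    (trivializationAt R4 (fun y : M => TangentSpace (𝓡 4) y) i) (hb ▸ hy)]
  refine (contMDiffAt_const (c := w)).congr_of_eventuallyEq ?_
  filter_upwards [(chartAt R4 i).open_source.mem_nhds hy] with z hz
  have hz' : z ∈ (trivializationAt R4 (fun y : M => TangentSpace (𝓡 4) y) i).baseSet := hz
  simp [coordField, Trivialization.apply_mk_symm _ hz']

theorem mfderiv_coordField (hp : p ∈ (chartAt R4 i).source) (w : R4) :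
    mfderiv (𝓡 4) 𝓘(ℝ, R4) (extChartAt (𝓡 4) i) p (coordField i w p) = w := by
  have hp' : p ∈ (trivializationAt R4 (fun y : M => TangentSpace (𝓡 4) y) i).baseSet := hp
  rw [← TangentBundle.continuousLinearMapAt_trivializationAt hp]
  have := Trivialization.continuousLinearMapAt_symmL (R := ℝ)
    (trivializationAt R4 (fun y : M => TangentSpace (𝓡 4) y) i) hp' w
  rw [Trivialization.symmL_apply _ hp'] at this
  exact this

theorem coordFrame_eq_coordField {y : R4} (hy : y ∈ (extChartAt (𝓡 4) i).target) (k : Fin 4) :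
    coordFrame i y k = coordField i (EuclideanSpace.single k 1) ((extChartAt (𝓡 4) i).symm y) := by
  have hp : (extChartAt (𝓡 4) i).symm y ∈ (chartAt R4 i).source := by
    simpa using (extChartAt (𝓡 4) i).map_target hy
  have hp' : (extChartAt (𝓡 4) i).symm y ∈
    (trivializationAt R4 (fun y : M => TangentSpace (𝓡 4) y) i).baseSet := hp
  have h := TangentBundle.symmL_trivializationAt (I := 𝓡 4) hp
  rw [coordField, ← Trivialization.symmL_apply (R := ℝ) _ hp', h]
  simp only [modelWithCornersSelf_coe, Set.range_id, mfderivWithin_univ, coordFrame]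
  rw [(extChartAt (𝓡 4) i).right_inv hy]
  rfl

theorem linearIndependent_coordField (hp : p ∈ (chartAt R4 i).source) :
    LinearIndependent ℝ (fun k : Fin 4 => coordField i (EuclideanSpace.single k 1) p) := by
  refine LinearIndependent.of_comp
    (mfderiv (𝓡 4) 𝓘(ℝ, R4) (extChartAt (𝓡 4) i) p).toLinearMap ?_
  have : (mfderiv (𝓡 4) 𝓘(ℝ, R4) (extChartAt (𝓡 4) i) p).toLinearMap ∘
      (fun k : Fin 4 => coordField i (EuclideanSpace.single k 1) p)
      = fun k : Fin 4 => (EuclideanSpace.single k (1 : ℝ) : R4) := by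
    funext k; exact mfderiv_coordField hp _
  rw [this]
  have := (EuclideanSpace.basisFun (Fin 4) ℝ).toBasis.linearIndependent
  have e : (fun k : Fin 4 => (EuclideanSpace.single k (1 : ℝ) : R4))
      = (EuclideanSpace.basisFun (Fin 4) ℝ).toBasis := by
    funext k; simp
  rw [e]; exact this

end CoordField

/-! ### The curvature tensor of a covariant derivative -/

section CurvatureTensor

variable {M : Type*} [TopologicalSpace M] [ChartedSpace R4 M] [IsManifold (𝓡 4) ∞ M] [T2Space M]
  {F : Type*} [NormedAddCommGroup F] [NormedSpace ℝ F] [FiniteDimensional ℝ F]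
  {V : M → Type*} [TopologicalSpace (TotalSpace F V)] [∀ x, AddCommGroup (V x)]
  [∀ x, Module ℝ (V x)] [∀ x, TopologicalSpace (V x)] [∀ x, IsTopologicalAddGroup (V x)]
  [∀ x, ContinuousSMul ℝ (V x)] [FiberBundle F V] [VectorBundle ℝ F V]
  [ContMDiffVectorBundle ∞ F V (𝓡 4)]
  {D : CovariantDerivative (𝓡 4) F V}
  {s t : (y : M) → V y} {f g : M → ℝ} {x : M} {U W Z : (y : M) → TangentSpace (𝓡 4) y}

theorem covariant_congr (hs : SmoothNear F s x) (h : ∀ᶠ y in nhds x, t y = s y) :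
    D t x = D s x :=
  D.isCovariantDerivativeOnUniv.congr_of_eventuallyEq (hs.congr h).mdiff hs.mdiff
    Filter.univ_mem h

theorem covariant_add (hs : SmoothNear F s x) (ht : SmoothNear F t x) :
    D (s + t) x = D s x + D t x :=
  D.isCovariantDerivativeOnUniv.add hs.mdiff ht.mdiff

theorem covariant_smul (hf : FSmoothNear f x) (hs : SmoothNear F s x)
    (u : TangentSpace (𝓡 4) x) :
    D (f • s) x u = f x • D s x u + mvfderiv (𝓡 4) f x u • s x := by
  have h := congrArg (fun L => L u) (D.isCovariantDerivativeOnUniv.leibniz hs.mdiff hf.mdiff)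
  simpa using h

theorem covariant_neg (hs : SmoothNear F s x) : D (-s) x = - D s x := by
  have h := D.isCovariantDerivativeOnUniv.smul_const (-1 : ℝ) hs.mdiff
  simpa using h

theorem SmoothNear.neg (hs : SmoothNear F s x) : SmoothNear F (-s) x := by
  filter_upwards [hs] with y h1 using h1.neg_section

theorem covariant_sub (hs : SmoothNear F s x) (ht : SmoothNear F t x) :
    D (s - t) x = D s x - D t x := by
  rw [sub_eq_add_neg, covariant_add hs ht.neg, covariant_neg ht, sub_eq_add_neg]

/-- The curvature `∇_U ∇_W s - ∇_W ∇_U s - ∇_[U,W] s` for given local sections. -/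
def curvOp (D : CovariantDerivative (𝓡 4) F V) (s : (y : M) → V y)
    (U W : (y : M) → TangentSpace (𝓡 4) y) (x : M) : V x :=
  D (fun y => D s y (W y)) x (U x) - D (fun y => D s y (U y)) x (W x)
    - D s x (VectorField.mlieBracket (𝓡 4) U W x)

theorem curvOp_swap : curvOp D s U W x = - curvOp D s W U x := by
  have h : VectorField.mlieBracket (𝓡 4) U W x = - VectorField.mlieBracket (𝓡 4) W U x :=
    VectorField.mlieBracket_swap_apply
  rw [curvOp, curvOp, h, map_neg]
  abel

variable (hD : D.ContMDiffCovariantDerivative ∞)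
include hD

theorem curvOp_add_section (hs : SmoothNear F s x) (ht : SmoothNear F t x)
    (hU : SmoothNear R4 U x) (hW : SmoothNear R4 W x) :
    curvOp D (s + t) U W x = curvOp D s U W x + curvOp D t U W x := by
  have h : ∀ {Z : (y : M) → TangentSpace (𝓡 4) y}, SmoothNear R4 Z x →
      D (fun y => D (s + t) y (Z y)) x
        = D (fun y => D s y (Z y)) x + D (fun y => D t y (Z y)) x := by
    intro Z hZ
    rw [← covariant_add (hs.covariant hD hZ) (ht.covariant hD hZ)]
    refine covariant_congr ((hs.covariant hD hZ).add (ht.covariant hD hZ)) ?_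
    filter_upwards [hs.eventually, ht.eventually] with y h1 h2
    rw [covariant_add h1 h2]; rfl
  rw [curvOp, curvOp, curvOp, h hU, h hW, covariant_add hs ht]
  simp only [add_apply]
  abel

theorem curvOp_smul_section (hf : FSmoothNear f x) (hs : SmoothNear F s x)
    (hU : SmoothNear R4 U x) (hW : SmoothNear R4 W x) :
    curvOp D (f • s) U W x = f x • curvOp D s U W x := by
  have h : ∀ {Z : (y : M) → TangentSpace (𝓡 4) y}, SmoothNear R4 Z x →
      ∀ v, D (fun y => D (f • s) y (Z y)) x v
        = f x • D (fun y => D s y (Z y)) x v + mvfderiv (𝓡 4) f x v • D s x (Z x)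
          + (mvfderiv (𝓡 4) f x (Z x) • D s x v
            + mvfderiv (𝓡 4) (fun y => mvfderiv (𝓡 4) f y (Z y)) x v • s x) := by
    intro Z hZ v
    rw [← covariant_smul hf (hs.covariant hD hZ), ← covariant_smul (hf.deriv hZ) hs,
      ← add_apply, ← covariant_add ((hs.covariant hD hZ).smul hf)
        (hs.smul (hf.deriv hZ))]
    congr 1
    refine covariant_congr (((hs.covariant hD hZ).smul hf).add (hs.smul (hf.deriv hZ))) ?_
    filter_upwards [hs.eventually, hf.eventually] with y h1 h2
    rw [covariant_smul h2 h1]; rfl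
  rw [curvOp, curvOp, h hU, h hW, covariant_smul hf hs, mvfderiv_mlieBracket hf hU hW]
  module

theorem curvOp_add_left (hs : SmoothNear F s x) (hU : SmoothNear R4 U x)
    (hZ : SmoothNear R4 Z x) :
    curvOp D s (U + Z) W x = curvOp D s U W x + curvOp D s Z W x := by
  have h : D (fun y => D s y ((U + Z) y)) x
        = D (fun y => D s y (U y)) x + D (fun y => D s y (Z y)) x := by
    rw [← covariant_add (hs.covariant hD hU) (hs.covariant hD hZ)]
    congr 1; funext y; simp
  have hb := VectorField.mlieBracket_add_left (W := W) hU.mdiff hZ.mdiff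
  rw [curvOp, curvOp, curvOp, h, hb, Pi.add_apply]
  simp only [add_apply, map_add]
  abel

theorem curvOp_smul_left (hf : FSmoothNear f x) (hs : SmoothNear F s x) (hU : SmoothNear R4 U x) :
    curvOp D s (f • U) W x = f x • curvOp D s U W x := by
  have h : ∀ v, D (fun y => D s y ((f • U) y)) x v
        = f x • D (fun y => D s y (U y)) x v + mvfderiv (𝓡 4) f x v • D s x (U x) := by
    intro v
    rw [← covariant_smul hf (hs.covariant hD hU)]
    congr 2; funext y; simp
  have hb := VectorField.mlieBracket_smul_left (W := W) hf.mdiff hU.mdiff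
  rw [curvOp, curvOp, h, hb]
  simp only [Pi.smul_apply', map_smul, map_add]
  module

theorem curvature_eq_curvOp (hs : SmoothNear F s x) (hU : SmoothNear R4 U x)
    (hW : SmoothNear R4 W x) : curvature D x (U x) (W x) (s x) = curvOp D s U W x := by
  have hs' : SmoothNear F (FiberBundle.extend F (s x)) x := smoothNear_extend (s x)
  have hU' : SmoothNear R4 (FiberBundle.extend R4 (U x)) x := smoothNear_extend (U x)
  have hW' : SmoothNear R4 (FiberBundle.extend R4 (W x)) x := smoothNear_extend (W x)
  have h0 : curvature D x (U x) (W x) (s x) = curvOp D (FiberBundle.extend F (s x))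
      (FiberBundle.extend R4 (U x)) (FiberBundle.extend R4 (W x)) x := by
    simp only [curvature, curvOp, FiberBundle.extend_apply_self]
  rw [h0]
  have h1 : ∀ {U W : (y : M) → TangentSpace (𝓡 4) y}, SmoothNear R4 U x → SmoothNear R4 W x →
      curvOp D (FiberBundle.extend F (s x)) U W x = curvOp D s U W x := by
    intro U W hU hW
    exact eq_of_tensorial (Φ := fun s => curvOp D s U W x)
      (fun f s hf hs => curvOp_smul_section hD hf hs hU hW)
      (fun s t hs ht => curvOp_add_section hD hs ht hU hW) hs' hs (by simp)
  have h2 : ∀ {U U' W : (y : M) → TangentSpace (𝓡 4) y}, SmoothNear R4 U x →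
      SmoothNear R4 U' x → SmoothNear R4 W x → U x = U' x →
      curvOp D s U W x = curvOp D s U' W x := by
    intro U U' W hU hU' hW h
    exact eq_of_tensorial (Φ := fun U => curvOp D s U W x)
      (fun f U hf hU => curvOp_smul_left hD hf hs hU)
      (fun U U' hU hU' => curvOp_add_left hD hs hU hU') hU hU' h
  rw [h1 hU' hW', h2 hU' hU hW' (by simp), curvOp_swap, h2 hW' hW hU (by simp), ← curvOp_swap]

variable (u v w : TangentSpace (𝓡 4) x) (e e' : V x) (c : ℝ)

theorem curvature_eq_extend : curvature D x u v e = curvOp D (FiberBundle.extend F e)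
      (FiberBundle.extend R4 u) (FiberBundle.extend R4 v) x := by
  simp only [curvature, curvOp, FiberBundle.extend_apply_self]

theorem curvature_swap : curvature D x u v e = - curvature D x v u e := by
  rw [curvature_eq_extend hD, curvature_eq_extend hD, curvOp_swap]

theorem curvature_add_section :
    curvature D x u v (e + e') = curvature D x u v e + curvature D x u v e' := by
  have h := curvature_eq_curvOp hD ((smoothNear_extend (F := F) e).add (smoothNear_extend e'))
    (smoothNear_extend (F := R4) u) (smoothNear_extend v)
  simp only [FiberBundle.extend_apply_self, Pi.add_apply] at h
  rw [h, curvOp_add_section hD (smoothNear_extend e) (smoothNear_extend e')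
    (smoothNear_extend u) (smoothNear_extend v), curvature_eq_extend hD, curvature_eq_extend hD]

theorem curvature_smul_section :
    curvature D x u v (c • e) = c • curvature D x u v e := by
  have hc : FSmoothNear (fun _ : M => c) x := FSmoothNear.const c
  have h := curvature_eq_curvOp hD ((smoothNear_extend (F := F) e).smul hc)
    (smoothNear_extend (F := R4) u) (smoothNear_extend v)
  simp only [FiberBundle.extend_apply_self, Pi.smul_apply'] at h
  rw [h, curvOp_smul_section hD hc (smoothNear_extend e)
    (smoothNear_extend u) (smoothNear_extend v), curvature_eq_extend hD]

theorem curvature_add_left :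
    curvature D x (u + v) w e = curvature D x u w e + curvature D x v w e := by
  have h := curvature_eq_curvOp hD (smoothNear_extend (F := F) e)
    ((smoothNear_extend (F := R4) u).add (smoothNear_extend v)) (smoothNear_extend w)
  simp only [FiberBundle.extend_apply_self, Pi.add_apply] at h
  rw [h, curvOp_add_left hD (smoothNear_extend e) (smoothNear_extend u)
    (smoothNear_extend v), curvature_eq_extend hD, curvature_eq_extend hD]

theorem curvature_smul_left :
    curvature D x (c • u) w e = c • curvature D x u w e := by
  have hc : FSmoothNear (fun _ : M => c) x := FSmoothNear.const c
  have h := curvature_eq_curvOp hD (smoothNear_extend (F := F) e)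
    ((smoothNear_extend (F := R4) u).smul hc) (smoothNear_extend w)
  simp only [FiberBundle.extend_apply_self, Pi.smul_apply'] at h
  rw [h, curvOp_smul_left hD hc (smoothNear_extend e) (smoothNear_extend u),
    curvature_eq_extend hD]

end CurvatureTensor

/-! ### Metric connections and their variations -/

section MetricConnection

variable {M : Type*} [TopologicalSpace M] [ChartedSpace R4 M] [IsManifold (𝓡 4) ∞ M] [T2Space M]
  {E : M → Type*} [∀ x, NormedAddCommGroup (E x)] [∀ x, InnerProductSpace ℝ (E x)]
  [TopologicalSpace (TotalSpace R3 E)] [FiberBundle R3 E] [VectorBundle ℝ R3 E]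
  [ContMDiffVectorBundle ∞ R3 E (𝓡 4)] [IsContMDiffRiemannianBundle (𝓡 4) ∞ R3 E]
  {A : CovariantDerivative (𝓡 4) R3 E}
  {a b : (x : M) → E x →L[ℝ] TangentSpace (𝓡 4) x →L[ℝ] E x}
  {s t : (y : M) → E y} {f g : M → ℝ} {x : M} {U W Z : (y : M) → TangentSpace (𝓡 4) y}

theorem FSmoothNear.inner (hs : SmoothNear R3 s x) (ht : SmoothNear R3 t x) :
    FSmoothNear (fun y => inner ℝ (s y) (t y)) x := by
  filter_upwards [hs, ht] with y h1 h2
  exact ContMDiffAt.inner_bundle (IB := 𝓡 4) (F := R3) (b := fun y => y) h1 h2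

theorem SmoothNear.soForm (ha : IsSoForm a) (hs : SmoothNear R3 s x) (hU : SmoothNear R4 U x) :
    SmoothNear R3 (fun y => a y (s y) (U y)) x := by
  filter_upwards [hs, hU] with y h1 h2
  exact ContMDiffAt.clm_bundle_apply₂ (F₁ := R3) (F₂ := R4) (F₃ := R3) (b := fun y => y)
    (ha.smooth.contMDiffAt) h1 h2

theorem mvfderiv_congr (h : f =ᶠ[nhds x] g) (u : TangentSpace (𝓡 4) x) :
    mvfderiv (𝓡 4) f x u = mvfderiv (𝓡 4) g x u := by
  have h1 : (mfderiv (𝓡 4) 𝓘(ℝ, ℝ) f x : R4 →L[ℝ] ℝ) = mfderiv (𝓡 4) 𝓘(ℝ, ℝ) g x := h.mfderiv_eq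
  exact congrArg (fun L : R4 →L[ℝ] ℝ => L u) h1

theorem mvfderiv_inner (hA : IsSO3Connection A) (hs : SmoothNear R3 s x) (ht : SmoothNear R3 t x)
    (u : TangentSpace (𝓡 4) x) :
    mvfderiv (𝓡 4) (fun y => inner ℝ (s y) (t y)) x u
      = inner ℝ (A s x u) (t x) + inner ℝ (s x) (A t x u) := by
  have h := hA.metric.mvfderiv_inner_eq (FiberBundle.extend R4 u) hs.mdiff ht.mdiff
  simpa using h

theorem curvature_skew (hA : IsSO3Connection A) (u v : TangentSpace (𝓡 4) x) (e e' : E x) :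
    inner ℝ (curvature A x u v e) e' = - inner ℝ e (curvature A x u v e') := by
  set s : (y : M) → E y := FiberBundle.extend R3 e with hs0
  set t : (y : M) → E y := FiberBundle.extend R3 e' with ht0
  set U : (y : M) → TangentSpace (𝓡 4) y := FiberBundle.extend R4 u with hU0
  set W : (y : M) → TangentSpace (𝓡 4) y := FiberBundle.extend R4 v with hW0
  have hs : SmoothNear R3 s x := smoothNear_extend e
  have ht : SmoothNear R3 t x := smoothNear_extend e'
  have hU : SmoothNear R4 U x := smoothNear_extend u
  have hW : SmoothNear R4 W x := smoothNear_extend v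
  have hse : s x = e := by simp [s]
  have hte : t x = e' := by simp [t]
  have h2 : ∀ {U W : (y : M) → TangentSpace (𝓡 4) y}, SmoothNear R4 U x → SmoothNear R4 W x →
      mvfderiv (𝓡 4) (fun y => mvfderiv (𝓡 4) (fun y => inner ℝ (s y) (t y)) y (W y)) x (U x)
      = inner ℝ (A (fun y => A s y (W y)) x (U x)) (t x) + inner ℝ (A s x (W x)) (A t x (U x))
        + (inner ℝ (A s x (U x)) (A t x (W x)) + inner ℝ (s x) (A (fun y => A t y (W y)) x (U x))) := by
    intro U W hU hW
    rw [← mvfderiv_inner hA (hs.covariant hA.smooth hW) ht,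
      ← mvfderiv_inner hA hs (ht.covariant hA.smooth hW), ← add_apply]
    rw [← mvfderiv_add (FSmoothNear.inner (hs.covariant hA.smooth hW) ht).mdiff
      (FSmoothNear.inner hs (ht.covariant hA.smooth hW)).mdiff]
    have hEq : (fun y => mvfderiv (𝓡 4) (fun y => inner ℝ (s y) (t y)) y (W y))
        =ᶠ[nhds x] ((fun y => inner ℝ (A s y (W y)) (t y)) + fun y => inner ℝ (s y) (A t y (W y))) := by
      filter_upwards [hs.eventually, ht.eventually] with y h1 h2
      rw [mvfderiv_inner hA h1 h2]; rfl
    exact mvfderiv_congr hEq _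
  have hbr := mvfderiv_mlieBracket (FSmoothNear.inner hs ht) hU hW
  rw [mvfderiv_inner hA hs ht, h2 hU hW, h2 hW hU] at hbr
  have hc1 := curvature_eq_curvOp hA.smooth hs hU hW
  have hc2 := curvature_eq_curvOp hA.smooth ht hU hW
  simp only [hse, hte, hU0, hW0, FiberBundle.extend_apply_self] at hc1 hc2 hbr
  rw [hc1, hc2]
  simp only [curvOp, inner_sub_left, inner_sub_right, FiberBundle.extend_apply_self] at hbr ⊢
  linarith

theorem shift_apply (c : ℝ) (u : TangentSpace (𝓡 4) x) :
    shift A a c s x u = A s x u + c • a x (s x) u := rfl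

theorem curvature_shift (hA : IsSO3Connection A) (ha : IsSoForm a) (c : ℝ)
    (u v : TangentSpace (𝓡 4) x) (e : E x) :
    curvature (shift A a c) x u v e = curvature A x u v e + c • dA A a x u v e
      + c ^ 2 • (a x (a x e v) u - a x (a x e u) v) := by
  set s : (y : M) → E y := FiberBundle.extend R3 e with hs0
  have hs : SmoothNear R3 s x := smoothNear_extend e
  have hse : s x = e := by simp [s]
  have h : ∀ {W : (y : M) → TangentSpace (𝓡 4) y}, SmoothNear R4 W x →
      ∀ u, A (fun y => shift A a c s y (W y)) x u = A (fun y => A s y (W y)) x u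
        + c • A (fun y => a y (s y) (W y)) x u := by
    intro W hW u
    have h1 := hs.soForm ha hW
    have h2 := h1.smul (FSmoothNear.const c)
    have h3 : (fun y => shift A a c s y (W y)) = (fun y => A s y (W y))
        + ((fun _ : M => c) • (fun y => a y (s y) (W y))) := by
      funext y; rfl
    rw [h3, covariant_add (hs.covariant hA.smooth hW) h2, add_apply,
      covariant_smul (FSmoothNear.const c) h1, mvfderiv_const]
    simp
  simp only [curvature, dA, ← hs0]
  rw [shift_apply, shift_apply, shift_apply, shift_apply, shift_apply,
    h (smoothNear_extend v), h (smoothNear_extend u)]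
  have haux : ∀ (p q : E x) (w : TangentSpace (𝓡 4) x),
      a x (p + c • q) w = a x p w + c • a x q w := by
    intro p q w
    rw [(a x).map_add, (a x).map_smul]
    rfl
  simp only [FiberBundle.extend_apply_self, hse, haux]
  module

theorem IsSO3Connection.shift (hA : IsSO3Connection A) (ha : IsSoForm a) (c : ℝ) :
    IsSO3Connection (shift A a c) := by
  constructor
  · rw [CovariantDerivative.isMetricCompatible_iff]
    intro x X σ τ hX hσ hτ
    rw [hA.metric.mvfderiv_inner_eq X hσ hτ]
    simp only [shift_apply, inner_add_left, inner_add_right, inner_smul_left, inner_smul_right,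
      ha.skew x (X x) (σ x) (τ x)]
    simp
    ring
  · refine ⟨⟨fun {σ} hσ => ?_⟩⟩
    have h1 := hA.smooth.contMDiff.contMDiff hσ
    have hσ' : ContMDiff (𝓡 4) ((𝓡 4).prod 𝓘(ℝ, R3)) ∞ (fun y => TotalSpace.mk' R3 y (σ y)) := by
      simpa using contMDiffOn_univ.mp hσ
    have h2 := ContMDiff.const_smul_section (a := c) (ha.smooth.clm_bundle_apply hσ')
    exact h1.add_section h2.contMDiffOn

/-- `d_A a` as a difference of curvatures of smooth connections. -/
theorem dA_eq_curvature (hA : IsSO3Connection A) (ha : IsSoForm a)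
    (u v : TangentSpace (𝓡 4) x) (e : E x) :
    dA A a x u v e = (1 / 2 : ℝ) • (curvature (shift A a 1) x u v e
      - curvature (shift A a (-1)) x u v e) := by
  rw [curvature_shift hA ha, curvature_shift hA ha]
  module

theorem dA_smul (ha : IsSoForm a) (hf : FSmoothNear f x)
    (u v : TangentSpace (𝓡 4) x) (e : E x) :
    dA A (fun y => f y • a y) x u v e = f x • dA A a x u v e
      + (mvfderiv (𝓡 4) f x u • a x e v - mvfderiv (𝓡 4) f x v • a x e u) := by
  set s : (y : M) → E y := FiberBundle.extend R3 e with hs0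
  have hs : SmoothNear R3 s x := smoothNear_extend e
  have hse : s x = e := by simp [s]
  have h : ∀ {W : (y : M) → TangentSpace (𝓡 4) y}, SmoothNear R4 W x →
      ∀ u, A (fun y => (f y • a y) (s y) (W y)) x u = f x • A (fun y => a y (s y) (W y)) x u
        + mvfderiv (𝓡 4) f x u • a x (s x) (W x) := by
    intro W hW u
    rw [← covariant_smul hf (hs.soForm ha hW)]
    rfl
  simp only [dA, ← hs0]
  rw [h (smoothNear_extend v), h (smoothNear_extend u)]
  simp only [FiberBundle.extend_apply_self, hse, smul_apply]
  module

end MetricConnection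

/-! ### The square root of a positive definite matrix -/

section SquareRoot

open Matrix

variable {G S H : Matrix (Fin 3) (Fin 3) ℝ}

/-- The Sylvester equation `SH + HS = 0` has only the trivial solution when `S` is positive
definite. -/
theorem sylvester_eq_zero (hS : S.PosDef) (h : S * H + H * S = 0) : H = 0 := by
  have h1 : (Hᵀ * (S * H + H * S)).trace = 0 := by simp [h]
  have h2 : (Hᴴ * S * H).PosSemidef := hS.posSemidef.conjTranspose_mul_mul_same H
  have h3 : (H * S * Hᴴ).PosSemidef := hS.posSemidef.mul_mul_conjTranspose_same H
  rw [conjTranspose_eq_transpose_of_trivial] at h2 h3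
  have h4 : (Hᵀ * S * H).trace + (H * S * Hᵀ).trace = 0 := by
    rw [← h1, mul_add, trace_add, ← mul_assoc, trace_mul_comm (H * S) Hᵀ]
  have h5 : (Hᵀ * S * H).trace = 0 := le_antisymm (by linarith [h3.trace_nonneg]) h2.trace_nonneg
  have h6 := h2.trace_eq_zero_iff.mp h5
  ext i j
  by_contra hne
  have hx : (H *ᵥ Pi.single j 1) ≠ 0 := fun h0 => hne (by simpa using congrFun h0 i)
  have h7 := hS.dotProduct_mulVec_pos hx
  have h8 : star (H *ᵥ Pi.single j 1) ⬝ᵥ (S *ᵥ (H *ᵥ Pi.single j 1))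
      = (Hᵀ * S * H) j j := by
    simp only [star_trivial, mulVec_mulVec, dotProduct_mulVec]
    rw [← vecMul_transpose, vecMul_vecMul, ← dotProduct_mulVec]
    simp [mul_assoc]
  rw [h8, h6] at h7
  simp at h7

/-- Two solutions of the same Sylvester equation agree. -/
theorem sylvester_unique {H' : Matrix (Fin 3) (Fin 3) ℝ} (hS : S.PosDef)
    (h : S * H + H * S = S * H' + H' * S) : H = H' := by
  refine sub_eq_zero.mp (sylvester_eq_zero hS ?_)
  rw [mul_sub, sub_mul]
  linear_combination (norm := abel) h

theorem sqrt_conj {R : Matrix (Fin 3) (Fin 3) ℝ} (hR : Rᵀ * R = 1) (hG : G.PosDef) :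
    CFC.sqrt (R * G * Rᵀ) = R * CFC.sqrt G * Rᵀ := by
  apply CFC.sqrt_unique
  · calc R * CFC.sqrt G * Rᵀ * (R * CFC.sqrt G * Rᵀ)
        = R * CFC.sqrt G * (Rᵀ * R) * CFC.sqrt G * Rᵀ := by simp only [mul_assoc]
      _ = R * (CFC.sqrt G * CFC.sqrt G) * Rᵀ := by rw [hR]; simp only [mul_assoc, mul_one]
      _ = R * G * Rᵀ := by rw [CFC.sqrt_mul_sqrt_self G hG.posSemidef.nonneg]
  · have := (sqrt_posDef hG).posSemidef.mul_mul_conjTranspose_same R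
    rw [conjTranspose_eq_transpose_of_trivial] at this
    exact this.nonneg

theorem sqrt_smul {c : ℝ} (hc : 0 < c) (hG : G.PosDef) :
    CFC.sqrt (c • G) = Real.sqrt c • CFC.sqrt G := by
  apply CFC.sqrt_unique
  · rw [smul_mul_smul_comm, CFC.sqrt_mul_sqrt_self G hG.posSemidef.nonneg, Real.mul_self_sqrt hc.le]
  · exact ((sqrt_posDef hG).posSemidef.smul (Real.sqrt_nonneg c)).nonneg

theorem posDef_conj {R : Matrix (Fin 3) (Fin 3) ℝ} (hR : Rᵀ * R = 1) (hG : G.PosDef) :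
    (R * G * Rᵀ).PosDef := by
  have h : Function.Injective R.vecMul := by
    have h' : R * Rᵀ = 1 := mul_eq_one_comm.mp hR
    intro v w hvw
    have := congrArg (fun z => z ᵥ* Rᵀ) hvw
    simpa [vecMul_vecMul, h'] using this
  have := hG.mul_mul_conjTranspose_same h
  rwa [conjTranspose_eq_transpose_of_trivial] at this

theorem signedRoot_smul {Λ c : ℝ} (hc : 0 < c) (hG : G.PosDef) :
    signedRoot Λ (c • G) = signedRoot Λ G := by
  have h1 : Real.sqrt c ≠ 0 := (Real.sqrt_pos.mpr hc).ne'
  have h2 : (CFC.sqrt G).trace ≠ 0 := (sqrt_posDef hG).trace_pos.ne'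
  rw [signedRoot, signedRoot, sqrt_smul hc hG, trace_smul, smul_smul, smul_eq_mul]
  congr 1
  field_simp

theorem signedRoot_conj {Λ : ℝ} {R : Matrix (Fin 3) (Fin 3) ℝ} (hR : Rᵀ * R = 1) (hG : G.PosDef) :
    signedRoot Λ (R * G * Rᵀ) = R * signedRoot Λ G * Rᵀ := by
  rw [signedRoot, signedRoot, sqrt_conj hR hG, trace_mul_comm, ← mul_assoc, hR, one_mul]
  simp

theorem signedRoot_symm {Λ : ℝ} (hG : G.PosDef) : (signedRoot Λ G)ᵀ = signedRoot Λ G := by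
  rw [signedRoot, transpose_smul]
  congr 1
  have := (sqrt_posDef hG).isHermitian
  rwa [IsHermitian, conjTranspose_eq_transpose_of_trivial] at this

section L2

open scoped Matrix.Norms.L2Operator

theorem exists_contDiffAt_sqrt (hG : G.PosDef) :
    ∃ ψ : Matrix (Fin 3) (Fin 3) ℝ → Matrix (Fin 3) (Fin 3) ℝ, ContDiffAt ℝ ∞ ψ G ∧
      ∀ᶠ G' in nhdsWithin G {G' | 0 ≤ G'}, ψ G' = CFC.sqrt G' := by
  set S := CFC.sqrt G with hSdef
  have hS : S.PosDef := sqrt_posDef hG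
  have hSS : S * S = G := CFC.sqrt_mul_sqrt_self G hG.posSemidef.nonneg
  let f : Matrix (Fin 3) (Fin 3) ℝ → Matrix (Fin 3) (Fin 3) ℝ := fun T => T * T
  have hf : ContDiff ℝ ∞ f := contDiff_id.mul contDiff_id
  let L : Matrix (Fin 3) (Fin 3) ℝ →L[ℝ] Matrix (Fin 3) (Fin 3) ℝ := fderiv ℝ f S
  have hL : ∀ H, L H = S * H + H * S := by
    intro H
    have h := (hasFDerivAt_id (𝕜 := ℝ) S).mul' (hasFDerivAt_id (𝕜 := ℝ) S)
    have h' : fderiv ℝ f S = _ := h.fderiv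
    simp only [L, h']
    simp
  have hinj : Function.Injective L := by
    intro H H' h
    rw [hL, hL] at h
    exact sylvester_unique hS h
  let e : Matrix (Fin 3) (Fin 3) ℝ ≃L[ℝ] Matrix (Fin 3) (Fin 3) ℝ :=
    (LinearEquiv.ofInjectiveEndo (L : Matrix (Fin 3) (Fin 3) ℝ →ₗ[ℝ] Matrix (Fin 3) (Fin 3) ℝ) hinj).toContinuousLinearEquiv
  have he : (e : Matrix (Fin 3) (Fin 3) ℝ →L[ℝ] Matrix (Fin 3) (Fin 3) ℝ) = L := by
    rfl
  have hd : HasFDerivAt f (e : Matrix (Fin 3) (Fin 3) ℝ →L[ℝ] Matrix (Fin 3) (Fin 3) ℝ) S := by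
    rw [he]
    exact (hf.differentiable (by simp) S).hasFDerivAt
  have hfS : f S = G := hSS
  refine ⟨hf.contDiffAt.localInverse hd (by simp), ?_, ?_⟩
  · have := hf.contDiffAt.to_localInverse hd (by simp)
    rwa [hfS] at this
  · have hstrict : HasStrictFDerivAt f (e : Matrix (Fin 3) (Fin 3) ℝ →L[ℝ] Matrix (Fin 3) (Fin 3) ℝ) S :=
      hf.contDiffAt.hasStrictFDerivAt' hd (by simp)
    have hleft := hstrict.eventually_left_inverse
    have hc : Filter.Tendsto CFC.sqrt (nhdsWithin G {G' | 0 ≤ G'}) (nhds S) :=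
      CFC.continuousOn_sqrt G hG.posSemidef.nonneg
    filter_upwards [hc.eventually hleft, self_mem_nhdsWithin] with G' h1 h2
    have : f (CFC.sqrt G') = G' := CFC.sqrt_mul_sqrt_self G' h2
    rw [this] at h1
    exact h1

variable {W : Type*} [NormedAddCommGroup W] [NormedSpace ℝ W]

/-- The entries of the square root of a family of positive definite matrices are as smooth as the
entries of the family. -/
theorem contDiffAt_sqrt {n : ℕ∞} {G : W → Matrix (Fin 3) (Fin 3) ℝ} {w : W}
    (hs : ∀ i j, ContDiffAt ℝ n (fun z => G z i j) w) (hpos : ∀ᶠ z in nhds w, (G z).PosDef)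
    (i j : Fin 3) : ContDiffAt ℝ n (fun z => CFC.sqrt (G z) i j) w := by
  obtain ⟨ψ, hψ, hψ'⟩ := exists_contDiffAt_sqrt hpos.self_of_nhds
  have hGs : ContDiffAt ℝ n G w := by
    have : G = fun z => ∑ i, ∑ j, G z i j • Matrix.single i j (1 : ℝ) := by
      funext z
      conv_lhs => rw [matrix_eq_sum_single (G z)]
      simp
    rw [this]
    exact ContDiffAt.sum fun i _ => ContDiffAt.sum fun j _ => (hs i j).smul contDiffAt_const
  have h1 : ContDiffAt ℝ n (fun z => ψ (G z)) w :=
    ContDiffAt.comp w (hψ.of_le (by exact_mod_cast le_top)) hGs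
  let ev : Matrix (Fin 3) (Fin 3) ℝ →L[ℝ] ℝ := (Matrix.entryLinearMap ℝ ℝ i j).toContinuousLinearMap
  have h2 : ContDiffAt ℝ n (fun z => ev (ψ (G z))) w := ev.contDiff.contDiffAt.comp w h1
  refine h2.congr_of_eventuallyEq ?_
  have hcont : Filter.Tendsto G (nhds w) (nhdsWithin (G w) {G' | 0 ≤ G'}) := by
    refine tendsto_nhdsWithin_iff.mpr ⟨hGs.continuousAt, ?_⟩
    filter_upwards [hpos] with z hz using hz.posSemidef.nonneg
  filter_upwards [hcont.eventually hψ'] with z hz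
  change _ = ψ (G z) i j
  rw [hz]

end L2

/-- Positive definiteness is an open condition on symmetric matrices. -/
theorem eventually_posDef {W : Type*} [TopologicalSpace W] {G : W → Matrix (Fin 3) (Fin 3) ℝ}
    {w : W} (hc : ∀ i j, ContinuousAt (fun z => G z i j) w) (hsymm : ∀ z, (G z)ᵀ = G z)
    (hw : (G w).PosDef) : ∀ᶠ z in nhds w, (G z).PosDef := by
  have hK : IsCompact (Metric.sphere (0 : EuclideanSpace ℝ (Fin 3)) 1) := isCompact_sphere _ _
  have h := hK.eventually_forall_of_forall_eventually (x₀ := w)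
    (P := fun z v => 0 < ∑ i, ∑ j, v i * (G z i j * v j)) ?_
  · filter_upwards [h] with z hz
    refine PosDef.of_dotProduct_mulVec_pos ?_ ?_
    · rw [IsHermitian, conjTranspose_eq_transpose_of_trivial, hsymm z]
    · intro x hx
      set v : EuclideanSpace ℝ (Fin 3) := WithLp.toLp 2 x
      have hv : v ≠ 0 := fun h0 => hx (by
        funext i; simpa using congrFun (congrArg (fun u : EuclideanSpace ℝ (Fin 3) => u.ofLp) h0) i)
      have hn : ‖v‖ ≠ 0 := norm_ne_zero_iff.mpr hv
      have := hz (‖v‖⁻¹ • v) (by simp [norm_smul, hn])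
      have hexp : ∑ i, ∑ j, (‖v‖⁻¹ • v) i * (G z i j * (‖v‖⁻¹ • v) j)
          = (‖v‖⁻¹) ^ 2 * ∑ i, ∑ j, x i * (G z i j * x j) := by
        simp only [Finset.mul_sum]
        refine Finset.sum_congr rfl fun i _ => Finset.sum_congr rfl fun j _ => ?_
        simp only [PiLp.smul_apply, smul_eq_mul, v]
        ring
      rw [hexp] at this
      have h2 := pos_of_mul_pos_right this (by positivity)
      simpa [dotProduct, mulVec, Finset.mul_sum] using h2
  · intro v hv
    have hcont : ContinuousAt (fun p : W × EuclideanSpace ℝ (Fin 3) =>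
        ∑ i, ∑ j, p.2 i * (G p.1 i j * p.2 j)) (w, v) := by
      refine tendsto_finsetSum _ fun i _ => tendsto_finsetSum _ fun j _ => ?_
      have h1 : ∀ i, ContinuousAt (fun p : W × EuclideanSpace ℝ (Fin 3) => p.2 i) (w, v) :=
        fun i => by fun_prop
      have h2 : ContinuousAt (fun p : W × EuclideanSpace ℝ (Fin 3) => G p.1 i j) (w, v) :=
        Filter.Tendsto.comp (hc i j) continuousAt_fst
      exact (h1 i).mul (h2.mul (h1 j))
    refine hcont.eventually (lt_mem_nhds ?_)
    have hv0 : v.ofLp ≠ 0 := by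
      intro h0
      have : v = 0 := by ext i; simpa using congrFun h0 i
      simp [this] at hv
    have := hw.dotProduct_mulVec_pos hv0
    simpa [dotProduct, mulVec, Finset.mul_sum] using this

end SquareRoot

section SquareRoot

open Matrix

/-- The function `(tr √G)² / (2Λ)`, which is the pure connection Lagrangian as a function of the
matrix `G` of the 4-forms `F^i ∧ F^j`. -/
def rootLagrangian (Λ : ℝ) (G : Matrix (Fin 3) (Fin 3) ℝ) : ℝ := (CFC.sqrt G).trace ^ 2 / (2 * Λ)

theorem rootLagrangian_smul {Λ c : ℝ} (hc : 0 < c) {G : Matrix (Fin 3) (Fin 3) ℝ} (hG : G.PosDef) :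
    rootLagrangian Λ (c • G) = c * rootLagrangian Λ G := by
  rw [rootLagrangian, rootLagrangian, sqrt_smul hc hG, trace_smul, smul_eq_mul, mul_pow,
    Real.sq_sqrt hc.le, mul_div_assoc]

theorem rootLagrangian_conj {Λ : ℝ} {R G : Matrix (Fin 3) (Fin 3) ℝ} (hR : Rᵀ * R = 1)
    (hG : G.PosDef) : rootLagrangian Λ (R * G * Rᵀ) = rootLagrangian Λ G := by
  rw [rootLagrangian, rootLagrangian, sqrt_conj hR hG, trace_mul_comm, ← mul_assoc, hR, one_mul]

theorem isUnit_det_of_posDef {G : Matrix (Fin 3) (Fin 3) ℝ} (hG : G.PosDef) : IsUnit G.det :=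
  (isUnit_iff_isUnit_det G).mp hG.isUnit

theorem isUnit_det_signedRoot {Λ : ℝ} (hΛ : Λ ≠ 0) {G : Matrix (Fin 3) (Fin 3) ℝ} (hG : G.PosDef) :
    IsUnit (signedRoot Λ G).det := by
  have h := isUnit_det_of_posDef (signedRoot_sign hΛ hG)
  rw [det_smul] at h
  exact isUnit_of_mul_isUnit_right h

/-- The square root is a multiple of the signed root. -/
theorem sqrt_eq_smul_signedRoot {Λ : ℝ} (hΛ : Λ ≠ 0) {G : Matrix (Fin 3) (Fin 3) ℝ}
    (hG : G.PosDef) : CFC.sqrt G = ((CFC.sqrt G).trace / Λ) • signedRoot Λ G := by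
  have h2 : (CFC.sqrt G).trace ≠ 0 := (sqrt_posDef hG).trace_pos.ne'
  rw [signedRoot, smul_smul, div_mul_div_cancel₀ hΛ, div_self h2, one_smul]

/-- The Lagrangian as `½ tr(XG)`, `X` being the inverse of the signed root of `G`. -/
theorem rootLagrangian_eq {Λ : ℝ} (hΛ : Λ ≠ 0) {G : Matrix (Fin 3) (Fin 3) ℝ} (hG : G.PosDef) :
    rootLagrangian Λ G = (1 / 2) * ((signedRoot Λ G)⁻¹ * G).trace := by
  set s := (CFC.sqrt G).trace / Λ with hs
  have h1 : G = s ^ 2 • (signedRoot Λ G * signedRoot Λ G) := by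
    conv_lhs => rw [← CFC.sqrt_mul_sqrt_self G hG.posSemidef.nonneg, sqrt_eq_smul_signedRoot hΛ hG]
    rw [smul_mul_smul_comm, sq]
  have h2 : (signedRoot Λ G)⁻¹ * G = s ^ 2 • signedRoot Λ G := by
    conv_lhs => enter [2]; rw [h1]
    rw [Matrix.mul_smul, ← mul_assoc, nonsing_inv_mul _ (isUnit_det_signedRoot hΛ hG), one_mul]
  rw [h2, trace_smul, signedRoot_trace hG, rootLagrangian, hs, smul_eq_mul]
  field_simp

variable {Λ : ℝ} {G G' : ℝ → Matrix (Fin 3) (Fin 3) ℝ} {G'' m : Matrix (Fin 3) (Fin 3) ℝ} {μ : ℝ}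

/-- First and second derivatives of the square root of a curve of positive definite matrices. -/
theorem exists_deriv_sqrt (hs : ∀ i j, ContDiffAt ℝ 2 (fun t => G t i j) 0)
    (hpos : ∀ᶠ t in nhds 0, (G t).PosDef)
    (h1 : ∀ᶠ t in nhds 0, ∀ i j, HasDerivAt (fun t => G t i j) (G' t i j) t)
    (h2 : ∀ i j, HasDerivAt (fun t => G' t i j) (G'' i j) 0) :
    ∃ (S' : ℝ → Matrix (Fin 3) (Fin 3) ℝ) (S'' : Matrix (Fin 3) (Fin 3) ℝ),
      (∀ᶠ t in nhds 0, ∀ i j, HasDerivAt (fun t => CFC.sqrt (G t) i j) (S' t i j) t) ∧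
      (∀ i j, HasDerivAt (fun t => S' t i j) (S'' i j) 0) ∧
      (∀ᶠ t in nhds 0, CFC.sqrt (G t) * S' t + S' t * CFC.sqrt (G t) = G' t) ∧
      CFC.sqrt (G 0) * S'' + S'' * CFC.sqrt (G 0) + (2 : ℝ) • (S' 0 * S' 0) = G'' := by
  set S : ℝ → Matrix (Fin 3) (Fin 3) ℝ := fun t => CFC.sqrt (G t) with hSdef
  have hS : ∀ i j, ContDiffAt ℝ 2 (fun t => S t i j) 0 :=
    fun i j => contDiffAt_sqrt (n := 2) hs hpos i j
  let S' : ℝ → Matrix (Fin 3) (Fin 3) ℝ := fun t => Matrix.of fun i j => deriv (fun t => S t i j) t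
  let S'' : Matrix (Fin 3) (Fin 3) ℝ := Matrix.of fun i j => deriv (fun t => S' t i j) 0
  have hS1 : ∀ᶠ t in nhds 0, ∀ i j, HasDerivAt (fun t => S t i j) (S' t i j) t := by
    have : ∀ i j, ∀ᶠ t in nhds (0 : ℝ), ContDiffAt ℝ 2 (fun t => S t i j) t :=
      fun i j => (hS i j).eventually (by simp)
    filter_upwards [Filter.eventually_all.mpr fun i => Filter.eventually_all.mpr (this i)] with t ht i j
    exact ((ht i j).differentiableAt (by simp)).hasDerivAt
  have hS2 : ∀ i j, HasDerivAt (fun t => S' t i j) (S'' i j) 0 := by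
    intro i j
    have h : ContDiffAt ℝ 1 (deriv (fun t => S t i j)) 0 := by
      have := (hS i j).fderiv_right (m := 1) (by norm_num)
      exact this.clm_apply contDiffAt_const
    exact (h.differentiableAt (by simp)).hasDerivAt
  have hprod : ∀ᶠ t in nhds 0, S t * S' t + S' t * S t = G' t := by
    have hsq : ∀ᶠ t in nhds (0 : ℝ), G t = S t * S t := by
      filter_upwards [hpos] with t ht
      exact (CFC.sqrt_mul_sqrt_self (G t) ht.posSemidef.nonneg).symm
    filter_upwards [hS1, h1, hsq.eventually_nhds] with t ht h1t hsqt
    ext i j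
    have hd : HasDerivAt (fun t => ∑ k, S t i k * S t k j)
        (∑ k, (S' t i k * S t k j + S t i k * S' t k j)) t :=
      HasDerivAt.fun_sum fun k _ => (ht i k).mul (ht k j)
    have he : (fun t => G t i j) =ᶠ[nhds t] fun t => ∑ k, S t i k * S t k j := by
      filter_upwards [hsqt] with r hr
      rw [hr, mul_apply]
    rw [(h1t i j).unique (hd.congr_of_eventuallyEq he), Finset.sum_add_distrib, Matrix.add_apply, mul_apply,
      mul_apply, add_comm]
  refine ⟨S', S'', hS1, hS2, hprod, ?_⟩
  ext i j
  have hd : HasDerivAt (fun t => ∑ k, S t i k * S' t k j + ∑ k, S' t i k * S t k j)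
      (∑ k, (S' 0 i k * S' 0 k j + S 0 i k * S'' k j)
        + ∑ k, (S'' i k * S 0 k j + S' 0 i k * S' 0 k j)) 0 :=
    (HasDerivAt.fun_sum fun k _ => (hS1.self_of_nhds i k).mul (hS2 k j)).add
      (HasDerivAt.fun_sum fun k _ => (hS2 i k).mul (hS1.self_of_nhds k j))
  have he : (fun t => G' t i j) =ᶠ[nhds 0]
      fun t => ∑ k, S t i k * S' t k j + ∑ k, S' t i k * S t k j := by
    filter_upwards [hprod] with r hr
    rw [← hr, Matrix.add_apply, mul_apply, mul_apply]
  rw [(h2 i j).unique (hd.congr_of_eventuallyEq he)]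
  simp only [Finset.sum_add_distrib, Matrix.add_apply, Matrix.smul_apply, mul_apply, smul_eq_mul, S]
  ring

theorem contDiffAt_rootLagrangian {W : Type*} [NormedAddCommGroup W] [NormedSpace ℝ W] {n : ℕ∞}
    {G : W → Matrix (Fin 3) (Fin 3) ℝ} {w : W}
    (hs : ∀ i j, ContDiffAt ℝ n (fun z => G z i j) w) (hpos : ∀ᶠ z in nhds w, (G z).PosDef) :
    ContDiffAt ℝ n (fun z => rootLagrangian Λ (G z)) w := by
  have h : ContDiffAt ℝ n (fun z => (∑ i, CFC.sqrt (G z) i i) ^ 2 / (2 * Λ)) w :=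
    ((ContDiffAt.sum fun i _ => contDiffAt_sqrt hs hpos i i).pow 2).div_const _
  exact h

/-- The first derivative of the Lagrangian along a curve. -/
theorem hasDerivAt_rootLagrangian (hΛ : Λ ≠ 0) (hs : ∀ i j, ContDiffAt ℝ 2 (fun t => G t i j) 0)
    (hpos : ∀ᶠ t in nhds 0, (G t).PosDef)
    (h1 : ∀ᶠ t in nhds 0, ∀ i j, HasDerivAt (fun t => G t i j) (G' t i j) t)
    (h2 : ∀ i j, HasDerivAt (fun t => G' t i j) (G'' i j) 0) :
    HasDerivAt (fun t => rootLagrangian Λ (G t))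
      ((1 / 2) * ((signedRoot Λ (G 0))⁻¹ * G' 0).trace) 0 := by
  obtain ⟨S', S'', hS1, hS2, hp1, hp2⟩ := exists_deriv_sqrt hs hpos h1 h2
  have hτ : HasDerivAt (fun t => ∑ i, CFC.sqrt (G t) i i) (∑ i, S' 0 i i) 0 :=
    HasDerivAt.fun_sum fun i _ => hS1.self_of_nhds i i
  have h := (hτ.pow 2).div_const (2 * Λ)
  have hG := hpos.self_of_nhds
  set Y := signedRoot Λ (G 0) with hY
  set s := (CFC.sqrt (G 0)).trace / Λ with hs'
  have hYu : IsUnit Y.det := isUnit_det_signedRoot hΛ hG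
  have hSY : CFC.sqrt (G 0) = s • Y := sqrt_eq_smul_signedRoot hΛ hG
  have hkey : (Y⁻¹ * G' 0).trace = 2 * s * (S' 0).trace := by
    rw [← hp1.self_of_nhds, hSY, mul_add, trace_add, Matrix.smul_mul, Matrix.mul_smul, ← mul_assoc,
      nonsing_inv_mul _ hYu, one_mul, ← mul_assoc, Matrix.mul_smul, trace_smul, trace_smul,
      trace_mul_comm _ Y, ← mul_assoc, mul_nonsing_inv _ hYu, one_mul]
    simp; ring
  have hval : (1 / 2) * (Y⁻¹ * G' 0).trace
      = ((2 : ℕ) * (CFC.sqrt (G 0)).trace ^ (2 - 1) * (S' 0).trace) / (2 * Λ) := by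
    rw [hkey, hs']
    field_simp
    norm_num
    ring
  rw [hval]
  exact h

/-- The second derivative of the Lagrangian along a curve through `2μY²` with velocity
`2μ(Ym + mY)`, `tr m = 0`: to first order the square root moves by a multiple of `m`, so that its
trace is stationary. -/
theorem iteratedDeriv_two_rootLagrangian (hΛ : Λ ≠ 0)
    (hs : ∀ i j, ContDiffAt ℝ 2 (fun t => G t i j) 0)
    (hpos : ∀ᶠ t in nhds 0, (G t).PosDef)
    (h1 : ∀ᶠ t in nhds 0, ∀ i j, HasDerivAt (fun t => G t i j) (G' t i j) t)
    (h2 : ∀ i j, HasDerivAt (fun t => G' t i j) (G'' i j) 0)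
    (h0 : G 0 = (2 * μ) • (signedRoot Λ (G 0) * signedRoot Λ (G 0)))
    (hm : G' 0 = (2 * μ) • (signedRoot Λ (G 0) * m + m * signedRoot Λ (G 0)))
    (htr : m.trace = 0) :
    iteratedDeriv 2 (fun t => rootLagrangian Λ (G t)) 0
      = (1 / 2) * ((signedRoot Λ (G 0))⁻¹ * G'').trace
        - 2 * μ * ((signedRoot Λ (G 0))⁻¹ * (m * m)).trace := by
  obtain ⟨S', S'', hS1, hS2, hp1, hp2⟩ := exists_deriv_sqrt hs hpos h1 h2
  have hτ : ∀ᶠ t in nhds (0 : ℝ),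
      HasDerivAt (fun t => ∑ i, CFC.sqrt (G t) i i) (∑ i, S' t i i) t := by
    filter_upwards [hS1] with t ht using HasDerivAt.fun_sum fun i _ => ht i i
  have hq : deriv (fun t => rootLagrangian Λ (G t)) =ᶠ[nhds 0]
      fun t => (∑ i, CFC.sqrt (G t) i i) * (∑ i, S' t i i) / Λ := by
    filter_upwards [hτ] with t ht
    have h := ((ht.pow 2).div_const (2 * Λ)).deriv
    change deriv (fun t => (∑ i, CFC.sqrt (G t) i i) ^ 2 / (2 * Λ)) t = _
    refine h.trans ?_
    field_simp
    norm_num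
    ring
  have hτ' : HasDerivAt (fun t => ∑ i, S' t i i) (∑ i, S'' i i) 0 :=
    HasDerivAt.fun_sum fun i _ => hS2 i i
  have hd := ((hτ.self_of_nhds.mul hτ').div_const Λ).deriv
  have hq2 : iteratedDeriv 2 (fun t => rootLagrangian Λ (G t)) 0
      = ((S' 0).trace * (S' 0).trace + (CFC.sqrt (G 0)).trace * S''.trace) / Λ := by
    rw [iteratedDeriv_succ, iteratedDeriv_one, hq.deriv_eq]
    exact hd
  have hG := hpos.self_of_nhds
  set Y := signedRoot Λ (G 0) with hY
  set s := (CFC.sqrt (G 0)).trace / Λ with hs'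
  have hYu : IsUnit Y.det := isUnit_det_signedRoot hΛ hG
  have hSY : CFC.sqrt (G 0) = s • Y := sqrt_eq_smul_signedRoot hΛ hG
  have hs2 : s ^ 2 = 2 * μ := by
    have h3 : s ^ 2 • (Y * Y) = (2 * μ) • (Y * Y) := by
      rw [← h0, sq, ← smul_mul_smul_comm, ← hSY, CFC.sqrt_mul_sqrt_self (G 0) hG.posSemidef.nonneg]
    obtain ⟨c, hc, hYY⟩ := signedRoot_sq hΛ hG
    have h4 := congrArg trace h3
    rw [trace_smul, trace_smul, hYY, trace_smul] at h4
    exact mul_right_cancel₀ (mul_ne_zero hc.ne' hG.trace_pos.ne') h4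
  have hS'm : S' 0 = s • m := by
    refine sylvester_unique (sqrt_posDef hG) ?_
    rw [hp1.self_of_nhds, hm, hSY, ← hs2]
    simp only [Matrix.smul_mul, Matrix.mul_smul, smul_smul, smul_add]
    ring_nf
  have hkey : (Y⁻¹ * G'').trace = 2 * s * S''.trace + 2 * s ^ 2 * (Y⁻¹ * (m * m)).trace := by
    rw [← hp2, hSY, hS'm, mul_add, mul_add, trace_add, trace_add, Matrix.smul_mul, Matrix.mul_smul, ← mul_assoc,
      nonsing_inv_mul _ hYu, one_mul, ← mul_assoc, Matrix.mul_smul, trace_smul, trace_smul,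
      trace_mul_comm _ Y, ← mul_assoc, mul_nonsing_inv _ hYu, one_mul, Matrix.mul_smul, Matrix.smul_mul,
      Matrix.mul_smul, Matrix.mul_smul, Matrix.mul_smul]
    simp only [trace_smul, smul_eq_mul]
    ring
  rw [hq2, hkey, hS'm, trace_smul, htr, ← hs2, hs']
  simp only [smul_zero, zero_mul, zero_add]
  field_simp
  ring

end SquareRoot

/-! ### Two-forms in dimension four -/

section TwoForms

open Matrix

/-- The wedge product of two 2-forms, in terms of their components: `wedge22` of the forms on the
frame in which the components are taken. -/
def pf (B C : Matrix (Fin 4) (Fin 4) ℝ) : ℝ :=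
  B 0 1 * C 2 3 - B 0 2 * C 1 3 + B 0 3 * C 1 2 + B 1 2 * C 0 3 - B 1 3 * C 0 2 + B 2 3 * C 0 1

/-- The skew matrix with given entries above the diagonal. -/
def skewOf (a b c d e f : ℝ) : Matrix (Fin 4) (Fin 4) ℝ :=
  !![0, a, b, c; -a, 0, d, e; -b, -d, 0, f; -c, -e, -f, 0]

theorem skewOf_entries (a b c d e f : ℝ) :
    let B := skewOf a b c d e f
    B 0 0 = 0 ∧ B 0 1 = a ∧ B 0 2 = b ∧ B 0 3 = c ∧ B 1 0 = -a ∧ B 1 1 = 0 ∧ B 1 2 = d ∧ B 1 3 = e ∧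
    B 2 0 = -b ∧ B 2 1 = -d ∧ B 2 2 = 0 ∧ B 2 3 = f ∧ B 3 0 = -c ∧ B 3 1 = -e ∧ B 3 2 = -f ∧
    B 3 3 = 0 :=
  ⟨rfl, rfl, rfl, rfl, rfl, rfl, rfl, rfl, rfl, rfl, rfl, rfl, rfl, rfl, rfl, rfl⟩

theorem star2_entries (B : Matrix (Fin 4) (Fin 4) ℝ) :
    star2 B 0 0 = 0 ∧ star2 B 0 1 = B 2 3 ∧ star2 B 0 2 = B 3 1 ∧ star2 B 0 3 = B 1 2 ∧
    star2 B 1 0 = B 3 2 ∧ star2 B 1 1 = 0 ∧ star2 B 1 2 = B 0 3 ∧ star2 B 1 3 = B 2 0 ∧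
    star2 B 2 0 = B 1 3 ∧ star2 B 2 1 = B 3 0 ∧ star2 B 2 2 = 0 ∧ star2 B 2 3 = B 0 1 ∧
    star2 B 3 0 = B 2 1 ∧ star2 B 3 1 = B 0 2 ∧ star2 B 3 2 = B 1 0 ∧ star2 B 3 3 = 0 :=
  ⟨rfl, rfl, rfl, rfl, rfl, rfl, rfl, rfl, rfl, rfl, rfl, rfl, rfl, rfl, rfl, rfl⟩

theorem eq_skewOf {B : Matrix (Fin 4) (Fin 4) ℝ} (hB : Bᵀ = -B) :
    B = skewOf (B 0 1) (B 0 2) (B 0 3) (B 1 2) (B 1 3) (B 2 3) := by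
  have h : ∀ i j, B j i = - B i j := fun i j => by simpa using congrFun (congrFun hB i) j
  have h0 : ∀ i, B i i = 0 := fun i => by linarith [h i i]
  ext i j
  fin_cases i <;> fin_cases j <;> simp [skewOf, h0, h 0 1, h 0 2, h 0 3, h 1 2, h 1 3, h 2 3]

theorem skew_ext {B C : Matrix (Fin 4) (Fin 4) ℝ} (hB : Bᵀ = -B) (hC : Cᵀ = -C)
    (h01 : B 0 1 = C 0 1) (h02 : B 0 2 = C 0 2) (h03 : B 0 3 = C 0 3) (h12 : B 1 2 = C 1 2)
    (h13 : B 1 3 = C 1 3) (h23 : B 2 3 = C 2 3) : B = C := by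
  rw [eq_skewOf hB, eq_skewOf hC, h01, h02, h03, h12, h13, h23]

theorem congr_skew {B : Matrix (Fin 4) (Fin 4) ℝ} (hB : Bᵀ = -B) (P : Matrix (Fin 4) (Fin 4) ℝ) :
    (Pᵀ * B * P)ᵀ = -(Pᵀ * B * P) := by
  simp [hB, mul_assoc]

theorem star2_transpose (B : Matrix (Fin 4) (Fin 4) ℝ) (hB : Bᵀ = -B) :
    (star2 B)ᵀ = - star2 B := by
  rw [eq_skewOf hB]
  ext i j
  fin_cases i <;> fin_cases j <;> simp [skewOf, star2]

theorem mul_star2_add {B C : Matrix (Fin 4) (Fin 4) ℝ} (hB : Bᵀ = -B) (hC : Cᵀ = -C) :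
    B * star2 C + C * star2 B = -(pf B C) • 1 := by
  rw [eq_skewOf hB, eq_skewOf hC]
  generalize B 0 1 = a, B 0 2 = b, B 0 3 = c, B 1 2 = d, B 1 3 = e, B 2 3 = f
  generalize C 0 1 = a', C 0 2 = b', C 0 3 = c', C 1 2 = d', C 1 3 = e', C 2 3 = f'
  refine Matrix.ext ?_
  simp only [Fin.forall_fin_succ, Fin.forall_fin_zero, Fin.succ_zero_eq_one, Fin.succ_one_eq_two]
  simp [Matrix.mul_apply, Fin.sum_univ_four, star2_entries, skewOf_entries, pf]
  repeat' apply And.intro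
  all_goals ring

theorem star2_mul_add {B C : Matrix (Fin 4) (Fin 4) ℝ} (hB : Bᵀ = -B) (hC : Cᵀ = -C) :
    star2 B * C + star2 C * B = -(pf B C) • 1 := by
  rw [eq_skewOf hB, eq_skewOf hC]
  generalize B 0 1 = a, B 0 2 = b, B 0 3 = c, B 1 2 = d, B 1 3 = e, B 2 3 = f
  generalize C 0 1 = a', C 0 2 = b', C 0 3 = c', C 1 2 = d', C 1 3 = e', C 2 3 = f'
  refine Matrix.ext ?_
  simp only [Fin.forall_fin_succ, Fin.forall_fin_zero, Fin.succ_zero_eq_one, Fin.succ_one_eq_two]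
  simp [Matrix.mul_apply, Fin.sum_univ_four, star2_entries, skewOf_entries, pf]
  repeat' apply And.intro
  all_goals ring

/-- The Hodge star, as a map from covariant to contravariant 2-tensors, is equivariant up to the
determinant. -/
theorem star2_congr (P : Matrix (Fin 4) (Fin 4) ℝ) {B : Matrix (Fin 4) (Fin 4) ℝ} (hB : Bᵀ = -B) :
    P * star2 (Pᵀ * B * P) * Pᵀ = P.det • star2 B := by
  have hs := star2_transpose _ (congr_skew hB P)
  have hs' := star2_transpose _ hB
  have hL : (P * star2 (Pᵀ * B * P) * Pᵀ)ᵀ = -(P * star2 (Pᵀ * B * P) * Pᵀ) := by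
    rw [transpose_mul, transpose_mul, hs, transpose_transpose]
    simp [mul_assoc]
  have hR : (P.det • star2 B)ᵀ = -(P.det • star2 B) := by rw [transpose_smul, hs', smul_neg]
  have hdet : P.det = P 0 0 * (P 1 1 * (P 2 2 * P 3 3 - P 2 3 * P 3 2)
        - P 1 2 * (P 2 1 * P 3 3 - P 2 3 * P 3 1) + P 1 3 * (P 2 1 * P 3 2 - P 2 2 * P 3 1))
      - P 0 1 * (P 1 0 * (P 2 2 * P 3 3 - P 2 3 * P 3 2)
        - P 1 2 * (P 2 0 * P 3 3 - P 2 3 * P 3 0) + P 1 3 * (P 2 0 * P 3 2 - P 2 2 * P 3 0))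
      + P 0 2 * (P 1 0 * (P 2 1 * P 3 3 - P 2 3 * P 3 1)
        - P 1 1 * (P 2 0 * P 3 3 - P 2 3 * P 3 0) + P 1 3 * (P 2 0 * P 3 1 - P 2 1 * P 3 0))
      - P 0 3 * (P 1 0 * (P 2 1 * P 3 2 - P 2 2 * P 3 1)
        - P 1 1 * (P 2 0 * P 3 2 - P 2 2 * P 3 0) + P 1 2 * (P 2 0 * P 3 1 - P 2 1 * P 3 0)) := by
    rw [Matrix.det_succ_row_zero]
    simp [Fin.sum_univ_succ, Matrix.det_fin_three, Fin.succAbove, Matrix.submatrix_apply]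
    ring
  rw [eq_skewOf hB] at hL hR ⊢
  generalize B 0 1 = a, B 0 2 = b, B 0 3 = c, B 1 2 = d, B 1 3 = e, B 2 3 = f at hL hR ⊢
  refine skew_ext hL hR ?_ ?_ ?_ ?_ ?_ ?_ <;>
    simp only [Matrix.mul_apply, Fin.sum_univ_four, Matrix.transpose_apply, Matrix.smul_apply,
      smul_eq_mul, star2_entries, skewOf_entries, hdet] <;> ring

theorem pf_congr (P : Matrix (Fin 4) (Fin 4) ℝ) {B C : Matrix (Fin 4) (Fin 4) ℝ} (hB : Bᵀ = -B)
    (hC : Cᵀ = -C) : pf (Pᵀ * B * P) (Pᵀ * C * P) = P.det * pf B C := by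
  by_cases hP : P = 0
  · subst hP
    rw [Matrix.det_zero]
    simp [pf]
  have h1 := congrArg (P * ·) (star2_mul_add (congr_skew hB P) (congr_skew hC P))
  have h2 : P * (star2 (Pᵀ * B * P) * (Pᵀ * C * P) + star2 (Pᵀ * C * P) * (Pᵀ * B * P))
      = P.det • ((star2 B * C + star2 C * B) * P) := by
    have e1 : P * (star2 (Pᵀ * B * P) * (Pᵀ * C * P)) = (P * star2 (Pᵀ * B * P) * Pᵀ) * C * P := by
      simp only [mul_assoc]
    have e2 : P * (star2 (Pᵀ * C * P) * (Pᵀ * B * P)) = (P * star2 (Pᵀ * C * P) * Pᵀ) * B * P := by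
      simp only [mul_assoc]
    rw [mul_add, e1, e2, star2_congr P hB, star2_congr P hC]
    simp only [Matrix.smul_mul, add_mul, smul_add]
  rw [h2, star2_mul_add hB hC] at h1
  have h3 : (P.det * pf B C - pf (Pᵀ * B * P) (Pᵀ * C * P)) • P = 0 := by
    simp only [neg_smul, Matrix.smul_mul, one_mul, Matrix.mul_smul, mul_one,
      smul_neg, smul_smul, neg_mul, mul_neg] at h1
    rw [sub_smul, sub_eq_zero]
    exact neg_injective h1
  rcases smul_eq_zero.mp h3 with h | h
  · linarith
  · exact absurd h hP

/-- The standard basis of the self-dual forms: `f⁰ ∧ f^a + f^b ∧ f^c` for `(a, b, c)` cyclic. -/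
def sdBasis : Fin 3 → Matrix (Fin 4) (Fin 4) ℝ :=
  ![skewOf 1 0 0 0 0 1, skewOf 0 1 0 0 (-1) 0, skewOf 0 0 1 1 0 0]

theorem skewOf_transpose (a b c d e f : ℝ) : (skewOf a b c d e f)ᵀ = -skewOf a b c d e f := by
  ext i j
  fin_cases i <;> fin_cases j <;> simp [skewOf]

theorem sdBasis_skew (i : Fin 3) : (sdBasis i)ᵀ = -sdBasis i := by
  fin_cases i <;> exact skewOf_transpose ..

theorem star2_sdBasis (i : Fin 3) : star2 (sdBasis i) = sdBasis i := by
  fin_cases i <;> ext a b <;> fin_cases a <;> fin_cases b <;> simp [sdBasis, star2, skewOf]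

theorem pf_sdBasis (i j : Fin 3) : pf (sdBasis i) (sdBasis j) = if i = j then 2 else 0 := by
  fin_cases i <;> fin_cases j <;> simp [pf, sdBasis, skewOf] <;> norm_num

/-- The symmetric form `K₁ * K₂ K₃` built from three 2-forms; up to a volume factor it is the
metric which makes them self-dual. -/
def urbantke (K : Fin 3 → Matrix (Fin 4) (Fin 4) ℝ) : Matrix (Fin 4) (Fin 4) ℝ :=
  K 0 * star2 (K 1) * K 2

theorem urbantke_congr (P : Matrix (Fin 4) (Fin 4) ℝ) {K : Fin 3 → Matrix (Fin 4) (Fin 4) ℝ}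
    (hK : ∀ i, (K i)ᵀ = -K i) :
    urbantke (fun i => Pᵀ * K i * P) = P.det • (Pᵀ * urbantke K * P) := by
  have h : urbantke (fun i => Pᵀ * K i * P)
      = Pᵀ * (K 0 * (P * star2 (Pᵀ * K 1 * P) * Pᵀ) * K 2) * P := by
    simp only [urbantke, mul_assoc]
  rw [h, star2_congr P (hK 1)]
  simp [urbantke]

theorem urbantke_sdBasis : urbantke sdBasis = 1 := by
  rw [urbantke, star2_sdBasis]
  ext i j
  fin_cases i <;> fin_cases j <;> simp [sdBasis, skewOf]

section Triple

variable {K : Fin 3 → Matrix (Fin 4) (Fin 4) ℝ} {ν : ℝ}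

theorem mul_star2_eq_neg (hK : ∀ i, (K i)ᵀ = -K i)
    (hpf : ∀ i j, pf (K i) (K j) = if i = j then 2 * ν else 0) {i j : Fin 3} (h : i ≠ j) :
    K i * star2 (K j) = -(K j * star2 (K i)) := by
  have := mul_star2_add (hK i) (hK j)
  rw [hpf, if_neg h, neg_zero, zero_smul] at this
  exact eq_neg_of_add_eq_zero_left this

theorem star2_mul_eq_neg (hK : ∀ i, (K i)ᵀ = -K i)
    (hpf : ∀ i j, pf (K i) (K j) = if i = j then 2 * ν else 0) {i j : Fin 3} (h : i ≠ j) :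
    star2 (K i) * K j = -(star2 (K j) * K i) := by
  have := star2_mul_add (hK i) (hK j)
  rw [hpf, if_neg h, neg_zero, zero_smul] at this
  exact eq_neg_of_add_eq_zero_left this

theorem mul_star2_self (hK : ∀ i, (K i)ᵀ = -K i)
    (hpf : ∀ i j, pf (K i) (K j) = if i = j then 2 * ν else 0) (i : Fin 3) : K i * star2 (K i) = (-ν) • 1 := by
  have := mul_star2_add (hK i) (hK i)
  rw [hpf, if_pos rfl, ← two_smul ℝ, ← mul_neg, mul_smul] at this
  exact smul_right_injective _ (two_ne_zero' ℝ) this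

theorem star2_mul_self (hK : ∀ i, (K i)ᵀ = -K i)
    (hpf : ∀ i j, pf (K i) (K j) = if i = j then 2 * ν else 0) (i : Fin 3) : star2 (K i) * K i = (-ν) • 1 := by
  have := star2_mul_add (hK i) (hK i)
  rw [hpf, if_pos rfl, ← two_smul ℝ, ← mul_neg, mul_smul] at this
  exact smul_right_injective _ (two_ne_zero' ℝ) this

end Triple

/-- The construction `K₁ * K₂ K₃` is invariant under rotations of the triple of forms. -/
theorem urbantke_rotate {R : Matrix (Fin 3) (Fin 3) ℝ} (hR : Rᵀ * R = 1) (hdet : R.det = 1)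
    {K : Fin 3 → Matrix (Fin 4) (Fin 4) ℝ} (hK : ∀ i, (K i)ᵀ = -K i) {ν : ℝ}
    (hpf : ∀ i j, pf (K i) (K j) = if i = j then 2 * ν else 0) :
    urbantke (fun i => ∑ j, R i j • K j) = urbantke K := by
  -- the product of three of the forms
  let T : Fin 3 → Fin 3 → Fin 3 → Matrix (Fin 4) (Fin 4) ℝ := fun i j k => K i * star2 (K j) * K k
  have hT1 : ∀ i k, T i i k = (-ν) • K k := fun i k => by simp only [T, mul_star2_self hK hpf, Matrix.smul_mul, one_mul]
  have hT2 : ∀ i k, T i k k = (-ν) • K i := fun i k => by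
    simp only [T, mul_assoc, star2_mul_self hK hpf, Matrix.mul_smul, mul_one]
  have hT3 : ∀ i j k, i ≠ j → T i j k = - T j i k := fun i j k h => by
    simp only [T]; rw [mul_star2_eq_neg hK hpf h, neg_mul]
  have hT4 : ∀ i j k, j ≠ k → T i j k = - T i k j := fun i j k h => by
    simp only [T, mul_assoc]; rw [star2_mul_eq_neg hK hpf h, mul_neg]
  have hU : urbantke K = T 0 1 2 := rfl
  have hsum : urbantke (fun i => ∑ j, R i j • K j)
      = ∑ i, ∑ j, ∑ k, (R 0 i * R 1 j * R 2 k) • T i j k := by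
    have hst : star2 (∑ j, R 1 j • K j) = ∑ j, R 1 j • star2 (K j) := by
      ext a b
      fin_cases a <;> fin_cases b <;> simp [star2, Fin.sum_univ_three]
    simp only [urbantke, hst, T, Finset.sum_mul, Finset.mul_sum, Matrix.smul_mul, Matrix.mul_smul, smul_smul]
    rw [Finset.sum_comm]
    refine (Finset.sum_congr rfl fun k _ => Finset.sum_comm).trans ?_
    rw [Finset.sum_comm]
    refine Finset.sum_congr rfl fun i _ => ?_
    refine Finset.sum_congr rfl fun j _ => Finset.sum_congr rfl fun k _ => ?_
    congr 1; ring
  have hRR : R * Rᵀ = 1 := mul_eq_one_comm.mp hR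
  have hR' : ∀ i j, ∑ k, R i k * R j k = if i = j then 1 else 0 := by
    intro i j
    have := congrFun (congrFun hRR i) j
    simpa [Matrix.mul_apply, Matrix.one_apply] using this
  rw [hsum, hU]
  have e : ∀ {i j k : Fin 3}, i ≠ j → i ≠ k → T i j i = ν • K j := by
    intro i j k h _
    rw [hT3 i j i h, hT2]; simp
  simp only [Fin.sum_univ_three]
  rw [hT1 0, hT1 0, hT1 0, hT1 1, hT1 1, hT1 1, hT1 2, hT1 2, hT1 2, hT2 0 1, hT2 0 2, hT2 1 0,
    hT2 1 2, hT2 2 0, hT2 2 1, e (i := 0) (j := 1) (k := 2) (by decide) (by decide),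
    e (i := 0) (j := 2) (k := 1) (by decide) (by decide),
    e (i := 1) (j := 0) (k := 2) (by decide) (by decide),
    e (i := 1) (j := 2) (k := 0) (by decide) (by decide),
    e (i := 2) (j := 0) (k := 1) (by decide) (by decide),
    e (i := 2) (j := 1) (k := 0) (by decide) (by decide),
    hT4 0 2 1 (by decide), hT3 1 0 2 (by decide), hT4 1 2 0 (by decide), hT3 1 0 2 (by decide),
    hT3 2 0 1 (by decide), hT4 0 2 1 (by decide), hT3 2 1 0 (by decide), hT4 1 2 0 (by decide),
    hT3 1 0 2 (by decide)]
  rw [Matrix.det_fin_three] at hdet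
  have r01 := hR' 0 1
  have r02 := hR' 0 2
  have r12 := hR' 1 2
  simp [Fin.sum_univ_three] at r01 r02 r12
  ext a b
  simp only [Matrix.add_apply, Matrix.smul_apply, Matrix.neg_apply, smul_eq_mul]
  linear_combination (T 0 1 2 a b) * hdet
    - ν * (R 2 0 * K 0 a b + R 2 1 * K 1 a b + R 2 2 * K 2 a b) * r01
    - ν * (R 0 0 * K 0 a b + R 0 1 * K 1 a b + R 0 2 * K 2 a b) * r12
    + ν * (R 1 0 * K 0 a b + R 1 1 * K 1 a b + R 1 2 * K 2 a b) * r02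

end TwoForms

/-! ### Standard frames for triples of self-dual forms -/

section QuaternionFrame

open Matrix

/-- The frame `v, J₁v, J₂v, J₃v` as the columns of a matrix, where `v` is the first basis vector and
`J₁ = ν⁻¹ * K₂ K₃` and its cyclic permutations are the almost complex structures of the triple of
2-forms `K`. -/
def quatFrame (K : Fin 3 → Matrix (Fin 4) (Fin 4) ℝ) (ν : ℝ) : Matrix (Fin 4) (Fin 4) ℝ :=
  Matrix.of fun a b =>
    (![1, ν⁻¹ • (star2 (K 1) * K 2), ν⁻¹ • (star2 (K 2) * K 0), ν⁻¹ • (star2 (K 0) * K 1)] b) a 0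

/-- Abstract form of the quaternion relations: the frame `v, J₁v, J₂v, J₃v` normalises the metric
`g` and the forms `-g Jᵢ`. -/
theorem quaternion_frame {g J₁ J₂ J₃ P : Matrix (Fin 4) (Fin 4) ℝ} {v : Fin 4 → ℝ} (hv : v ≠ 0)
    (hg : gᵀ = g) (h11 : J₁ * J₁ = -1) (h22 : J₂ * J₂ = -1) (h33 : J₃ * J₃ = -1)
    (h12 : J₁ * J₂ = J₃) (h23 : J₂ * J₃ = J₁) (h31 : J₃ * J₁ = J₂)
    (s1 : J₁ᵀ * g = -(g * J₁)) (s2 : J₂ᵀ * g = -(g * J₂)) (s3 : J₃ᵀ * g = -(g * J₃))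
    (hP0 : P.col 0 = v) (hP1 : P.col 1 = J₁ *ᵥ v) (hP2 : P.col 2 = J₂ *ᵥ v)
    (hP3 : P.col 3 = J₃ *ᵥ v) :
    P.det ≠ 0 ∧ Pᵀ * g * P = (v ⬝ᵥ g *ᵥ v) • 1 ∧
    Pᵀ * (-(g * J₁)) * P = (v ⬝ᵥ g *ᵥ v) • sdBasis 0 ∧
    Pᵀ * (-(g * J₂)) * P = (v ⬝ᵥ g *ᵥ v) • sdBasis 1 ∧
    Pᵀ * (-(g * J₃)) * P = (v ⬝ᵥ g *ᵥ v) • sdBasis 2 := by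
  have h21 : J₂ * J₁ = -J₃ := by rw [← h23, ← mul_assoc, h22]; simp
  have h32 : J₃ * J₂ = -J₁ := by rw [← h31, ← mul_assoc, h33]; simp
  have h13 : J₁ * J₃ = -J₂ := by rw [← h12, ← mul_assoc, h11]; simp
  have hdet : P.det ≠ 0 := by
    intro h0
    obtain ⟨w, hw, hPw⟩ := Matrix.exists_mulVec_eq_zero_iff.mpr h0
    have hsum : P *ᵥ w = (w 0 • 1 + w 1 • J₁ + w 2 • J₂ + w 3 • J₃) *ᵥ v := by
      have : P *ᵥ w = w 0 • P.col 0 + w 1 • P.col 1 + w 2 • P.col 2 + w 3 • P.col 3 := by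
        ext a
        simp [mulVec, dotProduct, Fin.sum_univ_four, mul_comm]
      rw [this, hP0, hP1, hP2, hP3]
      simp [add_mulVec, smul_mulVec]
    have hN : (w 0 • 1 - w 1 • J₁ - w 2 • J₂ - w 3 • J₃) * (w 0 • 1 + w 1 • J₁ + w 2 • J₂ + w 3 • J₃)
        = (w 0 ^ 2 + w 1 ^ 2 + w 2 ^ 2 + w 3 ^ 2) • (1 : Matrix (Fin 4) (Fin 4) ℝ) := by
      simp only [mul_add, sub_mul, Matrix.smul_mul, Matrix.mul_smul, one_mul, mul_one, h11, h22, h33,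
        h12, h13, h21, h23, h31, h32]
      module
    have hz : (w 0 ^ 2 + w 1 ^ 2 + w 2 ^ 2 + w 3 ^ 2) • v = 0 := by
      have h := congrArg ((w 0 • 1 - w 1 • J₁ - w 2 • J₂ - w 3 • J₃) *ᵥ ·) hPw
      simp only [hsum, mulVec_mulVec, hN, mulVec_zero] at h
      simpa [smul_mulVec] using h
    rcases smul_eq_zero.mp hz with h | h
    · refine hw ?_
      have h0 : w 0 = 0 := by nlinarith [sq_nonneg (w 0), sq_nonneg (w 1), sq_nonneg (w 2), sq_nonneg (w 3)]
      have h1 : w 1 = 0 := by nlinarith [sq_nonneg (w 0), sq_nonneg (w 1), sq_nonneg (w 2), sq_nonneg (w 3)]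
      have h2 : w 2 = 0 := by nlinarith [sq_nonneg (w 0), sq_nonneg (w 1), sq_nonneg (w 2), sq_nonneg (w 3)]
      have h3 : w 3 = 0 := by nlinarith [sq_nonneg (w 0), sq_nonneg (w 1), sq_nonneg (w 2), sq_nonneg (w 3)]
      ext a; fin_cases a <;> assumption
    · exact hv h
  have hcol : ∀ {B C : Matrix (Fin 4) (Fin 4) ℝ}, B.col 0 = C.col 0 → B.col 1 = C.col 1 →
      B.col 2 = C.col 2 → B.col 3 = C.col 3 → B = C := by
    intro B C h0 h1 h2 h3
    ext a b
    fin_cases b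
    · exact congrFun h0 a
    · exact congrFun h1 a
    · exact congrFun h2 a
    · exact congrFun h3 a
  have hmulcol : ∀ (B C : Matrix (Fin 4) (Fin 4) ℝ) b, (B * C).col b = B *ᵥ C.col b := by
    intro B C b; rfl
  have hPη : ∀ (i : Fin 3) b, (-(P * sdBasis i)).col b
      = -(sdBasis i 0 b • P.col 0 + sdBasis i 1 b • P.col 1 + sdBasis i 2 b • P.col 2
        + sdBasis i 3 b • P.col 3) := by
    intro i b
    ext a
    simp [Matrix.mul_apply, Fin.sum_univ_four, mul_comm]
  have hJv : ∀ (B C D : Matrix (Fin 4) (Fin 4) ℝ), B * C = D → B *ᵥ (C *ᵥ v) = D *ᵥ v := by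
    intro B C D h; rw [mulVec_mulVec, h]
  have L1 : J₁ * P = -(P * sdBasis 0) := by
    apply hcol <;> rw [hmulcol, hPη] <;>
      simp [hP0, hP1, hP2, hP3, sdBasis, skewOf_entries, hJv _ _ _ h11, hJv _ _ _ h12, hJv _ _ _ h13, neg_mulVec]
  have L2 : J₂ * P = -(P * sdBasis 1) := by
    apply hcol <;> rw [hmulcol, hPη] <;>
      simp [hP0, hP1, hP2, hP3, sdBasis, skewOf_entries, hJv _ _ _ h21, hJv _ _ _ h22, hJv _ _ _ h23, neg_mulVec]
  have L3 : J₃ * P = -(P * sdBasis 2) := by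
    apply hcol <;> rw [hmulcol, hPη] <;>
      simp [hP0, hP1, hP2, hP3, sdBasis, skewOf_entries, hJv _ _ _ h31, hJv _ _ _ h32, hJv _ _ _ h33, neg_mulVec]
  have hcomm : ∀ {J : Matrix (Fin 4) (Fin 4) ℝ} {i : Fin 3}, Jᵀ * g = -(g * J) →
      J * P = -(P * sdBasis i) →
      Pᵀ * (-(g * J)) * P = Pᵀ * g * P * sdBasis i ∧
      Pᵀ * (-(g * J)) * P = sdBasis i * (Pᵀ * g * P) := by
    intro J i h1 h2
    constructor
    · calc Pᵀ * (-(g * J)) * P = -(Pᵀ * g * (J * P)) := by simp [mul_assoc]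
        _ = _ := by rw [h2]; simp [mul_assoc]
    · calc Pᵀ * (-(g * J)) * P = (J * P)ᵀ * g * P := by
            rw [← h1, transpose_mul]; simp [mul_assoc]
        _ = _ := by rw [h2, transpose_neg, transpose_mul, sdBasis_skew]; simp [mul_assoc]
  set Q := Pᵀ * g * P with hQ
  have hQs : ∀ i j, Q i j = Q j i := by
    have : Qᵀ = Q := by simp [hQ, hg, mul_assoc]
    intro i j; conv_lhs => rw [← this]
    rfl
  have hQ00 : Q 0 0 = v ⬝ᵥ g *ᵥ v := by
    rw [hQ, mul_assoc, ← hP0]; rfl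
  have c1 := (hcomm s1 L1).1.symm.trans (hcomm s1 L1).2
  have c2 := (hcomm s2 L2).1.symm.trans (hcomm s2 L2).2
  have c3 := (hcomm s3 L3).1.symm.trans (hcomm s3 L3).2
  have e : ∀ {B C : Matrix (Fin 4) (Fin 4) ℝ} (_ : B = C) a b, B a b = C a b := fun h a b => by rw [h]
  have hQ1 : Q = (v ⬝ᵥ g *ᵥ v) • 1 := by
    rw [← hQ00]
    have a1 := e c1 0 0
    have a2 := e c2 0 0
    have a3 := e c3 0 0
    have a4 := e c1 0 1
    have a5 := e c2 0 2
    have a6 := e c3 0 3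
    have a7 := e c1 0 2
    have a8 := e c1 0 3
    have a9 := e c2 0 3
    have a10 := e c2 0 1
    have a11 := e c3 0 1
    have a12 := e c3 0 2
    simp [Matrix.mul_apply, Fin.sum_univ_four, sdBasis, skewOf_entries] at a1 a2 a3 a4 a5 a6 a7 a8 a9 a10 a11 a12
    have q1 := hQs 0 1
    have q2 := hQs 0 2
    have q3 := hQs 0 3
    have q4 := hQs 1 2
    have q5 := hQs 1 3
    have q6 := hQs 2 3
    ext a b
    fin_cases a <;> fin_cases b <;> simp <;> linarith
  refine ⟨hdet, hQ1, ?_, ?_, ?_⟩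
  · rw [(hcomm s1 L1).1, hQ1]; simp
  · rw [(hcomm s2 L2).1, hQ1]; simp
  · rw [(hcomm s3 L3).1, hQ1]; simp

variable {K : Fin 3 → Matrix (Fin 4) (Fin 4) ℝ} {ν : ℝ}

/-- Three 2-forms with `Kᵢ ∧ Kⱼ = 2 δᵢⱼ ν` generate the quaternions, and the quaternionic frame is
conformally orthonormal for `ν⁻¹ urbantke K` and brings them to the standard form. -/
theorem quatFrame_spec (hK : ∀ i, (K i)ᵀ = -K i)
    (hpf : ∀ i j, pf (K i) (K j) = if i = j then 2 * ν else 0) (hν : ν ≠ 0) :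
    (quatFrame K ν).det ≠ 0 ∧
    (quatFrame K ν)ᵀ * (ν⁻¹ • urbantke K) * quatFrame K ν = (ν⁻¹ * urbantke K 0 0) • 1 ∧
    ∀ i, (quatFrame K ν)ᵀ * K i * quatFrame K ν = (ν⁻¹ * urbantke K 0 0) • sdBasis i := by
  have swap1 : ∀ {i j}, i ≠ j → K i * star2 (K j) = -(K j * star2 (K i)) :=
    fun h => mul_star2_eq_neg hK hpf h
  have swap2 : ∀ {i j}, i ≠ j → star2 (K i) * K j = -(star2 (K j) * K i) :=
    fun h => star2_mul_eq_neg hK hpf h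
  have sq1 : ∀ i, K i * star2 (K i) = (-ν) • 1 := fun i => mul_star2_self hK hpf i
  have sq2 : ∀ i, star2 (K i) * K i = (-ν) • 1 := fun i => star2_mul_self hK hpf i
  -- the metric, and its cyclic expressions
  have g2 : K 1 * star2 (K 2) * K 0 = urbantke K := by
    rw [swap1 (by decide : (1 : Fin 3) ≠ 2), neg_mul, mul_assoc, swap2 (by decide : (1 : Fin 3) ≠ 0),
      mul_neg, neg_neg, ← mul_assoc, swap1 (by decide : (2 : Fin 3) ≠ 0), neg_mul, mul_assoc,
      swap2 (by decide : (2 : Fin 3) ≠ 1), mul_neg, neg_neg, ← mul_assoc, urbantke]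
  have g3 : K 2 * star2 (K 0) * K 1 = urbantke K := by
    rw [swap1 (by decide : (2 : Fin 3) ≠ 0), neg_mul, mul_assoc,
      swap2 (by decide : (2 : Fin 3) ≠ 1), mul_neg, neg_neg, ← mul_assoc, urbantke]
  have hS : ∀ i, (star2 (K i))ᵀ = -star2 (K i) := fun i => star2_transpose _ (hK i)
  have gsymm : (urbantke K)ᵀ = urbantke K := by
    rw [urbantke, transpose_mul, transpose_mul, hK, hK, hS]
    simp only [neg_mul, mul_neg, neg_neg]
    rw [← mul_assoc, swap1 (by decide : (2 : Fin 3) ≠ 1), neg_mul, neg_neg, g2, urbantke]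
  have sqr : ∀ {j k}, j ≠ k → (star2 (K j) * K k) * (star2 (K j) * K k) = (-(ν ^ 2)) • 1 := by
    intro j k h
    calc (star2 (K j) * K k) * (star2 (K j) * K k)
        = star2 (K j) * (K k * star2 (K j)) * K k := by simp only [mul_assoc]
      _ = -((star2 (K j) * K j) * (star2 (K k) * K k)) := by
          rw [swap1 h.symm]; simp only [mul_neg, neg_mul, mul_assoc]
      _ = _ := by rw [sq2, sq2, smul_mul_smul_comm, mul_one]; module
  have prod : ∀ {i j k}, j ≠ i → (star2 (K j) * K k) * (star2 (K k) * K i)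
      = ν • (star2 (K i) * K j) := by
    intro i j k h
    calc (star2 (K j) * K k) * (star2 (K k) * K i)
        = star2 (K j) * (K k * star2 (K k)) * K i := by simp only [mul_assoc]
      _ = (-ν) • (star2 (K j) * K i) := by rw [sq1]; simp
      _ = _ := by rw [swap2 h]; module
  have gJ : ∀ {i j k}, j ≠ k → K i * star2 (K j) * K k = urbantke K →
      -((ν⁻¹ • urbantke K) * (ν⁻¹ • (star2 (K j) * K k))) = K i := by
    intro i j k h hg
    rw [← hg, smul_mul_smul_comm, mul_assoc (K i), mul_assoc (K i), sqr h]
    simp only [Matrix.mul_smul, mul_one, smul_smul]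
    rw [← neg_smul]
    have : -(ν⁻¹ * ν⁻¹ * -ν ^ 2) = 1 := by field_simp
    rw [this, one_smul]
  have gJ1 := gJ (by decide : (1 : Fin 3) ≠ 2) (rfl : K 0 * star2 (K 1) * K 2 = urbantke K)
  have gJ2 := gJ (by decide : (2 : Fin 3) ≠ 0) g2
  have gJ3 := gJ (by decide : (0 : Fin 3) ≠ 1) g3
  have sq' : ∀ {j k}, j ≠ k →
      (ν⁻¹ • (star2 (K j) * K k)) * (ν⁻¹ • (star2 (K j) * K k)) = -1 := by
    intro j k h
    rw [smul_mul_smul_comm, sqr h, smul_smul]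
    have : ν⁻¹ * ν⁻¹ * -ν ^ 2 = -1 := by field_simp
    rw [this, neg_one_smul]
  have prod' : ∀ {i j k}, j ≠ i → (ν⁻¹ • (star2 (K j) * K k)) * (ν⁻¹ • (star2 (K k) * K i))
      = ν⁻¹ • (star2 (K i) * K j) := by
    intro i j k h
    rw [smul_mul_smul_comm, prod h, smul_smul]
    congr 1
    field_simp
  have skewJ : ∀ {i : Fin 3} {J : Matrix (Fin 4) (Fin 4) ℝ}, -((ν⁻¹ • urbantke K) * J) = K i →
      Jᵀ * (ν⁻¹ • urbantke K) = -((ν⁻¹ • urbantke K) * J) := by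
    intro i J h
    have h1 : Jᵀ * (ν⁻¹ • urbantke K) = -(K i)ᵀ := by
      rw [← h, transpose_neg, transpose_mul, transpose_smul, gsymm, neg_neg]
    rw [h1, hK, neg_neg, h]
  have hcol0 : ∀ B : Matrix (Fin 4) (Fin 4) ℝ, (fun a => B a 0) = B *ᵥ Pi.single 0 1 := by
    intro B; ext a; simp
  have main := quaternion_frame (g := ν⁻¹ • urbantke K) (P := quatFrame K ν)
    (v := Pi.single 0 1) (by intro h; simpa using congrFun h 0)
    (by rw [transpose_smul, gsymm])
    (sq' (by decide : (1 : Fin 3) ≠ 2)) (sq' (by decide : (2 : Fin 3) ≠ 0))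
    (sq' (by decide : (0 : Fin 3) ≠ 1)) (prod' (by decide)) (prod' (by decide)) (prod' (by decide))
    (skewJ gJ1) (skewJ gJ2) (skewJ gJ3)
    (by ext a; simp [quatFrame, Matrix.one_apply, Pi.single_apply])
    (by rw [← hcol0]; rfl) (by rw [← hcol0]; rfl) (by rw [← hcol0]; rfl)
  rw [gJ1, gJ2, gJ3] at main
  have hq : (Pi.single 0 1 : Fin 4 → ℝ) ⬝ᵥ (ν⁻¹ • urbantke K) *ᵥ Pi.single 0 1
      = ν⁻¹ * urbantke K 0 0 := by simp
  rw [hq] at main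
  refine ⟨main.1, main.2.1, fun i => ?_⟩
  fin_cases i
  · exact main.2.2.1
  · exact main.2.2.2.1
  · exact main.2.2.2.2

/-- The square of the conformal factor of the quaternionic frame. -/
theorem quatFrame_factor (hK : ∀ i, (K i)ᵀ = -K i)
    (hpf : ∀ i j, pf (K i) (K j) = if i = j then 2 * ν else 0) (hν : ν ≠ 0) :
    (ν⁻¹ * urbantke K 0 0) ^ 2 = (quatFrame K ν).det * ν := by
  have h := pf_congr (quatFrame K ν) (hK 0) (hK 0)
  rw [(quatFrame_spec hK hpf hν).2.2 0, hpf, if_pos rfl] at h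
  have h2 : ∀ (c : ℝ) (B : Matrix (Fin 4) (Fin 4) ℝ), pf (c • B) (c • B) = c ^ 2 * pf B B := by
    intro c B
    simp only [pf, Matrix.smul_apply, smul_eq_mul]; ring
  rw [h2, pf_sdBasis, if_pos rfl] at h
  linarith

end QuaternionFrame

/-! ### Pointwise identities in a frame in which the self-dual forms are standard -/

section Identities

open Matrix

/-- The coefficients of the self-dual part of a 2-form. -/
def sdCoeff (B : Matrix (Fin 4) (Fin 4) ℝ) (j : Fin 3) : ℝ := (1 / 2) * pf (sdBasis j) B

/-- The wedge product of two 2-forms: the self-dual parts contribute positively and the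
anti-self-dual parts negatively. -/
theorem pf_eq_sd_sub_asd {B C : Matrix (Fin 4) (Fin 4) ℝ} (hB : Bᵀ = -B) (hC : Cᵀ = -C) :
    pf B C = 2 * ∑ k, sdCoeff B k * sdCoeff C k - inner2 (asd B) (asd C) := by
  rw [eq_skewOf hB, eq_skewOf hC]
  simp only [pf, sdCoeff, inner2, asd, Fin.sum_univ_three, Fin.sum_univ_four, sdBasis,
    Matrix.smul_apply, Matrix.sub_apply, star2_entries, skewOf_entries, smul_eq_mul,
    Matrix.cons_val_zero, Matrix.cons_val_one, Matrix.cons_val]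
  ring

/-- For a horizontal triple of 1-forms the quadratic part `-[a, a]/2` of the curvature has wedge
product `|a|²/2` with the self-dual forms. -/
theorem sum_pf_bracket {a : Fin 3 → Fin 4 → ℝ} {Q : Fin 3 → Matrix (Fin 4) (Fin 4) ℝ}
    (hQ : ∀ i u v, Q i u v = a (i + 2) u * a (i + 1) v - a (i + 1) u * a (i + 2) v)
    (hh : ∀ p q r, ∑ i, (sdBasis i p q * a i r + sdBasis i q r * a i p + sdBasis i r p * a i q) = 0) :
    2 * ∑ i, pf (sdBasis i) (Q i) = ∑ i, ∑ c, a i c ^ 2 := by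
  have h1 := hh 0 1 2
  have h2 := hh 0 1 3
  have h3 := hh 0 2 3
  have h4 := hh 1 2 3
  simp [Fin.sum_univ_three, sdBasis, skewOf_entries] at h1 h2 h3 h4
  simp [Fin.sum_univ_three, Fin.sum_univ_four, pf, hQ, sdBasis, skewOf_entries]
  -- the difference of the two sides is minus the squared norm of the horizontality condition
  linear_combination -(a 0 2 + -a 1 1 + a 2 0) * h1 - (a 0 3 + -a 1 0 + -a 2 1) * h2
    - (a 0 0 + a 1 3 + -a 2 2) * h3 - (a 0 1 + a 1 2 + a 2 3) * h4

end Identities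

/-! ### Components of skew endomorphisms -/

section SoComp

open Matrix

variable {F : Type*} [NormedAddCommGroup F] [InnerProductSpace ℝ F]

/-- `B` is a skew endomorphism. -/
structure IsSkewEnd (B : F → F) : Prop where
  lin : IsLinearMap ℝ B
  skew : ∀ p q, inner ℝ (B p) q = - inner ℝ p (B q)

/-- The components of the endomorphism `B` in the orthonormal frame `e`. -/
def soCompOf (e : Fin 3 → F) (B : F → F) (j : Fin 3) : ℝ :=
  inner ℝ (B (e (j + 2))) (e (j + 1))

/-- The cofactor matrix. -/
def cof3 (O : Matrix (Fin 3) (Fin 3) ℝ) : Matrix (Fin 3) (Fin 3) ℝ :=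
  Matrix.of fun j k =>
    O (j + 2) (k + 2) * O (j + 1) (k + 1) - O (j + 2) (k + 1) * O (j + 1) (k + 2)

theorem cof3_eq {O : Matrix (Fin 3) (Fin 3) ℝ} (hO : O * Oᵀ = 1) : cof3 O = O.det • O := by
  have h1 : cof3 O = (adjugate O)ᵀ := by
    rw [adjugate_fin_three]
    ext i j
    fin_cases i <;> fin_cases j <;> simp [cof3, Fin.add_def] <;> ring
  have h2 : adjugate O = O.det • Oᵀ := by
    have := congrArg (· * Oᵀ) (adjugate_mul O)
    simpa [mul_assoc, hO] using this
  rw [h1, h2, transpose_smul, transpose_transpose]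

theorem det_sq_of_orthogonal {O : Matrix (Fin 3) (Fin 3) ℝ} (hO : O * Oᵀ = 1) : O.det * O.det = 1 := by
  have := congrArg det hO
  simpa using this

theorem cof3_orthogonal {O : Matrix (Fin 3) (Fin 3) ℝ} (hO : O * Oᵀ = 1) :
    (cof3 O)ᵀ * cof3 O = 1 ∧ (cof3 O).det = 1 := by
  have h := det_sq_of_orthogonal hO
  have hO' : Oᵀ * O = 1 := mul_eq_one_comm.mp hO
  rw [cof3_eq hO]
  constructor
  · rw [transpose_smul, smul_mul_smul_comm, hO', h, one_smul]
  · rw [det_smul, Fintype.card_fin, pow_succ, pow_two, h, one_mul, h]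

theorem sum_inner_smul {e : Fin 3 → F} (he : Orthonormal ℝ e) (hF : Module.finrank ℝ F = 3) (w : F) :
    w = ∑ i, (inner ℝ (e i) w : ℝ) • e i := by
  have : FiniteDimensional ℝ F := FiniteDimensional.of_finrank_pos (by rw [hF]; norm_num)
  let b := (basisOfOrthonormalOfCardEqFinrank he (by simp [hF])).toOrthonormalBasis (by simpa using he)
  have hb : ∀ i, b i = e i := by intro i; simp [b]
  have := (b.sum_repr' w).symm
  simpa [hb] using this

variable {e e' : Fin 3 → F}

theorem soCompOf_change (hF : Module.finrank ℝ F = 3) (he : Orthonormal ℝ e) {B : F → F}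
    (hB : IsSkewEnd B) (j : Fin 3) :
    soCompOf e' B j
      = ∑ k, cof3 (Matrix.of fun a i => (inner ℝ (e i) (e' a) : ℝ)) j k * soCompOf e B k := by
  have hexp := fun a => sum_inner_smul he hF (e' a)
  let O : Matrix (Fin 3) (Fin 3) ℝ := Matrix.of fun a i => (inner ℝ (e i) (e' a) : ℝ)
  let Bl : F →ₗ[ℝ] F := IsLinearMap.mk' B hB.lin
  have key : ∀ p q, (inner ℝ (B (e' p)) (e' q) : ℝ)
      = ∑ i, ∑ j, O p i * O q j * inner ℝ (B (e i)) (e j) := by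
    intro p q
    have h1 : B (e' p) = ∑ i, O p i • B (e i) := by
      change Bl (e' p) = ∑ i, O p i • Bl (e i)
      conv_lhs => rw [hexp p]
      simp [O]
    conv_lhs => rw [h1, hexp q]
    simp only [sum_inner, inner_sum, inner_smul_left, inner_smul_right, O, Matrix.of_apply,
      Finset.mul_sum]
    rw [Finset.sum_comm]
    refine Finset.sum_congr rfl fun i _ => Finset.sum_congr rfl fun j _ => ?_
    simp
    ring
  have hsk : ∀ i j, (inner ℝ (B (e i)) (e j) : ℝ) = - inner ℝ (B (e j)) (e i) := by
    intro i j
    rw [hB.skew, real_inner_comm]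
  have hdiag : ∀ i, (inner ℝ (B (e i)) (e i) : ℝ) = 0 := fun i => by linarith [hsk i i]
  have e1 : (1 : Fin 3) + 2 = 0 := rfl
  have e2 : (2 : Fin 3) + 2 = 1 := rfl
  have e3 : (1 : Fin 3) + 1 = 2 := rfl
  have e4 : (2 : Fin 3) + 1 = 0 := rfl
  change _ = ∑ k, cof3 O j k * _
  simp only [soCompOf, key, cof3, Fin.sum_univ_three, Matrix.of_apply, zero_add, e1, e2, e3, e4]
  rw [hdiag 0, hdiag 1, hdiag 2, hsk 0 1, hsk 1 2, hsk 2 0]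
  ring

theorem frame_matrix_orthogonal (hF : Module.finrank ℝ F = 3) (he : Orthonormal ℝ e)
    (he' : Orthonormal ℝ e') :
    let O : Matrix (Fin 3) (Fin 3) ℝ := Matrix.of fun a i => (inner ℝ (e i) (e' a) : ℝ)
    O * Oᵀ = 1 := by
  intro O
  ext a b
  have h := orthonormal_iff_ite.mp he' a b
  rw [sum_inner_smul he hF (e' a), sum_inner] at h
  simp only [inner_smul_left] at h
  rw [Matrix.mul_apply, Matrix.one_apply, ← h]
  rfl

/-- The components of skew endomorphisms in two orthonormal frames differ by a rotation. -/
theorem exists_rotation (hF : Module.finrank ℝ F = 3) (he : Orthonormal ℝ e)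
    (he' : Orthonormal ℝ e') :
    ∃ R : Matrix (Fin 3) (Fin 3) ℝ, Rᵀ * R = 1 ∧ R.det = 1 ∧
      ∀ B, IsSkewEnd B → ∀ j, soCompOf e' B j = ∑ k, R j k * soCompOf e B k := by
  have h := cof3_orthogonal (frame_matrix_orthogonal hF he he')
  exact ⟨_, h.1, h.2, fun B hB j => soCompOf_change hF he hB j⟩

/-- Every rotation of the components comes from a change of the orthonormal frame. -/
theorem exists_rotated_frame (hF : Module.finrank ℝ F = 3) (he : Orthonormal ℝ e)
    {R : Matrix (Fin 3) (Fin 3) ℝ} (hR : Rᵀ * R = 1) (hdet : R.det = 1) :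
    ∃ e' : Fin 3 → F, Orthonormal ℝ e' ∧
      ∀ B, IsSkewEnd B → ∀ j, soCompOf e' B j = ∑ k, R j k * soCompOf e B k := by
  have hR' : R * Rᵀ = 1 := mul_eq_one_comm.mp hR
  let e' : Fin 3 → F := fun a => ∑ i, R a i • e i
  have hee : ∀ i j, (inner ℝ (e i) (e j) : ℝ) = if i = j then 1 else 0 := orthonormal_iff_ite.mp he
  have hO : (Matrix.of fun a i => (inner ℝ (e i) (e' a) : ℝ)) = R := by
    ext a i
    simp [e', inner_sum, inner_smul_right, hee]
  refine ⟨e', orthonormal_iff_ite.mpr fun a b => ?_, fun B hB j => ?_⟩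
  · have := congrFun (congrFun hR' a) b
    rw [Matrix.mul_apply, Matrix.one_apply] at this
    rw [← this]
    simp [e', inner_sum, inner_smul_right, sum_inner, inner_smul_left, hee, mul_comm]
  · rw [soCompOf_change hF he hB, hO, cof3_eq hR', hdet, one_smul]

end SoComp

/-! ### Two-forms as functions of two vectors -/

section FormAlgebra

open Matrix

variable {V : Type*} [AddCommGroup V] [Module ℝ V]

/-- `β` is an alternating bilinear form. -/
structure IsTwoForm (β : V → V → ℝ) : Prop where
  swap : ∀ u v, β u v = - β v u
  add : ∀ u u' v, β (u + u') v = β u v + β u' v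
  smul : ∀ (c : ℝ) u v, β (c • u) v = c * β u v

variable {α β : V → V → ℝ}

theorem IsTwoForm.sum_smul (hβ : IsTwoForm β) {ι κ : Type*} (S : Finset ι) (S' : Finset κ)
    (c : ι → ℝ) (d : κ → ℝ) (f : ι → V) (g : κ → V) :
    β (∑ i ∈ S, c i • f i) (∑ j ∈ S', d j • g j) = ∑ i ∈ S, ∑ j ∈ S', c i * d j * β (f i) (g j) := by
  let L : V →ₗ[ℝ] V →ₗ[ℝ] ℝ := LinearMap.mk₂ ℝ β hβ.add hβ.smul
    (fun u v w => by rw [hβ.swap, hβ.add, hβ.swap v, hβ.swap w]; ring)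
    (fun c u v => by rw [hβ.swap, hβ.smul, hβ.swap v]; simp)
  change L _ _ = ∑ i ∈ S, ∑ j ∈ S', c i * d j * L (f i) (g j)
  simp only [map_sum, map_smul, LinearMap.sum_apply, LinearMap.smul_apply, smul_eq_mul,
    Finset.mul_sum]
  refine Finset.sum_comm.trans ?_
  refine Finset.sum_congr rfl fun i _ => Finset.sum_congr rfl fun j _ => by ring

theorem IsTwoForm.comb {ι : Type*} {S : Finset ι} {β : ι → V → V → ℝ} (c : ι → ℝ)
    (h : ∀ i ∈ S, IsTwoForm (β i)) : IsTwoForm (fun u v => ∑ i ∈ S, c i * β i u v) where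
  swap u v := by
    rw [← Finset.sum_neg_distrib]
    exact Finset.sum_congr rfl fun i hi => by rw [(h i hi).swap]; ring
  add u u' v := by
    rw [← Finset.sum_add_distrib]
    exact Finset.sum_congr rfl fun i hi => by rw [(h i hi).add]; ring
  smul c' u v := by
    rw [Finset.mul_sum]
    exact Finset.sum_congr rfl fun i hi => by rw [(h i hi).smul]; ring

theorem IsTwoForm.comps_skew (hβ : IsTwoForm β) (f : Fin 4 → V) : (comps f β)ᵀ = -comps f β := by
  ext a b
  simpa [comps] using hβ.swap (f b) (f a)

theorem wedge22_eq_pf (f : Fin 4 → V) : wedge22 α β f = pf (comps f α) (comps f β) := rfl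

/-- The frame obtained from `f` by the matrix `P`. -/
def changeFrame (f : Fin 4 → V) (P : Matrix (Fin 4) (Fin 4) ℝ) : Fin 4 → V :=
  fun b => ∑ a, P a b • f a

theorem IsTwoForm.comps_change (hβ : IsTwoForm β) (f : Fin 4 → V) (P : Matrix (Fin 4) (Fin 4) ℝ) :
    comps (changeFrame f P) β = Pᵀ * comps f β * P := by
  ext a b
  simp only [comps, changeFrame, Matrix.of_apply, hβ.sum_smul, Matrix.mul_apply,
    Matrix.transpose_apply, Finset.sum_mul]
  rw [Finset.sum_comm]
  exact Finset.sum_congr rfl fun i _ => Finset.sum_congr rfl fun j _ => by ring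

theorem wedge22_change (hα : IsTwoForm α) (hβ : IsTwoForm β) (f : Fin 4 → V)
    (P : Matrix (Fin 4) (Fin 4) ℝ) : wedge22 α β (changeFrame f P) = P.det * wedge22 α β f := by
  rw [wedge22_eq_pf, wedge22_eq_pf, hα.comps_change, hβ.comps_change,
    pf_congr P (hα.comps_skew f) (hβ.comps_skew f)]

theorem changeFrame_toMatrix (b : Module.Basis (Fin 4) ℝ V) (v : Fin 4 → V) :
    changeFrame b (b.toMatrix v) = v := by
  funext c
  simp [changeFrame, Module.Basis.toMatrix_apply, b.sum_repr]

theorem wedge22_basis (hα : IsTwoForm α) (hβ : IsTwoForm β) (b : Module.Basis (Fin 4) ℝ V)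
    (v : Fin 4 → V) : wedge22 α β v = b.det v * wedge22 α β b := by
  rw [Module.Basis.det_apply, ← wedge22_change hα hβ, changeFrame_toMatrix]

theorem wedge22_sum_left {ι : Type*} (S : Finset ι) (c : ι → ℝ) (α : ι → V → V → ℝ) (v : Fin 4 → V) :
    wedge22 (fun u w => ∑ i ∈ S, c i * α i u w) β v = ∑ i ∈ S, c i * wedge22 (α i) β v := by
  classical
  induction S using Finset.induction_on with
  | empty => simp [wedge22]
  | insert i S hi ih =>
    rw [Finset.sum_insert hi, ← ih]
    simp only [wedge22, Finset.sum_insert hi]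
    ring

theorem wedge22_comm (v : Fin 4 → V) : wedge22 α β v = wedge22 β α v := by
  simp only [wedge22]; ring

theorem wedge22_sum_right {ι : Type*} (S : Finset ι) (c : ι → ℝ) (α : ι → V → V → ℝ)
    (v : Fin 4 → V) :
    wedge22 β (fun u w => ∑ i ∈ S, c i * α i u w) v = ∑ i ∈ S, c i * wedge22 β (α i) v := by
  rw [wedge22_comm, wedge22_sum_left]
  exact Finset.sum_congr rfl fun i _ => by rw [wedge22_comm]

/-- The matrix of wedge products of linear combinations of 2-forms. -/
theorem wedge22_matrix (R T : Matrix (Fin 3) (Fin 3) ℝ) (α β : Fin 3 → V → V → ℝ) (v : Fin 4 → V) :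
    (Matrix.of fun i j => wedge22 (fun u w => ∑ k, R i k * α k u w)
      (fun u w => ∑ k, T j k * β k u w) v)
      = R * (Matrix.of fun i j => wedge22 (α i) (β j) v) * Tᵀ := by
  ext i j
  simp only [Matrix.of_apply, wedge22_sum_left, wedge22_sum_right, Matrix.mul_apply,
    Matrix.transpose_apply, Finset.mul_sum, Finset.sum_mul]
  exact Finset.sum_congr rfl fun k _ => Finset.sum_congr rfl fun l _ => by ring

/-- A frame obtained from a basis by an invertible matrix is a basis. -/
theorem exists_basis_changeFrame (b : Module.Basis (Fin 4) ℝ V) {P : Matrix (Fin 4) (Fin 4) ℝ}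
    (hP : P.det ≠ 0) : ∃ f : Module.Basis (Fin 4) ℝ V, ⇑f = changeFrame b P := by
  have hM : b.toMatrix (changeFrame b P) = P := by
    ext i j
    simp [Module.Basis.toMatrix_apply, changeFrame, Finsupp.single_apply]
  have hu : IsUnit (b.det (changeFrame b P)) := by
    rw [Module.Basis.det_apply, hM]
    exact hP.isUnit
  obtain ⟨h1, h2⟩ := (Module.Basis.is_basis_iff_det b).mpr hu
  exact ⟨Module.Basis.mk h1 h2.ge, Module.Basis.coe_mk h1 h2.ge⟩

end FormAlgebra

/-! ### The forms `F` and `Σ` in an arbitrary orthonormal frame of the fibre -/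

section FrameForms

open Matrix

variable {M : Type*} [TopologicalSpace M] [ChartedSpace R4 M] [IsManifold (𝓡 4) ∞ M] [T2Space M]
  {E : M → Type*} [∀ x, NormedAddCommGroup (E x)] [∀ x, InnerProductSpace ℝ (E x)]
  [TopologicalSpace (TotalSpace R3 E)] [FiberBundle R3 E] [VectorBundle ℝ R3 E]
  [ContMDiffVectorBundle ∞ R3 E (𝓡 4)] [IsContMDiffRiemannianBundle (𝓡 4) ∞ R3 E]
  {A : CovariantDerivative (𝓡 4) R3 E}
  {a : (x : M) → E x →L[ℝ] TangentSpace (𝓡 4) x →L[ℝ] E x} {x : M}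

theorem isSkewEnd_curvature (hA : IsSO3Connection A) (u v : TangentSpace (𝓡 4) x) :
    IsSkewEnd (curvature A x u v) where
  lin := ⟨fun e e' => curvature_add_section hA.smooth u v e e',
    fun c e => curvature_smul_section hA.smooth u v e c⟩
  skew := curvature_skew hA u v

theorem isSkewEnd_soForm (ha : IsSoForm a) (u : TangentSpace (𝓡 4) x) :
    IsSkewEnd (fun e => a x e u) where
  lin := ⟨fun e e' => by rw [(a x).map_add]; rfl, fun c e => by rw [(a x).map_smul]; rfl⟩
  skew := ha.skew x u

theorem IsSkewEnd.sub {F : Type*} [NormedAddCommGroup F] [InnerProductSpace ℝ F] {B C : F → F}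
    (hB : IsSkewEnd B) (hC : IsSkewEnd C) : IsSkewEnd (fun e => B e - C e) where
  lin := (IsLinearMap.mk' B hB.lin - IsLinearMap.mk' C hC.lin).isLinear
  skew p q := by rw [inner_sub_left, inner_sub_right, hB.skew, hC.skew]; ring

theorem IsSkewEnd.smul {F : Type*} [NormedAddCommGroup F] [InnerProductSpace ℝ F] {B : F → F}
    (hB : IsSkewEnd B) (c : ℝ) : IsSkewEnd (fun e => c • B e) where
  lin := (c • IsLinearMap.mk' B hB.lin).isLinear
  skew p q := by rw [inner_smul_left, inner_smul_right, hB.skew]; simp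

theorem isSkewEnd_dA (hA : IsSO3Connection A) (ha : IsSoForm a) (u v : TangentSpace (𝓡 4) x) :
    IsSkewEnd (dA A a x u v) := by
  have h := ((isSkewEnd_curvature (hA.shift ha 1) u v).sub
    (isSkewEnd_curvature (hA.shift ha (-1)) u v)).smul (1 / 2)
  have he : dA A a x u v = fun e => (1 / 2 : ℝ) • (curvature (shift A a 1) x u v e
      - curvature (shift A a (-1)) x u v e) := by
    funext e; exact dA_eq_curvature hA ha u v e
  rwa [he]

/-- The curvature 2-forms in the orthonormal frame `e` of the fibre at `x`. -/
def curvFormOf (A : CovariantDerivative (𝓡 4) R3 E) (e : Fin 3 → E x) (i : Fin 3)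
    (u v : TangentSpace (𝓡 4) x) : ℝ :=
  soCompOf e (curvature A x u v) i

/-- The 2-forms `(d_A a)^i` in the orthonormal frame `e` of the fibre at `x`. -/
def dAFormOf (A : CovariantDerivative (𝓡 4) R3 E)
    (a : (x : M) → E x →L[ℝ] TangentSpace (𝓡 4) x →L[ℝ] E x) (e : Fin 3 → E x) (i : Fin 3)
    (u v : TangentSpace (𝓡 4) x) : ℝ :=
  soCompOf e (dA A a x u v) i

theorem isTwoForm_curvFormOf (hA : IsSO3Connection A) (e : Fin 3 → E x) (i : Fin 3) :
    IsTwoForm (curvFormOf A e i) where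
  swap u v := by rw [curvFormOf, curvFormOf, soCompOf, soCompOf, curvature_swap hA.smooth, inner_neg_left]
  add u u' v := by
    simp only [curvFormOf, soCompOf, curvature_add_left hA.smooth, inner_add_left]
  smul c u v := by
    simp only [curvFormOf, soCompOf, curvature_smul_left hA.smooth, inner_smul_left]
    simp

theorem dAFormOf_eq (hA : IsSO3Connection A) (ha : IsSoForm a) (e : Fin 3 → E x) (i : Fin 3)
    (u v : TangentSpace (𝓡 4) x) :
    dAFormOf A a e i u v = (1 / 2) * curvFormOf (shift A a 1) e i u v
      + (-(1 / 2)) * curvFormOf (shift A a (-1)) e i u v := by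
  simp only [dAFormOf, curvFormOf, soCompOf, dA_eq_curvature hA ha, inner_smul_left, inner_sub_left]
  simp
  ring

theorem isTwoForm_dAFormOf (hA : IsSO3Connection A) (ha : IsSoForm a) (e : Fin 3 → E x) (i : Fin 3) :
    IsTwoForm (dAFormOf A a e i) := by
  have h1 := isTwoForm_curvFormOf (hA.shift ha 1) e i
  have h2 := isTwoForm_curvFormOf (hA.shift ha (-1)) e i
  refine ⟨fun u v => ?_, fun u u' v => ?_, fun c u v => ?_⟩ <;> simp only [dAFormOf_eq hA ha]
  · rw [h1.swap, h2.swap]; ring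
  · rw [h1.add, h2.add]; ring
  · rw [h1.smul, h2.smul]; ring

/-- The matrix `F^i ∧ F^j` in the orthonormal frame `e`, evaluated on `v`. -/
def GOf (A : CovariantDerivative (𝓡 4) R3 E) (e : Fin 3 → E x)
    (v : Fin 4 → TangentSpace (𝓡 4) x) : Matrix (Fin 3) (Fin 3) ℝ :=
  Matrix.of fun i j => wedge22 (curvFormOf A e i) (curvFormOf A e j) v

theorem GOf_symm (e : Fin 3 → E x) (v : Fin 4 → TangentSpace (𝓡 4) x) :
    (GOf A e v)ᵀ = GOf A e v := by
  ext i j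
  exact wedge22_comm v

variable (oM : ManifoldOrientation M) (oE : FibreOrientation E) (Λ : ℝ)

theorem GOf_basis (hA : IsSO3Connection A) (e : Fin 3 → E x) (v : Fin 4 → TangentSpace (𝓡 4) x) :
    GOf A e v = (refBasis oM x).det v • GOf A e (refBasis oM x) := by
  ext i j
  exact wedge22_basis (isTwoForm_curvFormOf hA e i) (isTwoForm_curvFormOf hA e j) _ v

/-- The matrix `Y` in the orthonormal frame `e`. -/
def YOf (oM : ManifoldOrientation M) (Λ : ℝ) (A : CovariantDerivative (𝓡 4) R3 E) (e : Fin 3 → E x) : Matrix (Fin 3) (Fin 3) ℝ := signedRoot Λ (GOf A e (refBasis oM x))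

/-- The 2-forms `Σ_i` in the orthonormal frame `e`. -/
def SigOf (oM : ManifoldOrientation M) (Λ : ℝ) (A : CovariantDerivative (𝓡 4) R3 E)
    (e : Fin 3 → E x) (i : Fin 3) (u v : TangentSpace (𝓡 4) x) : ℝ :=
  ∑ j, (YOf oM Λ A e)⁻¹ i j * curvFormOf A e j u v

/-- The rotation `R` takes components in the frame `e` to components in the frame `e'`. -/
def IsRotation (R : Matrix (Fin 3) (Fin 3) ℝ) (e e' : Fin 3 → E x) : Prop :=
  ∀ B : E x → E x, IsSkewEnd B → ∀ j, soCompOf e' B j = ∑ k, R j k * soCompOf e B k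

theorem orthonormal_fibreFrame : Orthonormal ℝ (fibreFrame oE x) := (fibreFrame oE x).orthonormal

variable {oM oE Λ} {e e' : Fin 3 → E x} {R : Matrix (Fin 3) (Fin 3) ℝ}

theorem GOf_rotate (hA : IsSO3Connection A) (hrot : IsRotation R e e')
    (v : Fin 4 → TangentSpace (𝓡 4) x) : GOf A e' v = R * GOf A e v * Rᵀ := by
  have h : ∀ i, curvFormOf A e' i = fun u w => ∑ k, R i k * curvFormOf A e k u w :=
    fun i => funext fun u => funext fun w => hrot _ (isSkewEnd_curvature hA u w) i
  simp only [GOf, h]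
  exact wedge22_matrix R R _ _ v

theorem GOf_posDef (hA : IsSO3Connection A) (hpos : (FF oM oE A x).PosDef)
    (he : Orthonormal ℝ e) : (GOf A e (refBasis oM x)).PosDef := by
  obtain ⟨R, hR, -, hrot⟩ := exists_rotation (finrank_fibre x) (orthonormal_fibreFrame oE (x := x)) he
  rw [GOf_rotate hA hrot]
  exact posDef_conj hR hpos

section Rotate

theorem YOf_rotate (hA : IsSO3Connection A) (hpos : (GOf A e (refBasis oM x)).PosDef)
    (hR : Rᵀ * R = 1) (hrot : IsRotation R e e') :
    YOf oM Λ A e' = R * YOf oM Λ A e * Rᵀ := by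
  rw [YOf, GOf_rotate hA hrot, signedRoot_conj hR hpos, YOf]

theorem XOf_rotate (hΛ : Λ ≠ 0) (hA : IsSO3Connection A)
    (hpos : (GOf A e (refBasis oM x)).PosDef)
    (hR : Rᵀ * R = 1) (hrot : IsRotation R e e') :
    (YOf oM Λ A e')⁻¹ = R * (YOf oM Λ A e)⁻¹ * Rᵀ := by
  rw [YOf_rotate hA hpos hR hrot]
  refine inv_eq_right_inv ?_
  have hu : IsUnit (YOf oM Λ A e).det := isUnit_det_signedRoot hΛ hpos
  calc R * YOf oM Λ A e * Rᵀ * (R * (YOf oM Λ A e)⁻¹ * Rᵀ)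
      = R * YOf oM Λ A e * (Rᵀ * R) * (YOf oM Λ A e)⁻¹ * Rᵀ := by simp only [mul_assoc]
    _ = R * (YOf oM Λ A e * (YOf oM Λ A e)⁻¹) * Rᵀ := by rw [hR]; simp only [mul_assoc, mul_one]
    _ = 1 := by rw [mul_nonsing_inv _ hu, mul_one]; exact mul_eq_one_comm.mp hR

theorem SigOf_rotate (hΛ : Λ ≠ 0) (hA : IsSO3Connection A)
    (hpos : (GOf A e (refBasis oM x)).PosDef)
    (hR : Rᵀ * R = 1) (hrot : IsRotation R e e') (i : Fin 3) (u v : TangentSpace (𝓡 4) x) :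
    SigOf oM Λ A e' i u v = ∑ j, R i j * SigOf oM Λ A e j u v := by
  have h1 : ∀ j, curvFormOf A e' j u v = (R *ᵥ fun k => curvFormOf A e k u v) j :=
    fun j => hrot _ (isSkewEnd_curvature hA u v) j
  have h2 : SigOf oM Λ A e' i u v = ((YOf oM Λ A e')⁻¹ *ᵥ (R *ᵥ fun k => curvFormOf A e k u v)) i := by
    simp only [SigOf, h1]; rfl
  have h3 : (∑ j, R i j * SigOf oM Λ A e j u v)
      = (R *ᵥ ((YOf oM Λ A e)⁻¹ *ᵥ fun k => curvFormOf A e k u v)) i := rfl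
  rw [h2, h3, XOf_rotate hΛ hA hpos hR hrot, mulVec_mulVec, mulVec_mulVec, mul_assoc, hR, mul_one]

end Rotate

theorem isTwoForm_SigOf (hA : IsSO3Connection A) (e : Fin 3 → E x) (i : Fin 3) :
    IsTwoForm (SigOf oM Λ A e i) :=
  IsTwoForm.comb _ fun j _ => isTwoForm_curvFormOf hA e j

/-- `F^i = Y_{ij} Σ_j`. -/
theorem curvFormOf_eq (hΛ : Λ ≠ 0) (hpos : (GOf A e (refBasis oM x)).PosDef) (i : Fin 3)
    (u v : TangentSpace (𝓡 4) x) :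
    curvFormOf A e i u v = ∑ j, YOf oM Λ A e i j * SigOf oM Λ A e j u v := by
  have hu : IsUnit (YOf oM Λ A e).det := isUnit_det_signedRoot hΛ hpos
  have h : (∑ j, YOf oM Λ A e i j * SigOf oM Λ A e j u v)
      = (YOf oM Λ A e *ᵥ ((YOf oM Λ A e)⁻¹ *ᵥ fun k => curvFormOf A e k u v)) i := rfl
  rw [h, mulVec_mulVec, mul_nonsing_inv _ hu, one_mulVec]

theorem volForm_basis (hA : IsSO3Connection A) (b : Module.Basis (Fin 4) ℝ (TangentSpace (𝓡 4) x))
    (v : Fin 4 → TangentSpace (𝓡 4) x) :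
    volForm oM oE Λ A x v = b.det v * volForm oM oE Λ A x b := by
  have h : ∀ i, IsTwoForm (Sig oM oE Λ A x i) := fun i => isTwoForm_SigOf hA (fibreFrame oE x) i
  simp only [volForm, fun i => wedge22_basis (h i) (h i) b v, Fin.sum_univ_three]
  ring

/-- `Σ_i ∧ Σ_j` is a positive multiple of `δ_{ij}` on the reference basis. -/
theorem exists_wedge_SigOf (hΛ : Λ ≠ 0) (hpos : (GOf A e (refBasis oM x)).PosDef) :
    ∃ c : ℝ, 0 < c ∧ ∀ i j, wedge22 (SigOf oM Λ A e i) (SigOf oM Λ A e j) (refBasis oM x)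
      = if i = j then c else 0 := by
  obtain ⟨c, hc, hYY⟩ := signedRoot_sq hΛ hpos
  set Y := YOf oM Λ A e with hY
  have hu : IsUnit Y.det := isUnit_det_signedRoot hΛ hpos
  have hYs : Yᵀ = Y := signedRoot_symm hpos
  refine ⟨c⁻¹, inv_pos.mpr hc, fun i j => ?_⟩
  have h := wedge22_matrix Y⁻¹ Y⁻¹ (curvFormOf A e) (curvFormOf A e) (refBasis oM x)
  have hG : (Matrix.of fun i j => wedge22 (curvFormOf A e i) (curvFormOf A e j) (refBasis oM x))
      = c⁻¹ • (Y * Y) := by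
    change GOf A e (refBasis oM x) = _
    rw [hY, YOf, hYY, smul_smul, inv_mul_cancel₀ hc.ne', one_smul]
  rw [hG, transpose_nonsing_inv, hYs, Matrix.mul_smul, Matrix.smul_mul, ← mul_assoc,
    nonsing_inv_mul _ hu, one_mul, mul_nonsing_inv _ hu] at h
  have := congrFun (congrFun h i) j
  simp only [Matrix.of_apply, Matrix.smul_apply, Matrix.one_apply, smul_eq_mul, mul_ite, mul_one,
    mul_zero] at this
  exact this

theorem volForm_ref_pos (hΛ : Λ ≠ 0) (hpos : (FF oM oE A x).PosDef) :
    0 < volForm oM oE Λ A x (refBasis oM x) := by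
  obtain ⟨c, hc, h⟩ := exists_wedge_SigOf (e := fibreFrame oE x) hΛ hpos
  have : volForm oM oE Λ A x (refBasis oM x) = c / 2 := by
    have h' : ∀ i, wedge22 (Sig oM oE Λ A x i) (Sig oM oE Λ A x i) (refBasis oM x) = c := by
      intro i
      have := h i i
      rw [if_pos rfl] at this
      exact this
    simp only [volForm, h', Fin.sum_univ_three]
    ring
  rw [this]
  positivity

theorem volForm_basis_ne_zero (hΛ : Λ ≠ 0) (hA : IsSO3Connection A) (hpos : (FF oM oE A x).PosDef)
    (b : Module.Basis (Fin 4) ℝ (TangentSpace (𝓡 4) x)) : volForm oM oE Λ A x b ≠ 0 := by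
  rw [volForm_basis hA (refBasis oM x) b]
  exact mul_ne_zero ((refBasis oM x).isUnit_det b).ne_zero (volForm_ref_pos hΛ hpos).ne'

/-- `Σ_i ∧ Σ_j = 2 δ_{ij} μ_A` in every orthonormal frame. -/
theorem wedge_SigOf (hΛ : Λ ≠ 0) (hA : IsSO3Connection A) (hpos : (FF oM oE A x).PosDef)
    (he : Orthonormal ℝ e) (i j : Fin 3) (v : Fin 4 → TangentSpace (𝓡 4) x) :
    wedge22 (SigOf oM Λ A e i) (SigOf oM Λ A e j) v
      = if i = j then 2 * volForm oM oE Λ A x v else 0 := by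
  have key : ∀ i j, wedge22 (SigOf oM Λ A (fibreFrame oE x) i) (SigOf oM Λ A (fibreFrame oE x) j) v
      = if i = j then 2 * volForm oM oE Λ A x v else 0 := by
    obtain ⟨c, hc, h⟩ := exists_wedge_SigOf (e := fibreFrame oE x) hΛ hpos
    have hc' : ∀ i j, wedge22 (SigOf oM Λ A (fibreFrame oE x) i) (SigOf oM Λ A (fibreFrame oE x) j) v
        = if i = j then (refBasis oM x).det v * c else 0 := by
      intro i j
      rw [wedge22_basis (isTwoForm_SigOf hA _ i) (isTwoForm_SigOf hA _ j) (refBasis oM x), h]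
      simp
    have hvol : volForm oM oE Λ A x v = (refBasis oM x).det v * c / 2 := by
      have h' : ∀ i, wedge22 (Sig oM oE Λ A x i) (Sig oM oE Λ A x i) v = (refBasis oM x).det v * c := by
        intro i
        have := hc' i i
        rw [if_pos rfl] at this
        exact this
      simp only [volForm, h', Fin.sum_univ_three]
      ring
    intro i j
    rw [hc', hvol]
    congr 1
    ring
  obtain ⟨R, hR, -, hrot⟩ := exists_rotation (finrank_fibre x) (orthonormal_fibreFrame oE (x := x)) he
  have hS : ∀ i, SigOf oM Λ A e i
      = fun u w => ∑ k, R i k * SigOf oM Λ A (fibreFrame oE x) k u w :=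
    fun i => funext fun u => funext fun w => SigOf_rotate hΛ hA hpos hR hrot i u w
  have h := wedge22_matrix R R (SigOf oM Λ A (fibreFrame oE x)) (SigOf oM Λ A (fibreFrame oE x)) v
  have hm : (Matrix.of fun i j => wedge22 (SigOf oM Λ A (fibreFrame oE x) i)
      (SigOf oM Λ A (fibreFrame oE x) j) v) = (2 * volForm oM oE Λ A x v) • 1 := by
    ext i j
    simp [key, Matrix.one_apply]
  rw [hm, Matrix.mul_smul, mul_one, Matrix.smul_mul, mul_eq_one_comm.mp hR] at h
  have := congrFun (congrFun h i) j
  simp only [Matrix.of_apply, ← hS] at this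
  rw [this]
  simp [Matrix.one_apply]

end FrameForms

/-! ### The metric `g_A` -/

section Metric

open Matrix

variable {M : Type*} [TopologicalSpace M] [ChartedSpace R4 M] [IsManifold (𝓡 4) ∞ M] [T2Space M]
  {E : M → Type*} [∀ x, NormedAddCommGroup (E x)] [∀ x, InnerProductSpace ℝ (E x)]
  [TopologicalSpace (TotalSpace R3 E)] [FiberBundle R3 E] [VectorBundle ℝ R3 E]
  [ContMDiffVectorBundle ∞ R3 E (𝓡 4)] [IsContMDiffRiemannianBundle (𝓡 4) ∞ R3 E]
  {oM : ManifoldOrientation M} {oE : FibreOrientation E} {Λ : ℝ}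
  {A : CovariantDerivative (𝓡 4) R3 E} {x : M} {e : Fin 3 → E x}

theorem isTwoForm_Sig (hA : IsSO3Connection A) (i : Fin 3) : IsTwoForm (Sig oM oE Λ A x i) :=
  isTwoForm_SigOf hA (fibreFrame oE x) i

theorem wedge_Sig (hΛ : Λ ≠ 0) (hA : IsSO3Connection A) (hpos : (FF oM oE A x).PosDef)
    (i j : Fin 3) (v : Fin 4 → TangentSpace (𝓡 4) x) :
    wedge22 (Sig oM oE Λ A x i) (Sig oM oE Λ A x j) v
      = if i = j then 2 * volForm oM oE Λ A x v else 0 :=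
  wedge_SigOf hΛ hA hpos (orthonormal_fibreFrame oE) i j v

theorem volForm_changeFrame (hA : IsSO3Connection A)
    (f : Fin 4 → TangentSpace (𝓡 4) x) (P : Matrix (Fin 4) (Fin 4) ℝ) :
    volForm oM oE Λ A x (changeFrame f P) = P.det * volForm oM oE Λ A x f := by
  simp only [volForm, fun i => wedge22_change (isTwoForm_Sig (oM := oM) (oE := oE) (Λ := Λ) hA i)
    (isTwoForm_Sig (oM := oM) (oE := oE) (Λ := Λ) hA i) f P, Fin.sum_univ_three]
  ring

/-- In the rescaled quaternionic frame the triple `K` is standard up to the sign of the conformal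
factor. -/
theorem quatFrame_normalized {K : Fin 3 → Matrix (Fin 4) (Fin 4) ℝ} {ν : ℝ}
    (hK : ∀ i, (K i)ᵀ = -K i) (hpf : ∀ i j, pf (K i) (K j) = if i = j then 2 * ν else 0)
    (hν : ν ≠ 0) :
    let q := ν⁻¹ * urbantke K 0 0
    let P := (Real.sqrt |q|)⁻¹ • quatFrame K ν
    q ≠ 0 ∧ P.det * ν = 1 ∧ ∀ i, Pᵀ * K i * P = (q / |q|) • sdBasis i := by
  intro q P
  obtain ⟨hdet, -, hspec⟩ := quatFrame_spec hK hpf hν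
  have hfac := quatFrame_factor hK hpf hν
  have hq : q ≠ 0 := by
    intro h0
    have h1 : (quatFrame K ν).det * ν = 0 := by rw [← hfac]; change q ^ 2 = 0; rw [h0]; ring
    exact mul_ne_zero hdet hν h1
  have hs : Real.sqrt |q| * Real.sqrt |q| = |q| := Real.mul_self_sqrt (abs_nonneg q)
  have hs0 : Real.sqrt |q| ≠ 0 := (Real.sqrt_pos.mpr (abs_pos.mpr hq)).ne'
  refine ⟨hq, ?_, fun i => ?_⟩
  · simp only [P, det_smul, Fintype.card_fin]
    rw [mul_assoc, ← hfac]
    change (Real.sqrt |q|)⁻¹ ^ 4 * q ^ 2 = 1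
    have h4 : Real.sqrt |q| ^ 4 = q ^ 2 := by
      rw [← sq_abs q, ← hs]
      ring_nf
      simp
    rw [inv_pow, h4, inv_mul_cancel₀ (pow_ne_zero 2 hq)]
  · simp only [P, transpose_smul, Matrix.smul_mul, Matrix.mul_smul, hspec i, smul_smul]
    congr 1
    rw [← mul_assoc, ← mul_inv, hs, mul_comm, div_eq_mul_inv]

theorem star2_smul (c : ℝ) (B : Matrix (Fin 4) (Fin 4) ℝ) : star2 (c • B) = c • star2 B := by
  ext i j
  fin_cases i <;> fin_cases j <;> simp [star2_entries]

theorem exists_isMetricFrame (hΛ : Λ ≠ 0) (hA : IsSO3Connection A) (hpos : (FF oM oE A x).PosDef) :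
    ∃ f, IsMetricFrame oM oE Λ A x f := by
  set b := refBasis oM x
  have hν := volForm_basis_ne_zero hΛ hA hpos b
  have hK : ∀ i, (comps b (Sig oM oE Λ A x i))ᵀ = -comps b (Sig oM oE Λ A x i) :=
    fun i => (isTwoForm_Sig hA i).comps_skew b
  obtain ⟨hq, hdet, hspec⟩ := quatFrame_normalized hK
    (fun i j => wedge_Sig hΛ hA hpos i j b) hν
  obtain ⟨f, hf⟩ := exists_basis_changeFrame b (left_ne_zero_of_mul_eq_one hdet)
  refine ⟨f, ?_, fun i => ?_⟩
  · rw [hf, volForm_changeFrame hA, hdet]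
  · rw [hf, (isTwoForm_Sig hA i).comps_change, hspec, star2_smul, star2_sdBasis]

theorem isMetricFrame_metricFrame (hΛ : Λ ≠ 0) (hA : IsSO3Connection A)
    (hpos : (FF oM oE A x).PosDef) : IsMetricFrame oM oE Λ A x (metricFrame oM oE Λ A x) :=
  @Classical.epsilon_spec_aux _ ⟨refBasis oM x⟩ _ (exists_isMetricFrame hΛ hA hpos)

/-- A self-dual form is the combination of the standard ones with coefficients `β(f₀, f_a)`. -/
theorem eq_sum_sdBasis {B : Matrix (Fin 4) (Fin 4) ℝ} (hB : Bᵀ = -B) (hs : star2 B = B) :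
    B = ∑ a : Fin 3, B 0 a.succ • sdBasis a := by
  have h23 : B 2 3 = B 0 1 := by rw [← congrFun (congrFun hs 0) 1]; rfl
  have h31 : B 3 1 = B 0 2 := by rw [← congrFun (congrFun hs 0) 2]; rfl
  have h12 : B 1 2 = B 0 3 := by rw [← congrFun (congrFun hs 0) 3]; rfl
  have h13 : B 1 3 = -B 3 1 := by simpa using congrFun (congrFun hB 3) 1
  have hC : (∑ a : Fin 3, B 0 a.succ • sdBasis a)ᵀ = -∑ a : Fin 3, B 0 a.succ • sdBasis a := by
    rw [transpose_sum, ← Finset.sum_neg_distrib]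
    exact Finset.sum_congr rfl fun a _ => by rw [transpose_smul, sdBasis_skew, smul_neg]
  refine skew_ext hB hC ?_ ?_ ?_ ?_ ?_ ?_ <;>
    simp [Fin.sum_univ_three, sdBasis, skewOf_entries, h23, h31, h12, h13]

/-- The matrix of the forms `Σ_i` in the standard basis of self-dual forms of `metricFrame` is a
rotation: this is the content of the sign condition. -/
theorem exists_rotation_metricFrame (hΛ : Λ ≠ 0) (hA : IsSO3Connection A)
    (hdef : IsDefinite oM oE A) (hsign : HasSignOf oM oE Λ A) (x : M) :
    ∃ C : Matrix (Fin 3) (Fin 3) ℝ, C * Cᵀ = 1 ∧ C.det = 1 ∧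
      ∀ i, comps (metricFrame oM oE Λ A x) (Sig oM oE Λ A x i) = ∑ a, C i a • sdBasis a := by
  have hpos := hdef.posDef x
  have hm := isMetricFrame_metricFrame hΛ hA hpos
  set f := metricFrame oM oE Λ A x with hf
  let C : Matrix (Fin 3) (Fin 3) ℝ := Matrix.of fun i a => Sig oM oE Λ A x i (f 0) (f a.succ)
  have hC : ∀ i, comps f (Sig oM oE Λ A x i) = ∑ a, C i a • sdBasis a := fun i =>
    eq_sum_sdBasis ((isTwoForm_Sig hA i).comps_skew f) (hm.selfDual i)
  have hCC : C * Cᵀ = 1 := by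
    ext i j
    have h := wedge_Sig hΛ hA hpos i j f
    rw [wedge22_eq_pf, hC i, hC j, hm.vol] at h
    simp [pf, Fin.sum_univ_three, sdBasis, skewOf_entries] at h
    rw [Matrix.mul_apply, Matrix.one_apply, Fin.sum_univ_three]
    simp only [Matrix.transpose_apply]
    split_ifs at h ⊢ <;> linarith
  refine ⟨C, hCC, ?_, hC⟩
  have hdet : 0 < C.det := by
    have h1 := hsign x
    rw [← hf] at h1
    set N : Matrix (Fin 3) (Fin 3) ℝ :=
      Matrix.of fun i a : Fin 3 => curvForm oE A x i (f 0) (f a.succ) with hN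
    have hCN : C = X oM oE Λ A x * N := by
      ext i a
      rfl
    have h2 := (signedRoot_sign hΛ hpos).inv.det_pos
    have hYu : IsUnit (Y oM oE Λ A x).det := isUnit_det_signedRoot hΛ hpos
    have h3 : 0 < (Λ • Y oM oE Λ A x).det := (signedRoot_sign hΛ hpos).det_pos
    have h4 : (X oM oE Λ A x).det * (Y oM oE Λ A x).det = 1 := by
      rw [← det_mul, X, nonsing_inv_mul _ hYu, det_one]
    rw [det_smul, Fintype.card_fin] at h3
    rw [hCN, det_mul]
    have h5 : 0 < Λ ^ 4 * ((X oM oE Λ A x).det * N.det) := by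
      have : Λ ^ 4 * ((X oM oE Λ A x).det * N.det)
          = (Λ ^ 3 * (Y oM oE Λ A x).det) * (Λ * N.det) * (X oM oE Λ A x).det ^ 2 := by
        linear_combination (-(Λ ^ 4) * (X oM oE Λ A x).det * N.det) * h4
      rw [this]
      have h6 : (X oM oE Λ A x).det ≠ 0 := left_ne_zero_of_mul_eq_one h4
      positivity
    exact pos_of_mul_pos_right h5 (by positivity)
  have := det_sq_of_orthogonal hCC
  nlinarith

/-- Urbantke's formula for the metric `g_A`. -/
theorem gA_basis (hΛ : Λ ≠ 0) (hA : IsSO3Connection A) (hdef : IsDefinite oM oE A)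
    (hsign : HasSignOf oM oE Λ A) (b : Module.Basis (Fin 4) ℝ (TangentSpace (𝓡 4) x)) (a c : Fin 4) :
    gA oM oE Λ A x (b a) (b c)
      = (volForm oM oE Λ A x b)⁻¹ * urbantke (fun i => comps b (Sig oM oE Λ A x i)) a c := by
  have hpos := hdef.posDef x
  obtain ⟨C, hC, hCdet, hCspec⟩ := exists_rotation_metricFrame hΛ hA hdef hsign x
  have hm := isMetricFrame_metricFrame hΛ hA hpos
  set f := metricFrame oM oE Λ A x with hf
  set K := fun i => comps b (Sig oM oE Λ A x i) with hKdef
  have hK : ∀ i, (K i)ᵀ = -K i := fun i => (isTwoForm_Sig hA i).comps_skew b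
  set Q := b.toMatrix f with hQ
  have hcf : changeFrame b Q = f := changeFrame_toMatrix b f
  have h1 : (fun i => Qᵀ * K i * Q) = fun i => ∑ a, C i a • sdBasis a := by
    funext i
    rw [← hCspec, ← hcf, (isTwoForm_Sig hA i).comps_change]
  have h2 := urbantke_congr Q hK
  rw [h1, urbantke_rotate (ν := 1) (mul_eq_one_comm.mp hC) hCdet sdBasis_skew
    (by intro i j; rw [pf_sdBasis]; norm_num), urbantke_sdBasis] at h2
  have hvol : Q.det * volForm oM oE Λ A x b = 1 := by
    rw [← volForm_changeFrame hA, hcf, hm.vol]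
  have hν : volForm oM oE Λ A x b ≠ 0 := right_ne_zero_of_mul_eq_one hvol
  have hQdet : Q.det = (volForm oM oE Λ A x b)⁻¹ := eq_inv_of_mul_eq_one_left hvol
  set Q' := f.toMatrix b with hQ'
  have hQQ' : Q * Q' = 1 := b.toMatrix_mul_toMatrix_flip f
  have h3 : Q'ᵀ * Q' = (volForm oM oE Λ A x b)⁻¹ • urbantke K := by
    have h4 : Q'ᵀ * 1 * Q' = Q'ᵀ * (Q.det • (Qᵀ * urbantke K * Q)) * Q' := by rw [h2]
    rw [mul_one] at h4
    rw [h4, Matrix.mul_smul, Matrix.smul_mul, hQdet]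
    congr 1
    calc Q'ᵀ * (Qᵀ * urbantke K * Q) * Q' = (Q * Q')ᵀ * urbantke K * (Q * Q') := by
          rw [transpose_mul]; simp only [mul_assoc]
      _ = urbantke K := by rw [hQQ']; simp
  have h5 := congrFun (congrFun h3 a) c
  rw [Matrix.smul_apply, smul_eq_mul] at h5
  rw [← h5, gA, Matrix.mul_apply]
  rfl

/-- Urbantke's formula, with the forms `Σ_i` in an arbitrary orthonormal frame of the fibre. -/
theorem gA_basis' (hΛ : Λ ≠ 0) (hA : IsSO3Connection A) (hdef : IsDefinite oM oE A)
    (hsign : HasSignOf oM oE Λ A) (he : Orthonormal ℝ e)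
    (b : Module.Basis (Fin 4) ℝ (TangentSpace (𝓡 4) x)) (a c : Fin 4) :
    gA oM oE Λ A x (b a) (b c)
      = (volForm oM oE Λ A x b)⁻¹ * urbantke (fun i => comps b (SigOf oM Λ A e i)) a c := by
  have hpos := hdef.posDef x
  obtain ⟨R, hR, hdet, hrot⟩ :=
    exists_rotation (finrank_fibre x) (orthonormal_fibreFrame oE (x := x)) he
  have h : (fun i => comps b (SigOf oM Λ A e i))
      = fun i => ∑ j, R i j • comps b (Sig oM oE Λ A x j) := by
    funext i
    ext a c
    rw [Matrix.sum_apply]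
    exact SigOf_rotate hΛ hA hpos hR hrot i (b a) (b c)
  rw [gA_basis hΛ hA hdef hsign, h, urbantke_rotate hR hdet
    (fun i => (isTwoForm_Sig hA i).comps_skew b) (fun i j => wedge_Sig hΛ hA hpos i j b)]

theorem gA_self_pos {v : TangentSpace (𝓡 4) x} (hv : v ≠ 0) : 0 < gA oM oE Λ A x v v := by
  simp only [gA, ← pow_two]
  refine lt_of_le_of_ne (Finset.sum_nonneg fun i _ => sq_nonneg _) fun h => hv ?_
  have h0 := (Finset.sum_eq_zero_iff_of_nonneg fun i _ => sq_nonneg _).mp h.symm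
  refine (metricFrame oM oE Λ A x).ext_elem fun i => ?_
  simpa using h0 i (Finset.mem_univ i)

/-- The conformal factor of the quaternionic frame is positive: the metric is positive definite. -/
theorem urbantke_zero_pos (hΛ : Λ ≠ 0) (hA : IsSO3Connection A) (hdef : IsDefinite oM oE A)
    (hsign : HasSignOf oM oE Λ A) (he : Orthonormal ℝ e)
    (b : Module.Basis (Fin 4) ℝ (TangentSpace (𝓡 4) x)) :
    0 < (volForm oM oE Λ A x b)⁻¹ * urbantke (fun i => comps b (SigOf oM Λ A e i)) 0 0 := by
  rw [← gA_basis' hΛ hA hdef hsign he]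
  exact gA_self_pos (b.ne_zero 0)

/-- There is an orthonormal frame of the fibre in which the forms `Σ_i` are the standard self-dual
forms of `metricFrame`. -/
theorem exists_adapted_fibreFrame (hΛ : Λ ≠ 0) (hA : IsSO3Connection A)
    (hdef : IsDefinite oM oE A) (hsign : HasSignOf oM oE Λ A) (x : M) :
    ∃ (e : Fin 3 → E x) (R : Matrix (Fin 3) (Fin 3) ℝ), Orthonormal ℝ e ∧ Rᵀ * R = 1 ∧ R.det = 1 ∧
      IsRotation R (fibreFrame oE x) e ∧
      ∀ i, comps (metricFrame oM oE Λ A x) (SigOf oM Λ A e i) = sdBasis i := by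
  obtain ⟨C, hC, hCdet, hCspec⟩ := exists_rotation_metricFrame hΛ hA hdef hsign x
  have hC' : Cᵀ * C = 1 := mul_eq_one_comm.mp hC
  have hR : (Cᵀ)ᵀ * Cᵀ = 1 := by rw [transpose_transpose, hC]
  obtain ⟨e, he, hrot⟩ := exists_rotated_frame (finrank_fibre x)
    (orthonormal_fibreFrame oE (x := x)) hR (by rw [det_transpose, hCdet])
  refine ⟨e, Cᵀ, he, hR, by rw [det_transpose, hCdet], hrot, fun i => ?_⟩
  have h : comps (metricFrame oM oE Λ A x) (SigOf oM Λ A e i)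
      = ∑ j, Cᵀ i j • comps (metricFrame oM oE Λ A x) (Sig oM oE Λ A x j) := by
    ext a c
    rw [Matrix.sum_apply]
    exact SigOf_rotate hΛ hA (hdef.posDef x) hR hrot i _ _
  rw [h]
  simp only [hCspec, Finset.smul_sum, smul_smul]
  rw [Finset.sum_comm]
  have hi : ∀ a, ∑ j, Cᵀ i j * C j a = if i = a then 1 else 0 := by
    intro a
    rw [← Matrix.one_apply, ← hC', Matrix.mul_apply]
  simp only [← Finset.sum_smul, hi]
  simp

end Metric

/-! ### Smooth functions of smooth functions -/

section SmoothOps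

open Matrix

variable {M : Type*} [TopologicalSpace M] [ChartedSpace R4 M] [IsManifold (𝓡 4) ∞ M]
  {f g : M → ℝ} {x : M}

theorem FSmoothNear.comp_real {G : ℝ → ℝ} (hf : FSmoothNear f x)
    (hG : ∀ᶠ w in nhds (f x), ContDiffAt ℝ ∞ G w) : FSmoothNear (fun y => G (f y)) x :=
  FSmoothNear.comp_pi hf hG

theorem FSmoothNear.inv (hf : FSmoothNear f x) (h0 : f x ≠ 0) : FSmoothNear (fun y => (f y)⁻¹) x :=
  hf.comp_real ((eventually_ne_nhds h0).mono fun _ hw => contDiffAt_inv ℝ hw)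

theorem FSmoothNear.sqrt (hf : FSmoothNear f x) (h0 : 0 < f x) :
    FSmoothNear (fun y => Real.sqrt (f y)) x :=
  hf.comp_real ((eventually_gt_nhds h0).mono fun _ hw => Real.contDiffAt_sqrt hw.ne')

theorem FSmoothNear.continuousAt (hf : FSmoothNear f x) : ContinuousAt f x :=
  hf.self_of_nhds.continuousAt

/-- The entries of the square root of a smooth family of positive definite matrices are smooth. -/
theorem FSmoothNear.matrixSqrt {G : M → Matrix (Fin 3) (Fin 3) ℝ}
    (hG : ∀ i j, FSmoothNear (fun y => G y i j) x) (hsymm : ∀ y, (G y)ᵀ = G y)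
    (hpos : (G x).PosDef) (i j : Fin 3) : FSmoothNear (fun y => CFC.sqrt (G y) i j) x := by
  let φ : M → (Fin 3 → Fin 3 → ℝ) := fun y => G y
  let N : (Fin 3 → Fin 3 → ℝ) → Matrix (Fin 3) (Fin 3) ℝ :=
    fun w => Matrix.of fun i j => (w i j + w j i) / 2
  have hN : ∀ y, N (φ y) = G y := by
    intro y
    ext a b
    have : G y b a = G y a b := congrFun (congrFun (hsymm y) a) b
    simp [N, φ, this]
  have hφ : ∀ᶠ y in nhds x, ContMDiffAt (𝓡 4) 𝓘(ℝ, Fin 3 → Fin 3 → ℝ) ∞ φ y := by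
    filter_upwards [Filter.eventually_all.mpr fun i => Filter.eventually_all.mpr (hG i)] with y hy
    exact contMDiffAt_pi_space.mpr fun i => contMDiffAt_pi_space.mpr fun j => hy i j
  have hNs : ∀ w a b, ContDiffAt ℝ ∞ (fun w => N w a b) w := by
    intro w a b
    simp only [N, Matrix.of_apply]
    fun_prop
  have hNpos : ∀ᶠ w in nhds (φ x), (N w).PosDef := by
    refine eventually_posDef (fun a b => (hNs _ a b).continuousAt) (fun w => ?_) (by rwa [hN])
    ext a b
    simp [N, add_comm]
  have h := FSmoothNear.comp_pi (G := fun w => CFC.sqrt (N w) i j) hφ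
    (hNpos.eventually_nhds.mono fun w hw => contDiffAt_sqrt (n := ⊤) (hNs w) hw i j)
  simpa only [hN] using h

theorem FSmoothNear.matrixInv {G : M → Matrix (Fin 3) (Fin 3) ℝ}
    (hG : ∀ i j, FSmoothNear (fun y => G y i j) x) (hdet : (G x).det ≠ 0) (i j : Fin 3) :
    FSmoothNear (fun y => (G y)⁻¹ i j) x := by
  have hd : FSmoothNear (fun y => (G y).det) x := by
    simp only [Matrix.det_fin_three]
    exact ((((((hG 0 0).mul (hG 1 1)).mul (hG 2 2)).sub (((hG 0 0).mul (hG 1 2)).mul (hG 2 1))).sub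
      (((hG 0 1).mul (hG 1 0)).mul (hG 2 2))).add (((hG 0 1).mul (hG 1 2)).mul (hG 2 0))).add
      (((hG 0 2).mul (hG 1 0)).mul (hG 2 1)) |>.sub (((hG 0 2).mul (hG 1 1)).mul (hG 2 0))
  have hadj : FSmoothNear (fun y => (G y).adjugate i j) x := by
    simp only [Matrix.adjugate_fin_three]
    have h : ∀ a b c d, FSmoothNear (fun y => G y a b * G y c d) x :=
      fun a b c d => (hG a b).mul (hG c d)
    have h1 : ∀ a b c d a' b' c' d',
        FSmoothNear (fun y => G y a b * G y c d - G y a' b' * G y c' d') x :=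
      fun a b c d a' b' c' d' => (h a b c d).sub (h a' b' c' d')
    have h2 : ∀ a b c d a' b' c' d',
        FSmoothNear (fun y => -(G y a b * G y c d) + G y a' b' * G y c' d') x :=
      fun a b c d a' b' c' d' => (h a b c d).neg.add (h a' b' c' d')
    fin_cases i <;> fin_cases j <;> simp <;> first | exact h1 .. | exact h2 ..
  refine ((hd.inv hdet).mul hadj).congr (Filter.Eventually.of_forall fun y => ?_)
  rw [Matrix.inv_def, Matrix.smul_apply, Ring.inverse_eq_inv', smul_eq_mul]

end SmoothOps

/-! ### Smooth local frames -/

section Frames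

open Matrix

variable {M : Type*} [TopologicalSpace M] [ChartedSpace R4 M] [IsManifold (𝓡 4) ∞ M] [T2Space M]
  {E : M → Type*} [∀ x, NormedAddCommGroup (E x)] [∀ x, InnerProductSpace ℝ (E x)]
  [TopologicalSpace (TotalSpace R3 E)] [FiberBundle R3 E] [VectorBundle ℝ R3 E]
  [ContMDiffVectorBundle ∞ R3 E (𝓡 4)] [IsContMDiffRiemannianBundle (𝓡 4) ∞ R3 E]
  {x : M}

/-- `e` is a smooth orthonormal frame of `E` near `x`. -/
structure IsOrthoFrame (e : Fin 3 → (y : M) → E y) (x : M) : Prop where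
  smooth : ∀ i, SmoothNear R3 (e i) x
  ortho : ∀ᶠ y in nhds x, Orthonormal ℝ (fun i => e i y)

/-- `V` is a smooth frame of the tangent bundle near `x`. -/
structure IsTangentFrame (V : Fin 4 → (y : M) → TangentSpace (𝓡 4) y) (x : M) : Prop where
  smooth : ∀ a, SmoothNear R4 (V a) x
  indep : ∀ᶠ y in nhds x, LinearIndependent ℝ (fun a => V a y)

theorem IsOrthoFrame.eventually {e : Fin 3 → (y : M) → E y} (h : IsOrthoFrame e x) :
    ∀ᶠ y in nhds x, IsOrthoFrame e y := by
  filter_upwards [Filter.eventually_all.mpr fun i => (h.smooth i).eventually,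
    h.ortho.eventually_nhds] with y h1 h2 using ⟨h1, h2⟩

theorem IsTangentFrame.eventually {V : Fin 4 → (y : M) → TangentSpace (𝓡 4) y}
    (h : IsTangentFrame V x) : ∀ᶠ y in nhds x, IsTangentFrame V y := by
  filter_upwards [Filter.eventually_all.mpr fun i => (h.smooth i).eventually,
    h.indep.eventually_nhds] with y h1 h2 using ⟨h1, h2⟩

theorem exists_basis_of_linearIndependent {v : Fin 4 → TangentSpace (𝓡 4) x}
    (h : LinearIndependent ℝ v) :
    ∃ b : Module.Basis (Fin 4) ℝ (TangentSpace (𝓡 4) x), ⇑b = v :=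
  ⟨basisOfLinearIndependentOfCardEqFinrank h (by rw [finrank_tangent]; simp), by simp⟩

theorem isTangentFrame_coordField {i : M} (hx : x ∈ (chartAt R4 i).source) :
    IsTangentFrame (fun k => coordField i (EuclideanSpace.single k 1)) x where
  smooth k := smoothNear_coordField hx _
  indep := by
    filter_upwards [(chartAt R4 i).open_source.mem_nhds hx] with y hy
    exact linearIndependent_coordField hy

/-- Smooth orthonormal frames exist locally, by the Gram–Schmidt process. -/
theorem exists_isOrthoFrame_extending {b : Fin 3 → E x} (ho : Orthonormal ℝ b) :
    ∃ e : Fin 3 → (y : M) → E y, IsOrthoFrame e x ∧ ∀ i, e i x = b i := by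
  -- normalization of a section of unit length at `x`
  have hnorm : ∀ s : (y : M) → E y, SmoothNear R3 s x → inner ℝ (s x) (s x) = (1 : ℝ) →
      ∃ n : (y : M) → E y, SmoothNear R3 n x ∧ n x = s x ∧
        (∀ᶠ y in nhds x, inner ℝ (n y) (n y) = (1 : ℝ)) ∧
        ∀ y (z : E y), inner ℝ z (s y) = (0 : ℝ) → inner ℝ z (n y) = (0 : ℝ) := by
    intro s hs h1
    have hp : (0 : ℝ) < inner ℝ (s x) (s x) := by rw [h1]; exact one_pos
    have hf := FSmoothNear.inner hs hs
    refine ⟨(fun y => (Real.sqrt (inner ℝ (s y) (s y)))⁻¹) • s,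
      SmoothNear.smul ((hf.sqrt hp).inv (Real.sqrt_pos.mpr hp).ne') hs, ?_, ?_, ?_⟩
    · show (Real.sqrt (inner ℝ (s x) (s x)))⁻¹ • s x = s x
      rw [h1, Real.sqrt_one, inv_one, one_smul]
    · filter_upwards [hf.continuousAt.eventually (eventually_gt_nhds hp)] with y hy
      simp only [Pi.smul_apply', inner_smul_left, inner_smul_right]
      have h1 : Real.sqrt (inner ℝ (s y) (s y)) ≠ 0 := (Real.sqrt_pos.mpr hy).ne'
      have h2 : Real.sqrt (inner ℝ (s y) (s y)) * Real.sqrt (inner ℝ (s y) (s y))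
        = inner ℝ (s y) (s y) := Real.mul_self_sqrt hy.le
      simp only [conj_trivial]
      rw [← h2]
      field_simp
      rw [Real.sqrt_sq (Real.sqrt_nonneg _)]
    · intro y z hz
      simp [inner_smul_right, hz]
  have hb : ∀ i j, inner ℝ (b i) (b j) = if i = j then (1 : ℝ) else 0 :=
    orthonormal_iff_ite.mp ho
  let s : Fin 3 → (y : M) → E y := fun i => FiberBundle.extend R3 (b i)
  have hs : ∀ i, SmoothNear R3 (s i) x := fun i => smoothNear_extend (b i)
  have hsx : ∀ i, s i x = b i := fun i => by simp [s]
  obtain ⟨n0, hn0, hn0x, hn0u, hn0p⟩ := hnorm (s 0) (hs 0) (by rw [hsx, hb, if_pos rfl])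
  have hr1 : SmoothNear R3 (s 1 - (fun y => inner ℝ (n0 y) (s 1 y) : M → ℝ) • n0) x :=
    (hs 1).sub (SmoothNear.smul (FSmoothNear.inner hn0 (hs 1)) hn0)
  have hr1x : (s 1 - (fun y => inner ℝ (n0 y) (s 1 y) : M → ℝ) • n0) x = b 1 := by
    simp only [Pi.sub_apply, Pi.smul_apply', hn0x, hsx, hb]
    simp
  obtain ⟨n1, hn1, hn1x, hn1u, hn1p⟩ := hnorm _ hr1 (by rw [hr1x, hb, if_pos rfl])
  rw [hr1x] at hn1x
  have hr2 : SmoothNear R3 (s 2 - (fun y => inner ℝ (n0 y) (s 2 y) : M → ℝ) • n0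
      - (fun y => inner ℝ (n1 y) (s 2 y) : M → ℝ) • n1) x :=
    ((hs 2).sub (SmoothNear.smul (FSmoothNear.inner hn0 (hs 2)) hn0)).sub
      (SmoothNear.smul (FSmoothNear.inner hn1 (hs 2)) hn1)
  have hr2x : (s 2 - (fun y => inner ℝ (n0 y) (s 2 y) : M → ℝ) • n0
      - (fun y => inner ℝ (n1 y) (s 2 y) : M → ℝ) • n1) x = b 2 := by
    simp only [Pi.sub_apply, Pi.smul_apply', hn0x, hn1x, hsx, hb]
    simp
  obtain ⟨n2, hn2, hn2x, hn2u, hn2p⟩ := hnorm _ hr2 (by rw [hr2x, hb, if_pos rfl])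
  rw [hr2x] at hn2x
  rw [hsx] at hn0x
  refine ⟨![n0, n1, n2], ⟨?_, ?_⟩, ?_⟩
  · intro i
    fin_cases i <;> assumption
  rotate_left
  · intro i
    fin_cases i <;> assumption
  · filter_upwards [hn0u, hn1u, hn2u] with y h0 h1 h2
    have h01 : inner ℝ (n0 y) (n1 y) = (0 : ℝ) := by
      refine hn1p y _ ?_
      simp only [Pi.sub_apply, Pi.smul_apply', inner_sub_right, inner_smul_right, h0, mul_one, sub_self]
    have h10 : inner ℝ (n1 y) (n0 y) = (0 : ℝ) := by rw [real_inner_comm, h01]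
    have h02 : inner ℝ (n0 y) (n2 y) = (0 : ℝ) := by
      refine hn2p y _ ?_
      simp only [Pi.sub_apply, Pi.smul_apply', inner_sub_right, inner_smul_right, h0, h01, mul_one,
        mul_zero, sub_self]
    have h12 : inner ℝ (n1 y) (n2 y) = (0 : ℝ) := by
      refine hn2p y _ ?_
      simp only [Pi.sub_apply, Pi.smul_apply', inner_sub_right, inner_smul_right, h1, h10, mul_one,
        mul_zero, sub_zero, sub_self]
    have h20 : inner ℝ (n2 y) (n0 y) = (0 : ℝ) := by rw [real_inner_comm, h02]
    have h21 : inner ℝ (n2 y) (n1 y) = (0 : ℝ) := by rw [real_inner_comm, h12]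
    refine orthonormal_iff_ite.mpr fun i j => ?_
    fin_cases i <;> fin_cases j
    exacts [h0, h01, h02, h10, h1, h12, h20, h21, h2]

theorem exists_isOrthoFrame (x : M) : ∃ e : Fin 3 → (y : M) → E y, IsOrthoFrame e x := by
  have hfin : FiniteDimensional ℝ (E x) :=
    FiniteDimensional.of_finrank_pos (by rw [finrank_fibre]; norm_num)
  obtain ⟨e, he, -⟩ := exists_isOrthoFrame_extending
    ((stdOrthonormalBasis ℝ (E x)).reindex (finCongr (finrank_fibre x))).orthonormal
  exact ⟨e, he⟩

end Frames

/-! ### Smoothness of the geometric forms in smooth frames -/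

section SmoothForms

open Matrix

variable {M : Type*} [TopologicalSpace M] [ChartedSpace R4 M] [IsManifold (𝓡 4) ∞ M] [T2Space M]
  {E : M → Type*} [∀ x, NormedAddCommGroup (E x)] [∀ x, InnerProductSpace ℝ (E x)]
  [TopologicalSpace (TotalSpace R3 E)] [FiberBundle R3 E] [VectorBundle ℝ R3 E]
  [ContMDiffVectorBundle ∞ R3 E (𝓡 4)] [IsContMDiffRiemannianBundle (𝓡 4) ∞ R3 E]
  {A : CovariantDerivative (𝓡 4) R3 E}
  {a : (x : M) → E x →L[ℝ] TangentSpace (𝓡 4) x →L[ℝ] E x} {x : M}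
  {oM : ManifoldOrientation M} {oE : FibreOrientation E} {Λ : ℝ}
  {e : Fin 3 → (y : M) → E y} {V : Fin 4 → (y : M) → TangentSpace (𝓡 4) y}
  {U W : (y : M) → TangentSpace (𝓡 4) y}

theorem SmoothNear.curvature {s : (y : M) → E y} (hA : IsSO3Connection A) (hs : SmoothNear R3 s x)
    (hU : SmoothNear R4 U x) (hW : SmoothNear R4 W x) :
    SmoothNear R3 (fun y => PureConnection.curvature A y (U y) (W y) (s y)) x := by
  have h : SmoothNear R3 (fun y => curvOp A s U W y) x :=
    (((hs.covariant hA.smooth hW).covariant hA.smooth hU).sub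
      ((hs.covariant hA.smooth hU).covariant hA.smooth hW)).sub
      (hs.covariant hA.smooth (hU.mlieBracket hW))
  refine h.congr ?_
  filter_upwards [hs.eventually, hU.eventually, hW.eventually] with y h1 h2 h3
  exact curvature_eq_curvOp hA.smooth h1 h2 h3

theorem smooth_curvFormOf (hA : IsSO3Connection A) (he : IsOrthoFrame e x)
    (hU : SmoothNear R4 U x) (hW : SmoothNear R4 W x) (i : Fin 3) :
    FSmoothNear (fun y => curvFormOf A (fun k => e k y) i (U y) (W y)) x :=
  FSmoothNear.inner (SmoothNear.curvature hA (he.smooth _) hU hW) (he.smooth _)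

theorem smooth_dAFormOf (hA : IsSO3Connection A) (ha : IsSoForm a) (he : IsOrthoFrame e x)
    (hU : SmoothNear R4 U x) (hW : SmoothNear R4 W x) (i : Fin 3) :
    FSmoothNear (fun y => dAFormOf A a (fun k => e k y) i (U y) (W y)) x := by
  simp only [dAFormOf_eq hA ha]
  exact ((FSmoothNear.const _).mul (smooth_curvFormOf (hA.shift ha 1) he hU hW i)).add
    ((FSmoothNear.const _).mul (smooth_curvFormOf (hA.shift ha (-1)) he hU hW i))

theorem FSmoothNear.wedge22 {α β : (y : M) → TangentSpace (𝓡 4) y → TangentSpace (𝓡 4) y → ℝ}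
    (hα : ∀ a b, FSmoothNear (fun y => α y (V a y) (V b y)) x)
    (hβ : ∀ a b, FSmoothNear (fun y => β y (V a y) (V b y)) x) :
    FSmoothNear (fun y => PureConnection.wedge22 (α y) (β y) (fun a => V a y)) x := by
  simp only [PureConnection.wedge22]
  exact (((((((hα 0 1).mul (hβ 2 3)).sub ((hα 0 2).mul (hβ 1 3))).add ((hα 0 3).mul (hβ 1 2))).add
    ((hα 1 2).mul (hβ 0 3))).sub ((hα 1 3).mul (hβ 0 2))).add ((hα 2 3).mul (hβ 0 1)))

theorem smooth_GOf (hA : IsSO3Connection A) (he : IsOrthoFrame e x) (hV : IsTangentFrame V x)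
    (i j : Fin 3) :
    FSmoothNear (fun y => GOf A (fun k => e k y) (fun a => V a y) i j) x :=
  FSmoothNear.wedge22 (fun a b => smooth_curvFormOf hA he (hV.smooth a) (hV.smooth b) i)
    (fun a b => smooth_curvFormOf hA he (hV.smooth a) (hV.smooth b) j)

theorem det_ref_ne_zero {v : Fin 4 → TangentSpace (𝓡 4) x} (hv : LinearIndependent ℝ v) :
    (refBasis oM x).det v ≠ 0 := by
  obtain ⟨b, rfl⟩ := exists_basis_of_linearIndependent hv
  exact ((refBasis oM x).isUnit_det b).ne_zero

/-- The orientation of a smooth frame is locally constant. -/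
theorem exists_sign (hA : IsSO3Connection A) (hdef : IsDefinite oM oE A)
    (hV : IsTangentFrame V x) :
    ∃ κ : ℝ, (κ = 1 ∨ κ = -1) ∧
      ∀ᶠ y in nhds x, 0 < κ * (refBasis oM y).det (fun a => V a y) := by
  obtain ⟨e, he⟩ := exists_isOrthoFrame (E := E) x
  let τ : M → ℝ := fun y => (GOf A (fun k => e k y) (fun a => V a y)).trace
  have hτ : FSmoothNear τ x := by
    have : τ = fun y => ∑ i, GOf A (fun k => e k y) (fun a => V a y) i i := rfl
    rw [this]
    exact FSmoothNear.sum _ fun i _ => smooth_GOf hA he hV i i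
  have hsg : ∀ᶠ y in nhds x, ∃ p : ℝ, 0 < p ∧ τ y = (refBasis oM y).det (fun a => V a y) * p := by
    filter_upwards [he.ortho] with y hy
    refine ⟨_, (GOf_posDef hA (hdef.posDef y) hy).trace_pos, ?_⟩
    simp only [τ]
    rw [GOf_basis oM hA, trace_smul, smul_eq_mul]
  obtain ⟨p, hp, hτx⟩ := hsg.self_of_nhds
  have hτ0 : τ x ≠ 0 := by
    rw [hτx]
    exact mul_ne_zero (det_ref_ne_zero hV.indep.self_of_nhds) hp.ne'
  rcases lt_or_gt_of_ne hτ0 with h | h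
  · refine ⟨-1, Or.inr rfl, ?_⟩
    filter_upwards [hsg, hτ.continuousAt.eventually (eventually_lt_nhds h)] with y ⟨q, hq, h1⟩ h2
    rw [h1] at h2
    nlinarith
  · refine ⟨1, Or.inl rfl, ?_⟩
    filter_upwards [hsg, hτ.continuousAt.eventually (eventually_gt_nhds h)] with y ⟨q, hq, h1⟩ h2
    rw [h1] at h2
    nlinarith

/-- `Y` may be computed in any positively oriented frame. -/
theorem YOf_eq {y : M} {κ : ℝ} {e : Fin 3 → E y} (hA : IsSO3Connection A)
    (hdef : IsDefinite oM oE A) (he : Orthonormal ℝ e) {v : Fin 4 → TangentSpace (𝓡 4) y}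
    (hκ : 0 < κ * (refBasis oM y).det v) :
    YOf oM Λ A e = signedRoot Λ (κ • GOf A e v) ∧ (κ • GOf A e v).PosDef := by
  have hpos := GOf_posDef hA (hdef.posDef y) he
  rw [GOf_basis oM hA, smul_smul]
  exact ⟨(signedRoot_smul hκ hpos).symm, hpos.smul hκ⟩

theorem smooth_YOf (hA : IsSO3Connection A) (hdef : IsDefinite oM oE A) (he : IsOrthoFrame e x)
    (i j : Fin 3) : FSmoothNear (fun y => YOf oM Λ A (fun k => e k y) i j) x := by
  set V : Fin 4 → (y : M) → TangentSpace (𝓡 4) y :=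
    fun k => coordField x (EuclideanSpace.single k 1)
  have hV : IsTangentFrame V x := isTangentFrame_coordField (mem_chart_source R4 x)
  obtain ⟨κ, -, hκ⟩ := exists_sign hA hdef hV
  let G : M → Matrix (Fin 3) (Fin 3) ℝ := fun y => κ • GOf A (fun k => e k y) (fun a => V a y)
  have hG : ∀ i j, FSmoothNear (fun y => G y i j) x := fun i j =>
    (FSmoothNear.const κ).mul (smooth_GOf hA he hV i j)
  have hGs : ∀ y, (G y)ᵀ = G y := fun y => by
    simp only [G, transpose_smul]; rw [GOf_symm]
  have hGpos : (G x).PosDef :=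
    (YOf_eq (Λ := Λ) hA hdef he.ortho.self_of_nhds hκ.self_of_nhds).2
  have hS := fun i j => FSmoothNear.matrixSqrt hG hGs hGpos i j
  have htr : FSmoothNear (fun y => (CFC.sqrt (G y)).trace) x := by
    have : (fun y => (CFC.sqrt (G y)).trace) = fun y => ∑ i, CFC.sqrt (G y) i i := rfl
    rw [this]
    exact FSmoothNear.sum _ fun i _ => hS i i
  refine (((FSmoothNear.const Λ).mul
    (htr.inv (sqrt_posDef hGpos).trace_pos.ne')).mul (hS i j)).congr ?_
  filter_upwards [he.ortho, hκ] with y h1 h2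
  rw [(YOf_eq (Λ := Λ) hA hdef h1 h2).1, signedRoot, Matrix.smul_apply, smul_eq_mul, div_eq_mul_inv]

theorem smooth_SigOf (hΛ : Λ ≠ 0) (hA : IsSO3Connection A) (hdef : IsDefinite oM oE A)
    (he : IsOrthoFrame e x) (hU : SmoothNear R4 U x) (hW : SmoothNear R4 W x) (i : Fin 3) :
    FSmoothNear (fun y => SigOf oM Λ A (fun k => e k y) i (U y) (W y)) x := by
  have hu : IsUnit (YOf oM Λ A (fun k => e k x)).det :=
    isUnit_det_signedRoot hΛ (GOf_posDef hA (hdef.posDef x) he.ortho.self_of_nhds)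
  exact FSmoothNear.sum _ fun j _ =>
    (FSmoothNear.matrixInv (fun i j => smooth_YOf hA hdef he i j) hu.ne_zero i j).mul
      (smooth_curvFormOf hA he hU hW j)

theorem volForm_eq (hΛ : Λ ≠ 0) (hA : IsSO3Connection A) {y : M} (hpos : (FF oM oE A y).PosDef)
    {e : Fin 3 → E y} (he : Orthonormal ℝ e) (v : Fin 4 → TangentSpace (𝓡 4) y) :
    volForm oM oE Λ A y v = (1 / 2) * wedge22 (SigOf oM Λ A e 0) (SigOf oM Λ A e 0) v := by
  rw [wedge_SigOf hΛ hA hpos he, if_pos rfl]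
  ring

theorem smooth_volForm (hΛ : Λ ≠ 0) (hA : IsSO3Connection A) (hdef : IsDefinite oM oE A)
    (hV : IsTangentFrame V x) : FSmoothNear (fun y => volForm oM oE Λ A y (fun a => V a y)) x := by
  obtain ⟨e, he⟩ := exists_isOrthoFrame (E := E) x
  refine ((FSmoothNear.const (1 / 2)).mul (FSmoothNear.wedge22
    (fun a b => smooth_SigOf hΛ hA hdef he (hV.smooth a) (hV.smooth b) 0)
    (fun a b => smooth_SigOf hΛ hA hdef he (hV.smooth a) (hV.smooth b) 0))).congr ?_
  filter_upwards [he.ortho] with y hy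
  exact volForm_eq hΛ hA (hdef.posDef y) hy _

end SmoothForms

/-! ### Adapted tangent frames and coordinate expressions -/

section Adapted

open Matrix

variable {M : Type*} [TopologicalSpace M] [ChartedSpace R4 M] [IsManifold (𝓡 4) ∞ M] [T2Space M]
  {E : M → Type*} [∀ x, NormedAddCommGroup (E x)] [∀ x, InnerProductSpace ℝ (E x)]
  [TopologicalSpace (TotalSpace R3 E)] [FiberBundle R3 E] [VectorBundle ℝ R3 E]
  [ContMDiffVectorBundle ∞ R3 E (𝓡 4)] [IsContMDiffRiemannianBundle (𝓡 4) ∞ R3 E]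
  {A : CovariantDerivative (𝓡 4) R3 E}
  {a : (x : M) → E x →L[ℝ] TangentSpace (𝓡 4) x →L[ℝ] E x} {x : M}
  {oM : ManifoldOrientation M} {oE : FibreOrientation E} {Λ : ℝ}
  {e : Fin 3 → (y : M) → E y} {f V : Fin 4 → (y : M) → TangentSpace (𝓡 4) y}

/-- `f` is a smooth tangent frame near `x` in which the forms `Σ_i`, taken in the frame `e` of `E`,
are the standard self-dual forms. Such a frame is orthonormal for `g_A`. -/
structure IsAdaptedFrame (oM : ManifoldOrientation M) (oE : FibreOrientation E) (Λ : ℝ)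
    (A : CovariantDerivative (𝓡 4) R3 E)
    (e : Fin 3 → (y : M) → E y) (f : Fin 4 → (y : M) → TangentSpace (𝓡 4) y) (x : M) : Prop where
  frame : IsTangentFrame f x
  ortho : IsOrthoFrame e x
  sig : ∀ᶠ y in nhds x, ∀ i a b, SigOf oM Λ A (fun k => e k y) i (f a y) (f b y) = sdBasis i a b
  metric : ∀ᶠ y in nhds x, ∀ a b, gA oM oE Λ A y (f a y) (f b y) = if a = b then 1 else 0

theorem IsAdaptedFrame.eventually (h : IsAdaptedFrame oM oE Λ A e f x) :
    ∀ᶠ y in nhds x, IsAdaptedFrame oM oE Λ A e f y := by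
  filter_upwards [h.frame.eventually, h.ortho.eventually, h.sig.eventually_nhds,
    h.metric.eventually_nhds] with y h1 h2 h3 h4 using ⟨h1, h2, h3, h4⟩

theorem smooth_star2 {B : M → Matrix (Fin 4) (Fin 4) ℝ} (h : ∀ a b, FSmoothNear (fun y => B y a b) x)
    (a b : Fin 4) : FSmoothNear (fun y => star2 (B y) a b) x := by
  fin_cases a <;> fin_cases b <;> first | exact h _ _ | exact FSmoothNear.const 0

theorem smooth_matrix_mul {B C : M → Matrix (Fin 4) (Fin 4) ℝ}
    (hB : ∀ a b, FSmoothNear (fun y => B y a b) x) (hC : ∀ a b, FSmoothNear (fun y => C y a b) x)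
    (a b : Fin 4) : FSmoothNear (fun y => (B y * C y) a b) x := by
  simp only [Matrix.mul_apply]
  exact FSmoothNear.sum _ fun c _ => (hB a c).mul (hC c b)

theorem smooth_quatFrame {K : M → Fin 3 → Matrix (Fin 4) (Fin 4) ℝ} {ν : M → ℝ}
    (hK : ∀ i a b, FSmoothNear (fun y => K y i a b) x) (hν : FSmoothNear ν x) (h0 : ν x ≠ 0)
    (a b : Fin 4) : FSmoothNear (fun y => quatFrame (K y) (ν y) a b) x := by
  have h : ∀ i j, FSmoothNear (fun y => ((ν y)⁻¹ • (star2 (K y i) * K y j)) a 0) x := fun i j =>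
    (hν.inv h0).mul (smooth_matrix_mul (smooth_star2 (hK i)) (hK j) a 0)
  fin_cases b
  exacts [FSmoothNear.const _, h 1 2, h 2 0, h 0 1]

/-- At one point, the normalized quaternionic frame is adapted. -/
theorem adapted_at_point (hΛ : Λ ≠ 0) (hA : IsSO3Connection A) (hdef : IsDefinite oM oE A)
    (hsign : HasSignOf oM oE Λ A) {e : Fin 3 → E x} (he : Orthonormal ℝ e)
    (b : Module.Basis (Fin 4) ℝ (TangentSpace (𝓡 4) x))
    {K : Fin 3 → Matrix (Fin 4) (Fin 4) ℝ} (hK : K = fun i => comps b (SigOf oM Λ A e i)) {ν : ℝ}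
    (hν : ν = volForm oM oE Λ A x b) {P : Matrix (Fin 4) (Fin 4) ℝ}
    (hP : P = (Real.sqrt (ν⁻¹ * urbantke K 0 0))⁻¹ • quatFrame K ν) :
    LinearIndependent ℝ (changeFrame b P) ∧
      (∀ i a c, SigOf oM Λ A e i (changeFrame b P a) (changeFrame b P c) = sdBasis i a c) ∧
      ∀ a c, gA oM oE Λ A x (changeFrame b P a) (changeFrame b P c) = if a = c then 1 else 0 := by
  have htwo := fun i => isTwoForm_SigOf (oM := oM) (Λ := Λ) hA e i
  have hq : 0 < ν⁻¹ * urbantke K 0 0 := by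
    rw [hν, hK]
    exact urbantke_zero_pos hΛ hA hdef hsign he b
  have hKs : ∀ i, (K i)ᵀ = -K i := by
    intro i
    rw [hK]
    exact (htwo i).comps_skew _
  have hpf : ∀ i j, pf (K i) (K j) = if i = j then 2 * ν else 0 := by
    intro i j
    rw [hK, hν]
    exact wedge_SigOf hΛ hA (hdef.posDef x) he i j _
  obtain ⟨-, hdet, hspec⟩ := quatFrame_normalized hKs hpf
    (by rw [hν]; exact volForm_basis_ne_zero hΛ hA (hdef.posDef x) b)
  rw [abs_of_pos hq, ← hP] at hdet
  rw [abs_of_pos hq, ← hP, div_self hq.ne'] at hspec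
  obtain ⟨b', hb'⟩ := exists_basis_changeFrame b (left_ne_zero_of_mul_eq_one hdet)
  have hsd : ∀ i, comps b' (SigOf oM Λ A e i) = sdBasis i := by
    intro i
    rw [hb', (htwo i).comps_change]
    have := hspec i
    rw [hK, one_smul] at this
    exact this
  rw [← hb']
  refine ⟨b'.linearIndependent, fun i a c => ?_, fun a c => ?_⟩
  · rw [← hsd i]
    rfl
  · rw [gA_basis' hΛ hA hdef hsign he]
    simp only [hsd]
    have hv : volForm oM oE Λ A x b' = 1 := by
      rw [hb', volForm_changeFrame hA, ← hν]
      exact hdet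
    have hu : (fun i => sdBasis i) = sdBasis := rfl
    rw [hv, hu, urbantke_sdBasis, Matrix.one_apply]
    simp

theorem exists_adaptedFrame (hΛ : Λ ≠ 0) (hA : IsSO3Connection A) (hdef : IsDefinite oM oE A)
    (hsign : HasSignOf oM oE Λ A) (he : IsOrthoFrame e x) :
    ∃ f, IsAdaptedFrame oM oE Λ A e f x := by
  set V : Fin 4 → (y : M) → TangentSpace (𝓡 4) y :=
    fun k => coordField x (EuclideanSpace.single k 1) with hVdef
  have hV : IsTangentFrame V x := isTangentFrame_coordField (mem_chart_source R4 x)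
  let K : M → Fin 3 → Matrix (Fin 4) (Fin 4) ℝ :=
    fun y i => comps (fun a => V a y) (SigOf oM Λ A (fun k => e k y) i)
  let ν : M → ℝ := fun y => volForm oM oE Λ A y (fun a => V a y)
  let q : M → ℝ := fun y => (ν y)⁻¹ * urbantke (K y) 0 0
  have hKs : ∀ i a b, FSmoothNear (fun y => K y i a b) x := fun i a b =>
    smooth_SigOf hΛ hA hdef he (hV.smooth a) (hV.smooth b) i
  have hνs : FSmoothNear ν x := smooth_volForm hΛ hA hdef hV
  have hν0 : ∀ᶠ y in nhds x, ν y ≠ 0 := by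
    filter_upwards [hV.indep] with y hy
    obtain ⟨b, hb⟩ := exists_basis_of_linearIndependent hy
    simp only [ν, ← hb]
    exact volForm_basis_ne_zero hΛ hA (hdef.posDef y) b
  have hq0 : ∀ᶠ y in nhds x, 0 < q y := by
    filter_upwards [hV.indep, he.ortho] with y hy hey
    obtain ⟨b, hb⟩ := exists_basis_of_linearIndependent hy
    simp only [q, ν, K, ← hb]
    exact urbantke_zero_pos hΛ hA hdef hsign hey b
  have hqs : FSmoothNear q x := (hνs.inv hν0.self_of_nhds).mul
    (smooth_matrix_mul (smooth_matrix_mul (hKs 0) (smooth_star2 (hKs 1))) (hKs 2) 0 0)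
  let P : M → Matrix (Fin 4) (Fin 4) ℝ := fun y => (Real.sqrt (q y))⁻¹ • quatFrame (K y) (ν y)
  have hPs : ∀ a b, FSmoothNear (fun y => P y a b) x := fun a b =>
    ((hqs.sqrt hq0.self_of_nhds).inv (Real.sqrt_pos.mpr hq0.self_of_nhds).ne').mul
      (smooth_quatFrame hKs hνs hν0.self_of_nhds a b)
  let f : Fin 4 → (y : M) → TangentSpace (𝓡 4) y := fun a y => changeFrame (fun c => V c y) (P y) a
  have key : ∀ᶠ y in nhds x, LinearIndependent ℝ (fun a => f a y) ∧
      (∀ i a b, SigOf oM Λ A (fun k => e k y) i (f a y) (f b y) = sdBasis i a b) ∧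
      ∀ a b, gA oM oE Λ A y (f a y) (f b y) = if a = b then 1 else 0 := by
    filter_upwards [hV.indep, he.ortho] with y hy hey
    obtain ⟨b, hb⟩ := exists_basis_of_linearIndependent hy
    have h := adapted_at_point (P := P y) hΛ hA hdef hsign hey b rfl rfl (by rw [hb])
    rw [hb] at h
    exact h
  refine ⟨f, ⟨fun a => ?_, key.mono fun y h => h.1⟩, he, key.mono fun y h => h.2.1,
    key.mono fun y h => h.2.2⟩
  exact SmoothNear.sum _ fun c _ => SmoothNear.smul (hPs c a) (hV.smooth c)

/-- The coordinate expression of a smooth function is smooth. -/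
theorem FSmoothNear.contDiffAt_symm {h : M → ℝ} {i : M} {y : R4}
    (hy : y ∈ (extChartAt (𝓡 4) i).target) (hh : FSmoothNear h ((extChartAt (𝓡 4) i).symm y)) :
    ContDiffAt ℝ ∞ (fun z => h ((extChartAt (𝓡 4) i).symm z)) y := by
  have h1 : ContMDiffAt 𝓘(ℝ, R4) (𝓡 4) ∞ (extChartAt (𝓡 4) i).symm y :=
    (contMDiffOn_extChartAt_symm (n := ∞) i).contMDiffAt (extChartAt_target_mem_nhds' (by simpa using hy))
  exact (ContMDiffAt.comp y hh.self_of_nhds h1).contDiffAt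

end Adapted

/-! ### Differentiation under the integral sign -/

section Parametric

open MeasureTheory Set

variable {K : Set R4} {T : Set ℝ} {Φ Φ' : ℝ → R4 → ℝ}

/-- A function which is continuous on the compact set `K` and zero off `K` is integrable; it need not
be continuous across the boundary of `K`. -/
theorem integrable_of_zero_off (hK : IsCompact K) {h : R4 → ℝ} (h0 : ∀ y ∉ K, h y = 0)
    (hc : ContinuousOn h K) : Integrable h := by
  have : K.indicator h = h := by
    funext y
    by_cases hy : y ∈ K
    · simp [hy]
    · simp [hy, h0 y hy]
  rw [← this]
  exact (integrable_indicator_iff hK.measurableSet).mpr (hc.integrableOn_compact hK)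

theorem hasDerivAt_integral_of_zero_off (hK : IsCompact K) (hT : IsOpen T)
    (h0 : ∀ t, ∀ y ∉ K, Φ t y = 0) (h0' : ∀ t, ∀ y ∉ K, Φ' t y = 0)
    (hc : ContinuousOn (Function.uncurry Φ) (T ×ˢ K))
    (hc' : ContinuousOn (Function.uncurry Φ') (T ×ˢ K))
    (hd : ∀ t ∈ T, ∀ y ∈ K, HasDerivAt (fun t => Φ t y) (Φ' t y) t) {t : ℝ} (ht : t ∈ T) :
    HasDerivAt (fun t => ∫ y, Φ t y) (∫ y, Φ' t y) t := by
  obtain ⟨ε, hε, hball⟩ := Metric.nhds_basis_closedBall.mem_iff.mp (hT.mem_nhds ht)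
  have hslice : ∀ {Ψ : ℝ → R4 → ℝ}, ContinuousOn (Function.uncurry Ψ) (T ×ˢ K) → ∀ s ∈ T,
      ContinuousOn (Ψ s) K := fun h s hs =>
    h.comp (Continuous.prodMk_right s).continuousOn fun y hy => ⟨hs, hy⟩
  obtain ⟨C, hC⟩ := ((isCompact_closedBall t ε).prod hK).exists_bound_of_continuousOn
    (hc'.mono (prod_mono hball subset_rfl))
  have hbd : ∀ s ∈ Metric.ball t ε, ∀ y, ‖Φ' s y‖ ≤ K.indicator (fun _ => C) y := by
    intro s hs y
    by_cases hy : y ∈ K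
    · rw [indicator_of_mem hy]
      exact hC (s, y) ⟨Metric.ball_subset_closedBall hs, hy⟩
    · rw [indicator_of_notMem hy, h0' s y hy, norm_zero]
  refine (hasDerivAt_integral_of_dominated_loc_of_deriv_le (F := Φ) (F' := Φ')
    (bound := K.indicator fun _ => C) (Metric.ball_mem_nhds t hε) ?_ ?_ ?_ ?_ ?_ ?_).2
  · filter_upwards [Metric.ball_mem_nhds t hε] with s hs
    exact (integrable_of_zero_off hK (h0 s)
      (hslice hc s (hball (Metric.ball_subset_closedBall hs)))).aestronglyMeasurable
  · exact integrable_of_zero_off hK (h0 t) (hslice hc t ht)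
  · exact (integrable_of_zero_off hK (h0' t) (hslice hc' t ht)).aestronglyMeasurable
  · exact Filter.Eventually.of_forall fun y s hs => hbd s hs y
  · exact (integrable_indicator_iff hK.measurableSet).mpr
      (continuousOn_const.integrableOn_compact hK)
  · refine Filter.Eventually.of_forall fun y s hs => ?_
    by_cases hy : y ∈ K
    · exact hd s (hball (Metric.ball_subset_closedBall hs)) y hy
    · have : (fun t => Φ t y) = fun _ => 0 := funext fun t => h0 t y hy
      rw [this, h0' s y hy]
      exact hasDerivAt_const s 0

theorem continuousOn_integral_of_zero_off (hK : IsCompact K) (hT : IsOpen T)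
    (h0 : ∀ t, ∀ y ∉ K, Φ t y = 0) (hc : ContinuousOn (Function.uncurry Φ) (T ×ˢ K)) :
    ContinuousOn (fun t => ∫ y, Φ t y) T := by
  refine continuousOn_of_forall_continuousAt fun t ht => ?_
  obtain ⟨ε, hε, hball⟩ := Metric.nhds_basis_closedBall.mem_iff.mp (hT.mem_nhds ht)
  have hslice : ∀ s ∈ T, ContinuousOn (Φ s) K := fun s hs =>
    hc.comp (Continuous.prodMk_right s).continuousOn fun y hy => ⟨hs, hy⟩
  obtain ⟨C, hC⟩ := ((isCompact_closedBall t ε).prod hK).exists_bound_of_continuousOn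
    (hc.mono (prod_mono hball subset_rfl))
  refine continuousAt_of_dominated (bound := K.indicator fun _ => C) ?_ ?_ ?_ ?_
  · filter_upwards [Metric.ball_mem_nhds t hε] with s hs
    exact (integrable_of_zero_off hK (h0 s)
      (hslice s (hball (Metric.ball_subset_closedBall hs)))).aestronglyMeasurable
  · filter_upwards [Metric.ball_mem_nhds t hε] with s hs
    refine Filter.Eventually.of_forall fun y => ?_
    by_cases hy : y ∈ K
    · rw [indicator_of_mem hy]
      exact hC (s, y) ⟨Metric.ball_subset_closedBall hs, hy⟩
    · rw [indicator_of_notMem hy, h0 s y hy, norm_zero]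
  · exact (integrable_indicator_iff hK.measurableSet).mpr
      (continuousOn_const.integrableOn_compact hK)
  · refine Filter.Eventually.of_forall fun y => ?_
    by_cases hy : y ∈ K
    · have h1 : ContinuousOn (fun s => Φ s y) T :=
        hc.comp (Continuous.prodMk_left y).continuousOn fun s hs => ⟨hs, hy⟩
      exact h1.continuousAt (hT.mem_nhds ht)
    · have : (fun t => Φ t y) = fun _ => 0 := funext fun t => h0 t y hy
      rw [this]
      exact continuousAt_const

/-- The partial derivative of a `C^{n+1}` function in the first variable is `C^n`. -/
theorem contDiffAt_deriv_left {n : ℕ} {p : ℝ × R4}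
    (h : ContDiffAt ℝ (n + 1 : ℕ) (Function.uncurry Φ) p) :
    ContDiffAt ℝ n (Function.uncurry fun t y => deriv (fun s => Φ s y) t) p := by
  have h1 : ContDiffAt ℝ n (fun q => fderiv ℝ (Function.uncurry Φ) q (1, 0)) p :=
    (h.fderiv_right (m := n) (by norm_cast)).clm_apply contDiffAt_const
  refine h1.congr_of_eventuallyEq ?_
  filter_upwards [h.eventually (by simp)] with q hq
  have hq' : HasFDerivAt (Function.uncurry Φ) (fderiv ℝ (Function.uncurry Φ) q) (q.1, q.2) :=
    (hq.differentiableAt (by norm_cast)).hasFDerivAt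
  have h2 : HasDerivAt (fun s : ℝ => ((s, q.2) : ℝ × R4)) (1, 0) q.1 :=
    (hasDerivAt_id q.1).prodMk (hasDerivAt_const q.1 q.2)
  exact (hq'.comp_hasDerivAt q.1 h2).deriv

/-- Two derivatives of an integral with compact support, in a parameter. -/
theorem integral_contDiffAt_two (hK : IsCompact K) (h0 : ∀ t, ∀ y ∉ K, Φ t y = 0)
    (hΦ : ∀ y ∈ K, ContDiffAt ℝ 2 (Function.uncurry Φ) (0, y)) :
    ContDiffAt ℝ 2 (fun t => ∫ y, Φ t y) 0 ∧
    HasDerivAt (fun t => ∫ y, Φ t y) (∫ y, deriv (fun t => Φ t y) 0) 0 ∧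
    iteratedDeriv 2 (fun t => ∫ y, Φ t y) 0 = ∫ y, iteratedDeriv 2 (fun t => Φ t y) 0 := by
  set W := {p : ℝ × R4 | ContDiffAt ℝ 2 (Function.uncurry Φ) p} with hW
  have hWo : IsOpen W := isOpen_iff_eventually.mpr fun p hp => 
    ContDiffAt.eventually (show ContDiffAt ℝ 2 (Function.uncurry Φ) p from hp) (by simp)
  obtain ⟨T, V, hT, -, h0T, hKV, hTV⟩ := generalized_tube_lemma (s := {(0 : ℝ)}) (t := K)
    isCompact_singleton hK hWo (by rintro ⟨t, y⟩ ⟨ht, hy⟩; obtain rfl : t = 0 := ht; exact hΦ y hy)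
  have h0T : (0 : ℝ) ∈ T := h0T rfl
  have hTK : T ×ˢ K ⊆ W := (prod_mono subset_rfl hKV).trans hTV
  set Φ1 : ℝ → R4 → ℝ := fun t y => deriv (fun s => Φ s y) t with hΦ1
  set Φ2 : ℝ → R4 → ℝ := fun t y => deriv (fun s => Φ1 s y) t with hΦ2
  have hc0 : ∀ p ∈ W, ContDiffAt ℝ (1 + 1 : ℕ) (Function.uncurry Φ) p := fun p hp => hp
  have hc1 : ∀ p ∈ W, ContDiffAt ℝ (0 + 1 : ℕ) (Function.uncurry Φ1) p :=
    fun p hp => contDiffAt_deriv_left (n := 1) (hc0 p hp)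
  have hc2 : ∀ p ∈ W, ContDiffAt ℝ (0 : ℕ) (Function.uncurry Φ2) p :=
    fun p hp => contDiffAt_deriv_left (hc1 p hp)
  have hz1 : ∀ t, ∀ y ∉ K, Φ1 t y = 0 := by
    intro t y hy
    have : (fun t => Φ t y) = fun _ => 0 := funext fun t => h0 t y hy
    simp [hΦ1, this]
  have hz2 : ∀ t, ∀ y ∉ K, Φ2 t y = 0 := by
    intro t y hy
    have : (fun t => Φ1 t y) = fun _ => 0 := funext fun t => hz1 t y hy
    simp [hΦ2, this]
  have cont : ∀ {Ψ : ℝ → R4 → ℝ} {n : ℕ}, (∀ p ∈ W, ContDiffAt ℝ n (Function.uncurry Ψ) p) →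
      ContinuousOn (Function.uncurry Ψ) (T ×ˢ K) := fun h p hp =>
    (h p (hTK hp)).continuousAt.continuousWithinAt
  have diff : ∀ {Ψ : ℝ → R4 → ℝ} {n : ℕ}, (∀ p ∈ W, ContDiffAt ℝ (n + 1 : ℕ) (Function.uncurry Ψ) p) →
      ∀ t ∈ T, ∀ y ∈ K, HasDerivAt (fun t => Ψ t y) (deriv (fun t => Ψ t y) t) t := by
    intro Ψ n h t ht y hy
    have h1 : DifferentiableAt ℝ (Function.uncurry Ψ) ((fun s => (s, y)) t) :=
      (h (t, y) (hTK ⟨ht, hy⟩)).differentiableAt (by norm_cast)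
    have h2 : DifferentiableAt ℝ (fun s : ℝ => ((s, y) : ℝ × R4)) t :=
      differentiableAt_id.prodMk (differentiableAt_const y)
    exact (h1.comp t h2).hasDerivAt
  have d1 : ∀ t ∈ T, HasDerivAt (fun t => ∫ y, Φ t y) (∫ y, Φ1 t y) t := fun t ht =>
    hasDerivAt_integral_of_zero_off hK hT h0 hz1 (cont hc0) (cont hc1) (diff hc0) ht
  have d2 : ∀ t ∈ T, HasDerivAt (fun t => ∫ y, Φ1 t y) (∫ y, Φ2 t y) t := fun t ht =>
    hasDerivAt_integral_of_zero_off hK hT hz1 hz2 (cont hc1) (cont hc2) (diff hc1) ht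
  have c2 : ContinuousOn (fun t => ∫ y, Φ2 t y) T :=
    continuousOn_integral_of_zero_off hK hT hz2 (cont hc2)
  have e1 : ∀ t ∈ T, deriv (fun t => ∫ y, Φ t y) t = ∫ y, Φ1 t y := fun t ht => (d1 t ht).deriv
  refine ⟨?_, d1 0 h0T, ?_⟩
  · have s1 : ContDiffOn ℝ 1 (fun t => ∫ y, Φ1 t y) T := by
      refine (contDiffOn_succ_iff_deriv_of_isOpen (n := 0) hT).mpr
        ⟨fun t ht => (d2 t ht).differentiableAt.differentiableWithinAt, by simp, ?_⟩
      exact contDiffOn_zero.mpr (c2.congr fun t ht => (d2 t ht).deriv)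
    have s2 : ContDiffOn ℝ (1 + 1) (fun t => ∫ y, Φ t y) T :=
      (contDiffOn_succ_iff_deriv_of_isOpen (n := 1) hT).mpr
        ⟨fun t ht => (d1 t ht).differentiableAt.differentiableWithinAt, by simp, s1.congr e1⟩
    rw [one_add_one_eq_two] at s2
    exact s2.contDiffAt (hT.mem_nhds h0T)
  · rw [iteratedDeriv_succ, iteratedDeriv_one]
    have : deriv (fun t => ∫ y, Φ t y) =ᶠ[nhds 0] fun t => ∫ y, Φ1 t y := by
      filter_upwards [hT.mem_nhds h0T] with t ht using e1 t ht
    rw [this.deriv_eq, (d2 0 h0T).deriv]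
    refine integral_congr_ae (Filter.Eventually.of_forall fun y => ?_)
    simp only [hΦ2, hΦ1]
    rw [iteratedDeriv_succ, iteratedDeriv_one]

end Parametric

/-! ### Integrals of 4-forms -/

section IntegralForm

open MeasureTheory Set

variable {M : Type*} [TopologicalSpace M] [ChartedSpace R4 M] [IsManifold (𝓡 4) ∞ M] [T2Space M]
  {oM : ManifoldOrientation M}

/-- The density of the 4-form `η` in the chart at `i`, with the sign of the chart. -/
def density (oM : ManifoldOrientation M) (η : ∀ x : M, (Fin 4 → TangentSpace (𝓡 4) x) → ℝ) (i : M)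
    (y : R4) : ℝ :=
  orientationSign oM _ (coordFrame i y) * η _ (coordFrame i y)

variable [CompactSpace M]

theorem chartPartition_subordinate (i : M) :
    tsupport (chartPartition M i) ⊆ (chartAt R4 i).source :=
  Classical.choose_spec (SmoothPartitionOfUnity.exists_isSubordinate_chartAt_source (𝓡 4) M) i

/-- The support of the `i`-th function of the partition of unity, in the chart at `i`. -/
def chartSupport (i : M) : Set R4 := extChartAt (𝓡 4) i '' tsupport (chartPartition M i)

theorem isCompact_chartSupport (i : M) : IsCompact (chartSupport i) :=
  (isClosed_tsupport _).isCompact.image_of_continuousOn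
    ((continuousOn_extChartAt i).mono (by simpa using chartPartition_subordinate i))

theorem chartSupport_subset (i : M) : chartSupport i ⊆ (extChartAt (𝓡 4) i).target := by
  rintro _ ⟨x, hx, rfl⟩
  exact (extChartAt (𝓡 4) i).map_source (by simpa using chartPartition_subordinate i hx)

theorem chartPartition_symm_eq_zero {i : M} {y : R4} (hy : y ∈ (extChartAt (𝓡 4) i).target)
    (hs : y ∉ chartSupport i) : chartPartition M i ((extChartAt (𝓡 4) i).symm y) = 0 := by
  by_contra h
  exact hs ⟨_, subset_tsupport _ h, (extChartAt (𝓡 4) i).right_inv hy⟩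

/-- The weighted density of `η` in the chart at `i`, extended by zero. -/
def weightedDensity (oM : ManifoldOrientation M)
    (η : ∀ x : M, (Fin 4 → TangentSpace (𝓡 4) x) → ℝ) (i : M) : R4 → ℝ :=
  (extChartAt (𝓡 4) i).target.indicator fun y =>
    chartPartition M i ((extChartAt (𝓡 4) i).symm y) * density oM η i y

theorem weightedDensity_eq_zero (η : ∀ x : M, (Fin 4 → TangentSpace (𝓡 4) x) → ℝ) (i : M) {y : R4}
    (hy : y ∉ chartSupport i) : weightedDensity oM η i y = 0 := by
  by_cases h : y ∈ (extChartAt (𝓡 4) i).target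
  · rw [weightedDensity, indicator_of_mem h, chartPartition_symm_eq_zero h hy, zero_mul]
  · rw [weightedDensity, indicator_of_notMem h]

theorem finite_chartPartition :
    {i : M | (Function.support (chartPartition M i)).Nonempty}.Finite :=
  (chartPartition M).locallyFinite.finite_nonempty_of_compact

variable (M) in
/-- The charts which contribute to integrals over `M`. -/
def activeCharts : Finset M := (finite_chartPartition (M := M)).toFinset

theorem integralForm_eq_sum (η : ∀ x : M, (Fin 4 → TangentSpace (𝓡 4) x) → ℝ) :
    integralForm oM η = ∑ i ∈ activeCharts M, ∫ y, weightedDensity oM η i y := by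
  have h : ∀ i, (∫ y in (extChartAt (𝓡 4) i).target,
      chartPartition M i ((extChartAt (𝓡 4) i).symm y)
        * orientationSign oM _ (coordFrame i y) * η _ (coordFrame i y))
      = ∫ y, weightedDensity oM η i y := by
    intro i
    rw [weightedDensity, integral_indicator (isOpen_extChartAt_target i).measurableSet]
    simp only [density, mul_assoc]
  simp only [integralForm, h]
  refine finsum_eq_sum_of_support_subset _ fun i hi => ?_
  simp only [activeCharts, Finite.coe_toFinset, mem_ofPred_eq]
  by_contra hne
  rw [not_nonempty_iff_eq_empty, Function.support_eq_empty_iff] at hne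
  refine hi ?_
  have : weightedDensity oM η i = fun _ => 0 := by
    funext y
    by_cases hy : y ∈ (extChartAt (𝓡 4) i).target
    · rw [weightedDensity, indicator_of_mem hy, hne, Pi.zero_apply, zero_mul]
    · rw [weightedDensity, indicator_of_notMem hy]
  simp [this]

theorem contDiffAt_chartPartition (i : M) {y : R4} (hy : y ∈ (extChartAt (𝓡 4) i).target) :
    ContDiffAt ℝ ∞ (fun z => chartPartition M i ((extChartAt (𝓡 4) i).symm z)) y :=
  FSmoothNear.contDiffAt_symm hy
    (Filter.Eventually.of_forall fun _ => (chartPartition M i).contMDiff.contMDiffAt)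

/-- The integral of a family of 4-forms with `C²` coordinate densities may be differentiated twice
under the integral sign. -/
theorem integralForm_contDiffAt_two {η : ℝ → ∀ x : M, (Fin 4 → TangentSpace (𝓡 4) x) → ℝ}
    (h : ∀ i : M, ∀ y ∈ (extChartAt (𝓡 4) i).target,
      ContDiffAt ℝ 2 (fun p : ℝ × R4 => density oM (η p.1) i p.2) (0, y)) :
    ContDiffAt ℝ 2 (fun t => integralForm oM (η t)) 0 ∧
    HasDerivAt (fun t => integralForm oM (η t))
      (integralForm oM fun x v => deriv (fun t => η t x v) 0) 0 ∧
    iteratedDeriv 2 (fun t => integralForm oM (η t)) 0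
      = integralForm oM fun x v => iteratedDeriv 2 (fun t => η t x v) 0 := by
  have key := fun i : M => integral_contDiffAt_two (Φ := fun t => weightedDensity oM (η t) i)
    (isCompact_chartSupport i) (fun t y hy => weightedDensity_eq_zero _ i hy) (by
      intro y hy
      have hyt := chartSupport_subset i hy
      have h1 : ContDiffAt ℝ 2 (fun p : ℝ × R4 =>
          chartPartition M i ((extChartAt (𝓡 4) i).symm p.2) * density oM (η p.1) i p.2) (0, y) :=
        (ContDiffAt.comp (g := fun z => chartPartition M i ((extChartAt (𝓡 4) i).symm z))
          ((0, y) : ℝ × R4) ((contDiffAt_chartPartition i hyt).of_le (WithTop.coe_le_coe.mpr (le_top : (2 : ℕ∞) ≤ ⊤)))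
          contDiffAt_snd).mul (h i y hyt)
      refine h1.congr_of_eventuallyEq ?_
      filter_upwards [continuousAt_snd.preimage_mem_nhds
        ((isOpen_extChartAt_target i).mem_nhds hyt)] with p hp
      rw [Function.uncurry, weightedDensity,
        indicator_of_mem (s := (extChartAt (𝓡 4) i).target) hp])
  have hd1 : ∀ (i : M) y, deriv (fun t => weightedDensity oM (η t) i y) 0
      = weightedDensity oM (fun x v => deriv (fun t => η t x v) 0) i y := by
    intro i y
    by_cases hy : y ∈ (extChartAt (𝓡 4) i).target
    · simp only [weightedDensity, indicator_of_mem hy, density]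
      rw [deriv_const_mul_field, deriv_const_mul_field]
    · simp only [weightedDensity, indicator_of_notMem hy, deriv_const]
  have hd2 : ∀ (i : M) y, iteratedDeriv 2 (fun t => weightedDensity oM (η t) i y) 0
      = weightedDensity oM (fun x v => iteratedDeriv 2 (fun t => η t x v) 0) i y := by
    intro i y
    by_cases hy : y ∈ (extChartAt (𝓡 4) i).target
    · simp only [weightedDensity, indicator_of_mem hy, density]
      rw [iteratedDeriv_const_mul_field, iteratedDeriv_const_mul_field]
    · simp only [weightedDensity, indicator_of_notMem hy, iteratedDeriv_const]
      rfl
  simp only [integralForm_eq_sum, ← hd1, ← hd2]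
  refine ⟨ContDiffAt.sum fun i _ => (key i).1, HasDerivAt.fun_sum fun i _ => (key i).2.1, ?_⟩
  rw [iteratedDeriv_fun_sum fun i _ => (key i).1]
  exact Finset.sum_congr rfl fun i _ => (key i).2.2

theorem integralForm_congr {η η' : ∀ x : M, (Fin 4 → TangentSpace (𝓡 4) x) → ℝ}
    (h : ∀ (i : M), ∀ y ∈ (extChartAt (𝓡 4) i).target, η _ (coordFrame i y) = η' _ (coordFrame i y)) :
    integralForm oM η = integralForm oM η' := by
  rw [integralForm_eq_sum, integralForm_eq_sum]
  refine Finset.sum_congr rfl fun i _ => ?_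
  congr 1
  refine indicator_congr fun y hy => ?_
  rw [density, density, h i y hy]

theorem weightedDensity_nonneg {η : ∀ x : M, (Fin 4 → TangentSpace (𝓡 4) x) → ℝ}
    (h0 : ∀ (i : M), ∀ y ∈ (extChartAt (𝓡 4) i).target, 0 ≤ density oM η i y) (i : M) (y : R4) :
    0 ≤ weightedDensity oM η i y :=
  indicator_nonneg (fun y hy => mul_nonneg ((chartPartition M).nonneg i _) (h0 i y hy)) y

theorem integralForm_nonneg {η : ∀ x : M, (Fin 4 → TangentSpace (𝓡 4) x) → ℝ}
    (h0 : ∀ (i : M), ∀ y ∈ (extChartAt (𝓡 4) i).target, 0 ≤ density oM η i y) :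
    0 ≤ integralForm oM η := by
  rw [integralForm_eq_sum]
  exact Finset.sum_nonneg fun i _ => integral_nonneg (weightedDensity_nonneg h0 i)

/-- A continuous nonnegative 4-form with integral zero vanishes. -/
theorem density_eq_zero_of_integralForm_eq_zero {η : ∀ x : M, (Fin 4 → TangentSpace (𝓡 4) x) → ℝ}
    (hc : ∀ (i : M), ContinuousOn (density oM η i) (extChartAt (𝓡 4) i).target)
    (h0 : ∀ (i : M), ∀ y ∈ (extChartAt (𝓡 4) i).target, 0 ≤ density oM η i y)
    (hI : integralForm oM η = 0) (x : M) :
    ∃ i : M, ∃ y ∈ (extChartAt (𝓡 4) i).target, (extChartAt (𝓡 4) i).symm y = x ∧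
      density oM η i y = 0 := by
  obtain ⟨i, hi⟩ : ∃ i, chartPartition M i x ≠ 0 := by
    by_contra h
    push Not at h
    have h1 := (chartPartition M).sum_eq_one (mem_univ x)
    simp [h] at h1
  have hxs : x ∈ (extChartAt (𝓡 4) i).source := by
    simpa using chartPartition_subordinate i (subset_tsupport _ hi)
  refine ⟨i, extChartAt (𝓡 4) i x, (extChartAt (𝓡 4) i).map_source hxs,
    (extChartAt (𝓡 4) i).left_inv hxs, ?_⟩
  have hiA : i ∈ activeCharts M := by
    simp only [activeCharts, Finite.mem_toFinset, mem_ofPred_eq]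
    exact ⟨x, hi⟩
  rw [integralForm_eq_sum, Finset.sum_eq_zero_iff_of_nonneg
    fun i _ => integral_nonneg (weightedDensity_nonneg h0 i)] at hI
  have hcw : ContinuousOn (weightedDensity oM η i) (extChartAt (𝓡 4) i).target := by
    have : ContinuousOn (fun y => chartPartition M i ((extChartAt (𝓡 4) i).symm y)
        * density oM η i y) (extChartAt (𝓡 4) i).target :=
      ContinuousOn.mul (fun y hy => (contDiffAt_chartPartition i hy).continuousAt.continuousWithinAt)
        (hc i)
    exact this.congr fun y hy => indicator_of_mem hy _
  have hint : Integrable (weightedDensity oM η i) :=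
    integrable_of_zero_off (isCompact_chartSupport i) (fun y hy => weightedDensity_eq_zero η i hy)
      (hcw.mono (chartSupport_subset i))
  have hae := (integral_eq_zero_iff_of_nonneg (weightedDensity_nonneg h0 i) hint).mp (hI i hiA)
  have heq : EqOn (weightedDensity oM η i) 0 (extChartAt (𝓡 4) i).target :=
    Measure.eqOn_open_of_ae_eq (ae_restrict_of_ae hae) (isOpen_extChartAt_target i) hcw
      continuousOn_const
  have h1 := heq ((extChartAt (𝓡 4) i).map_source hxs)
  rw [weightedDensity, indicator_of_mem ((extChartAt (𝓡 4) i).map_source hxs),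
    (extChartAt (𝓡 4) i).left_inv hxs] at h1
  exact (mul_eq_zero.mp h1).resolve_left hi

end IntegralForm

/-! ### Variation of the Lagrangian -/

section Variation

open Matrix

variable {M : Type*} [TopologicalSpace M] [ChartedSpace R4 M] [IsManifold (𝓡 4) ∞ M] [T2Space M]
  {E : M → Type*} [∀ x, NormedAddCommGroup (E x)] [∀ x, InnerProductSpace ℝ (E x)]
  [TopologicalSpace (TotalSpace R3 E)] [FiberBundle R3 E] [VectorBundle ℝ R3 E]
  [ContMDiffVectorBundle ∞ R3 E (𝓡 4)] [IsContMDiffRiemannianBundle (𝓡 4) ∞ R3 E]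
  {A : CovariantDerivative (𝓡 4) R3 E}
  {a : (x : M) → E x →L[ℝ] TangentSpace (𝓡 4) x →L[ℝ] E x} {x : M}
  {oM : ManifoldOrientation M} {oE : FibreOrientation E} {Λ : ℝ}

/-- The 1-forms `a^i` in the orthonormal frame `e` of the fibre at `x`. -/
def aFormOf (a : (x : M) → E x →L[ℝ] TangentSpace (𝓡 4) x →L[ℝ] E x) (e : Fin 3 → E x) (i : Fin 3)
    (u : TangentSpace (𝓡 4) x) : ℝ :=
  soCompOf e (fun s => a x s u) i

/-- The components of `[a(u), a(v)]`, the quadratic part of the curvature of `A + a`. -/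
def brFormOf (a : (x : M) → E x →L[ℝ] TangentSpace (𝓡 4) x →L[ℝ] E x) (e : Fin 3 → E x) (i : Fin 3)
    (u v : TangentSpace (𝓡 4) x) : ℝ :=
  soCompOf e (fun s => a x (a x s v) u - a x (a x s u) v) i

theorem curvFormOf_shift (hA : IsSO3Connection A) (ha : IsSoForm a) (t : ℝ) (e : Fin 3 → E x)
    (i : Fin 3) (u v : TangentSpace (𝓡 4) x) :
    curvFormOf (shift A a t) e i u v
      = curvFormOf A e i u v + t * dAFormOf A a e i u v + t ^ 2 * brFormOf a e i u v := by
  simp only [curvFormOf, dAFormOf, brFormOf, soCompOf, curvature_shift hA ha, inner_add_left,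
    inner_smul_left, conj_trivial]

theorem brFormOf_eq (ha : IsSoForm a) {e : Fin 3 → E x} (he : Orthonormal ℝ e) (i : Fin 3)
    (u v : TangentSpace (𝓡 4) x) :
    brFormOf a e i u v = aFormOf a e (i + 2) u * aFormOf a e (i + 1) v
      - aFormOf a e (i + 1) u * aFormOf a e (i + 2) v := by
  have key : ∀ (u v : TangentSpace (𝓡 4) x) (p q : Fin 3), inner ℝ (a x (a x (e p) v) u) (e q)
      = -∑ k, (inner ℝ (a x (e p) v) (e k) : ℝ) * inner ℝ (a x (e q) u) (e k) := by
    intro u v p q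
    rw [ha.skew]
    congr 1
    conv_lhs => rw [sum_inner_smul he (finrank_fibre x) (a x (e q) u)]
    rw [inner_sum]
    refine Finset.sum_congr rfl fun k _ => ?_
    rw [inner_smul_right, mul_comm, real_inner_comm (e k) (a x (e p) v),
      real_inner_comm (e k) (a x (e q) u)]
  have hd : ∀ (u : TangentSpace (𝓡 4) x) (p : Fin 3), inner ℝ (a x (e p) u) (e p) = (0 : ℝ) := by
    intro u p
    have h := ha.skew x u (e p) (e p)
    rw [real_inner_comm (a x (e p) u) (e p)] at h
    linarith
  have hs : ∀ (u : TangentSpace (𝓡 4) x) (p q : Fin 3),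
      inner ℝ (a x (e p) u) (e q) = -(inner ℝ (a x (e q) u) (e p) : ℝ) := by
    intro u p q
    rw [ha.skew, real_inner_comm]
  simp only [brFormOf, aFormOf, soCompOf, inner_sub_left, key, Fin.sum_univ_three]
  have h10 := fun w => hs w 1 0
  have h20 := fun w => hs w 2 0
  have h21 := fun w => hs w 2 1
  have e1 : (0 : Fin 3) + 2 = 2 := rfl
  have e2 : (0 : Fin 3) + 1 = 1 := rfl
  have e3 : (1 : Fin 3) + 2 = 0 := rfl
  have e4 : (1 : Fin 3) + 1 = 2 := rfl
  have e5 : (2 : Fin 3) + 2 = 1 := rfl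
  have e6 : (2 : Fin 3) + 1 = 0 := rfl
  fin_cases i <;>
    simp only [Fin.zero_eta, Fin.mk_one, Fin.reduceFinMk, e1, e2, e3, e4, e5, e6, hd, h10, h20, h21] <;>
    ring

theorem isTwoForm_brFormOf (ha : IsSoForm a) {e : Fin 3 → E x} (he : Orthonormal ℝ e) (i : Fin 3) :
    IsTwoForm (brFormOf a e i) := by
  have hadd : ∀ i (u v : TangentSpace (𝓡 4) x), aFormOf a e i (u + v) = aFormOf a e i u + aFormOf a e i v := by
    intro i u v
    simp only [aFormOf, soCompOf]
    rw [(a x _).map_add, inner_add_left]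
  have hsm : ∀ i (c : ℝ) (u : TangentSpace (𝓡 4) x), aFormOf a e i (c • u) = c * aFormOf a e i u := by
    intro i c u
    simp only [aFormOf, soCompOf]
    rw [(a x _).map_smul, inner_smul_left, conj_trivial]
  refine ⟨fun u v => ?_, fun u u' v => ?_, fun c u v => ?_⟩ <;>
    simp only [brFormOf_eq ha he, hadd, hsm] <;> ring

/-- The coefficients of `F^i ∧ F^j` for the connection `A + t a`, as polynomials in `t`. -/
theorem GOf_shift (hA : IsSO3Connection A) (ha : IsSoForm a) (t : ℝ) (e : Fin 3 → E x)
    (v : Fin 4 → TangentSpace (𝓡 4) x) (i j : Fin 3) :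
    GOf (shift A a t) e v i j
      = wedge22 (curvFormOf A e i) (curvFormOf A e j) v
        + t * (wedge22 (dAFormOf A a e i) (curvFormOf A e j) v
          + wedge22 (curvFormOf A e i) (dAFormOf A a e j) v)
        + t ^ 2 * (wedge22 (curvFormOf A e i) (brFormOf a e j) v
          + wedge22 (dAFormOf A a e i) (dAFormOf A a e j) v
          + wedge22 (brFormOf a e i) (curvFormOf A e j) v)
        + t ^ 3 * (wedge22 (dAFormOf A a e i) (brFormOf a e j) v
          + wedge22 (brFormOf a e i) (dAFormOf A a e j) v)
        + t ^ 4 * wedge22 (brFormOf a e i) (brFormOf a e j) v := by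
  simp only [GOf, Matrix.of_apply, wedge22, curvFormOf_shift hA ha]
  ring

/-- The Plebanski integrand is the Lagrangian evaluated on the matrix `F^i ∧ F^j`, in any frame. -/
theorem plebanskiForm_eq (hΛ : Λ ≠ 0) (hA : IsSO3Connection A) {e : Fin 3 → E x}
    (he : Orthonormal ℝ e) {v : Fin 4 → TangentSpace (𝓡 4) x} {κ : ℝ} 
    (hd : 0 < κ * (refBasis oM x).det v) (hG : (κ • GOf A e v).PosDef) :
    κ * plebanskiForm Λ (curvForm oE A x) (Sig oM oE Λ A x) (Psi oM oE Λ A x) v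
      = rootLagrangian Λ (κ • GOf A e v) := by
  set d := (refBasis oM x).det v with hdd
  have hGv : κ • GOf A e v = (κ * d) • GOf A e (refBasis oM x) := by
    rw [GOf_basis oM hA e v, smul_smul]
  have hpe : (GOf A e (refBasis oM x)).PosDef := by
    have : GOf A e (refBasis oM x) = (κ * d)⁻¹ • (κ • GOf A e v) := by
      rw [hGv, smul_smul, inv_mul_cancel₀ hd.ne', one_smul]
    rw [this]
    exact hG.smul (inv_pos.mpr hd)
  obtain ⟨R, hR, -, hrot⟩ := exists_rotation (finrank_fibre x) he (orthonormal_fibreFrame oE (x := x))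
  have hFF : FF oM oE A x = R * GOf A e (refBasis oM x) * Rᵀ :=
    GOf_rotate hA hrot (refBasis oM x)
  have hpos : (FF oM oE A x).PosDef := by
    rw [hFF]
    exact posDef_conj hR hpe
  rw [hGv, rootLagrangian_smul hd hpe, ← rootLagrangian_conj hR hpe, ← hFF,
    rootLagrangian_eq hΛ hpos, mul_assoc]
  congr 1
  set Y0 := Y oM oE Λ A x with hY
  have hX : (signedRoot Λ (FF oM oE A x))⁻¹ = Y0⁻¹ := rfl
  have hYs : Y0ᵀ = Y0 := signedRoot_symm hpos
  have hu : IsUnit Y0.det := isUnit_det_signedRoot hΛ hpos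
  have hGx : (Matrix.of fun i j => wedge22 (curvForm oE A x i) (curvForm oE A x j) v)
      = d • FF oM oE A x := GOf_basis oM hA (fibreFrame oE x) v
  have h1 : ∑ i, wedge22 (curvForm oE A x i) (Sig oM oE Λ A x i) v
      = d * (Y0⁻¹ * FF oM oE A x).trace := by
    have h := congrArg Matrix.trace
      (wedge22_matrix 1 Y0⁻¹ (curvForm oE A x) (curvForm oE A x) v)
    rw [hGx, one_mul, transpose_nonsing_inv, hYs, Matrix.smul_mul, trace_smul, trace_mul_comm] at h
    rw [← smul_eq_mul, ← h]
    simp [Matrix.trace, Matrix.one_apply]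
    rfl
  have h2 : ∑ i, ∑ j, (Psi oM oE Λ A x + (Λ / 3) • (1 : Matrix (Fin 3) (Fin 3) ℝ)) i j
        * wedge22 (Sig oM oE Λ A x i) (Sig oM oE Λ A x j) v
      = d * (Y0⁻¹ * FF oM oE A x).trace := by
    have hP : Psi oM oE Λ A x + (Λ / 3) • (1 : Matrix (Fin 3) (Fin 3) ℝ) = Y0 := by
      rw [Psi, sub_add_cancel]
    have h := wedge22_matrix Y0⁻¹ Y0⁻¹ (curvForm oE A x) (curvForm oE A x) v
    rw [hGx, transpose_nonsing_inv, hYs] at h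
    set N : Matrix (Fin 3) (Fin 3) ℝ := Matrix.of fun i j =>
      wedge22 (Sig oM oE Λ A x i) (Sig oM oE Λ A x j) v with hN
    have hN' : N = Y0⁻¹ * d • FF oM oE A x * Y0⁻¹ := h
    have hNs : ∑ i, ∑ j, Y0 i j * N i j = (Y0 * Nᵀ).trace := by
      simp [Matrix.trace, Matrix.mul_apply]
    have hNt : Nᵀ = N := by
      ext i j
      exact wedge22_comm v
    rw [hP]
    change ∑ i, ∑ j, Y0 i j * N i j = _
    rw [hNs, hNt, hN', Matrix.mul_smul, Matrix.smul_mul, Matrix.mul_smul, trace_smul, smul_eq_mul,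
      mul_assoc, ← mul_assoc Y0, mul_nonsing_inv _ hu, one_mul, trace_mul_comm]
  rw [plebanskiForm, h1, h2, hX]
  ring

/-- The Lagrangian density of the connection `A + t a` on the frame `v`. -/
def pleb (oM : ManifoldOrientation M) (oE : FibreOrientation E) (Λ : ℝ)
    (A : CovariantDerivative (𝓡 4) R3 E) (x : M) (v : Fin 4 → TangentSpace (𝓡 4) x) : ℝ :=
  plebanskiForm Λ (curvForm oE A x) (Sig oM oE Λ A x) (Psi oM oE Λ A x) v

/-- The derivative of the Lagrangian: `Σ_i ∧ (d_A a)^i`. -/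
def firstVariation (oM : ManifoldOrientation M) (oE : FibreOrientation E) (Λ : ℝ)
    (A : CovariantDerivative (𝓡 4) R3 E)
    (a : (x : M) → E x →L[ℝ] TangentSpace (𝓡 4) x →L[ℝ] E x) (x : M)
    (v : Fin 4 → TangentSpace (𝓡 4) x) : ℝ :=
  ∑ i, wedge22 (Sig oM oE Λ A x i) (dAForm oE A a x i) v

theorem sum_rotate {R : Matrix (Fin 3) (Fin 3) ℝ} (hR : Rᵀ * R = 1) (p q : Fin 3 → ℝ) :
    ∑ i, (∑ j, R i j * p j) * (∑ k, R i k * q k) = ∑ j, p j * q j := by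
  change (R *ᵥ p) ⬝ᵥ (R *ᵥ q) = p ⬝ᵥ q
  rw [dotProduct_mulVec, ← mulVec_transpose, mulVec_mulVec, hR, one_mulVec]

theorem exists_sign_at {v : Fin 4 → TangentSpace (𝓡 4) x} (hv : LinearIndependent ℝ v) :
    ∃ κ : ℝ, κ * κ = 1 ∧ 0 < κ * (refBasis oM x).det v := by
  rcases lt_or_gt_of_ne (det_ref_ne_zero (oM := oM) hv) with h | h
  · exact ⟨-1, by norm_num, by linarith⟩
  · exact ⟨1, by norm_num, by linarith⟩

/-- The data needed to differentiate the Lagrangian along `A + t a` at one point. -/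
theorem shift_curve (hA : IsSO3Connection A) (hdef : IsDefinite oM oE A)
    (ha : IsSoForm a) {e : Fin 3 → E x} (he : Orthonormal ℝ e) {v : Fin 4 → TangentSpace (𝓡 4) x}
    {κ : ℝ} (hκ : 0 < κ * (refBasis oM x).det v) :
    (∀ i j, ContDiffAt ℝ 2 (fun t => (κ • GOf (shift A a t) e v) i j) 0) ∧
    (∀ᶠ t in nhds 0, (κ • GOf (shift A a t) e v).PosDef) ∧
    ∃ G' : ℝ → Matrix (Fin 3) (Fin 3) ℝ,
      (∀ t i j, HasDerivAt (fun t => (κ • GOf (shift A a t) e v) i j) (G' t i j) t) ∧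
      (∀ i j, G' 0 i j = κ * (wedge22 (dAFormOf A a e i) (curvFormOf A e j) v
          + wedge22 (curvFormOf A e i) (dAFormOf A a e j) v)) ∧
      ∀ i j, HasDerivAt (fun t => G' t i j) (κ * (2 * (wedge22 (curvFormOf A e i) (brFormOf a e j) v
          + wedge22 (dAFormOf A a e i) (dAFormOf A a e j) v
          + wedge22 (brFormOf a e i) (curvFormOf A e j) v))) 0 := by
  have hs : ∀ i j, ContDiffAt ℝ 2 (fun t => (κ • GOf (shift A a t) e v) i j) 0 := by
    intro i j
    simp only [Matrix.smul_apply, smul_eq_mul, GOf_shift hA ha]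
    fun_prop
  refine ⟨hs, ?_, ?_⟩
  · refine eventually_posDef (fun i j => (hs i j).continuousAt) (fun t => ?_) ?_
    · rw [transpose_smul, GOf_symm]
    · have h0 : GOf (shift A a 0) e v = GOf A e v := by
        ext i j
        rw [GOf_shift hA ha]
        simp [GOf]
      rw [h0]
      exact (YOf_eq (Λ := 1) hA hdef he hκ).2
  · have hpoly : ∀ c0 c1 c2 c3 c4 t : ℝ,
        HasDerivAt (fun t => κ * (c0 + t * c1 + t ^ 2 * c2 + t ^ 3 * c3 + t ^ 4 * c4))
          (κ * (c1 + 2 * t * c2 + 3 * t ^ 2 * c3 + 4 * t ^ 3 * c4)) t := by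
      intro c0 c1 c2 c3 c4 t
      have h := (((((hasDerivAt_const t c0).add ((hasDerivAt_id t).mul_const c1)).add
        (((hasDerivAt_id t).pow 2).mul_const c2)).add
        (((hasDerivAt_id t).pow 3).mul_const c3)).add
        (((hasDerivAt_id t).pow 4).mul_const c4)).const_mul κ
      refine h.congr_deriv ?_
      simp
    have hpoly' : ∀ c1 c2 c3 c4 : ℝ,
        HasDerivAt (fun t => κ * (c1 + 2 * t * c2 + 3 * t ^ 2 * c3 + 4 * t ^ 3 * c4))
          (κ * (2 * c2)) 0 := by
      intro c1 c2 c3 c4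
      have h := ((((hasDerivAt_const (0 : ℝ) c1).add (((hasDerivAt_id (0 : ℝ)).const_mul 2).mul_const c2)).add
        ((((hasDerivAt_id (0 : ℝ)).pow 2).const_mul 3).mul_const c3)).add
        ((((hasDerivAt_id (0 : ℝ)).pow 3).const_mul 4).mul_const c4)).const_mul κ
      refine h.congr_deriv ?_
      simp
    refine ⟨fun t => Matrix.of fun i j => κ * ((wedge22 (dAFormOf A a e i) (curvFormOf A e j) v
          + wedge22 (curvFormOf A e i) (dAFormOf A a e j) v)
        + 2 * t * (wedge22 (curvFormOf A e i) (brFormOf a e j) v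
          + wedge22 (dAFormOf A a e i) (dAFormOf A a e j) v
          + wedge22 (brFormOf a e i) (curvFormOf A e j) v)
        + 3 * t ^ 2 * (wedge22 (dAFormOf A a e i) (brFormOf a e j) v
          + wedge22 (brFormOf a e i) (dAFormOf A a e j) v)
        + 4 * t ^ 3 * wedge22 (brFormOf a e i) (brFormOf a e j) v), ?_, ?_, ?_⟩
    · intro t i j
      simp only [Matrix.smul_apply, smul_eq_mul, GOf_shift hA ha, Matrix.of_apply]
      exact hpoly _ _ _ _ _ _
    · intro i j
      simp
    · intro i j
      simp only [Matrix.of_apply]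
      exact hpoly' _ _ _ _

theorem pleb_shift (hΛ : Λ ≠ 0) (hA : IsSO3Connection A) (ha : IsSoForm a) {e : Fin 3 → E x}
    (he : Orthonormal ℝ e) {v : Fin 4 → TangentSpace (𝓡 4) x} {κ : ℝ} (hκ1 : κ * κ = 1)
    (hκ : 0 < κ * (refBasis oM x).det v) {t : ℝ} (hG : (κ • GOf (shift A a t) e v).PosDef) :
    pleb oM oE Λ (shift A a t) x v = κ * rootLagrangian Λ (κ • GOf (shift A a t) e v) := by
  rw [← plebanskiForm_eq (oE := oE) hΛ (hA.shift ha t) he hκ hG, ← mul_assoc, hκ1, one_mul, pleb]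

theorem dAFormOf_rotate (hA : IsSO3Connection A) (ha : IsSoForm a) {e e' : Fin 3 → E x}
    {R : Matrix (Fin 3) (Fin 3) ℝ} (hrot : IsRotation R e e') (i : Fin 3)
    (u v : TangentSpace (𝓡 4) x) :
    dAFormOf A a e' i u v = ∑ j, R i j * dAFormOf A a e j u v :=
  hrot _ (isSkewEnd_dA hA ha u v) i

/-- The matrix of wedge products `Σ_i ∧ (d_A a)^j` transforms by conjugation. -/
theorem wedge_Sig_dA_rotate (hΛ : Λ ≠ 0) (hA : IsSO3Connection A) (ha : IsSoForm a)
    {e e' : Fin 3 → E x} (hpos : (GOf A e (refBasis oM x)).PosDef)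
    {R : Matrix (Fin 3) (Fin 3) ℝ} (hR : Rᵀ * R = 1) (hrot : IsRotation R e e')
    (v : Fin 4 → TangentSpace (𝓡 4) x) :
    (Matrix.of fun i j => wedge22 (SigOf oM Λ A e' i) (dAFormOf A a e' j) v)
      = R * (Matrix.of fun i j => wedge22 (SigOf oM Λ A e i) (dAFormOf A a e j) v) * Rᵀ := by
  rw [← wedge22_matrix]
  ext i j
  have h1 : SigOf oM Λ A e' i = fun u w => ∑ k, R i k * SigOf oM Λ A e k u w :=
    funext fun u => funext fun w => SigOf_rotate hΛ hA hpos hR hrot i u w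
  have h2 : dAFormOf A a e' j = fun u w => ∑ k, R j k * dAFormOf A a e k u w :=
    funext fun u => funext fun w => dAFormOf_rotate hA ha hrot j u w
  rw [Matrix.of_apply, h1, h2]
  rfl

theorem firstVariation_eq (hΛ : Λ ≠ 0) (hA : IsSO3Connection A) (hdef : IsDefinite oM oE A)
    (ha : IsSoForm a) {e : Fin 3 → E x} (he : Orthonormal ℝ e) (v : Fin 4 → TangentSpace (𝓡 4) x) :
    firstVariation oM oE Λ A a x v = ∑ i, wedge22 (SigOf oM Λ A e i) (dAFormOf A a e i) v := by
  obtain ⟨R, hR, -, hrot⟩ := exists_rotation (finrank_fibre x) (orthonormal_fibreFrame oE (x := x)) he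
  have h := congrArg Matrix.trace (wedge_Sig_dA_rotate hΛ hA ha (hdef.posDef x) hR hrot v)
  rw [trace_mul_comm, ← mul_assoc, hR, one_mul] at h
  exact h.symm

theorem hasDerivAt_pleb (hΛ : Λ ≠ 0) (hA : IsSO3Connection A) (hdef : IsDefinite oM oE A)
    (ha : IsSoForm a) {v : Fin 4 → TangentSpace (𝓡 4) x} (hv : LinearIndependent ℝ v) :
    HasDerivAt (fun t => pleb oM oE Λ (shift A a t) x v) (firstVariation oM oE Λ A a x v) 0 := by
  obtain ⟨κ, hκ1, hκ⟩ := exists_sign_at (oM := oM) hv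
  set e : Fin 3 → E x := ⇑(fibreFrame oE x) with hedef
  have he : Orthonormal ℝ e := orthonormal_fibreFrame oE
  obtain ⟨hs, hp, G', h1, h1', h2⟩ := shift_curve (oM := oM) (oE := oE) hA hdef ha he hκ
  have hG0 : GOf (shift A a 0) e v = GOf A e v := by
    ext i j
    rw [GOf_shift hA ha]
    simp [GOf]
  have h := (hasDerivAt_rootLagrangian hΛ hs hp (Filter.Eventually.of_forall h1)
    (G'' := Matrix.of fun i j => (κ * (2 * (wedge22 (curvFormOf A e i) (brFormOf a e j) v
          + wedge22 (dAFormOf A a e i) (dAFormOf A a e j) v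
          + wedge22 (brFormOf a e i) (curvFormOf A e j) v)))) h2).const_mul κ
  have hev : (fun t => pleb oM oE Λ (shift A a t) x v)
      =ᶠ[nhds 0] fun t => κ * rootLagrangian Λ (κ • GOf (shift A a t) e v) := by
    filter_upwards [hp] with t ht using pleb_shift hΛ hA ha he hκ1 hκ ht
  refine (h.congr_of_eventuallyEq hev).congr_deriv ?_
  rw [hG0, ← (YOf_eq hA hdef he hκ).1]
  set Xm := (YOf oM Λ A e)⁻¹ with hXm
  have hXs : ∀ i j, Xm i j = Xm j i := by
    intro i j
    have hYs : (YOf oM Λ A e)ᵀ = YOf oM Λ A e := signedRoot_symm (hdef.posDef x)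
    rw [← congrFun (congrFun (show Xmᵀ = Xm by rw [hXm, transpose_nonsing_inv, hYs]) i) j]
    rfl
  rw [firstVariation_eq hΛ hA hdef ha he]
  have hsig : ∀ i, SigOf oM Λ A e i = fun u w => ∑ j, Xm i j * curvFormOf A e j u w := fun i => rfl
  simp only [Matrix.trace, Matrix.diag_apply, Matrix.mul_apply, h1', hsig, wedge22_sum_left]
  have hc : ∀ i j, wedge22 (dAFormOf A a e i) (curvFormOf A e j) v
      = wedge22 (curvFormOf A e j) (dAFormOf A a e i) v := fun i j => wedge22_comm v
  simp only [hc]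
  simp only [Fin.sum_univ_three, hXs 1 0, hXs 2 0, hXs 2 1]
  linear_combination (Xm 0 0 * wedge22 (curvFormOf A e 0) (dAFormOf A a e 0) v
    + Xm 0 1 * wedge22 (curvFormOf A e 1) (dAFormOf A a e 0) v
    + Xm 0 2 * wedge22 (curvFormOf A e 2) (dAFormOf A a e 0) v
    + Xm 0 1 * wedge22 (curvFormOf A e 0) (dAFormOf A a e 1) v
    + Xm 1 1 * wedge22 (curvFormOf A e 1) (dAFormOf A a e 1) v
    + Xm 1 2 * wedge22 (curvFormOf A e 2) (dAFormOf A a e 1) v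
    + Xm 0 2 * wedge22 (curvFormOf A e 0) (dAFormOf A a e 2) v
    + Xm 1 2 * wedge22 (curvFormOf A e 1) (dAFormOf A a e 2) v
    + Xm 2 2 * wedge22 (curvFormOf A e 2) (dAFormOf A a e 2) v) * hκ1

end Variation

/-! ### Smooth dependence of the action, and the Euler–Lagrange equation -/

section Action

open Matrix

variable {M : Type*} [TopologicalSpace M] [ChartedSpace R4 M] [IsManifold (𝓡 4) ∞ M] [T2Space M]
  {E : M → Type*} [∀ x, NormedAddCommGroup (E x)] [∀ x, InnerProductSpace ℝ (E x)]
  [TopologicalSpace (TotalSpace R3 E)] [FiberBundle R3 E] [VectorBundle ℝ R3 E]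
  [ContMDiffVectorBundle ∞ R3 E (𝓡 4)] [IsContMDiffRiemannianBundle (𝓡 4) ∞ R3 E]
  {A : CovariantDerivative (𝓡 4) R3 E}
  {a : (x : M) → E x →L[ℝ] TangentSpace (𝓡 4) x →L[ℝ] E x} {x : M}
  {oM : ManifoldOrientation M} {oE : FibreOrientation E} {Λ : ℝ}
  {e : Fin 3 → (y : M) → E y} {V : Fin 4 → (y : M) → TangentSpace (𝓡 4) y}
  {U W : (y : M) → TangentSpace (𝓡 4) y}

theorem smooth_brFormOf (ha : IsSoForm a) (he : IsOrthoFrame e x)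
    (hU : SmoothNear R4 U x) (hW : SmoothNear R4 W x) (i : Fin 3) :
    FSmoothNear (fun y => brFormOf a (fun k => e k y) i (U y) (W y)) x :=
  FSmoothNear.inner ((((he.smooth _).soForm ha hW).soForm ha hU).sub
    (((he.smooth _).soForm ha hU).soForm ha hW)) (he.smooth _)

theorem orientationSign_eq {v : Fin 4 → TangentSpace (𝓡 4) x} {κ : ℝ} (h1 : κ = 1 ∨ κ = -1)
    (hκ : 0 < κ * (refBasis oM x).det v) : orientationSign oM x v = κ := by
  rcases h1 with rfl | rfl
  · rw [orientationSign, if_pos (by linarith)]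
  · rw [orientationSign, if_neg (by linarith)]

theorem coordFrame_eq {i : M} {y : R4} (hy : y ∈ (extChartAt (𝓡 4) i).target) :
    coordFrame i y
      = fun k => coordField i (EuclideanSpace.single k 1) ((extChartAt (𝓡 4) i).symm y) :=
  funext fun k => coordFrame_eq_coordField hy k

theorem continuousAt_symm {i : M} {y : R4} (hy : y ∈ (extChartAt (𝓡 4) i).target) :
    ContinuousAt (extChartAt (𝓡 4) i).symm y :=
  (continuousOn_extChartAt_symm i).continuousAt ((isOpen_extChartAt_target i).mem_nhds hy)

theorem symm_mem_source {i : M} {y : R4} (hy : y ∈ (extChartAt (𝓡 4) i).target) :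
    (extChartAt (𝓡 4) i).symm y ∈ (chartAt R4 i).source := by
  simpa using (extChartAt (𝓡 4) i).map_target hy

theorem linearIndependent_coordFrame {i : M} {y : R4} (hy : y ∈ (extChartAt (𝓡 4) i).target) :
    LinearIndependent ℝ (coordFrame i y) := by
  rw [coordFrame_eq hy]
  exact linearIndependent_coordField (symm_mem_source hy)

theorem contDiffAt_density_pleb (hΛ : Λ ≠ 0) (hA : IsSO3Connection A) (hdef : IsDefinite oM oE A)
    (ha : IsSoForm a) (i : M) {y : R4} (hy : y ∈ (extChartAt (𝓡 4) i).target) :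
    ContDiffAt ℝ 2 (fun p : ℝ × R4 => density oM (pleb oM oE Λ (shift A a p.1)) i p.2) (0, y) := by
  set σ := (extChartAt (𝓡 4) i).symm with hσ
  have hp : σ y ∈ (chartAt R4 i).source := symm_mem_source hy
  set V : Fin 4 → (z : M) → TangentSpace (𝓡 4) z :=
    fun k => coordField i (EuclideanSpace.single k 1) with hVdef
  have hV : IsTangentFrame V (σ y) := isTangentFrame_coordField hp
  obtain ⟨e, he⟩ := exists_isOrthoFrame (E := E) (σ y)
  obtain ⟨κ, hκ1, hκ⟩ := exists_sign hA hdef hV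
  let G : ℝ × R4 → Matrix (Fin 3) (Fin 3) ℝ := fun p =>
    κ • GOf (shift A a p.1) (fun k => e k (σ p.2)) (fun b => V b (σ p.2))
  have hsn : ∀ {h : M → ℝ}, FSmoothNear h (σ y) →
      ContDiffAt ℝ 2 (fun p : ℝ × R4 => h (σ p.2)) (0, y) := fun {h} hh =>
    ContDiffAt.comp (g := fun z => h (σ z)) ((0, y) : ℝ × R4)
      ((hh.contDiffAt_symm hy).of_le (WithTop.coe_le_coe.mpr (le_top : (2 : ℕ∞) ≤ ⊤))) contDiffAt_snd
  have hF := fun i b c => smooth_curvFormOf hA he (hV.smooth b) (hV.smooth c) i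
  have hB := fun i b c => smooth_dAFormOf hA ha he (hV.smooth b) (hV.smooth c) i
  have hQ := fun i b c => smooth_brFormOf ha he (hV.smooth b) (hV.smooth c) i
  have hG : ∀ i j, ContDiffAt ℝ 2 (fun p => G p i j) (0, y) := by
    intro i j
    simp only [G, Matrix.smul_apply, smul_eq_mul, GOf_shift hA ha]
    have ht : ContDiffAt ℝ 2 (fun p : ℝ × R4 => p.1) (0, y) := contDiffAt_fst
    have w0 := hsn (FSmoothNear.wedge22 (hF i) (hF j))
    have w1 := (hsn (FSmoothNear.wedge22 (hB i) (hF j))).add (hsn (FSmoothNear.wedge22 (hF i) (hB j)))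
    have w2 := ((hsn (FSmoothNear.wedge22 (hF i) (hQ j))).add
      (hsn (FSmoothNear.wedge22 (hB i) (hB j)))).add (hsn (FSmoothNear.wedge22 (hQ i) (hF j)))
    have w3 := (hsn (FSmoothNear.wedge22 (hB i) (hQ j))).add (hsn (FSmoothNear.wedge22 (hQ i) (hB j)))
    have w4 := hsn (FSmoothNear.wedge22 (hQ i) (hQ j))
    exact contDiffAt_const.mul ((((w0.add (ht.mul w1)).add ((ht.pow 2).mul w2)).add
      ((ht.pow 3).mul w3)).add ((ht.pow 4).mul w4))
  have hGpos : ∀ᶠ p in nhds ((0, y) : ℝ × R4), (G p).PosDef := by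
    refine eventually_posDef (fun i j => (hG i j).continuousAt) (fun p => ?_) ?_
    · simp only [G, transpose_smul, GOf_symm]
    · have h0 : G (0, y) = κ • GOf A (fun k => e k (σ y)) (fun b => V b (σ y)) := by
        simp only [G]
        congr 1
        ext i j
        rw [GOf_shift hA ha]
        simp [GOf]
      rw [h0]
      exact (YOf_eq (Λ := 1) hA hdef he.ortho.self_of_nhds hκ.self_of_nhds).2
  have hκκ : κ * κ = 1 := by rcases hκ1 with rfl | rfl <;> norm_num
  refine (contDiffAt_rootLagrangian (Λ := Λ) (n := 2) hG hGpos).congr_of_eventuallyEq ?_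
  have hcont : ContinuousAt (fun p : ℝ × R4 => σ p.2) (0, y) :=
    ContinuousAt.comp (g := σ) (f := Prod.snd) (continuousAt_symm hy) continuousAt_snd
  filter_upwards [hGpos, hcont.eventually hκ, hcont.eventually he.ortho,
    continuousAt_snd.preimage_mem_nhds ((isOpen_extChartAt_target i).mem_nhds hy)] with p h1 h2 h3 h4
  have hcf : coordFrame i p.2 = fun b => V b (σ p.2) := coordFrame_eq h4
  rw [density, hcf, orientationSign_eq hκ1 h2, pleb_shift hΛ hA ha h3 hκκ h2 h1, ← mul_assoc, hκκ,
    one_mul]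

/-- The action along `A + t a` is `C²`, and is differentiated under the integral sign. -/
theorem action_shift [CompactSpace M] (hΛ : Λ ≠ 0) (hA : IsSO3Connection A) (hdef : IsDefinite oM oE A)
    (ha : IsSoForm a) :
    ContDiffAt ℝ 2 (fun t => action oM oE Λ (shift A a t)) 0 ∧
    HasDerivAt (fun t => action oM oE Λ (shift A a t))
      (integralForm oM (firstVariation oM oE Λ A a)) 0 ∧
    hessian oM oE Λ A a = integralForm oM fun x v =>
      iteratedDeriv 2 (fun t => pleb oM oE Λ (shift A a t) x v) 0 := by
  obtain ⟨h1, h2, h3⟩ := integralForm_contDiffAt_two (oM := oM)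
    (η := fun t => pleb oM oE Λ (shift A a t))
    fun i y hy => contDiffAt_density_pleb hΛ hA hdef ha i hy
  refine ⟨h1, ?_, h3⟩
  have : integralForm oM (firstVariation oM oE Λ A a)
      = integralForm oM fun x v => deriv (fun t => pleb oM oE Λ (shift A a t) x v) 0 :=
    integralForm_congr fun i y hy =>
      (hasDerivAt_pleb hΛ hA hdef ha (linearIndependent_coordFrame hy)).deriv.symm
  rw [this]
  exact h2

theorem IsSoForm.smul {θ : M → ℝ} (hθ : ContMDiff (𝓡 4) 𝓘(ℝ, ℝ) ∞ θ) (ha : IsSoForm a) :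
    IsSoForm (fun x => θ x • a x) where
  skew x u e e' := by
    have h1 : ∀ e, (θ x • a x) e u = θ x • a x e u := fun e => rfl
    rw [h1, h1, inner_smul_left, inner_smul_right, ha.skew]
    simp
  smooth := hθ.smul_section ha.smooth

/-- The first variation is linear over functions on horizontal forms. -/
theorem firstVariation_smul (hA : IsSO3Connection A) (ha : IsSoForm a) (hh : IsHorizontal oM oE Λ A a) {θ : M → ℝ} (hθ : FSmoothNear θ x)
    (v : Fin 4 → TangentSpace (𝓡 4) x) :
    firstVariation oM oE Λ A (fun x => θ x • a x) x v = θ x * firstVariation oM oE Λ A a x v := by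
  set D : TangentSpace (𝓡 4) x → ℝ := fun u => mvfderiv (𝓡 4) θ x u with hD
  have h1 : ∀ i u w, dAForm oE A (fun x => θ x • a x) x i u w
      = θ x * dAForm oE A a x i u w + (D u * aForm oE a x i w - D w * aForm oE a x i u) := by
    intro i u w
    simp only [dAForm, aForm, soComp, dA_smul ha hθ, inner_add_left, inner_sub_left, inner_smul_left,
      conj_trivial, hD]
  have hS : ∀ i u w, Sig oM oE Λ A x i u w = - Sig oM oE Λ A x i w u := fun i u w =>
    (isTwoForm_Sig hA i).swap u w
  have e1 := hh x (v 1) (v 2) (v 3)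
  have e2 := hh x (v 0) (v 2) (v 3)
  have e3 := hh x (v 0) (v 1) (v 3)
  have e4 := hh x (v 0) (v 1) (v 2)
  simp only [Fin.sum_univ_three, wedge21] at e1 e2 e3 e4
  rw [hS 0 (v 3), hS 1 (v 3), hS 2 (v 3)] at e1 e2 e3
  rw [hS 0 (v 2), hS 1 (v 2), hS 2 (v 2)] at e4
  simp only [firstVariation, Fin.sum_univ_three, wedge22, h1]
  linear_combination D (v 0) * e1 - D (v 1) * e2 + D (v 2) * e3 - D (v 3) * e4

theorem smooth_firstVariation (hΛ : Λ ≠ 0) (hA : IsSO3Connection A) (hdef : IsDefinite oM oE A)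
    (ha : IsSoForm a) (hV : IsTangentFrame V x) :
    FSmoothNear (fun y => firstVariation oM oE Λ A a y (fun b => V b y)) x := by
  obtain ⟨e, he⟩ := exists_isOrthoFrame (E := E) x
  refine (FSmoothNear.sum Finset.univ fun i _ => FSmoothNear.wedge22
    (fun b c => smooth_SigOf hΛ hA hdef he (hV.smooth b) (hV.smooth c) i)
    (fun b c => smooth_dAFormOf hA ha he (hV.smooth b) (hV.smooth c) i)).congr ?_
  filter_upwards [he.ortho] with y hy
  exact firstVariation_eq hΛ hA hdef ha hy _

theorem firstVariation_basis (hA : IsSO3Connection A) (ha : IsSoForm a)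
    (b : Module.Basis (Fin 4) ℝ (TangentSpace (𝓡 4) x)) (v : Fin 4 → TangentSpace (𝓡 4) x) :
    firstVariation oM oE Λ A a x v = b.det v * firstVariation oM oE Λ A a x b := by
  simp only [firstVariation, Finset.mul_sum]
  exact Finset.sum_congr rfl fun i _ =>
    wedge22_basis (isTwoForm_Sig hA i) (isTwoForm_dAFormOf hA ha (fibreFrame oE x) i) b v

/-- The ratio of the first variation and the volume form. -/
def variationDensity (oM : ManifoldOrientation M) (oE : FibreOrientation E) (Λ : ℝ)
    (A : CovariantDerivative (𝓡 4) R3 E)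
    (a : (x : M) → E x →L[ℝ] TangentSpace (𝓡 4) x →L[ℝ] E x) (x : M) : ℝ :=
  (volForm oM oE Λ A x (refBasis oM x))⁻¹ * firstVariation oM oE Λ A a x (refBasis oM x)

theorem firstVariation_eq_density (hΛ : Λ ≠ 0) (hA : IsSO3Connection A) (hdef : IsDefinite oM oE A)
    (ha : IsSoForm a) (v : Fin 4 → TangentSpace (𝓡 4) x) :
    firstVariation oM oE Λ A a x v = variationDensity oM oE Λ A a x * volForm oM oE Λ A x v := by
  have h0 := (volForm_ref_pos (oE := oE) hΛ (hdef.posDef x)).ne'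
  rw [variationDensity, volForm_basis hA (refBasis oM x) v, firstVariation_basis hA ha (refBasis oM x) v]
  field_simp

theorem volForm_ne_zero (hΛ : Λ ≠ 0) (hA : IsSO3Connection A) (hdef : IsDefinite oM oE A)
    {v : Fin 4 → TangentSpace (𝓡 4) x} (hv : LinearIndependent ℝ v) :
    volForm oM oE Λ A x v ≠ 0 := by
  obtain ⟨b, rfl⟩ := exists_basis_of_linearIndependent hv
  exact volForm_basis_ne_zero hΛ hA (hdef.posDef x) b

theorem orientationSign_mul_volForm_pos (hΛ : Λ ≠ 0) (hA : IsSO3Connection A)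
    (hdef : IsDefinite oM oE A) {v : Fin 4 → TangentSpace (𝓡 4) x} (hv : LinearIndependent ℝ v) :
    0 < orientationSign oM x v * volForm oM oE Λ A x v := by
  rw [volForm_basis hA (refBasis oM x) v, orientationSign, ← mul_assoc]
  refine mul_pos ?_ (volForm_ref_pos hΛ (hdef.posDef x))
  split_ifs with h
  · linarith
  · have := lt_of_le_of_ne (not_lt.mp h) (det_ref_ne_zero hv)
    linarith

theorem smooth_variationDensity (hΛ : Λ ≠ 0) (hA : IsSO3Connection A) (hdef : IsDefinite oM oE A)
    (ha : IsSoForm a) (x : M) : FSmoothNear (variationDensity oM oE Λ A a) x := by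
  have hV : IsTangentFrame (fun k => coordField x (EuclideanSpace.single k 1)) x :=
    isTangentFrame_coordField (mem_chart_source R4 x)
  refine (((smooth_volForm hΛ hA hdef hV).inv
    (volForm_ne_zero hΛ hA hdef hV.indep.self_of_nhds)).mul
    (smooth_firstVariation hΛ hA hdef ha hV)).congr ?_
  filter_upwards [hV.indep] with y hy
  have h0 := volForm_ne_zero hΛ hA hdef hy
  rw [firstVariation_eq_density hΛ hA hdef ha]
  field_simp

/-- At a critical point the first variation vanishes pointwise on horizontal forms: these are a
module over the smooth functions, on which the first variation is linear. -/
theorem variationDensity_eq_zero [CompactSpace M] (hΛ : Λ ≠ 0) (hA : IsSO3Connection A) (hdef : IsDefinite oM oE A)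
    (hcrit : IsCritical oM oE Λ A) (ha : IsSoForm a) (hh : IsHorizontal oM oE Λ A a) (x : M) :
    variationDensity oM oE Λ A a x = 0 := by
  -- The variation of the action along `θ a`, for `θ` the density of the first variation itself, is
  -- the integral of `θ²`.
  set θ := variationDensity oM oE Λ A a with hθ
  have hθs : ∀ x, FSmoothNear θ x := smooth_variationDensity hΛ hA hdef ha
  have hθa : IsSoForm (fun x => θ x • a x) := ha.smul fun x => (hθs x).self_of_nhds
  have hI : integralForm oM (firstVariation oM oE Λ A fun x => θ x • a x) = 0 :=
    (action_shift hΛ hA hdef hθa).2.1.unique (hcrit _ hθa)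
  have heq : ∀ y v, firstVariation oM oE Λ A (fun x => θ x • a x) y v
      = θ y ^ 2 * volForm oM oE Λ A y v := by
    intro y v
    rw [firstVariation_smul hA ha hh (hθs y), firstVariation_eq_density hΛ hA hdef ha]
    ring
  have hd : ∀ i y, density oM (firstVariation oM oE Λ A fun x => θ x • a x) i y
      = θ ((extChartAt (𝓡 4) i).symm y) ^ 2
        * (orientationSign oM _ (coordFrame i y) * volForm oM oE Λ A _ (coordFrame i y)) := by
    intro i y
    rw [density, heq]
    ring
  have hc : ∀ i : M, ContinuousOn (density oM (firstVariation oM oE Λ A fun x => θ x • a x) i)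
      (extChartAt (𝓡 4) i).target := by
    intro i y hy
    have hV : IsTangentFrame (fun k => coordField i (EuclideanSpace.single k 1))
        ((extChartAt (𝓡 4) i).symm y) := isTangentFrame_coordField (symm_mem_source hy)
    obtain ⟨κ, hκ1, hκ⟩ := exists_sign hA hdef hV
    have h1 : ContinuousAt (fun z => κ * firstVariation oM oE Λ A (fun x => θ x • a x)
        ((extChartAt (𝓡 4) i).symm z)
        (fun k => coordField i (EuclideanSpace.single k 1) ((extChartAt (𝓡 4) i).symm z))) y :=
      continuousAt_const.mul
        ((smooth_firstVariation hΛ hA hdef hθa hV).contDiffAt_symm hy).continuousAt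
    refine (h1.congr ?_).continuousWithinAt
    filter_upwards [(continuousAt_symm hy).eventually hκ,
      (isOpen_extChartAt_target i).mem_nhds hy] with z h2 h3
    rw [density, coordFrame_eq h3, orientationSign_eq hκ1 h2]
  have hnn : ∀ i : M, ∀ y ∈ (extChartAt (𝓡 4) i).target,
      0 ≤ density oM (firstVariation oM oE Λ A fun x => θ x • a x) i y := by
    intro i y hy
    rw [hd]
    have h1 := orientationSign_mul_volForm_pos hΛ hA hdef (linearIndependent_coordFrame hy)
    positivity
  obtain ⟨i, y, hy, rfl, hy0⟩ := density_eq_zero_of_integralForm_eq_zero hc hnn hI x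
  rw [hd] at hy0
  have h1 := orientationSign_mul_volForm_pos hΛ hA hdef (linearIndependent_coordFrame hy)
  exact pow_eq_zero_iff two_ne_zero |>.mp ((mul_eq_zero.mp hy0).resolve_right h1.ne')

end Action

/-! ### The second variation -/

section Second

open Matrix

variable {M : Type*} [TopologicalSpace M] [ChartedSpace R4 M] [IsManifold (𝓡 4) ∞ M] [T2Space M]
  {E : M → Type*} [∀ x, NormedAddCommGroup (E x)] [∀ x, InnerProductSpace ℝ (E x)]
  [TopologicalSpace (TotalSpace R3 E)] [FiberBundle R3 E] [VectorBundle ℝ R3 E]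
  [ContMDiffVectorBundle ∞ R3 E (𝓡 4)] [IsContMDiffRiemannianBundle (𝓡 4) ∞ R3 E]
  {A : CovariantDerivative (𝓡 4) R3 E}
  {a : (x : M) → E x →L[ℝ] TangentSpace (𝓡 4) x →L[ℝ] E x} {x : M}
  {oM : ManifoldOrientation M} {oE : FibreOrientation E} {Λ : ℝ}

theorem aFormOf_rotate (ha : IsSoForm a) {e e' : Fin 3 → E x} {R : Matrix (Fin 3) (Fin 3) ℝ}
    (hrot : IsRotation R e e') (i : Fin 3) (u : TangentSpace (𝓡 4) x) :
    aFormOf a e' i u = ∑ j, R i j * aFormOf a e j u :=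
  hrot _ (isSkewEnd_soForm ha u) i

theorem sum_asd_rotate {R X0 : Matrix (Fin 3) (Fin 3) ℝ} (hR : Rᵀ * R = 1)
    (B : Fin 3 → Matrix (Fin 4) (Fin 4) ℝ) :
    ∑ i, ∑ j, (R * X0 * Rᵀ) i j
        * inner2 (asd (∑ k, R i k • B k)) (asd (∑ k, R j k • B k))
      = ∑ i, ∑ j, X0 i j * inner2 (asd (B i)) (asd (B j)) := by
  let N : Matrix (Fin 3) (Fin 3) ℝ := Matrix.of fun i j => inner2 (asd (B i)) (asd (B j))
  have h1 : ∀ i p q, asd (∑ k, R i k • B k) p q = ∑ k, R i k * asd (B k) p q := by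
    intro i p q
    simp only [asd, Matrix.smul_apply, Matrix.sub_apply, Fin.sum_univ_three,
      Matrix.add_apply, smul_eq_mul]
    fin_cases p <;> fin_cases q <;> simp [star2] <;> ring
  have h2 : ∀ i j, inner2 (asd (∑ k, R i k • B k)) (asd (∑ k, R j k • B k)) = (R * N * Rᵀ) i j := by
    intro i j
    simp only [inner2, h1]
    simp only [Matrix.mul_apply, Matrix.transpose_apply, N, Matrix.of_apply, inner2,
      Fin.sum_univ_three]
    simp only [Finset.mul_sum, Finset.sum_mul, ← Finset.sum_add_distrib]
    exact Finset.sum_congr rfl fun p _ => Finset.sum_congr rfl fun q _ => by ring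
  have htr : ∀ P Q : Matrix (Fin 3) (Fin 3) ℝ, ∑ i, ∑ j, P i j * Q i j = (P * Qᵀ).trace := by
    intro P Q
    simp [Matrix.trace, Matrix.mul_apply]
  simp only [h2]
  change _ = ∑ i, ∑ j, X0 i j * N i j
  rw [htr, htr, transpose_mul, transpose_mul, transpose_transpose]
  calc (R * X0 * Rᵀ * (R * (Nᵀ * Rᵀ))).trace = (R * (X0 * (Rᵀ * R) * Nᵀ) * Rᵀ).trace := by
        simp only [mul_assoc]
    _ = (X0 * Nᵀ).trace := by
        rw [hR, mul_one, trace_mul_comm, ← mul_assoc, hR, one_mul]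

theorem volForm_metricFrame (hΛ : Λ ≠ 0) (hA : IsSO3Connection A) (hdef : IsDefinite oM oE A)
    (v : Fin 4 → TangentSpace (𝓡 4) x) :
    (metricFrame oM oE Λ A x).det v = volForm oM oE Λ A x v := by
  rw [volForm_basis hA (metricFrame oM oE Λ A x) v,
    (isMetricFrame_metricFrame hΛ hA (hdef.posDef x)).vol, mul_one]

/-- The vertical gauge condition says that `Σ_i ∧ (d_A a)^j` is symmetric in `i`, `j`. -/
theorem symm_of_isVertical (hv : IsVertical oM oE Λ A a) (v : Fin 4 → TangentSpace (𝓡 4) x) :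
    (Matrix.of fun i j => wedge22 (Sig oM oE Λ A x i) (dAForm oE A a x j) v)ᵀ
      = Matrix.of fun i j => wedge22 (Sig oM oE Λ A x i) (dAForm oE A a x j) v := by
  have h0 := hv x 0 v
  have h1 := hv x 1 v
  have h2 := hv x 2 v
  simp [Fin.sum_univ_three, eps, Matrix.det_fin_three] at h0 h1 h2
  ext i j
  fin_cases i <;> fin_cases j <;> simp <;> linarith

/-- The second derivative of the Lagrangian in a frame of `E` adapted to `metricFrame`. -/
theorem iteratedDeriv_pleb (hΛ : Λ ≠ 0) (hA : IsSO3Connection A) (hdef : IsDefinite oM oE A)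
    (hsign : HasSignOf oM oE Λ A) (ha : IsSoForm a) (hh : IsHorizontal oM oE Λ A a)
    (hvert : IsVertical oM oE Λ A a) (htr : variationDensity oM oE Λ A a x = 0)
    {v : Fin 4 → TangentSpace (𝓡 4) x} (hv : LinearIndependent ℝ v) :
    iteratedDeriv 2 (fun t => pleb oM oE Λ (shift A a t) x v) 0 = hessianForm oM oE Λ A a x v := by
  obtain ⟨κ, hκ1, hκ⟩ := exists_sign_at (oM := oM) hv
  obtain ⟨e, R, he, hR, hRdet, hrot, hsd⟩ := exists_adapted_fibreFrame hΛ hA hdef hsign x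
  set f := metricFrame oM oE Λ A x with hf
  set ν := volForm oM oE Λ A x v with hν
  have hpos0 := hdef.posDef x
  have hpos := GOf_posDef hA hpos0 he
  obtain ⟨hs, hp, G', h1, h1', h2⟩ := shift_curve (oM := oM) (oE := oE) hA hdef ha he hκ
  have hG0 : GOf (shift A a 0) e v = GOf A e v := by
    ext i j
    rw [GOf_shift hA ha]
    simp [GOf]
  have hYY := (YOf_eq (Λ := Λ) hA hdef he hκ).1
  set Y0 := YOf oM Λ A e with hY0
  have hYs : Y0ᵀ = Y0 := signedRoot_symm hpos
  have hYs' : ∀ i j, Y0 i j = Y0 j i := fun i j => congrFun (congrFun hYs.symm i) j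
  -- wedge products are computed in the adapted frame
  have hw : ∀ {α β : TangentSpace (𝓡 4) x → TangentSpace (𝓡 4) x → ℝ}, IsTwoForm α → IsTwoForm β →
      wedge22 α β v = ν * pf (comps f α) (comps f β) := by
    intro α β hα hβ
    rw [wedge22_basis hα hβ f v, hf, volForm_metricFrame hΛ hA hdef, wedge22_eq_pf]
  have tS := fun i => isTwoForm_SigOf (oM := oM) (Λ := Λ) hA e i
  have tF := fun i => isTwoForm_curvFormOf hA e i
  have tB := fun i => isTwoForm_dAFormOf hA ha e i
  have tQ := fun i => isTwoForm_brFormOf ha he i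
  let m : Matrix (Fin 3) (Fin 3) ℝ := Matrix.of fun i j => sdCoeff (comps f (dAFormOf A a e i)) j
  have hSB : ∀ i j, wedge22 (SigOf oM Λ A e j) (dAFormOf A a e i) v = 2 * ν * m i j := by
    intro i j
    rw [hw (tS j) (tB i), hsd]
    simp only [m, sdCoeff, Matrix.of_apply]
    ring
  have hν0 : ν ≠ 0 := volForm_ne_zero hΛ hA hdef hv
  have hms : ∀ i j, m i j = m j i := by
    have h := wedge_Sig_dA_rotate hΛ hA ha (e := fibreFrame oE x) hpos0 hR hrot v
    have hsym : (Matrix.of fun i j => wedge22 (SigOf oM Λ A e i) (dAFormOf A a e j) v)ᵀ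
        = Matrix.of fun i j => wedge22 (SigOf oM Λ A e i) (dAFormOf A a e j) v := by
      have hs0 := symm_of_isVertical hvert v
      have hs1 : (Matrix.of fun i j => wedge22 (SigOf oM Λ A (fibreFrame oE x) i)
          (dAFormOf A a (fibreFrame oE x) j) v)ᵀ = Matrix.of fun i j =>
          wedge22 (SigOf oM Λ A (fibreFrame oE x) i) (dAFormOf A a (fibreFrame oE x) j) v := hs0
      rw [h, transpose_mul, transpose_mul, transpose_transpose, hs1, mul_assoc]
    intro i j
    have h3 := congrFun (congrFun hsym i) j
    simp only [Matrix.transpose_apply, Matrix.of_apply, hSB] at h3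
    exact (mul_left_cancel₀ (mul_ne_zero two_ne_zero hν0) h3)
  have hmt : m.trace = 0 := by
    have h3 := firstVariation_eq (oE := oE) hΛ hA hdef ha he v
    rw [firstVariation_eq_density hΛ hA hdef ha, htr, zero_mul] at h3
    simp only [hSB, ← Finset.mul_sum] at h3
    exact (mul_eq_zero.mp h3.symm).resolve_left (mul_ne_zero two_ne_zero hν0)
  have hFS : ∀ i, curvFormOf A e i = fun u w => ∑ j, Y0 i j * SigOf oM Λ A e j u w :=
    fun i => funext fun u => funext fun w => curvFormOf_eq hΛ hpos i u w
  have hBF : ∀ i j, wedge22 (dAFormOf A a e i) (curvFormOf A e j) v = 2 * ν * (m * Y0) i j := by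
    intro i j
    rw [wedge22_comm, hFS, wedge22_sum_left, Matrix.mul_apply, Finset.mul_sum]
    refine Finset.sum_congr rfl fun k _ => ?_
    rw [hSB, hYs' j k]
    ring
  have hFB : ∀ i j, wedge22 (curvFormOf A e i) (dAFormOf A a e j) v = 2 * ν * (Y0 * m) i j := by
    intro i j
    rw [hFS, wedge22_sum_left, Matrix.mul_apply, Finset.mul_sum]
    refine Finset.sum_congr rfl fun k _ => ?_
    rw [hSB, hms j k]
    ring
  have hGY : GOf A e v = (2 * ν) • (Y0 * Y0) := by
    have h3 := wedge22_matrix Y0 Y0 (SigOf oM Λ A e) (SigOf oM Λ A e) v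
    have h4 : (Matrix.of fun i j => wedge22 (SigOf oM Λ A e i) (SigOf oM Λ A e j) v)
        = (2 * ν) • (1 : Matrix (Fin 3) (Fin 3) ℝ) := by
      ext i j
      simp [wedge_SigOf hΛ hA hpos0 he, Matrix.one_apply, hν]
    rw [h4, Matrix.mul_smul, mul_one, Matrix.smul_mul, hYs] at h3
    rw [← h3]
    ext i j
    simp only [GOf, Matrix.of_apply, hFS]
  let G2 : Matrix (Fin 3) (Fin 3) ℝ := Matrix.of fun i j =>
    κ * (2 * (wedge22 (curvFormOf A e i) (brFormOf a e j) v
      + wedge22 (dAFormOf A a e i) (dAFormOf A a e j) v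
      + wedge22 (brFormOf a e i) (curvFormOf A e j) v))
  have hmain := iteratedDeriv_two_rootLagrangian (G'' := G2) (μ := κ * ν) (m := m) hΛ hs hp
    (Filter.Eventually.of_forall h1) h2
    (by
      simp only [hG0]
      rw [← hYY, hGY, smul_smul]
      congr 1
      ring)
    (by
      simp only [hG0]
      rw [← hYY]
      ext i j
      rw [h1', hBF, hFB, Matrix.smul_apply, Matrix.add_apply, smul_eq_mul]
      ring) hmt
  have hev : (fun t => pleb oM oE Λ (shift A a t) x v)
      =ᶠ[nhds 0] fun t => κ * rootLagrangian Λ (κ • GOf (shift A a t) e v) := by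
    filter_upwards [hp] with t ht using pleb_shift hΛ hA ha he hκ1 hκ ht
  rw [hev.iteratedDeriv_eq, iteratedDeriv_const_mul_field, hmain]
  simp only [hG0]
  rw [← hYY]
  set X0 := Y0⁻¹ with hX0
  have hXs : X0ᵀ = X0 := by rw [hX0, transpose_nonsing_inv, hYs]
  have hXs' : ∀ i j, X0 i j = X0 j i := fun i j => congrFun (congrFun hXs.symm i) j
  have hu : IsUnit Y0.det := isUnit_det_signedRoot hΛ hpos
  -- the terms with the bracket give `|a|²`
  let aa : Fin 3 → Fin 4 → ℝ := fun i c => aFormOf a e i (f c)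
  have hbr : 2 * ∑ i, pf (sdBasis i) (comps f (brFormOf a e i)) = ∑ i, ∑ c, aa i c ^ 2 := by
    refine sum_pf_bracket (fun i u w => brFormOf_eq ha he i (f u) (f w)) fun p q r => ?_
    have h3 : ∀ u w z, ∑ i, SigOf oM Λ A e i u w * aFormOf a e i z
        = ∑ i, Sig oM oE Λ A x i u w * aForm oE a x i z := by
      intro u w z
      simp only [aFormOf_rotate ha hrot, SigOf_rotate hΛ hA (e := fibreFrame oE x) hpos0 hR hrot]
      exact sum_rotate hR _ _
    have h4 := hh x (f p) (f q) (f r)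
    simp only [wedge21, Finset.sum_add_distrib, ← h3] at h4
    have h5 : ∀ i p q, SigOf oM Λ A e i (f p) (f q) = sdBasis i p q := fun i p q => by
      rw [← hsd]; rfl
    simp only [h5] at h4
    rw [Finset.sum_add_distrib, Finset.sum_add_distrib]
    exact h4
  have hXF : ∀ (q : Fin 3 → TangentSpace (𝓡 4) x → TangentSpace (𝓡 4) x → ℝ),
      ∑ i, ∑ j, X0 i j * wedge22 (curvFormOf A e j) (q i) v
        = ∑ i, wedge22 (SigOf oM Λ A e i) (q i) v := by
    intro q
    refine Finset.sum_congr rfl fun i _ => ?_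
    have hsig : SigOf oM Λ A e i = fun u w => ∑ j, X0 i j * curvFormOf A e j u w := rfl
    rw [hsig, wedge22_sum_left]
  have hBB : ∀ i j, wedge22 (dAFormOf A a e i) (dAFormOf A a e j) v
      = ν * (2 * (m * m) i j - inner2 (asd (comps f (dAFormOf A a e i)))
          (asd (comps f (dAFormOf A a e j)))) := by
    intro i j
    rw [hw (tB i) (tB j), pf_eq_sd_sub_asd ((tB i).comps_skew f) ((tB j).comps_skew f),
      Matrix.mul_apply]
    have h3 : ∑ k, m i k * m k j = ∑ k, sdCoeff (comps f (dAFormOf A a e i)) k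
        * sdCoeff (comps f (dAFormOf A a e j)) k :=
      Finset.sum_congr rfl fun k _ => by rw [hms k j]; rfl
    rw [h3]
  have hT : (X0 * G2).trace = κ * (2 * ν) * (∑ i, ∑ c, aa i c ^ 2 + 2 * (X0 * (m * m)).trace
      - ∑ i, ∑ j, X0 i j * inner2 (asd (comps f (dAFormOf A a e i)))
          (asd (comps f (dAFormOf A a e j)))) := by
    have e1 : (X0 * G2).trace = κ * 2 * (∑ i, ∑ j, X0 i j * wedge22 (curvFormOf A e j) (brFormOf a e i) v
        + ∑ i, ∑ j, X0 i j * wedge22 (dAFormOf A a e j) (dAFormOf A a e i) v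
        + ∑ i, ∑ j, X0 i j * wedge22 (brFormOf a e j) (curvFormOf A e i) v) := by
      simp only [Matrix.trace, Matrix.diag_apply, Matrix.mul_apply, G2, Matrix.of_apply,
        ← Finset.sum_add_distrib, Finset.mul_sum]
      exact Finset.sum_congr rfl fun i _ => Finset.sum_congr rfl fun j _ => by ring
    have e2 : ∑ i, ∑ j, X0 i j * wedge22 (brFormOf a e j) (curvFormOf A e i) v
        = ∑ i, ∑ j, X0 i j * wedge22 (curvFormOf A e j) (brFormOf a e i) v := by
      rw [Finset.sum_comm]
      exact Finset.sum_congr rfl fun i _ => Finset.sum_congr rfl fun j _ => by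
        rw [hXs' j i, wedge22_comm]
    have e3 : ∑ i, ∑ j, X0 i j * wedge22 (dAFormOf A a e j) (dAFormOf A a e i) v
        = ν * (2 * (X0 * (m * m)).trace - ∑ i, ∑ j, X0 i j
          * inner2 (asd (comps f (dAFormOf A a e i))) (asd (comps f (dAFormOf A a e j)))) := by
      have hi : ∀ i j, inner2 (asd (comps f (dAFormOf A a e j))) (asd (comps f (dAFormOf A a e i)))
          = inner2 (asd (comps f (dAFormOf A a e i))) (asd (comps f (dAFormOf A a e j))) := by
        intro i j
        simp only [inner2, mul_comm]
      have hexp : ∀ i j, X0 i j * wedge22 (dAFormOf A a e j) (dAFormOf A a e i) v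
          = ν * (2 * (X0 i j * (m * m) j i)
          - X0 i j * inner2 (asd (comps f (dAFormOf A a e i))) (asd (comps f (dAFormOf A a e j)))) := by
        intro i j
        rw [hBB, hi]
        ring
      simp only [hexp]
      simp only [← Finset.mul_sum, Finset.sum_sub_distrib]
      rfl
    have e4 : ∑ i, wedge22 (SigOf oM Λ A e i) (brFormOf a e i) v
        = ν * ∑ i, pf (sdBasis i) (comps f (brFormOf a e i)) := by
      rw [Finset.mul_sum]
      exact Finset.sum_congr rfl fun i _ => by rw [hw (tS i) (tQ i), hsd]
    rw [e1, e2, e3, hXF, e4, ← hbr]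
    ring
  rw [hT]
  -- back to the reference frame of the fibre
  have hnorm : normSq oM oE Λ A a x = ∑ i, ∑ c, aa i c ^ 2 := by
    rw [normSq, Finset.sum_comm]
    conv_rhs => rw [Finset.sum_comm]
    refine Finset.sum_congr rfl fun c _ => ?_
    simp only [aa, aFormOf_rotate ha hrot, pow_two]
    exact (sum_rotate hR _ _).symm
  have hXrot : X0 = R * X oM oE Λ A x * Rᵀ :=
    XOf_rotate hΛ hA (e := fibreFrame oE x) hpos0 hR hrot
  have hcomp : ∀ i, comps f (dAFormOf A a e i) = ∑ k, R i k • comps f (dAForm oE A a x k) := by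
    intro i
    ext p q
    rw [Matrix.sum_apply]
    exact dAFormOf_rotate hA ha hrot i (f p) (f q)
  have hasd : ∑ i, ∑ j, X0 i j * inner2 (asd (comps f (dAFormOf A a e i)))
          (asd (comps f (dAFormOf A a e j)))
      = ∑ i, ∑ j, X oM oE Λ A x i j
          * inner2 (dAMinus oM oE Λ A a x i) (dAMinus oM oE Λ A a x j) := by
    simp only [hXrot, hcomp]
    exact sum_asd_rotate hR _
  rw [hasd, ← hnorm, hessianForm]
  linear_combination (ν * (normSq oM oE Λ A a x - ∑ i, ∑ j, X oM oE Λ A x i j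
          * inner2 (dAMinus oM oE Λ A a x i) (dAMinus oM oE Λ A a x j))) * hκ1

/-- The second variation formula. -/
theorem hessian_eq [CompactSpace M] (hΛ : Λ ≠ 0) (hA : IsSO3Connection A)
    (hdef : IsDefinite oM oE A) (hsign : HasSignOf oM oE Λ A) (hcrit : IsCritical oM oE Λ A)
    (ha : IsSoForm a) (hh : IsHorizontal oM oE Λ A a) (hvert : IsVertical oM oE Λ A a) :
    hessian oM oE Λ A a = integralForm oM (hessianForm oM oE Λ A a) := by
  rw [(action_shift hΛ hA hdef ha).2.2]
  exact integralForm_congr fun i y hy => iteratedDeriv_pleb hΛ hA hdef hsign ha hh hvert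
    (variationDensity_eq_zero hΛ hA hdef hcrit ha hh _) (linearIndependent_coordFrame hy)

end Second

/-! ### The algebra of the torsion equations -/

section TorsionAlgebra

variable {α : Fin 4 → Fin 3 → ℝ} {γ : Fin 4 → Fin 4 → Fin 4 → ℝ}

/-- The components of `d_A b` in an adapted frame for the 1-form `b` whose components are
`b^i(f_r) = s_i Σ_i(f_d, f_r)` with constant `s`. -/
def contractedVariation (α : Fin 4 → Fin 3 → ℝ) (γ : Fin 4 → Fin 4 → Fin 4 → ℝ) (s : Fin 3 → ℝ)
    (d : Fin 4) (i : Fin 3) : Matrix (Fin 4) (Fin 4) ℝ :=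
  Matrix.of fun p r => -∑ c, (γ p r c - γ r p c) * (s i * sdBasis i d c)
    + (α p (i + 2) * (s (i + 1) * sdBasis (i + 1) d r)
      - α p (i + 1) * (s (i + 2) * sdBasis (i + 2) d r))
    - (α r (i + 2) * (s (i + 1) * sdBasis (i + 1) d p)
      - α r (i + 1) * (s (i + 2) * sdBasis (i + 2) d p))

/-- One of the three cyclic summands of the second Bianchi identity for `F^i = Y_{ij} Σ_j` in an
adapted frame; `dY p` is the derivative of `Y` along the `p`-th frame vector. -/
def bianchiTerm (α : Fin 4 → Fin 3 → ℝ) (γ : Fin 4 → Fin 4 → Fin 4 → ℝ)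
    (Y : Matrix (Fin 3) (Fin 3) ℝ) (dY : Fin 4 → Matrix (Fin 3) (Fin 3) ℝ) (i : Fin 3)
    (p q r : Fin 4) : ℝ :=
  ∑ j, dY p i j * sdBasis j q r - ∑ c, (γ p q c - γ q p c) * ∑ j, Y i j * sdBasis j c r
    + (α p (i + 2) * ∑ j, Y (i + 1) j * sdBasis j q r
      - α p (i + 1) * ∑ j, Y (i + 2) j * sdBasis j q r)

/-- The difference between the connection on `E`, with coefficients `α`, and the connection which the
connection on the tangent bundle, with coefficients `γ`, induces on self-dual forms. -/
def selfDualDiff (α : Fin 4 → Fin 3 → ℝ) (γ : Fin 4 → Fin 4 → Fin 4 → ℝ) (j : Fin 3) (c : Fin 4) :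
    ℝ :=
  α c j + ![γ c 0 1 + γ c 2 3, γ c 0 2 - γ c 1 3, γ c 0 3 + γ c 1 2] j

/-- The Euler–Lagrange equations, tested with `b^i = s_i Σ_i(f_d, ·)` for trace-free `s`, leave only
four free components of `selfDualDiff`. -/
theorem selfDualDiff_of_variation (hγ : ∀ c a b, γ c a b = -γ c b a)
    (hEL : ∀ s : Fin 3 → ℝ, ∑ i, s i = 0 → ∀ d,
      ∑ i, pf (sdBasis i) (contractedVariation α γ s d i) = 0) :
    let τ := selfDualDiff α γ
    (τ 0 1 = τ 1 2 ∧ τ 1 2 = τ 2 3) ∧ (τ 1 3 = τ 0 0 ∧ τ 2 2 = -τ 1 3) ∧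
      (τ 1 0 = -τ 0 3 ∧ τ 1 0 = τ 2 1) ∧ (τ 1 1 = -τ 0 2 ∧ τ 2 0 = -τ 1 1) := by
  have hd : ∀ c a, γ c a a = 0 := fun c a => by linarith [hγ c a a]
  have w10 := fun c => hγ c 1 0
  have w20 := fun c => hγ c 2 0
  have w30 := fun c => hγ c 3 0
  have w21 := fun c => hγ c 2 1
  have w31 := fun c => hγ c 3 1
  have w32 := fun c => hγ c 3 2
  -- a basis of the trace-free diagonals `s`
  have u : ∑ i, (![1, -1, 0] : Fin 3 → ℝ) i = 0 := by simp [Fin.sum_univ_three]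
  have v : ∑ i, (![0, 1, -1] : Fin 3 → ℝ) i = 0 := by simp [Fin.sum_univ_three]
  have u0 := hEL _ u 0
  have u1 := hEL _ u 1
  have u2 := hEL _ u 2
  have u3 := hEL _ u 3
  have v0 := hEL _ v 0
  have v1 := hEL _ v 1
  have v2 := hEL _ v 2
  have v3 := hEL _ v 3
  simp [pf, contractedVariation, Fin.sum_univ_three, Fin.sum_univ_four, sdBasis, skewOf_entries, hd,
    w10, w20, w30, w21, w31, w32] at u0 u1 u2 u3 v0 v1 v2 v3
  simp only [selfDualDiff, Matrix.cons_val_zero, Matrix.cons_val_one, Matrix.cons_val]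
  refine ⟨⟨?_, ?_⟩, ⟨?_, ?_⟩, ⟨?_, ?_⟩, ⟨?_, ?_⟩⟩ <;> linarith

/-- If `tr Y` is a nonzero constant, the Euler–Lagrange equations and the second Bianchi identity
force the connection on `E` to be the one induced on self-dual forms. -/
theorem selfDualDiff_eq_zero {Y : Matrix (Fin 3) (Fin 3) ℝ} {dY : Fin 4 → Matrix (Fin 3) (Fin 3) ℝ}
    (hγ : ∀ c a b, γ c a b = -γ c b a)
    (hEL : ∀ s : Fin 3 → ℝ, ∑ i, s i = 0 → ∀ d,
      ∑ i, pf (sdBasis i) (contractedVariation α γ s d i) = 0)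
    (hB : ∀ i p q r, bianchiTerm α γ Y dY i p q r + bianchiTerm α γ Y dY i q r p
      + bianchiTerm α γ Y dY i r p q = 0)
    (hYs : ∀ i j, Y i j = Y j i) (hdYs : ∀ p i j, dY p i j = dY p j i) (hY : Y.trace ≠ 0)
    (hdY : ∀ p, (dY p).trace = 0) (j : Fin 3) (c : Fin 4) : selfDualDiff α γ j c = 0 := by
  obtain ⟨⟨e1, e2⟩, ⟨e3, e4⟩, ⟨e5, e6⟩, ⟨e7, e8⟩⟩ := selfDualDiff_of_variation hγ hEL
  have hd : ∀ c a, γ c a a = 0 := fun c a => by linarith [hγ c a a]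
  have w10 := fun c => hγ c 1 0
  have w20 := fun c => hγ c 2 0
  have w30 := fun c => hγ c 3 0
  have w21 := fun c => hγ c 2 1
  have w31 := fun c => hγ c 3 1
  have w32 := fun c => hγ c 3 2
  have y10 := hYs 1 0
  have y20 := hYs 2 0
  have y21 := hYs 2 1
  have d10 := fun p => hdYs p 1 0
  have d20 := fun p => hdYs p 2 0
  have d21 := fun p => hdYs p 2 1
  have hd0 := hdY 0
  have hd1 := hdY 1
  have hd2 := hdY 2
  have hd3 := hdY 3
  simp only [Matrix.trace, Matrix.diag, Fin.sum_univ_three] at hd0 hd1 hd2 hd3 hY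
  simp only [selfDualDiff, Matrix.cons_val_zero, Matrix.cons_val_one, Matrix.cons_val]
    at e1 e2 e3 e4 e5 e6 e7 e8
  -- In each of the four cases three components of the Bianchi identity combine, modulo the
  -- relations `e1`, …, `e8`, to `tr Y` times a free component of `selfDualDiff`: the derivatives of
  -- the off-diagonal entries of `Y` cancel, and those of the diagonal entries add up to `d (tr Y)`.
  have k0 : selfDualDiff α γ 0 1 = 0 := by
    have c0 := hB 0 0 2 3
    have c1 := hB 1 0 1 3
    have c2 := hB 2 0 1 2
    simp [bianchiTerm, Fin.sum_univ_three, Fin.sum_univ_four, sdBasis, skewOf_entries, hd,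
      w10, w20, w30, w21, w31, w32, y10, y20, y21, d10, d20, d21] at c0 c1 c2
    refine (mul_eq_zero.mp ?_).resolve_right hY
    simp only [selfDualDiff, Matrix.cons_val_zero]
    linear_combination (1/2) * c0 + (-1/2) * c1 + (1/2) * c2 + (-1/2) * hd0 + (1) * Y 0 0 * e1
      + (1/2) * Y 0 0 * e2 + (1/2) * Y 0 1 * e7 + (1/2) * Y 0 2 * e5 + (-1/2) * Y 0 2 * e6
      + (1/2) * Y 1 1 * e1 + (1/2) * Y 1 1 * e2 + (1/2) * Y 1 2 * e4 + (1/2) * Y 2 2 * e1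
  have k1 : selfDualDiff α γ 1 3 = 0 := by
    have c0 := hB 0 1 2 3
    have c1 := hB 1 0 1 2
    have c2 := hB 2 0 1 3
    simp [bianchiTerm, Fin.sum_univ_three, Fin.sum_univ_four, sdBasis, skewOf_entries, hd,
      w10, w20, w30, w21, w31, w32, y10, y20, y21, d10, d20, d21] at c0 c1 c2
    refine (mul_eq_zero.mp ?_).resolve_right hY
    simp only [selfDualDiff, Matrix.cons_val_zero, Matrix.cons_val_one]
    linear_combination (-1/2) * c0 + (1/2) * c1 + (1/2) * c2 + (1/2) * hd1 + (1/2) * Y 0 0 * e4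
      + (1/2) * Y 0 1 * e5 + (-1/2) * Y 0 2 * e7 + (1/2) * Y 0 2 * e8 + (1/2) * Y 1 1 * e3
      + (1/2) * Y 1 1 * e4 + (-1/2) * Y 1 2 * e2 + (1/2) * Y 2 2 * e3
  have k2 : selfDualDiff α γ 1 0 = 0 := by
    have c0 := hB 0 0 1 2
    have c1 := hB 1 1 2 3
    have c2 := hB 2 0 2 3
    simp [bianchiTerm, Fin.sum_univ_three, Fin.sum_univ_four, sdBasis, skewOf_entries, hd,
      w10, w20, w30, w21, w31, w32, y10, y20, y21, d10, d20, d21] at c0 c1 c2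
    refine (mul_eq_zero.mp ?_).resolve_right hY
    simp only [selfDualDiff, Matrix.cons_val_zero, Matrix.cons_val_one]
    linear_combination (-1/2) * c0 + (-1/2) * c1 + (1/2) * c2 + (1/2) * hd2 + (1/2) * Y 0 0 * e6
      + (-1/2) * Y 0 1 * e3 + (1/2) * Y 0 2 * e1 + (1/2) * Y 0 2 * e2 + (1/2) * Y 1 1 * e5
      + (1/2) * Y 1 1 * e6 + (1/2) * Y 1 2 * e8 + (1/2) * Y 2 2 * e5
  have k3 : selfDualDiff α γ 1 1 = 0 := by
    have c0 := hB 0 0 1 3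
    have c1 := hB 1 0 2 3
    have c2 := hB 2 1 2 3
    simp [bianchiTerm, Fin.sum_univ_three, Fin.sum_univ_four, sdBasis, skewOf_entries, hd,
      w10, w20, w30, w21, w31, w32, y10, y20, y21, d10, d20, d21] at c0 c1 c2
    refine (mul_eq_zero.mp ?_).resolve_right hY
    simp only [selfDualDiff, Matrix.cons_val_zero, Matrix.cons_val_one]
    linear_combination (1/2) * c0 + (1/2) * c1 + (1/2) * c2 + (-1/2) * hd3 + (1/2) * Y 0 0 * e8
      + (1/2) * Y 0 1 * e1 + (1/2) * Y 0 2 * e3 + (-1/2) * Y 0 2 * e4 + (1/2) * Y 1 1 * e7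
      + (1/2) * Y 1 1 * e8 + (-1/2) * Y 1 2 * e6 + (1/2) * Y 2 2 * e7
  have z := selfDualDiff_of_variation hγ hEL
  simp only [k0, k1, k2, k3] at z
  obtain ⟨⟨z1, z2⟩, ⟨z3, z4⟩, ⟨z5, z6⟩, ⟨z7, z8⟩⟩ := z
  rw [← z1] at z2
  have z9 := neg_eq_zero.mp z5.symm
  have z10 := neg_eq_zero.mp z7.symm
  rw [neg_zero] at z4 z8
  fin_cases j <;> fin_cases c <;>
    first | assumption | (symm; assumption)

end TorsionAlgebra

/-! ### Structure equations in smooth frames -/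

section Structure

variable {M : Type*} [TopologicalSpace M] [ChartedSpace R4 M] [IsManifold (𝓡 4) ∞ M] [T2Space M]
  {E : M → Type*} [∀ x, NormedAddCommGroup (E x)] [∀ x, InnerProductSpace ℝ (E x)]
  [TopologicalSpace (TotalSpace R3 E)] [FiberBundle R3 E] [VectorBundle ℝ R3 E]
  [ContMDiffVectorBundle ∞ R3 E (𝓡 4)] [IsContMDiffRiemannianBundle (𝓡 4) ∞ R3 E]
  {A : CovariantDerivative (𝓡 4) R3 E}
  {a : (x : M) → E x →L[ℝ] TangentSpace (𝓡 4) x →L[ℝ] E x} {x : M}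
  {oM : ManifoldOrientation M} {oE : FibreOrientation E} {Λ : ℝ}
  {e : Fin 3 → (y : M) → E y} {s : (y : M) → E y}
  {U V W : (y : M) → TangentSpace (𝓡 4) y}

/-- The connection 1-forms `α^j` of `A` in the frame `e`: `∇ e_i = ε_{ijk} α^j e_k`. -/
def connForm (A : CovariantDerivative (𝓡 4) R3 E) (e : Fin 3 → (y : M) → E y) (x : M) (j : Fin 3)
    (u : TangentSpace (𝓡 4) x) : ℝ :=
  inner ℝ (A (e (j + 2)) x u) (e (j + 1) x)

theorem covariant_frame (hA : IsSO3Connection A) (he : IsOrthoFrame e x) (j : Fin 3)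
    (u : TangentSpace (𝓡 4) x) :
    A (e j) x u = connForm A e x (j + 1) u • e (j + 2) x - connForm A e x (j + 2) u • e (j + 1) x := by
  have hee : ∀ i k, (inner ℝ (e i x) (e k x) : ℝ) = if i = k then 1 else 0 :=
    orthonormal_iff_ite.mp he.ortho.self_of_nhds
  have hskew : ∀ i k, (inner ℝ (A (e i) x u) (e k x) : ℝ) + inner ℝ (e i x) (A (e k) x u) = 0 := by
    intro i k
    rw [← mvfderiv_inner hA (he.smooth i) (he.smooth k)]
    have h : (fun y => (inner ℝ (e i y) (e k y) : ℝ)) =ᶠ[nhds x] fun _ => if i = k then 1 else 0 := by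
      filter_upwards [he.ortho] with y hy
      exact orthonormal_iff_ite.mp hy i k
    rw [mvfderiv_congr h, mvfderiv_const]
    simp
  have h0 : (inner ℝ (e j x) (A (e j) x u) : ℝ) = 0 := by
    have := hskew j j
    rw [real_inner_comm] at this
    linarith
  have h1 : (inner ℝ (e (j + 1) x) (A (e j) x u) : ℝ) = -connForm A e x (j + 2) u := by
    have := hskew (j + 1) j
    have h2 : connForm A e x (j + 2) u = inner ℝ (A (e (j + 1)) x u) (e j x) := by
      fin_cases j <;> rfl
    rw [h2]
    linarith
  have h2 : (inner ℝ (e (j + 2) x) (A (e j) x u) : ℝ) = connForm A e x (j + 1) u := by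
    rw [real_inner_comm]
    fin_cases j <;> rfl
  have hsum : ∀ g : Fin 3 → E x, ∑ i, g i = g j + g (j + 1) + g (j + 2) := by
    intro g
    rw [Fin.sum_univ_three]
    fin_cases j <;> simp <;> abel
  conv_lhs => rw [sum_inner_smul he.ortho.self_of_nhds (finrank_fibre x) (A (e j) x u)]
  rw [hsum, h0, h1, h2]
  module

/-- The components of the covariant derivative of a skew endomorphism. -/
theorem mvfderiv_soCompOf (hA : IsSO3Connection A) (he : IsOrthoFrame e x)
    {B : (y : M) → E y → E y} (hB : IsSkewEnd (B x))
    (hs : ∀ i, SmoothNear R3 (fun y => B y (e i y)) x) (j : Fin 3) (u : TangentSpace (𝓡 4) x) :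
    inner ℝ (A (fun y => B y (e (j + 2) y)) x u - B x (A (e (j + 2)) x u)) (e (j + 1) x)
      = mvfderiv (𝓡 4) (fun y => soCompOf (fun k => e k y) (B y) j) x u
        + (connForm A e x (j + 2) u * soCompOf (fun k => e k x) (B x) (j + 1)
          - connForm A e x (j + 1) u * soCompOf (fun k => e k x) (B x) (j + 2)) := by
  have h := mvfderiv_inner hA (hs (j + 2)) (he.smooth (j + 1)) u
  have hd : mvfderiv (𝓡 4) (fun y => soCompOf (fun k => e k y) (B y) j) x u = _ := h
  rw [hd, inner_sub_left, covariant_frame hA he (j + 1), covariant_frame hA he (j + 2)]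
  have hl : ∀ (c d : ℝ) (p q : E x), B x (c • p - d • q) = c • B x p - d • B x q := by
    intro c d p q
    rw [hB.lin.map_sub, hB.lin.map_smul, hB.lin.map_smul]
  rw [hl]
  simp only [inner_sub_left, inner_sub_right, inner_smul_left, inner_smul_right, conj_trivial,
    soCompOf]
  have hsk : ∀ i k, (inner ℝ (B x (e i x)) (e k x) : ℝ) = -inner ℝ (B x (e k x)) (e i x) := by
    intro i k
    rw [hB.skew, real_inner_comm]
  have hdiag : ∀ i, (inner ℝ (B x (e i x)) (e i x) : ℝ) = 0 := fun i => by linarith [hsk i i]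
  have e1 := hsk 1 0
  have e2 := hsk 2 0
  have e3 := hsk 2 1
  fin_cases j <;> simp [hdiag] <;> simp only [e1, e2, e3] <;> ring

/-- `d_A a` may be computed with any smooth extensions. -/
theorem dA_eq (hA : IsSO3Connection A) (ha : IsSoForm a) (hs : SmoothNear R3 s x)
    (hU : SmoothNear R4 U x) (hW : SmoothNear R4 W x) :
    dA A a x (U x) (W x) (s x) = (A (fun y => a y (s y) (W y)) x (U x) - a x (A s x (U x)) (W x))
      - (A (fun y => a y (s y) (U y)) x (W x) - a x (A s x (W x)) (U x))
      - a x (s x) (VectorField.mlieBracket (𝓡 4) U W x) := by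
  have h : ∀ (c : ℝ) {W : (y : M) → TangentSpace (𝓡 4) y}, SmoothNear R4 W x →
      ∀ u, A (fun y => shift A a c s y (W y)) x u = A (fun y => A s y (W y)) x u
        + c • A (fun y => a y (s y) (W y)) x u := by
    intro c W hW u
    have h1 := hs.soForm ha hW
    have h2 := h1.smul (FSmoothNear.const c)
    have h3 : (fun y => shift A a c s y (W y)) = (fun y => A s y (W y))
        + ((fun _ : M => c) • (fun y => a y (s y) (W y))) := by
      funext y; rfl
    rw [h3, covariant_add (hs.covariant hA.smooth hW) h2, add_apply,
      covariant_smul (FSmoothNear.const c) h1, mvfderiv_const]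
    simp
  have haux : ∀ (p q : E x) (c : ℝ) (w : TangentSpace (𝓡 4) x),
      a x (p + c • q) w = a x p w + c • a x q w := by
    intro p q c w
    rw [(a x).map_add, (a x).map_smul]
    rfl
  rw [dA_eq_curvature hA ha, curvature_eq_curvOp (hA.shift ha 1).smooth hs hU hW,
    curvature_eq_curvOp (hA.shift ha (-1)).smooth hs hU hW]
  simp only [curvOp, shift_apply]
  have h1 := h 1 hW (U x)
  have h2 := h 1 hU (W x)
  have h3 := h (-1) hW (U x)
  have h4 := h (-1) hU (W x)
  simp only [shift_apply] at h1 h2 h3 h4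
  rw [h1, h2, h3, h4]
  simp only [haux]
  module

theorem dAFormOf_structure (hA : IsSO3Connection A) (ha : IsSoForm a) (he : IsOrthoFrame e x)
    (hU : SmoothNear R4 U x) (hW : SmoothNear R4 W x) (i : Fin 3) :
    dAFormOf A a (fun k => e k x) i (U x) (W x)
      = mvfderiv (𝓡 4) (fun y => aFormOf a (fun k => e k y) i (W y)) x (U x)
        - mvfderiv (𝓡 4) (fun y => aFormOf a (fun k => e k y) i (U y)) x (W x)
        - aFormOf a (fun k => e k x) i (VectorField.mlieBracket (𝓡 4) U W x)
        + (connForm A e x (i + 2) (U x) * aFormOf a (fun k => e k x) (i + 1) (W x)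
          - connForm A e x (i + 1) (U x) * aFormOf a (fun k => e k x) (i + 2) (W x))
        - (connForm A e x (i + 2) (W x) * aFormOf a (fun k => e k x) (i + 1) (U x)
          - connForm A e x (i + 1) (W x) * aFormOf a (fun k => e k x) (i + 2) (U x)) := by
  have h1 := mvfderiv_soCompOf hA he (B := fun y s => a y s (W y)) (isSkewEnd_soForm ha _)
    (fun k => (he.smooth k).soForm ha hW) i (U x)
  have h2 := mvfderiv_soCompOf hA he (B := fun y s => a y s (U y)) (isSkewEnd_soForm ha _)
    (fun k => (he.smooth k).soForm ha hU) i (W x)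
  have h3 : dAFormOf A a (fun k => e k x) i (U x) (W x) = _ :=
    congrArg (fun z => (inner ℝ z (e (i + 1) x) : ℝ)) (dA_eq hA ha (he.smooth (i + 2)) hU hW)
  rw [h3]
  simp only [inner_sub_left] at h1 h2 ⊢
  simp only [aFormOf]
  have h4 : soCompOf (fun k => e k x) (fun s => a x s (VectorField.mlieBracket (𝓡 4) U W x)) i
    = inner ℝ (a x (e (i + 2) x) (VectorField.mlieBracket (𝓡 4) U W x)) (e (i + 1) x) := rfl
  rw [h4]
  linarith

theorem mlieBracket_jacobi (hU : SmoothNear R4 U x) (hV : SmoothNear R4 V x)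
    (hW : SmoothNear R4 W x) :
    VectorField.mlieBracket (𝓡 4) (VectorField.mlieBracket (𝓡 4) U V) W x
      + VectorField.mlieBracket (𝓡 4) (VectorField.mlieBracket (𝓡 4) V W) U x
      + VectorField.mlieBracket (𝓡 4) (VectorField.mlieBracket (𝓡 4) W U) V x = 0 := by
  have : IsManifold (𝓡 4) (minSmoothness ℝ 3) M :=
    IsManifold.of_le (n := ∞) (by
      rw [minSmoothness_of_isRCLikeNormedField]
      exact WithTop.coe_le_coe.mpr (le_top : (3 : ℕ∞) ≤ ⊤))
  have h := VectorField.leibniz_identity_mlieBracket_apply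
    (hU.at_self.of_le minSmoothness_two_le_infty) (hV.at_self.of_le minSmoothness_two_le_infty)
    (hW.at_self.of_le minSmoothness_two_le_infty)
  rw [VectorField.mlieBracket_swap_apply (V := VectorField.mlieBracket (𝓡 4) V W),
    VectorField.mlieBracket_swap_apply (V := VectorField.mlieBracket (𝓡 4) W U),
    VectorField.mlieBracket_swap (V := W) (W := U), h]
  have hn : VectorField.mlieBracket (𝓡 4) V (-VectorField.mlieBracket (𝓡 4) U W) x
      = - VectorField.mlieBracket (𝓡 4) V (VectorField.mlieBracket (𝓡 4) U W) x := by
    have := VectorField.mlieBracket_const_smul_right (V := V) (c := (-1 : ℝ)) (I := 𝓡 4)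
      (hU.mlieBracket hW).mdiff
    simpa using this
  rw [hn]
  abel

theorem curvature_section (hA : IsSO3Connection A) (hs : SmoothNear R3 s x)
    (hV : SmoothNear R4 V x) (hW : SmoothNear R4 W x) (u : TangentSpace (𝓡 4) x) :
    A (fun y => curvature A y (V y) (W y) (s y)) x u
      = A (fun y => A (fun z => A s z (W z)) y (V y)) x u
        - A (fun y => A (fun z => A s z (V z)) y (W y)) x u
        - A (fun y => A s y (VectorField.mlieBracket (𝓡 4) V W y)) x u := by
  have hVW := (hs.covariant hA.smooth hW).covariant hA.smooth hV
  have hWV := (hs.covariant hA.smooth hV).covariant hA.smooth hW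
  have hB := hs.covariant hA.smooth (hV.mlieBracket hW)
  have h : ∀ᶠ y in nhds x, curvature A y (V y) (W y) (s y)
      = ((fun y => A (fun z => A s z (W z)) y (V y)) - (fun y => A (fun z => A s z (V z)) y (W y))
        - (fun y => A s y (VectorField.mlieBracket (𝓡 4) V W y))) y := by
    filter_upwards [hs.eventually, hV.eventually, hW.eventually] with y h1 h2 h3
    rw [curvature_eq_curvOp hA.smooth h1 h2 h3]
    rfl
  rw [covariant_congr ((hVW.sub hWV).sub hB) h, covariant_sub (hVW.sub hWV) hB,
    covariant_sub hVW hWV]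
  rfl

/-- The second Bianchi identity, in terms of smooth sections. -/
theorem curvature_bianchi (hA : IsSO3Connection A) (hs : SmoothNear R3 s x)
    (hU : SmoothNear R4 U x) (hV : SmoothNear R4 V x) (hW : SmoothNear R4 W x) :
    (A (fun y => curvature A y (V y) (W y) (s y)) x (U x)
        - curvature A x (V x) (W x) (A s x (U x))
        - curvature A x (VectorField.mlieBracket (𝓡 4) U V x) (W x) (s x))
      + (A (fun y => curvature A y (W y) (U y) (s y)) x (V x)
        - curvature A x (W x) (U x) (A s x (V x))
        - curvature A x (VectorField.mlieBracket (𝓡 4) V W x) (U x) (s x))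
      + (A (fun y => curvature A y (U y) (V y) (s y)) x (W x)
        - curvature A x (U x) (V x) (A s x (W x))
        - curvature A x (VectorField.mlieBracket (𝓡 4) W U x) (V x) (s x)) = 0 := by
  have hc := fun {Z : (y : M) → TangentSpace (𝓡 4) y} (hZ : SmoothNear R4 Z x) =>
    hs.covariant hA.smooth hZ
  have hj := congrArg (A s x) (mlieBracket_jacobi hU hV hW)
  simp only [map_add, map_zero] at hj
  rw [curvature_section hA hs hV hW, curvature_section hA hs hW hU, curvature_section hA hs hU hV,
    curvature_eq_curvOp hA.smooth (hc hU) hV hW, curvature_eq_curvOp hA.smooth (hc hV) hW hU,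
    curvature_eq_curvOp hA.smooth (hc hW) hU hV,
    curvature_eq_curvOp hA.smooth hs (hU.mlieBracket hV) hW,
    curvature_eq_curvOp hA.smooth hs (hV.mlieBracket hW) hU,
    curvature_eq_curvOp hA.smooth hs (hW.mlieBracket hU) hV]
  simp only [curvOp]
  have hj' : A s x (VectorField.mlieBracket (𝓡 4) (VectorField.mlieBracket (𝓡 4) U V) W x)
    = - (A s x (VectorField.mlieBracket (𝓡 4) (VectorField.mlieBracket (𝓡 4) V W) U x)
      + A s x (VectorField.mlieBracket (𝓡 4) (VectorField.mlieBracket (𝓡 4) W U) V x)) := by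
    rw [eq_neg_iff_add_eq_zero, ← hj]
    abel
  rw [hj']
  abel

/-- The second Bianchi identity for the components `F^i`. -/
theorem curvFormOf_bianchi (hA : IsSO3Connection A) (he : IsOrthoFrame e x)
    (hU : SmoothNear R4 U x) (hV : SmoothNear R4 V x) (hW : SmoothNear R4 W x) (i : Fin 3) :
    let F := fun y => curvFormOf A (fun k => e k y)
    let T := fun U V W : (y : M) → TangentSpace (𝓡 4) y =>
      mvfderiv (𝓡 4) (fun y => F y i (V y) (W y)) x (U x)
        - F x i (VectorField.mlieBracket (𝓡 4) U V x) (W x)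
        + (connForm A e x (i + 2) (U x) * F x (i + 1) (V x) (W x)
          - connForm A e x (i + 1) (U x) * F x (i + 2) (V x) (W x))
    T U V W + T V W U + T W U V = 0 := by
  intro F T
  have key : ∀ {U V W : (y : M) → TangentSpace (𝓡 4) y}, SmoothNear R4 U x → SmoothNear R4 V x →
      SmoothNear R4 W x → inner ℝ (A (fun y => curvature A y (V y) (W y) (e (i + 2) y)) x (U x)
        - curvature A x (V x) (W x) (A (e (i + 2)) x (U x))
        - curvature A x (VectorField.mlieBracket (𝓡 4) U V x) (W x) (e (i + 2) x)) (e (i + 1) x)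
      = T U V W := by
    intro U V W hU hV hW
    have h1 := mvfderiv_soCompOf hA he (B := fun y => curvature A y (V y) (W y))
      (isSkewEnd_curvature hA _ _) (fun k => (he.smooth k).curvature hA hV hW) i (U x)
    rw [inner_sub_left, h1]
    simp only [T, F, curvFormOf]
    have h4 : soCompOf (fun k => e k x)
        (curvature A x (VectorField.mlieBracket (𝓡 4) U V x) (W x)) i = inner ℝ
        (curvature A x (VectorField.mlieBracket (𝓡 4) U V x) (W x) (e (i + 2) x)) (e (i + 1) x) := rfl
    rw [h4]
    ring
  rw [← key hU hV hW, ← key hV hW hU, ← key hW hU hV, ← inner_add_left, ← inner_add_left,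
    curvature_bianchi hA (he.smooth _) hU hV hW, inner_zero_left]

end Structure

/-! ### Test forms supported near a point -/

section TestForms

variable {M : Type*} [TopologicalSpace M] [ChartedSpace R4 M] [IsManifold (𝓡 4) ∞ M] [T2Space M]
  {E : M → Type*} [∀ x, NormedAddCommGroup (E x)] [∀ x, InnerProductSpace ℝ (E x)]
  [TopologicalSpace (TotalSpace R3 E)] [FiberBundle R3 E] [VectorBundle ℝ R3 E]
  [ContMDiffVectorBundle ∞ R3 E (𝓡 4)] [IsContMDiffRiemannianBundle (𝓡 4) ∞ R3 E]
  {A : CovariantDerivative (𝓡 4) R3 E}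
  {a : (x : M) → E x →L[ℝ] TangentSpace (𝓡 4) x →L[ℝ] E x} {x : M}
  {oM : ManifoldOrientation M} {oE : FibreOrientation E} {Λ : ℝ}
  {e : Fin 3 → (y : M) → E y} {f : Fin 4 → (y : M) → TangentSpace (𝓡 4) y}

instance (x : M) : T2Space (TangentSpace (𝓡 4) x) := inferInstanceAs (T2Space R4)

theorem IsTwoForm.add_right {V : Type*} [AddCommGroup V] [Module ℝ V] {β : V → V → ℝ}
    (h : IsTwoForm β) (u v w : V) : β u (v + w) = β u v + β u w := by
  rw [h.swap, h.add, h.swap v, h.swap w]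
  ring

theorem IsTwoForm.smul_right {V : Type*} [AddCommGroup V] [Module ℝ V] {β : V → V → ℝ}
    (h : IsTwoForm β) (c : ℝ) (u v : V) : β u (c • v) = c * β u v := by
  rw [h.swap, h.smul, h.swap v]
  ring

theorem eq_sum_smulRight (L : R3 →L[ℝ] R4 →L[ℝ] R3) :
    L = ∑ k, ∑ l, (EuclideanSpace.proj k : R3 →L[ℝ] ℝ).smulRight
      ((EuclideanSpace.proj l : R4 →L[ℝ] ℝ).smulRight
        (L (EuclideanSpace.single k 1) (EuclideanSpace.single l 1))) := by
  ext v w i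
  have hv : v = ∑ k, v k • EuclideanSpace.single k (1 : ℝ) := by
    ext j
    simp [Finset.sum_apply, Pi.single_apply]
  have hw : w = ∑ k, w k • EuclideanSpace.single k (1 : ℝ) := by
    ext j
    simp [Finset.sum_apply, Pi.single_apply]
  conv_lhs => rw [hv, hw]
  simp only [map_sum, map_smul, _root_.sum_apply, _root_.smul_apply,
    ContinuousLinearMap.smulRight_apply, Finset.smul_sum]
  rw [Finset.sum_comm]
  refine congrArg (fun z : R3 => z i) (Finset.sum_congr rfl fun k _ => Finset.sum_congr rfl fun l _ => ?_)
  rw [smul_comm]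
  rfl

theorem contMDiffAt_smulRight {F G : Type*} [NormedAddCommGroup F] [NormedSpace ℝ F]
    [NormedAddCommGroup G] [NormedSpace ℝ G] (p : F →L[ℝ] ℝ) {g : M → G}
    (hg : ContMDiffAt (𝓡 4) 𝓘(ℝ, G) ∞ g x) :
    ContMDiffAt (𝓡 4) 𝓘(ℝ, F →L[ℝ] G) ∞ (fun y => p.smulRight (g y)) x :=
  (ContinuousLinearMap.smulRightL ℝ F G p).contDiff.contMDiff.contMDiffAt.comp x hg

/-- A section of `Hom(E, Hom(TM, E))` is smooth if it takes smooth sections and vector fields to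
smooth sections. -/
theorem contMDiffAt_of_apply
    (h : ∀ (s : (y : M) → E y) (V : (y : M) → TangentSpace (𝓡 4) y), SmoothNear R3 s x →
      SmoothNear R4 V x → SmoothNear R3 (fun y => a y (s y) (V y)) x) :
    ContMDiffAt (𝓡 4) ((𝓡 4).prod 𝓘(ℝ, R3 →L[ℝ] (R4 →L[ℝ] R3))) ∞
      (fun x => TotalSpace.mk' (R3 →L[ℝ] (R4 →L[ℝ] R3))
        (E := fun x => E x →L[ℝ] TangentSpace (𝓡 4) x →L[ℝ] E x) x (a x)) x := by
  rw [contMDiffAt_hom_bundle]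
  refine ⟨contMDiffAt_id, ?_⟩
  let sE : R3 → (y : M) → E y := fun v y => (trivializationAt R3 E x).symm y v
  let sT : R4 → (y : M) → TangentSpace (𝓡 4) y := fun w y =>
    (trivializationAt R4 (fun y : M => TangentSpace (𝓡 4) y) x).symm y w
  have hE : ∀ v, SmoothNear R3 (sE v) x := by
    intro v
    have h1 := smoothNear_extend (F := R3) ((trivializationAt R3 E x).symm x v)
    have h2 : (FiberBundle.extend R3 ((trivializationAt R3 E x).symm x v) : (y : M) → E y)
        = sE v := by
      funext y
      simp only [FiberBundle.extend, sE]
      rw [Trivialization.apply_mk_symm _ (FiberBundle.mem_baseSet_trivializationAt' x)]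
    rwa [h2] at h1
  have hT : ∀ w, SmoothNear R4 (sT w) x := by
    intro w
    have h1 := smoothNear_extend (F := R4) (V := fun y : M => TangentSpace (𝓡 4) y)
      ((trivializationAt R4 (fun y : M => TangentSpace (𝓡 4) y) x).symm x w)
    have h2 : (FiberBundle.extend R4
        ((trivializationAt R4 (fun y : M => TangentSpace (𝓡 4) y) x).symm x w) :
          (y : M) → TangentSpace (𝓡 4) y) = sT w := by
      funext y
      simp only [FiberBundle.extend, sT]
      rw [Trivialization.apply_mk_symm _ (FiberBundle.mem_baseSet_trivializationAt' x)]
    rwa [h2] at h1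
  have key : ∀ v w, ContMDiffAt (𝓡 4) 𝓘(ℝ, R3) ∞
      (fun y => (trivializationAt R3 E x ⟨y, a y (sE v y) (sT w y)⟩).2) x := fun v w =>
    (contMDiffAt_section x).mp (h _ _ (hE v) (hT w)).at_self
  have hsum : ContMDiffAt (𝓡 4) 𝓘(ℝ, R3 →L[ℝ] (R4 →L[ℝ] R3)) ∞
      (fun y => ∑ k : Fin 3, ∑ l : Fin 4, (EuclideanSpace.proj k : R3 →L[ℝ] ℝ).smulRight
        ((EuclideanSpace.proj l : R4 →L[ℝ] ℝ).smulRight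
          (trivializationAt R3 E x ⟨y, a y (sE (EuclideanSpace.single k 1) y)
            (sT (EuclideanSpace.single l 1) y)⟩).2)) x := by
    refine ContMDiffAt.sum fun k _ => ContMDiffAt.sum fun l _ => ?_
    exact contMDiffAt_smulRight _ (contMDiffAt_smulRight _ (key _ _))
  refine hsum.congr_of_eventuallyEq ?_
  have h1 := (trivializationAt R3 E x).open_baseSet.mem_nhds
    (FiberBundle.mem_baseSet_trivializationAt' x)
  have h2 := (trivializationAt R4 (fun y : M => TangentSpace (𝓡 4) y) x).open_baseSet.mem_nhds
    (FiberBundle.mem_baseSet_trivializationAt' x)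
  filter_upwards [h1, h2] with y hy1 hy2
  rw [eq_sum_smulRight (ContinuousLinearMap.inCoordinates R3 E (R4 →L[ℝ] R3)
    (fun x : M => TangentSpace (𝓡 4) x →L[ℝ] E x) x y x y (a y))]
  refine Finset.sum_congr rfl fun k _ => Finset.sum_congr rfl fun l _ => ?_
  rw [inCoordinates_apply_eq₂ hy1 hy2 hy1, Trivialization.linearMapAt_apply, if_pos hy1]

/-- The 1-form `c_i Σ_i(f_d, ·)` with values in `so(E)`, in the frame `e`. -/
def contractionForm (oM : ManifoldOrientation M) (Λ : ℝ) (hA : IsSO3Connection A)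
    (e : Fin 3 → (y : M) → E y) (z : (y : M) → TangentSpace (𝓡 4) y) (c : Fin 3 → ℝ) (y : M) :
    E y →L[ℝ] TangentSpace (𝓡 4) y →L[ℝ] E y :=
  let θ : Fin 3 → TangentSpace (𝓡 4) y →L[ℝ] ℝ := fun i => LinearMap.toContinuousLinearMap
    { toFun := fun u => c i * SigOf oM Λ A (fun k => e k y) i (z y) u
      map_add' := fun u v => by
        rw [(isTwoForm_SigOf hA _ i).add_right, mul_add]
      map_smul' := fun t u => by
        rw [(isTwoForm_SigOf hA _ i).smul_right, RingHom.id_apply, smul_eq_mul]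
        ring }
  ∑ i, ((innerSL ℝ (e (i + 2) y)).smulRight ((θ i).smulRight (e (i + 1) y))
    - (innerSL ℝ (e (i + 1) y)).smulRight ((θ i).smulRight (e (i + 2) y)))

variable {hA : IsSO3Connection A} {z : (y : M) → TangentSpace (𝓡 4) y} {c : Fin 3 → ℝ}

theorem contractionForm_apply (y : M) (s : E y) (u : TangentSpace (𝓡 4) y) :
    contractionForm oM Λ hA e z c y s u
      = ∑ i, (c i * SigOf oM Λ A (fun k => e k y) i (z y) u)
        • ((inner ℝ (e (i + 2) y) s : ℝ) • e (i + 1) y - (inner ℝ (e (i + 1) y) s : ℝ) • e (i + 2) y) := by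
  simp only [contractionForm, _root_.sum_apply, _root_.sub_apply, ContinuousLinearMap.smulRight_apply,
    _root_.smul_apply, innerSL_apply_apply]
  refine Finset.sum_congr rfl fun i _ => ?_
  rw [smul_sub]
  exact congrArg₂ HSub.hSub (smul_comm _ _ _) (smul_comm _ _ _)

theorem contractionForm_skew (y : M) (u : TangentSpace (𝓡 4) y) (s t : E y) :
    inner ℝ (contractionForm oM Λ hA e z c y s u) t
      = -(inner ℝ s (contractionForm oM Λ hA e z c y t u) : ℝ) := by
  simp only [contractionForm_apply, sum_inner, inner_sum, inner_smul_left, inner_smul_right,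
    inner_sub_left, inner_sub_right, conj_trivial, ← Finset.sum_neg_distrib]
  refine Finset.sum_congr rfl fun i _ => ?_
  rw [real_inner_comm s, real_inner_comm s]
  ring

theorem aFormOf_contractionForm {y : M} (he : Orthonormal ℝ fun k => e k y) (θ : ℝ) (j : Fin 3)
    (u : TangentSpace (𝓡 4) y) :
    aFormOf (fun y => θ • contractionForm oM Λ hA e z c y) (fun k => e k y) j u
      = θ * (c j * SigOf oM Λ A (fun k => e k y) j (z y) u) := by
  have hee : ∀ i k, (inner ℝ (e i y) (e k y) : ℝ) = if i = k then 1 else 0 :=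
    orthonormal_iff_ite.mp he
  have hn : ∀ i, ‖e i y‖ = 1 := he.1
  simp only [aFormOf, soCompOf, _root_.smul_apply, contractionForm_apply, inner_smul_left, hee, conj_trivial, Fin.sum_univ_three]
  fin_cases j <;> simp [inner_add_left, inner_neg_left, inner_smul_left, hee, hn]

theorem isSoForm_contractionForm (hΛ : Λ ≠ 0) (hdef : IsDefinite oM oE A) {θ : M → ℝ}
    (hθ : ContMDiff (𝓡 4) 𝓘(ℝ, ℝ) ∞ θ)
    (hS : ∀ y ∈ tsupport θ, IsOrthoFrame e y ∧ SmoothNear R4 z y) :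
    IsSoForm (fun y => θ y • contractionForm oM Λ hA e z c y) where
  skew y u s t := by
    simp only [_root_.smul_apply, inner_smul_left, inner_smul_right, contractionForm_skew,
      conj_trivial]
    ring
  smooth y := by
    refine contMDiffAt_of_apply fun s V hs hV => ?_
    by_cases hy : y ∈ tsupport θ
    · obtain ⟨he, hz⟩ := hS y hy
      have h1 : SmoothNear R3 (fun y => ∑ i, (fun y => θ y * (c i * SigOf oM Λ A (fun k => e k y) i (z y) (V y)) : M → ℝ)
          y • (((fun y => inner ℝ (e (i + 2) y) (s y) : M → ℝ) • e (i + 1)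
            - (fun y => inner ℝ (e (i + 1) y) (s y) : M → ℝ) • e (i + 2)) y)) y := by
        refine SmoothNear.sum _ fun i _ => SmoothNear.smul ?_ (SmoothNear.sub ?_ ?_)
        · exact FSmoothNear.mul (Filter.Eventually.of_forall fun y => hθ y)
            ((FSmoothNear.const _).mul (smooth_SigOf hΛ hA hdef he hz hV i))
        · exact SmoothNear.smul (FSmoothNear.inner (he.smooth _) hs) (he.smooth _)
        · exact SmoothNear.smul (FSmoothNear.inner (he.smooth _) hs) (he.smooth _)
      refine h1.congr (Filter.Eventually.of_forall fun y => ?_)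
      simp only [_root_.smul_apply, contractionForm_apply, Finset.smul_sum, smul_smul]
      rfl
    · have h0 : SmoothNear R3 ((fun _ => 0 : M → ℝ) • s) y :=
        SmoothNear.smul (FSmoothNear.const 0) hs
      refine h0.congr ?_
      filter_upwards [notMem_tsupport_iff_eventuallyEq.mp hy] with w hw
      simp [hw]

theorem wedge21_contraction {V : Type*} [AddCommGroup V] [Module ℝ V] {β : V → V → ℝ}
    (hβ : IsTwoForm β) (t : ℝ) (z u v w : V) :
    wedge21 β (fun p => t * β z p) u v w = t * ((1 / 2) * wedge22 β β ![z, u, v, w]) := by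
  simp only [wedge21, wedge22, Matrix.cons_val_zero, Matrix.cons_val_one, Matrix.cons_val]
  rw [hβ.swap w u]
  ring

theorem isHorizontal_of_frame (hΛ : Λ ≠ 0) (hA : IsSO3Connection A) (hdef : IsDefinite oM oE A)
    (ha : IsSoForm a) {e : Fin 3 → E x} (he : Orthonormal ℝ e) (u v w : TangentSpace (𝓡 4) x) :
    ∑ i, wedge21 (Sig oM oE Λ A x i) (aForm oE a x i) u v w
      = ∑ i, wedge21 (SigOf oM Λ A e i) (aFormOf a e i) u v w := by
  obtain ⟨R, hR, -, hrot⟩ := exists_rotation (finrank_fibre x) (orthonormal_fibreFrame oE (x := x)) he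
  have h1 : ∀ i p q, SigOf oM Λ A e i p q = ∑ j, R i j * Sig oM oE Λ A x j p q :=
    fun i p q => SigOf_rotate hΛ hA (hdef.posDef x) hR hrot i p q
  have h2 : ∀ i p, aFormOf a e i p = ∑ j, R i j * aForm oE a x j p :=
    fun i p => aFormOf_rotate ha hrot i p
  simp only [wedge21, h1, h2, Finset.sum_add_distrib, sum_rotate hR]

/-- Since `Σ_i ∧ Σ_i(z, ·)` is the contraction of `μ_A` with `z` for each `i`, the test form is horizontal
if `∑ c_i = 0`. -/
theorem isHorizontal_contractionForm (hΛ : Λ ≠ 0) (hdef : IsDefinite oM oE A)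
    (hc : ∑ i, c i = 0) {θ : M → ℝ} (hθ : ContMDiff (𝓡 4) 𝓘(ℝ, ℝ) ∞ θ)
    (hS : ∀ y ∈ tsupport θ, IsOrthoFrame e y ∧ SmoothNear R4 z y) :
    IsHorizontal oM oE Λ A (fun y => θ y • contractionForm oM Λ hA e z c y) := by
  have ha := isSoForm_contractionForm (c := c) (hA := hA) (oM := oM) hΛ hdef hθ hS
  intro y u v w
  by_cases hy : θ y = 0
  · refine Finset.sum_eq_zero fun i _ => ?_
    simp [wedge21, aForm, soComp, hy]
  · have he := (hS y (subset_tsupport _ hy)).1.ortho.self_of_nhds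
    rw [isHorizontal_of_frame hΛ hA hdef ha he]
    have h1 : ∀ i, aFormOf (fun y => θ y • contractionForm oM Λ hA e z c y) (fun k => e k y) i
        = fun p => (θ y * c i) * SigOf oM Λ A (fun k => e k y) i (z y) p := by
      intro i
      funext p
      rw [mul_assoc, ← aFormOf_contractionForm (hA := hA) he]
      rfl
    simp only [h1, wedge21_contraction (isTwoForm_SigOf hA _ _),
      wedge_SigOf hΛ hA (hdef.posDef y) he, if_true]
    rw [← Finset.sum_mul, ← Finset.mul_sum, hc]
    ring

end TestForms

/-! ### A critical connection is induced by the Levi-Civita connection -/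

section Parallel

variable {M : Type*} [TopologicalSpace M] [ChartedSpace R4 M] [IsManifold (𝓡 4) ∞ M] [T2Space M]
  {E : M → Type*} [∀ x, NormedAddCommGroup (E x)] [∀ x, InnerProductSpace ℝ (E x)]
  [TopologicalSpace (TotalSpace R3 E)] [FiberBundle R3 E] [VectorBundle ℝ R3 E]
  [ContMDiffVectorBundle ∞ R3 E (𝓡 4)] [IsContMDiffRiemannianBundle (𝓡 4) ∞ R3 E]
  {A : CovariantDerivative (𝓡 4) R3 E} {x : M}
  {oM : ManifoldOrientation M} {oE : FibreOrientation E} {Λ : ℝ}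
  {e : Fin 3 → (y : M) → E y} {f : Fin 4 → (y : M) → TangentSpace (𝓡 4) y}
  {D : CovariantDerivative (𝓡 4) R4 (fun x : M => TangentSpace (𝓡 4) x)}

theorem gA_comm (u v : TangentSpace (𝓡 4) x) : gA oM oE Λ A x u v = gA oM oE Λ A x v u := by
  simp only [gA, mul_comm]

theorem gA_sum_left {ι : Type*} (S : Finset ι) (c : ι → ℝ) (w : ι → TangentSpace (𝓡 4) x)
    (v : TangentSpace (𝓡 4) x) :
    gA oM oE Λ A x (∑ i ∈ S, c i • w i) v = ∑ i ∈ S, c i * gA oM oE Λ A x (w i) v := by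
  simp only [gA, map_sum, map_smul, Finsupp.coe_finsetSum, Finset.sum_apply, Finsupp.smul_apply,
    smul_eq_mul, Finset.sum_mul, Finset.mul_sum, mul_assoc]
  exact Finset.sum_comm

/-- The coefficients of the connection `D` in the frame `f`: `D_{f_c} f_a = γ_{cab} f_b`. -/
def frameCoeff (oM : ManifoldOrientation M) (oE : FibreOrientation E) (Λ : ℝ)
    (A : CovariantDerivative (𝓡 4) R3 E)
    (D : CovariantDerivative (𝓡 4) R4 (fun x : M => TangentSpace (𝓡 4) x))
    (f : Fin 4 → (y : M) → TangentSpace (𝓡 4) y) (x : M) (c a b : Fin 4) : ℝ :=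
  gA oM oE Λ A x (D (f a) x (f c x)) (f b x)

theorem IsAdaptedFrame.expand (h : IsAdaptedFrame oM oE Λ A e f x) (w : TangentSpace (𝓡 4) x) :
    w = ∑ b, gA oM oE Λ A x w (f b x) • f b x := by
  obtain ⟨β, hβ⟩ := exists_basis_of_linearIndependent h.frame.indep.self_of_nhds
  have hc : ∀ b, gA oM oE Λ A x w (f b x) = β.repr w b := by
    intro b
    conv_lhs => rw [← β.sum_repr w]
    rw [gA_sum_left]
    simp [hβ, h.metric.self_of_nhds]
  conv_lhs => rw [← β.sum_repr w]
  simp [hc, hβ]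

theorem IsAdaptedFrame.gA_covariant_skew (h : IsAdaptedFrame oM oE Λ A e f x)
    (hD : IsLeviCivita oM oE Λ A D) (u : TangentSpace (𝓡 4) x) (a b : Fin 4) :
    gA oM oE Λ A x (D (f a) x u) (f b x) = -gA oM oE Λ A x (D (f b) x u) (f a x) := by
  have h1 := hD.metric x u (f a) (f b) (h.frame.smooth a).mdiff (h.frame.smooth b).mdiff
  have h2 : (fun y => gA oM oE Λ A y (f a y) (f b y)) =ᶠ[nhds x] fun _ => if a = b then 1 else 0 :=
    h.metric.mono fun y hy => hy a b
  rw [mvfderiv_congr h2, mvfderiv_const, gA_comm (f a x)] at h1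
  exact eq_neg_of_add_eq_zero_left h1.symm

theorem IsAdaptedFrame.covariant (h : IsAdaptedFrame oM oE Λ A e f x) (c a : Fin 4) :
    D (f a) x (f c x) = ∑ b, frameCoeff oM oE Λ A D f x c a b • f b x :=
  h.expand _

theorem IsAdaptedFrame.bracket (h : IsAdaptedFrame oM oE Λ A e f x)
    (hD : IsLeviCivita oM oE Λ A D) (p q : Fin 4) :
    VectorField.mlieBracket (𝓡 4) (f p) (f q) x
      = ∑ c, (frameCoeff oM oE Λ A D f x p q c - frameCoeff oM oE Λ A D f x q p c) • f c x := by
  rw [← D.torsion_eq_zero_iff.mp hD.torsion_free (h.frame.smooth p).mdiff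
    (h.frame.smooth q).mdiff, h.covariant, h.covariant, ← Finset.sum_sub_distrib]
  simp only [sub_smul]

theorem IsTwoForm.sum_left {V ι : Type*} [AddCommGroup V] [Module ℝ V] {β : V → V → ℝ}
    (hβ : IsTwoForm β) (S : Finset ι) (c : ι → ℝ) (w : ι → V) (v : V) :
    β (∑ i ∈ S, c i • w i) v = ∑ i ∈ S, c i * β (w i) v := by
  let L : V →ₗ[ℝ] ℝ :=
    { toFun := fun u => β u v, map_add' := fun u u' => hβ.add u u' v,
      map_smul' := fun t u => hβ.smul t u v }
  have h : β (∑ i ∈ S, c i • w i) v = ∑ i ∈ S, β (c i • w i) v := map_sum L (fun i => c i • w i) S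
  rw [h]
  exact Finset.sum_congr rfl fun i _ => hβ.smul _ _ _

theorem mvfderiv_sum_mul_const {g : Fin 3 → M → ℝ} (hg : ∀ j, FSmoothNear (g j) x) (c : Fin 3 → ℝ)
    (u : TangentSpace (𝓡 4) x) :
    mvfderiv (𝓡 4) (fun y => ∑ j, g j y * c j) x u = ∑ j, mvfderiv (𝓡 4) (g j) x u * c j := by
  have h : ∀ j, MDifferentiableAt (𝓡 4) 𝓘(ℝ, ℝ) (fun y => g j y * c j) x := fun j =>
    ((hg j).mul (FSmoothNear.const (c j))).mdiff
  have hd : ∀ j, mvfderiv (𝓡 4) (fun y => g j y * c j) x u = mvfderiv (𝓡 4) (g j) x u * c j := by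
    intro j
    rw [mvfderiv_fun_mul (hg j).mdiff (FSmoothNear.const (c j)).mdiff, mvfderiv_const]
    simp [mul_comm]
  simp only [Fin.sum_univ_three]
  have h01 : MDifferentiableAt (𝓡 4) 𝓘(ℝ, ℝ) (fun y => g 0 y * c 0 + g 1 y * c 1) x := (h 0).add (h 1)
  rw [mvfderiv_fun_add h01 (h 2), mvfderiv_fun_add (h 0) (h 1), ← hd, ← hd, ← hd]
  rfl

/-- Globally defined horizontal forms which are equal to `s_i Σ_i(f_d, ·)` near `x`. -/
theorem exists_localized_contractionForm (hΛ : Λ ≠ 0) (hA : IsSO3Connection A)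
    (hdef : IsDefinite oM oE A) (h : IsAdaptedFrame oM oE Λ A e f x) (d : Fin 4) {s : Fin 3 → ℝ}
    (hs : ∑ i, s i = 0) :
    ∃ a : (x : M) → E x →L[ℝ] TangentSpace (𝓡 4) x →L[ℝ] E x, IsSoForm a ∧
      IsHorizontal oM oE Λ A a ∧
      ∀ᶠ y in nhds x, ∀ i u, aFormOf a (fun k => e k y) i u
        = s i * SigOf oM Λ A (fun k => e k y) i (f d y) u := by
  obtain ⟨χ, -, hχ⟩ := (SmoothBumpFunction.nhds_basis_tsupport (I := 𝓡 4) x).mem_iff.mp h.eventually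
  have hS : ∀ y ∈ tsupport χ, IsOrthoFrame e y ∧ SmoothNear R4 (f d) y := fun y hy =>
    ⟨(hχ hy).ortho, (hχ hy).frame.smooth d⟩
  refine ⟨fun y => χ y • contractionForm oM Λ hA e (f d) s y,
    isSoForm_contractionForm hΛ hdef χ.contMDiff hS,
    isHorizontal_contractionForm hΛ hdef hs χ.contMDiff hS, ?_⟩
  filter_upwards [χ.eventuallyEq_one, h.ortho.ortho] with y hy he i u
  have h1 := aFormOf_contractionForm (oM := oM) (Λ := Λ) (hA := hA) (z := f d) (c := s) he (χ y) i u
  have h2 : aFormOf (fun y => χ y • contractionForm oM Λ hA e (f d) s y) (fun k => e k y) i u = _ := h1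
  rw [h2, hy, Pi.one_apply, one_mul]

/-- The Euler–Lagrange equations in an adapted frame. -/
theorem variation_eq_zero [CompactSpace M] (hΛ : Λ ≠ 0) (hA : IsSO3Connection A)
    (hdef : IsDefinite oM oE A) (hcrit : IsCritical oM oE Λ A) (hD : IsLeviCivita oM oE Λ A D)
    (h : IsAdaptedFrame oM oE Λ A e f x) (s : Fin 3 → ℝ) (hs : ∑ i, s i = 0) (d : Fin 4) :
    ∑ i, pf (sdBasis i) (contractedVariation (fun c j => connForm A e x j (f c x))
      (frameCoeff oM oE Λ A D f x) s d i) = 0 := by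
  obtain ⟨a, ha, hh, hae⟩ := exists_localized_contractionForm hΛ hA hdef h d hs
  have h0 := firstVariation_eq_density hΛ hA hdef ha (fun k => f k x)
  rw [variationDensity_eq_zero hΛ hA hdef hcrit ha hh, zero_mul,
    firstVariation_eq hΛ hA hdef ha h.ortho.ortho.self_of_nhds] at h0
  rw [← h0]
  refine Finset.sum_congr rfl fun i _ => ?_
  have hsig : ∀ p q, SigOf oM Λ A (fun k => e k x) i (f p x) (f q x) = sdBasis i p q :=
    h.sig.self_of_nhds i
  have hcomp : ∀ᶠ y in nhds x, ∀ i r, aFormOf a (fun k => e k y) i (f r y) = s i * sdBasis i d r := by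
    filter_upwards [hae, h.sig] with y h1 h2 i r
    rw [h1, h2]
  have hder : ∀ i r u, mvfderiv (𝓡 4) (fun y => aFormOf a (fun k => e k y) i (f r y)) x u = 0 := by
    intro i r u
    rw [mvfderiv_congr (hcomp.mono fun y hy => hy i r), mvfderiv_const]
    rfl
  have hbr : ∀ p r, aFormOf a (fun k => e k x) i (VectorField.mlieBracket (𝓡 4) (f p) (f r) x)
      = ∑ c, (frameCoeff oM oE Λ A D f x p r c - frameCoeff oM oE Λ A D f x r p c)
        * (s i * sdBasis i d c) := by
    intro p r
    rw [hae.self_of_nhds, h.bracket hD, (isTwoForm_SigOf hA _ i).swap,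
      (isTwoForm_SigOf hA _ i).sum_left, ← Finset.sum_neg_distrib, Finset.mul_sum]
    refine Finset.sum_congr rfl fun c _ => ?_
    rw [(isTwoForm_SigOf hA _ i).swap, hsig]
    ring
  have key : ∀ p r, dAFormOf A a (fun k => e k x) i (f p x) (f r x)
      = contractedVariation (fun c j => connForm A e x j (f c x))
          (frameCoeff oM oE Λ A D f x) s d i p r := by
    intro p r
    rw [dAFormOf_structure hA ha h.ortho (h.frame.smooth p) (h.frame.smooth r), hder, hder, hbr]
    simp only [hcomp.self_of_nhds, contractedVariation, Matrix.of_apply]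
    ring
  simp only [wedge22, pf, hsig, key]

/-- The second Bianchi identity in an adapted frame. -/
theorem bianchiTerm_cyclic (hΛ : Λ ≠ 0) (hA : IsSO3Connection A)
    (hdef : IsDefinite oM oE A) (hD : IsLeviCivita oM oE Λ A D)
    (h : IsAdaptedFrame oM oE Λ A e f x) (i : Fin 3) (p q r : Fin 4) :
    let T := bianchiTerm (fun c j => connForm A e x j (f c x)) (frameCoeff oM oE Λ A D f x)
      (YOf oM Λ A (fun k => e k x))
      (fun p => Matrix.of fun i j => mvfderiv (𝓡 4) (fun y => YOf oM Λ A (fun k => e k y) i j) x (f p x)) i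
    T p q r + T q r p + T r p q = 0 := by
  intro T
  have hF : ∀ᶠ y in nhds x, ∀ i p q, curvFormOf A (fun k => e k y) i (f p y) (f q y)
      = ∑ j, YOf oM Λ A (fun k => e k y) i j * sdBasis j p q := by
    filter_upwards [h.ortho.ortho, h.sig] with y hy1 hy2 i p q
    rw [curvFormOf_eq hΛ (GOf_posDef hA (hdef.posDef y) hy1)]
    simp only [hy2]
  have key : ∀ p q r, mvfderiv (𝓡 4) (fun y => curvFormOf A (fun k => e k y) i (f q y) (f r y)) x (f p x)
        - curvFormOf A (fun k => e k x) i (VectorField.mlieBracket (𝓡 4) (f p) (f q) x) (f r x)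
        + (connForm A e x (i + 2) (f p x) * curvFormOf A (fun k => e k x) (i + 1) (f q x) (f r x)
          - connForm A e x (i + 1) (f p x) * curvFormOf A (fun k => e k x) (i + 2) (f q x) (f r x))
      = T p q r := by
    intro p q r
    rw [mvfderiv_congr (hF.mono fun y hy => hy i q r), h.bracket hD,
      (isTwoForm_curvFormOf hA _ i).sum_left]
    simp only [hF.self_of_nhds, T, bianchiTerm, Matrix.of_apply]
    rw [mvfderiv_sum_mul_const fun j => smooth_YOf hA hdef h.ortho i j]
  have hb := curvFormOf_bianchi hA h.ortho (h.frame.smooth p) (h.frame.smooth q) (h.frame.smooth r) i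
  simp only [key] at hb
  exact hb

theorem YOf_symm (hA : IsSO3Connection A) (hdef : IsDefinite oM oE A) {e : Fin 3 → E x}
    (he : Orthonormal ℝ e) (i j : Fin 3) : YOf oM Λ A e i j = YOf oM Λ A e j i := by
  have hp := sqrt_posDef (GOf_posDef hA (hdef.posDef x) he)
  have h := hp.1.apply j i
  simp only [YOf, signedRoot, Matrix.smul_apply]
  rw [← h]
  simp

theorem YOf_trace (hA : IsSO3Connection A) (hdef : IsDefinite oM oE A) {e : Fin 3 → E x}
    (he : Orthonormal ℝ e) : (YOf oM Λ A e).trace = Λ :=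
  signedRoot_trace (GOf_posDef hA (hdef.posDef x) he)

/-- A critical connection is the one which the Levi-Civita connection of `g_A` induces on the bundle
of self-dual forms. -/
theorem selfDualDiff_frame_eq_zero [CompactSpace M] (hΛ : Λ ≠ 0) (hA : IsSO3Connection A)
    (hdef : IsDefinite oM oE A) (hcrit : IsCritical oM oE Λ A) (hD : IsLeviCivita oM oE Λ A D)
    (h : IsAdaptedFrame oM oE Λ A e f x) (j : Fin 3) (c : Fin 4) :
    selfDualDiff (fun c j => connForm A e x j (f c x)) (frameCoeff oM oE Λ A D f x) j c = 0 := by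
  have hγ := fun c => h.gA_covariant_skew hD (f c x)
  have he := h.ortho.ortho.self_of_nhds
  refine selfDualDiff_eq_zero hγ (variation_eq_zero hΛ hA hdef hcrit hD h)
    (bianchiTerm_cyclic hΛ hA hdef hD h) (YOf_symm hA hdef he) ?_ ?_ ?_ j c
  · intro p i j
    refine mvfderiv_congr (h.ortho.ortho.mono fun y hy => ?_) _
    exact YOf_symm hA hdef hy i j
  · rw [YOf_trace hA hdef he]
    exact hΛ
  · intro p
    have h1 := mvfderiv_sum_mul_const (fun j => smooth_YOf (Λ := Λ) hA hdef h.ortho j j) (fun _ => 1)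
      (f p x)
    have h2 : (fun y => ∑ j, YOf oM Λ A (fun k => e k y) j j * 1) =ᶠ[nhds x] fun _ => Λ := by
      filter_upwards [h.ortho.ortho] with y hy
      simp only [mul_one]
      exact YOf_trace hA hdef hy
    rw [mvfderiv_congr h2, mvfderiv_const] at h1
    simpa [Matrix.trace] using h1.symm

end Parallel

/-! ### Curvature in a moving frame -/

section MovingFrame

variable {M : Type*} [TopologicalSpace M] [ChartedSpace R4 M] [IsManifold (𝓡 4) ∞ M] [T2Space M]
  {F : Type*} [NormedAddCommGroup F] [NormedSpace ℝ F] [FiniteDimensional ℝ F]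
  {V : M → Type*} [TopologicalSpace (TotalSpace F V)] [∀ x, AddCommGroup (V x)]
  [∀ x, Module ℝ (V x)] [∀ x, TopologicalSpace (V x)] [∀ x, IsTopologicalAddGroup (V x)]
  [∀ x, ContinuousSMul ℝ (V x)] [FiberBundle F V] [VectorBundle ℝ F V]
  [ContMDiffVectorBundle ∞ F V (𝓡 4)]
  {D : CovariantDerivative (𝓡 4) F V} {x : M} {U W : (y : M) → TangentSpace (𝓡 4) y}
  {ι : Type*} {φ : ι → (y : M) → V y}

theorem covariant_sum_smul (S : Finset ι) {g : ι → M → ℝ} (hg : ∀ b, FSmoothNear (g b) x)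
    (hφ : ∀ b, SmoothNear F (φ b) x) (u : TangentSpace (𝓡 4) x) :
    D (fun y => ∑ b ∈ S, g b y • φ b y) x u
      = ∑ b ∈ S, (g b x • D (φ b) x u + mvfderiv (𝓡 4) (g b) x u • φ b x) := by
  classical
  induction S using Finset.induction_on with
  | empty =>
    have h : (fun y => ∑ b ∈ (∅ : Finset ι), g b y • φ b y) = (0 : (y : M) → V y) := by
      funext y
      simp
    rw [h, D.zero]
    simp
  | insert b S hb ih =>
    have h : (fun y => ∑ b ∈ insert b S, g b y • φ b y)
        = g b • φ b + fun y => ∑ b ∈ S, g b y • φ b y := by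
      funext y
      rw [Finset.sum_insert hb]
      rfl
    have hs : SmoothNear F (fun y => ∑ b ∈ S, g b y • φ b y) x :=
      SmoothNear.sum S fun b _ => SmoothNear.smul (hg b) (hφ b)
    rw [h, covariant_add (SmoothNear.smul (hg b) (hφ b)) hs, _root_.add_apply,
      covariant_smul (hg b) (hφ b), ih, Finset.sum_insert hb]

/-- The curvature of a connection in terms of its connection forms: `Ω = dw + w ∧ w`. -/
theorem curvOp_frame [Fintype ι] {w : (y : M) → ι → ι → TangentSpace (𝓡 4) y → ℝ}
    (hφ : ∀ a, SmoothNear F (φ a) x) (hU : SmoothNear R4 U x) (hW : SmoothNear R4 W x)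
    (hw : ∀ᶠ y in nhds x, ∀ a u, D (φ a) y u = ∑ b, w y a b u • φ b y)
    (hsm : ∀ a b {Z : (y : M) → TangentSpace (𝓡 4) y}, SmoothNear R4 Z x →
      FSmoothNear (fun y => w y a b (Z y)) x) (a : ι) :
    curvOp D (φ a) U W x = ∑ c, (mvfderiv (𝓡 4) (fun y => w y a c (W y)) x (U x)
      - mvfderiv (𝓡 4) (fun y => w y a c (U y)) x (W x)
      - w x a c (VectorField.mlieBracket (𝓡 4) U W x)
      + ∑ b, (w x a b (W x) * w x b c (U x) - w x a b (U x) * w x b c (W x))) • φ c x := by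
  have key : ∀ {Z : (y : M) → TangentSpace (𝓡 4) y}, SmoothNear R4 Z x → ∀ u,
      D (fun y => D (φ a) y (Z y)) x u
        = ∑ c, (mvfderiv (𝓡 4) (fun y => w y a c (Z y)) x u
          + ∑ b, w x a b (Z x) * w x b c u) • φ c x := by
    intro Z hZ u
    have hs : SmoothNear F (fun y => ∑ b, w y a b (Z y) • φ b y) x :=
      SmoothNear.sum _ fun b _ => SmoothNear.smul (hsm a b hZ) (hφ b)
    rw [covariant_congr hs (hw.mono fun y hy => hy a (Z y)),
      covariant_sum_smul _ (fun b => hsm a b hZ) hφ]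
    simp only [hw.self_of_nhds, add_smul, Finset.sum_add_distrib, Finset.sum_smul, Finset.smul_sum,
      smul_smul]
    rw [add_comm, Finset.sum_comm]
  simp only [curvOp]
  rw [key hW, key hU, hw.self_of_nhds]
  simp only [add_smul, sub_smul, Finset.sum_add_distrib, Finset.sum_sub_distrib]
  abel

end MovingFrame

section Induced

variable {M : Type*} [TopologicalSpace M] [ChartedSpace R4 M] [IsManifold (𝓡 4) ∞ M] [T2Space M]
  {E : M → Type*} [∀ x, NormedAddCommGroup (E x)] [∀ x, InnerProductSpace ℝ (E x)]
  [TopologicalSpace (TotalSpace R3 E)] [FiberBundle R3 E] [VectorBundle ℝ R3 E]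
  [ContMDiffVectorBundle ∞ R3 E (𝓡 4)] [IsContMDiffRiemannianBundle (𝓡 4) ∞ R3 E]
  {A : CovariantDerivative (𝓡 4) R3 E} {x : M}
  {oM : ManifoldOrientation M} {oE : FibreOrientation E} {Λ : ℝ}
  {e : Fin 3 → (y : M) → E y} {f : Fin 4 → (y : M) → TangentSpace (𝓡 4) y}
  {D : CovariantDerivative (𝓡 4) R4 (fun x : M => TangentSpace (𝓡 4) x)}
  {U W : (y : M) → TangentSpace (𝓡 4) y}

theorem IsAdaptedFrame.gA_eq (hA : IsSO3Connection A) (h : IsAdaptedFrame oM oE Λ A e f x)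
    (w : TangentSpace (𝓡 4) x) :
    let S := fun b => SigOf oM Λ A (fun k => e k x) 0 w (f b x)
    gA oM oE Λ A x w (f 0 x) = S 1 ∧ gA oM oE Λ A x w (f 1 x) = -S 0 ∧
      gA oM oE Λ A x w (f 2 x) = S 3 ∧ gA oM oE Λ A x w (f 3 x) = -S 2 := by
  have hS : ∀ b, SigOf oM Λ A (fun k => e k x) 0 w (f b x)
      = ∑ a, gA oM oE Λ A x w (f a x) * sdBasis 0 a b := by
    intro b
    conv_lhs => rw [h.expand w]
    rw [(isTwoForm_SigOf hA _ 0).sum_left]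
    simp only [h.sig.self_of_nhds]
  simp only [hS, Fin.sum_univ_four]
  simp [sdBasis, skewOf_entries]

theorem IsAdaptedFrame.smooth_gA (hΛ : Λ ≠ 0) (hA : IsSO3Connection A) (hdef : IsDefinite oM oE A)
    (h : IsAdaptedFrame oM oE Λ A e f x) (hU : SmoothNear R4 U x) (b : Fin 4) :
    FSmoothNear (fun y => gA oM oE Λ A y (U y) (f b y)) x := by
  have hs := fun b => smooth_SigOf hΛ hA hdef h.ortho hU (h.frame.smooth b) 0
  have hev := h.eventually
  fin_cases b
  · exact (hs 1).congr (hev.mono fun y hy => (hy.gA_eq hA (U y)).1)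
  · exact (hs 0).neg.congr (hev.mono fun y hy => (hy.gA_eq hA (U y)).2.1)
  · exact (hs 3).congr (hev.mono fun y hy => (hy.gA_eq hA (U y)).2.2.1)
  · exact (hs 2).neg.congr (hev.mono fun y hy => (hy.gA_eq hA (U y)).2.2.2)

/-- The connection forms of `A` are the self-dual parts of those of the Levi-Civita connection. -/
theorem connForm_eq [CompactSpace M] (hΛ : Λ ≠ 0) (hA : IsSO3Connection A)
    (hdef : IsDefinite oM oE A) (hcrit : IsCritical oM oE Λ A) (hD : IsLeviCivita oM oE Λ A D)
    (h : IsAdaptedFrame oM oE Λ A e f x) (j : Fin 3) (u : TangentSpace (𝓡 4) x) :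
    let w := fun a b => gA oM oE Λ A x (D (f a) x u) (f b x)
    connForm A e x j u = -(![w 0 1 + w 2 3, w 0 2 - w 1 3, w 0 3 + w 1 2] j) := by
  intro w
  have hw : ∀ a b, w a b = ∑ c, gA oM oE Λ A x u (f c x) * frameCoeff oM oE Λ A D f x c a b := by
    intro a b
    have h1 : D (f a) x u = ∑ c, gA oM oE Λ A x u (f c x) • D (f a) x (f c x) := by
      conv_lhs => rw [h.expand u, map_sum]
      simp only [map_smul]
    simp only [w]
    rw [h1, gA_sum_left]
    rfl
  have hc : connForm A e x j u = ∑ c, gA oM oE Λ A x u (f c x) * connForm A e x j (f c x) := by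
    have h1 : A (e (j + 2)) x u = ∑ c, gA oM oE Λ A x u (f c x) • A (e (j + 2)) x (f c x) := by
      conv_lhs => rw [h.expand u, map_sum]
      simp only [map_smul]
    simp only [connForm]
    rw [h1, sum_inner]
    simp only [inner_smul_left, conj_trivial]
  have hd := fun c => selfDualDiff_frame_eq_zero hΛ hA hdef hcrit hD h j c
  have hd' : ∀ c, connForm A e x j (f c x) = -(![frameCoeff oM oE Λ A D f x c 0 1
      + frameCoeff oM oE Λ A D f x c 2 3, frameCoeff oM oE Λ A D f x c 0 2
      - frameCoeff oM oE Λ A D f x c 1 3, frameCoeff oM oE Λ A D f x c 0 3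
      + frameCoeff oM oE Λ A D f x c 1 2] j) := fun c => eq_neg_of_add_eq_zero_left (hd c)
  rw [hc]
  simp only [hd', hw, Fin.sum_univ_four]
  fin_cases j <;> simp <;> ring

/-- The self-dual part of the Riemannian curvature is the curvature of `A`. -/
theorem curvFormOf_eq_riemann [CompactSpace M] (hΛ : Λ ≠ 0) (hA : IsSO3Connection A)
    (hdef : IsDefinite oM oE A) (hcrit : IsCritical oM oE Λ A) (hD : IsLeviCivita oM oE Λ A D)
    (h : IsAdaptedFrame oM oE Λ A e f x) (j : Fin 3) (u v : TangentSpace (𝓡 4) x) :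
    let R := fun a b => gA oM oE Λ A x (curvature D x u v (f a x)) (f b x)
    (∀ a b, R a b = -R b a) ∧
      curvFormOf A (fun k => e k x) j u v = -(![R 0 1 + R 2 3, R 0 2 - R 1 3, R 0 3 + R 1 2] j) := by
  intro R
  obtain ⟨U, hU, hUx⟩ : ∃ U : (y : M) → TangentSpace (𝓡 4) y, SmoothNear R4 U x ∧ U x = u :=
    ⟨FiberBundle.extend R4 u, smoothNear_extend u, by simp⟩
  obtain ⟨W, hW, hWx⟩ : ∃ W : (y : M) → TangentSpace (𝓡 4) y, SmoothNear R4 W x ∧ W x = v :=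
    ⟨FiberBundle.extend R4 v, smoothNear_extend v, by simp⟩
  let β : (y : M) → Fin 3 → Fin 3 → TangentSpace (𝓡 4) y → ℝ := fun y i k u =>
    inner ℝ (A (e i) y u) (e k y)
  let w : (y : M) → Fin 4 → Fin 4 → TangentSpace (𝓡 4) y → ℝ := fun y a b u =>
    gA oM oE Λ A y (D (f a) y u) (f b y)
  have hee : ∀ i k, (inner ℝ (e i x) (e k x) : ℝ) = if i = k then 1 else 0 :=
    orthonormal_iff_ite.mp h.ortho.ortho.self_of_nhds
  have hws : ∀ a b {Z : (y : M) → TangentSpace (𝓡 4) y}, SmoothNear R4 Z x →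
      FSmoothNear (fun y => w y a b (Z y)) x := fun a b Z hZ =>
    h.smooth_gA hΛ hA hdef ((h.frame.smooth a).covariant hD.smooth hZ) b
  have hE := fun i => curvOp_frame (D := A) (w := β) (fun k => h.ortho.smooth k) hU hW
    (by
      filter_upwards [h.ortho.ortho] with y hy i u
      conv_lhs => rw [sum_inner_smul hy (finrank_fibre y) (A (e i) y u)]
      simp only [β, real_inner_comm])
    (fun i k Z hZ => FSmoothNear.inner ((h.ortho.smooth i).covariant hA.smooth hZ) (h.ortho.smooth k)) i
  have hT := fun a => curvOp_frame (D := D) (w := w) (fun k => h.frame.smooth k) hU hW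
    (h.eventually.mono fun y hy a u => hy.expand _) hws a
  have hRw : ∀ a b, R a b = mvfderiv (𝓡 4) (fun y => w y a b (W y)) x (U x)
      - mvfderiv (𝓡 4) (fun y => w y a b (U y)) x (W x)
      - w x a b (VectorField.mlieBracket (𝓡 4) U W x)
      + ∑ c, (w x a c (W x) * w x c b (U x) - w x a c (U x) * w x c b (W x)) := by
    intro a b
    simp only [R]
    rw [← hUx, ← hWx, curvature_eq_curvOp hD.smooth (h.frame.smooth a) hU hW, hT, gA_sum_left]
    simp [h.metric.self_of_nhds]
  have hFb : curvFormOf A (fun k => e k x) j u v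
      = mvfderiv (𝓡 4) (fun y => connForm A e y j (W y)) x (U x)
      - mvfderiv (𝓡 4) (fun y => connForm A e y j (U y)) x (W x)
      - connForm A e x j (VectorField.mlieBracket (𝓡 4) U W x)
      + ∑ c, (β x (j + 2) c (W x) * β x c (j + 1) (U x)
        - β x (j + 2) c (U x) * β x c (j + 1) (W x)) := by
    simp only [curvFormOf, soCompOf]
    rw [← hUx, ← hWx, curvature_eq_curvOp hA.smooth (h.ortho.smooth (j + 2)) hU hW, hE, sum_inner]
    simp only [inner_smul_left, conj_trivial, hee, mul_ite, mul_one, mul_zero, Finset.sum_ite_eq',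
      Finset.mem_univ, if_true]
    rfl
  have hβ : ∀ i k u, β x i k u = connForm A e x (i + 1) u * (if i + 2 = k then 1 else 0)
      - connForm A e x (i + 2) u * (if i + 1 = k then 1 else 0) := by
    intro i k u
    simp only [β]
    rw [covariant_frame hA h.ortho, inner_sub_left, inner_smul_left, inner_smul_left, hee, hee]
    rfl
  have hskew : ∀ u a b, w x a b u = -w x b a u := fun u => h.gA_covariant_skew hD u
  have hdiag : ∀ u a, w x a a u = 0 := fun u a => by linarith [hskew u a a]
  have hRskew : ∀ a b, R a b = -R b a := by
    intro a b
    have hd : ∀ {Z : (y : M) → TangentSpace (𝓡 4) y} (u : TangentSpace (𝓡 4) x),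
        mvfderiv (𝓡 4) (fun y => w y a b (Z y)) x u = -mvfderiv (𝓡 4) (fun y => w y b a (Z y)) x u := by
      intro Z u
      rw [mvfderiv_congr (h.eventually.mono fun y hy => hy.gA_covariant_skew hD (Z y) a b)]
      exact congrArg (fun L : TangentSpace (𝓡 4) x →L[ℝ] ℝ => L u) mvfderiv_fun_neg
    rw [hRw, hRw, hd, hd, hskew _ a b]
    have hq : ∑ c, (w x a c (W x) * w x c b (U x) - w x a c (U x) * w x c b (W x))
        = -∑ c, (w x b c (W x) * w x c a (U x) - w x b c (U x) * w x c a (W x)) := by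
      rw [← Finset.sum_neg_distrib]
      refine Finset.sum_congr rfl fun c _ => ?_
      rw [hskew _ b c, hskew _ b c, hskew _ c a, hskew _ c a]
      ring
    rw [hq]
    ring
  have hcon : ∀ᶠ y in nhds x, ∀ j u, connForm A e y j u
      = -(![w y 0 1 u + w y 2 3 u, w y 0 2 u - w y 1 3 u, w y 0 3 u + w y 1 2 u] j) :=
    h.eventually.mono fun y hy j u => connForm_eq hΛ hA hdef hcrit hD hy j u
  have hder : ∀ j {Z : (y : M) → TangentSpace (𝓡 4) y}, SmoothNear R4 Z x → ∀ u,
      let d := fun a b => mvfderiv (𝓡 4) (fun y => w y a b (Z y)) x u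
      mvfderiv (𝓡 4) (fun y => connForm A e y j (Z y)) x u
        = -(![d 0 1 + d 2 3, d 0 2 - d 1 3, d 0 3 + d 1 2] j) := by
    intro j Z hZ u d
    rw [mvfderiv_congr (hcon.mono fun y hy => hy j (Z y))]
    have hm := fun a b => (hws a b hZ).mdiff
    fin_cases j
    · exact (congrArg (fun L : TangentSpace (𝓡 4) x →L[ℝ] ℝ => L u)
        ((mvfderiv_fun_neg).trans (congrArg Neg.neg (mvfderiv_fun_add (hm 0 1) (hm 2 3)))))
    · exact (congrArg (fun L : TangentSpace (𝓡 4) x →L[ℝ] ℝ => L u)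
        ((mvfderiv_fun_neg).trans (congrArg Neg.neg (mvfderiv_fun_sub (hm 0 2) (hm 1 3)))))
    · exact (congrArg (fun L : TangentSpace (𝓡 4) x →L[ℝ] ℝ => L u)
        ((mvfderiv_fun_neg).trans (congrArg Neg.neg (mvfderiv_fun_add (hm 0 3) (hm 1 2)))))
  refine ⟨hRskew, ?_⟩
  rw [hFb, hder j hW, hder j hU]
  simp only [hβ, hRw, hcon.self_of_nhds, Fin.sum_univ_three, Fin.sum_univ_four]
  have w10 := fun u => hskew u 1 0
  have w20 := fun u => hskew u 2 0
  have w21 := fun u => hskew u 2 1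
  have w31 := fun u => hskew u 3 1
  have w32 := fun u => hskew u 3 2
  fin_cases j <;> simp [hdiag, w10, w20, w21, w31, w32] <;> ring

end Induced

/-! ### Negative curvature on self-dual forms -/

section Negative

variable {M : Type*} [TopologicalSpace M] [ChartedSpace R4 M] [IsManifold (𝓡 4) ∞ M] [T2Space M]
  {E : M → Type*} [∀ x, NormedAddCommGroup (E x)] [∀ x, InnerProductSpace ℝ (E x)]
  [TopologicalSpace (TotalSpace R3 E)] [FiberBundle R3 E] [VectorBundle ℝ R3 E]
  [ContMDiffVectorBundle ∞ R3 E (𝓡 4)] [IsContMDiffRiemannianBundle (𝓡 4) ∞ R3 E]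
  {A : CovariantDerivative (𝓡 4) R3 E}
  {oM : ManifoldOrientation M} {oE : FibreOrientation E} {Λ : ℝ}

theorem linearIndependent_of_sdBasis {x : M} {β : TangentSpace (𝓡 4) x → TangentSpace (𝓡 4) x → ℝ}
    (hβ : IsTwoForm β) {v : Fin 4 → TangentSpace (𝓡 4) x} (h : ∀ a b, β (v a) (v b) = sdBasis 0 a b) :
    LinearIndependent ℝ v := by
  rw [Fintype.linearIndependent_iff]
  intro c hc
  have key : ∀ b, ∑ a, c a * sdBasis 0 a b = 0 := by
    intro b
    have h1 := hβ.sum_left Finset.univ c v (v b)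
    rw [hc] at h1
    simp only [h] at h1
    rw [← h1]
    simpa using hβ.smul 0 0 (v b)
  have k0 := key 0
  have k1 := key 1
  have k2 := key 2
  have k3 := key 3
  simp [Fin.sum_univ_four, sdBasis, skewOf_entries] at k0 k1 k2 k3
  intro a
  fin_cases a <;> assumption

/-- A frame in which the `Σ_i` are the standard self-dual forms is orthonormal for `g_A`. -/
theorem gA_of_sdBasis (hΛ : Λ ≠ 0) (hA : IsSO3Connection A) (hdef : IsDefinite oM oE A)
    (hsign : HasSignOf oM oE Λ A) {x : M} {e : Fin 3 → E x} (he : Orthonormal ℝ e)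
    {v : Fin 4 → TangentSpace (𝓡 4) x}
    (h : ∀ i a b, SigOf oM Λ A e i (v a) (v b) = sdBasis i a b) (a b : Fin 4) :
    gA oM oE Λ A x (v a) (v b) = if a = b then 1 else 0 := by
  obtain ⟨w, hw⟩ := exists_basis_of_linearIndependent
    (linearIndependent_of_sdBasis (isTwoForm_SigOf hA e 0) (h 0))
  have hsd : (fun i => comps w (SigOf oM Λ A e i)) = sdBasis := by
    funext i
    ext a b
    simp only [comps, hw, Matrix.of_apply, h]
  have hvol : volForm oM oE Λ A x w = 1 := by
    rw [volForm_eq hΛ hA (hdef.posDef x) he]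
    have h1 := pf_sdBasis 0 0
    rw [if_pos rfl] at h1
    simp only [wedge22, hw, h]
    simp only [pf] at h1
    linarith
  rw [← hw, gA_basis' hΛ hA hdef hsign he, hsd, hvol, urbantke_sdBasis, Matrix.one_apply]
  simp

/-- Adapted frames extending the given frame of `g_A` at `x`. -/
theorem exists_adaptedFrame_metricFrame (hΛ : Λ ≠ 0) (hA : IsSO3Connection A)
    (hdef : IsDefinite oM oE A) (hsign : HasSignOf oM oE Λ A) (x : M) :
    ∃ (e : Fin 3 → (y : M) → E y) (f : Fin 4 → (y : M) → TangentSpace (𝓡 4) y),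
      IsAdaptedFrame oM oE Λ A e f x ∧ ∀ a, f a x = metricFrame oM oE Λ A x a := by
  obtain ⟨e0, R, he0, -, -, -, hc⟩ := exists_adapted_fibreFrame hΛ hA hdef hsign x
  obtain ⟨e, he, hex⟩ := exists_isOrthoFrame_extending he0
  obtain ⟨f, hf⟩ := exists_adaptedFrame hΛ hA hdef hsign he
  have hex' : (fun k => e k x) = e0 := funext hex
  let P : Fin 4 → Fin 4 → ℝ := fun a c => gA oM oE Λ A x (metricFrame oM oE Λ A x a) (f c x)
  let f' : Fin 4 → (y : M) → TangentSpace (𝓡 4) y := fun a y => ∑ c, P a c • f c y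
  have hfx : ∀ a, f' a x = metricFrame oM oE Λ A x a := fun a => (hf.expand _).symm
  have hval : ∀ y, (∀ i a b, SigOf oM Λ A (fun k => e k y) i (f a y) (f b y) = sdBasis i a b) →
      ∀ i a b, SigOf oM Λ A (fun k => e k y) i (f' a y) (f' b y)
        = ∑ c, P a c * -∑ d, P b d * sdBasis i d c := by
    intro y hy i a b
    have h2 := isTwoForm_SigOf (oM := oM) (Λ := Λ) hA (fun k => e k y) i
    simp only [f']
    rw [h2.sum_left]
    refine Finset.sum_congr rfl fun c _ => ?_
    rw [h2.swap, h2.sum_left]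
    simp only [hy]
  have hsig : ∀ᶠ y in nhds x, ∀ i a b,
      SigOf oM Λ A (fun k => e k y) i (f' a y) (f' b y) = sdBasis i a b := by
    filter_upwards [hf.sig] with y hy i a b
    rw [hval y hy, ← hval x hf.sig.self_of_nhds, hfx, hfx, hex', ← hc i]
    rfl
  refine ⟨e, f', ⟨⟨fun a => ?_, ?_⟩, he, hsig, ?_⟩, hfx⟩
  · exact SmoothNear.sum _ fun c _ => SmoothNear.smul (FSmoothNear.const (P a c)) (hf.frame.smooth c)
  · filter_upwards [hsig] with y hy
    exact linearIndependent_of_sdBasis (isTwoForm_SigOf hA _ 0) (hy 0)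
  · filter_upwards [hsig, he.ortho] with y hy hey
    exact gA_of_sdBasis hΛ hA hdef hsign hey hy

theorem sum_sdBasis_skew {R : Fin 4 → Fin 4 → ℝ} (hR : ∀ a b, R a b = -R b a) (i : Fin 3) :
    ∑ c, ∑ d, sdBasis i c d * R d c = 2 * -(![R 0 1 + R 2 3, R 0 2 - R 1 3, R 0 3 + R 1 2] i) := by
  have h10 := hR 1 0
  have h20 := hR 2 0
  have h30 := hR 3 0
  have h21 := hR 2 1
  have h31 := hR 3 1
  have h32 := hR 3 2
  fin_cases i <;> simp [Fin.sum_univ_four, sdBasis, skewOf_entries] <;> linarith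

theorem sum_sdBasis_comb (y : Fin 3 → ℝ) (i : Fin 3) :
    ∑ a, ∑ b, sdBasis i a b * ∑ j, y j * sdBasis j a b = 4 * y i := by
  fin_cases i <;> simp [Fin.sum_univ_three, Fin.sum_univ_four, sdBasis, skewOf_entries] <;> ring

/-- The curvature operator on `Σ_i` is `2 Y_{ii}`. -/
theorem curvatureQuadratic_sdBasis [CompactSpace M] (hΛ : Λ ≠ 0) (hA : IsSO3Connection A)
    (hdef : IsDefinite oM oE A) (hcrit : IsCritical oM oE Λ A)
    {D : CovariantDerivative (𝓡 4) R4 (fun x : M => TangentSpace (𝓡 4) x)}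
    (hD : IsLeviCivita oM oE Λ A D) {x : M} {e : Fin 3 → (y : M) → E y}
    {f : Fin 4 → (y : M) → TangentSpace (𝓡 4) y} (h : IsAdaptedFrame oM oE Λ A e f x)
    (hfx : ∀ a, f a x = metricFrame oM oE Λ A x a) (i : Fin 3) :
    curvatureQuadratic oM oE Λ A D x (sdBasis i) = 2 * YOf oM Λ A (fun k => e k x) i i := by
  have he := h.ortho.ortho.self_of_nhds
  have h1 : ∀ a b, ∑ c, ∑ d, sdBasis i c d
      * gA oM oE Λ A x (curvature D x (f a x) (f b x) (f d x)) (f c x)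
      = 2 * ∑ j, YOf oM Λ A (fun k => e k x) i j * sdBasis j a b := by
    intro a b
    obtain ⟨hR, hF⟩ := curvFormOf_eq_riemann hΛ hA hdef hcrit hD h i (f a x) (f b x)
    rw [sum_sdBasis_skew hR, ← hF, curvFormOf_eq hΛ (GOf_posDef hA (hdef.posDef x) he)]
    simp only [h.sig.self_of_nhds]
  have h2 := sum_sdBasis_comb (fun j => YOf oM Λ A (fun k => e k x) i j) i
  simp only [curvatureQuadratic, ← hfx]
  have h3 : ∀ a b, ∑ c, ∑ d, sdBasis i a b * sdBasis i c d
      * gA oM oE Λ A x (curvature D x (f a x) (f b x) (f d x)) (f c x)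
      = 2 * (sdBasis i a b * ∑ j, YOf oM Λ A (fun k => e k x) i j * sdBasis j a b) := by
    intro a b
    simp only [mul_assoc, ← Finset.mul_sum]
    rw [h1]
    ring
  simp only [h3, ← Finset.mul_sum]
  rw [h2]
  ring

/-- If the curvature operator is negative on self-dual forms, then so is `Λ = tr Y`, because the
operator takes the value `2 Y_{ii}` on `Σ_i`. -/
theorem neg_of_RPlusNegative [CompactSpace M] (hΛ : Λ ≠ 0) (hA : IsSO3Connection A)
    (hdef : IsDefinite oM oE A) (hsign : HasSignOf oM oE Λ A) (hcrit : IsCritical oM oE Λ A)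
    (hR : RPlusNegative oM oE Λ A) (x : M) : Λ < 0 := by
  obtain ⟨D, hD, hneg⟩ := hR
  obtain ⟨e, f, h, hfx⟩ := exists_adaptedFrame_metricFrame hΛ hA hdef hsign x
  have hY : ∀ i, YOf oM Λ A (fun k => e k x) i i < 0 := by
    intro i
    have h0 : sdBasis i ≠ 0 := by
      intro h0
      have := pf_sdBasis i i
      rw [h0] at this
      simp [pf] at this
    have := hneg x (sdBasis i) (sdBasis_skew i) (star2_sdBasis i) h0
    rw [curvatureQuadratic_sdBasis hΛ hA hdef hcrit hD h hfx] at this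
    linarith
  have ht := YOf_trace (Λ := Λ) hA hdef h.ortho.ortho.self_of_nhds
  rw [Matrix.trace, Fin.sum_univ_three] at ht
  simp only [Matrix.diag] at ht
  linarith [hY 0, hY 1, hY 2]

end Negative

/-! ### Positivity of the Hessian -/

section Positivity

variable {M : Type*} [TopologicalSpace M] [ChartedSpace R4 M] [IsManifold (𝓡 4) ∞ M] [T2Space M]
  {E : M → Type*} [∀ x, NormedAddCommGroup (E x)] [∀ x, InnerProductSpace ℝ (E x)]
  [TopologicalSpace (TotalSpace R3 E)] [FiberBundle R3 E] [VectorBundle ℝ R3 E]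
  [ContMDiffVectorBundle ∞ R3 E (𝓡 4)] [IsContMDiffRiemannianBundle (𝓡 4) ∞ R3 E]
  {A : CovariantDerivative (𝓡 4) R3 E} {x : M}
  {a : (x : M) → E x →L[ℝ] TangentSpace (𝓡 4) x →L[ℝ] E x}
  {oM : ManifoldOrientation M} {oE : FibreOrientation E} {Λ : ℝ}

theorem posDef_neg_X (hdef : IsDefinite oM oE A) (hΛ : Λ < 0) (x : M) :
    (-X oM oE Λ A x).PosDef := by
  have h1 : (Λ • Y oM oE Λ A x).PosDef := signedRoot_sign hΛ.ne (hdef.posDef x)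
  have h2 : (-Y oM oE Λ A x).PosDef := by
    have := h1.smul (a := (-Λ)⁻¹) (inv_pos.mpr (neg_pos.mpr hΛ))
    rwa [smul_smul, inv_neg, neg_mul, inv_mul_cancel₀ hΛ.ne, neg_one_smul] at this
  have hu : IsUnit (Y oM oE Λ A x).det := isUnit_det_signedRoot hΛ.ne (hdef.posDef x)
  have h3 : (-Y oM oE Λ A x)⁻¹ = -X oM oE Λ A x :=
    Matrix.inv_eq_right_inv (by rw [neg_mul_neg]; exact Matrix.mul_nonsing_inv _ hu)
  exact h3 ▸ h2.inv

/-- If `X` is negative definite, the integrand of the second variation is at least `|a|²`. -/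
theorem normSq_le (hX : (-X oM oE Λ A x).PosDef) :
    normSq oM oE Λ A a x ≤ normSq oM oE Λ A a x
      - ∑ i, ∑ j, X oM oE Λ A x i j
          * inner2 (dAMinus oM oE Λ A a x i) (dAMinus oM oE Λ A a x j) := by
  have h : ∀ b c, ∑ i, ∑ j, X oM oE Λ A x i j
      * (dAMinus oM oE Λ A a x i b c * dAMinus oM oE Λ A a x j b c) ≤ 0 := by
    intro b c
    have := hX.posSemidef.dotProduct_mulVec_nonneg (fun i => dAMinus oM oE Λ A a x i b c)
    simp only [dotProduct, Matrix.mulVec, Pi.star_apply, star_trivial, Matrix.neg_apply,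
      Finset.mul_sum] at this
    rw [← neg_nonneg, ← Finset.sum_neg_distrib]
    refine this.trans_eq (Finset.sum_congr rfl fun i _ => ?_)
    rw [← Finset.sum_neg_distrib]
    exact Finset.sum_congr rfl fun j _ => by ring
  have hsum : ∑ i, ∑ j, X oM oE Λ A x i j
          * inner2 (dAMinus oM oE Λ A a x i) (dAMinus oM oE Λ A a x j)
      = (1 / 2) * ∑ b, ∑ c, ∑ i, ∑ j, X oM oE Λ A x i j
          * (dAMinus oM oE Λ A a x i b c * dAMinus oM oE Λ A a x j b c) := by
    simp only [inner2, Finset.mul_sum]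
    simp only [Fin.sum_univ_three, Fin.sum_univ_four]
    ring
  have := Finset.sum_nonpos fun b (_ : b ∈ Finset.univ) =>
    Finset.sum_nonpos fun c (_ : c ∈ Finset.univ) => h b c
  rw [hsum]
  linarith

theorem normSq_nonneg (a : (x : M) → E x →L[ℝ] TangentSpace (𝓡 4) x →L[ℝ] E x) (x : M) :
    0 ≤ normSq oM oE Λ A a x :=
  Finset.sum_nonneg fun _ _ => Finset.sum_nonneg fun _ _ => sq_nonneg _

theorem eq_zero_of_normSq (ha : IsSoForm a) (h : normSq oM oE Λ A a x = 0) : a x = 0 := by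
  have h1 : ∀ i c, aForm oE a x i (metricFrame oM oE Λ A x c) = 0 := by
    intro i c
    have h2 := (Finset.sum_eq_zero_iff_of_nonneg fun i _ =>
      Finset.sum_nonneg fun _ _ => sq_nonneg _).mp h i (Finset.mem_univ i)
    have h3 := (Finset.sum_eq_zero_iff_of_nonneg fun _ _ => sq_nonneg _).mp h2 c (Finset.mem_univ c)
    exact pow_eq_zero_iff two_ne_zero |>.mp h3
  have hB : ∀ c s, a x s (metricFrame oM oE Λ A x c) = 0 := by
    intro c s
    have hsk := isSkewEnd_soForm ha (metricFrame oM oE Λ A x c)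
    have ho := orthonormal_fibreFrame oE (x := x)
    have hin : ∀ p q, (inner ℝ (a x (fibreFrame oE x p) (metricFrame oM oE Λ A x c))
        (fibreFrame oE x q) : ℝ) = 0 := by
      have hs2 : ∀ p q, (inner ℝ (a x (fibreFrame oE x p) (metricFrame oM oE Λ A x c))
          (fibreFrame oE x q) : ℝ) = -inner ℝ (a x (fibreFrame oE x q)
            (metricFrame oM oE Λ A x c)) (fibreFrame oE x p) := by
        intro p q
        rw [ha.skew, real_inner_comm]
      have k0 : (inner ℝ (a x (fibreFrame oE x 2) (metricFrame oM oE Λ A x c))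
        (fibreFrame oE x 1) : ℝ) = 0 := h1 0 c
      have k1 : (inner ℝ (a x (fibreFrame oE x 0) (metricFrame oM oE Λ A x c))
        (fibreFrame oE x 2) : ℝ) = 0 := h1 1 c
      have k2 : (inner ℝ (a x (fibreFrame oE x 1) (metricFrame oM oE Λ A x c))
        (fibreFrame oE x 0) : ℝ) = 0 := h1 2 c
      intro p q
      have hd := hs2 p p
      have ht := hs2 p q
      fin_cases p <;> fin_cases q <;> simp only [Fin.zero_eta, Fin.mk_one, Fin.reduceFinMk] at * <;>
        linarith
    have hz : ∀ p, a x (fibreFrame oE x p) (metricFrame oM oE Λ A x c) = 0 := by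
      intro p
      rw [sum_inner_smul ho (finrank_fibre x) (a x (fibreFrame oE x p) (metricFrame oM oE Λ A x c))]
      refine Finset.sum_eq_zero fun q _ => ?_
      rw [real_inner_comm, hin, zero_smul]
    have hl := sum_inner_smul ho (finrank_fibre x) s
    have hm : (IsLinearMap.mk' _ hsk.lin) s = 0 := by
      rw [hl, map_sum]
      refine Finset.sum_eq_zero fun p _ => ?_
      rw [map_smul, IsLinearMap.mk'_apply, hz, smul_zero]
    exact hm
  refine ContinuousLinearMap.ext fun s => ContinuousLinearMap.coe_injective
    ((metricFrame oM oE Λ A x).ext fun c => hB c s)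

theorem iteratedDeriv_density (η : ℝ → ∀ x : M, (Fin 4 → TangentSpace (𝓡 4) x) → ℝ) (i : M) (y : R4) :
    density oM (fun x v => iteratedDeriv 2 (fun t => η t x v) 0) i y
      = iteratedDeriv 2 (fun t => density oM (η t) i y) 0 := by
  simp only [density]
  rw [iteratedDeriv_const_mul_field]

/-- The integrand of the second variation is continuous in the charts, being the second derivative of
a density which is `C²` in `t` and the point jointly. -/
theorem continuousOn_density_iteratedDeriv (hΛ : Λ ≠ 0) (hA : IsSO3Connection A)
    (hdef : IsDefinite oM oE A) (ha : IsSoForm a) (i : M) :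
    ContinuousOn (density oM (fun x v => iteratedDeriv 2 (fun t => pleb oM oE Λ (shift A a t) x v) 0) i)
      (extChartAt (𝓡 4) i).target := by
  intro y hy
  have h2 : ContDiffAt ℝ ((1 : ℕ) + 1 : ℕ) (Function.uncurry fun (t : ℝ) (y : R4) =>
      density oM (pleb oM oE Λ (shift A a t)) i y) (0, y) :=
    contDiffAt_density_pleb hΛ hA hdef ha i hy
  have h0 := (contDiffAt_deriv_left (n := 0) (contDiffAt_deriv_left (n := 1) h2)).continuousAt
  have h1 : ContinuousAt (fun y : R4 => ((0 : ℝ), y)) y := by fun_prop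
  have h3 := ContinuousAt.comp (f := fun y : R4 => ((0 : ℝ), y)) h0 h1
  refine ContinuousAt.continuousWithinAt (h3.congr (Filter.Eventually.of_forall fun z => ?_))
  rw [iteratedDeriv_density]
  simp only [iteratedDeriv_succ, iteratedDeriv_zero]
  rfl

theorem hessian_eq_zero_of_forall [CompactSpace M] (h : ∀ x s u, a x s u = 0) : hessian oM oE Λ A a = 0 := by
  have hs : ∀ t : ℝ, shift A a t = shift A a 0 := by
    intro t
    refine congrArg A.addOneForm (funext fun x => ContinuousLinearMap.ext fun s =>
      ContinuousLinearMap.ext fun u => ?_)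
    change t • a x s u = (0 : ℝ) • a x s u
    rw [h, smul_zero, smul_zero]
  have hc : (fun t : ℝ => action oM oE Λ (shift A a t))
      = fun _ => action oM oE Λ (shift A a 0) :=
    funext fun t => by rw [hs t]
  rw [hessian, hc, iteratedDeriv_const]
  simp

/-- If `X` is negative definite, the second variation is positive on nonzero gauge-fixed forms. -/
theorem hessian_nonneg [CompactSpace M] (hΛ : Λ ≠ 0) (hA : IsSO3Connection A)
    (hdef : IsDefinite oM oE A) (hsign : HasSignOf oM oE Λ A) (hcrit : IsCritical oM oE Λ A)
    (hX : ∀ x, (-X oM oE Λ A x).PosDef) (ha : IsSoForm a) (hh : IsHorizontal oM oE Λ A a)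
    (hvert : IsVertical oM oE Λ A a) :
    0 ≤ hessian oM oE Λ A a ∧ (hessian oM oE Λ A a = 0 ↔ a = 0) := by
  have hnn : ∀ i : M, ∀ y ∈ (extChartAt (𝓡 4) i).target,
      normSq oM oE Λ A a ((extChartAt (𝓡 4) i).symm y)
        * (orientationSign oM _ (coordFrame i y) * volForm oM oE Λ A _ (coordFrame i y))
      ≤ density oM (hessianForm oM oE Λ A a) i y := by
    intro i y hy
    have hp := orientationSign_mul_volForm_pos hΛ hA hdef (linearIndependent_coordFrame hy)
    refine (mul_le_mul_of_nonneg_right (normSq_le (hX _)) hp.le).trans_eq ?_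
    rw [density, hessianForm]
    ring
  have hpos : ∀ i : M, ∀ y ∈ (extChartAt (𝓡 4) i).target,
      0 ≤ density oM (hessianForm oM oE Λ A a) i y := fun i y hy =>
    (mul_nonneg (normSq_nonneg a _) (orientationSign_mul_volForm_pos hΛ hA hdef
      (linearIndependent_coordFrame hy)).le).trans (hnn i y hy)
  have hH := hessian_eq hΛ hA hdef hsign hcrit ha hh hvert
  refine ⟨by rw [hH]; exact integralForm_nonneg hpos, fun h0 => ?_, fun h0 => ?_⟩
  swap
  · refine hessian_eq_zero_of_forall (a := a) fun x s u => ?_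
    rw [h0]
    rfl
  have hc : ∀ i : M, ContinuousOn (density oM (hessianForm oM oE Λ A a) i)
      (extChartAt (𝓡 4) i).target := fun i =>
    (continuousOn_density_iteratedDeriv hΛ hA hdef ha i).congr fun y hy => by
      rw [density, density, iteratedDeriv_pleb hΛ hA hdef hsign ha hh hvert
        (variationDensity_eq_zero hΛ hA hdef hcrit ha hh _) (linearIndependent_coordFrame hy)]
  funext x
  obtain ⟨i, y, hy, rfl, hd⟩ := density_eq_zero_of_integralForm_eq_zero hc hpos (hH ▸ h0) x
  have h1 := hnn i y hy
  rw [hd] at h1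
  have hp := orientationSign_mul_volForm_pos hΛ hA hdef (linearIndependent_coordFrame hy)
  exact eq_zero_of_normSq ha (le_antisymm (nonpos_of_mul_nonpos_left h1 hp) (normSq_nonneg a _))

end Positivity

end PureConnection

end

theorem mainTheorem4
    {M : Type*} [TopologicalSpace M] [ChartedSpace PureConnection.R4 M] [IsManifold (𝓡 4) ∞ M]
    [T2Space M] [CompactSpace M]
    {E : M → Type*} [∀ x, NormedAddCommGroup (E x)] [∀ x, InnerProductSpace ℝ (E x)]
    [TopologicalSpace (TotalSpace PureConnection.R3 E)] [FiberBundle PureConnection.R3 E]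
    [VectorBundle ℝ PureConnection.R3 E] [ContMDiffVectorBundle ∞ PureConnection.R3 E (𝓡 4)]
    [IsContMDiffRiemannianBundle (𝓡 4) ∞ PureConnection.R3 E]
    (oM : PureConnection.ManifoldOrientation M) (oE : PureConnection.FibreOrientation E)
    (Λ : ℝ) (hΛ : Λ ≠ 0)
    (A : CovariantDerivative (𝓡 4) PureConnection.R3 E)
    (hA : PureConnection.IsSO3Connection A)
    (hdef : PureConnection.IsDefinite oM oE A)
    (hsign : PureConnection.HasSignOf oM oE Λ A)
    (hcrit : PureConnection.IsCritical oM oE Λ A) :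
    (∀ a : (x : M) → E x →L[ℝ] TangentSpace (𝓡 4) x →L[ℝ] E x, PureConnection.IsSoForm a →
      PureConnection.IsHorizontal oM oE Λ A a → PureConnection.IsVertical oM oE Λ A a →
      ContDiffAt ℝ 2 (fun t : ℝ =>
        PureConnection.action oM oE Λ (PureConnection.shift A a t)) 0 ∧
      PureConnection.hessian oM oE Λ A a =
        PureConnection.integralForm oM (PureConnection.hessianForm oM oE Λ A a)) ∧
    (PureConnection.RPlusNegative oM oE Λ A →
      (∀ x : M, (-PureConnection.X oM oE Λ A x).PosDef) ∧
      ∀ a : (x : M) → E x →L[ℝ] TangentSpace (𝓡 4) x →L[ℝ] E x, PureConnection.IsSoForm a →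
        PureConnection.IsHorizontal oM oE Λ A a → PureConnection.IsVertical oM oE Λ A a →
        0 ≤ PureConnection.hessian oM oE Λ A a ∧
        (PureConnection.hessian oM oE Λ A a = 0 ↔ a = 0)) := by
  refine ⟨fun a ha hh hv => ⟨(PureConnection.action_shift hΛ hA hdef ha).1,
    PureConnection.hessian_eq hΛ hA hdef hsign hcrit ha hh hv⟩, ?_⟩
  intro hR
  have hX : ∀ x, (-PureConnection.X oM oE Λ A x).PosDef := fun x =>
    PureConnection.posDef_neg_X hdef
      (PureConnection.neg_of_RPlusNegative hΛ hA hdef hsign hcrit hR x) x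
  exact ⟨hX, fun a ha hh hv => PureConnection.hessian_nonneg hΛ hA hdef hsign hcrit hX ha hh hv⟩
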